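/- **Setting.** Fix constants $R>0$, $\gamma>1$, $\mu>0$, $\kappa>0$ and put $p(v,\theta)=R\theta/v$, $E=\frac{R}{\gamma-1}\theta+\frac{u^2}{2}$, $\lambda_1(v,\theta)=-\sqrt{\gamma p/v}$, $s(v,\theta)=\frac{R}{\gamma-1}\ln(\theta v^{\gamma-1})$, and let $\lambda_1(s,v)$ be $\lambda_1$ expressed through entropy and specific volume. States $(v,u,\theta)$ lie in $\mathbb R_+\times\mathbb R\times\mathbb R_+$. Consider states $(v_\pm,u_\pm,\theta_\pm)$, $(v_*,u_*,\theta_*)$, $(v^*,u^*,\theta^*)$ such that: * (1-rarefaction) $v_-<v_*$, $s(v_-,\theta_-)=s(v_*,\theta_*)$, $u_-=u_*-\int_{v_*}^{v_-}\lambda_1(s(v_*,\theta_*),y)\,dy$; * (2-contact) $u_*=u^*$ and $p(v_*,\theta_*)=p(v^*,\theta^*)=:p_*=:p^*$; * (3-shock) $v^*<v_+$, and with $\sigma:=\sqrt{-\frac{p_+-p^*}{v_+-v^*}}>0$, $p_+:=p(v_+,\theta_+)$, the Rankine–Hugoniot conditions $-\sigma[v]-[u]=0$, $-\sigma[u]+[p]=0$,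 $-\sigma[E]+[pu]=0$ hold between $(v^*,u^*,\theta^*)$ and $(v_+,u_+,\theta_+)$. Let $\delta_R=|v_*-v_-|$, $\delta_C=|v^*-v_*|$, $\delta_S=|v_+-v^*|$ and $\sigma^*=\sqrt{\gamma p^*/v^*}$. **Waves.** The approximate rarefaction wave $(v^R,u^R,\theta^R)(t,x)$ is given for $t\ge0$ by $\lambda_1(v^R,\theta^R)(t,x)=w(1+t,x)$, $s(v^R,\theta^R)=s(v_*,\theta_*)$ and $u^R+\int_{v_*}^{v^R}\lambda_1(s(v_*,\theta_*),y)\,dy=u_*$, where $w$ is the classical solution of $w_t+ww_x=0$ with $w(0,x)=\frac{w_*+w_-}{2}+\frac{w_*-w_-}{2}\tanh x$, $w_-=\lambda_1(v_-,\theta_-)$, $w_*=\lambda_1(v_*,\theta_*)$. The viscous contact wave is $$v^C=\frac{R\Theta}{p_*},\qquad u^C=u_*+\frac{(\gamma-1)\kappa\,\Theta_x}{R\gamma\,\Theta},\qquad \theta^C=\Theta,$$ where $\Theta=\Theta(x/\sqrt{1+t})>0$ is the self-similar solution of $\Theta_t=\frac{(\gamma-1)\kappa p_*}{R^2\gamma}\big(\frac{\Theta_x}{\Theta}\big)_x$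 with $\Theta(-\infty)=\theta_*$, $\Theta(+\infty)=\theta^*$. The viscous shock $(v^S,u^S,\theta^S)(\xi)$, with $v^S,\theta^S>0$, solves $$-\sigma (v^S)'-(u^S)'=0,\qquad -\sigma (u^S)'+(p^S)'=\Big(\mu\frac{(u^S)'}{v^S}\Big)',\qquad -\sigma (E^S)'+(p^Su^S)'=\Big(\kappa\frac{(\theta^S)'}{v^S}\Big)'+\Big(\mu\frac{u^S(u^S)'}{v^S}\Big)',$$ tends to $(v^*,u^*,\theta^*)$ at $-\infty$ and to $(v_+,u_+,\theta_+)$ at $+\infty$, and is normalized by $v^S(0)=\frac{v^*+v_+}{2}$. For a shift $\mathbf X(t)$ write $f^{-\mathbf X}(\xi)=f(\xi-\mathbf X(t))$ and set, with $x=\xi+\sigma t$, $$(\bar v,\bar u,\bar\theta)(t,\xi)=(v^R,u^R,\theta^R)(t,x)+(v^C,u^C,\theta^C)(t,x)+(v^S,u^S,\theta^S)(\xi-\mathbf X(t))-(v_*,u_*,\theta_*)-(v^*,u^*,\theta^*),$$ $\bar p=p(\bar v,\bar\theta)$. For $\lambda>0$ let $a(\xi)=1+\frac{\lambda}{\delta_S}(v^S(\xi)-v^*)$.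 Let $M$ be either $M_0$ or $\frac32M_0$, where $$M_0=\frac{\gamma(\gamma+1)p^*}{2(v^*)^2(\sigma^*)^3}\Big(1+\frac{2\kappa(\gamma-1)^2}{\mu R\gamma}\Big).$$ **Functionals.** For $U=(v,u,\theta)$ with $p=p(v,\theta)$, and with $\Phi(z)=z-1-\ln z$, at each time $t$ let $$\mathbf B_1=\int_{\mathbb R}a^{-\mathbf X}(v^S)^{-\mathbf X}_\xi\Big[\tfrac{(\gamma+1)p^*\sigma^*}{2(v^*)^2}(v-\bar v)^2+\tfrac{R\sigma^*}{2v^*\theta^*}(\theta-\bar\theta)^2-\tfrac{p^*\sigma^*}{v^*\theta^*}(v-\bar v)(\theta-\bar\theta)\Big]d\xi,$$ $$\mathbf B_2=\int_{\mathbb R}a_\xi^{-\mathbf X}(u-\bar u)(p-\bar p)\,d\xi,\qquad \mathbf G=\sigma\int_{\mathbb R}a_\xi^{-\mathbf X}\Big[R\bar\theta\,\Phi\big(\tfrac{v}{\bar v}\big)+\tfrac{R\bar\theta}{\gamma-1}\Phi\big(\tfrac{\theta}{\bar\theta}\big)+\tfrac{(u-\bar u)^2}{2}\Big]d\xi,$$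 $$\mathbf D=\int_{\mathbb R}a^{-\mathbf X}\Big[\tfrac{\mu}{v}|(u-\bar u)_\xi|^2+\tfrac{\kappa}{v\theta}|(\theta-\bar\theta)_\xi|^2\Big]d\xi,\qquad \mathcal G^S=\int_{\mathbb R}|(v^S)^{-\mathbf X}_\xi|\,|(v-\bar v,u-\bar u,\theta-\bar\theta)|^2d\xi.$$ **Lemma 4.3.** For every state $(v_+,u_+,\theta_+)\in\mathbb R_+\times\mathbb R\times\mathbb R_+$ and every $K>0$ there are constants $\delta_0,\varepsilon_1,\eta,C_1,C_2,C_3>0$ (depending only on these data and on $R,\gamma,\mu,\kappa$) such that the following holds. Take states and waves as above with this $(v_+,u_+,\theta_+)$ and with $\delta_R,\delta_C,\delta_S<\delta_0$, a number $\lambda$ with $\delta_S\le\eta\lambda$ and $\lambda\le K\sqrt{\delta_S}$, and $T>0$. Let $U=(v,u,\theta)$ with $v,\theta>0$ solve, on $[0,T]$, $$v_t-\sigma v_\xi-u_\xi=0,\qquad u_t-\sigma u_\xi+p_\xi=\Big(\mu\frac{u_\xi}{v}\Big)_\xi,\qquad \frac{R}{\gamma-1}(\theta_t-\sigma\theta_\xi)+pu_\xi=\Big(\kappa\frac{\theta_\xi}{v}\Big)_\xi+\mu\frac{u_\xi^2}{v},$$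 and let $\mathbf X$ be an absolutely continuous solution on $[0,T]$ of $\mathbf X(0)=0$, $$\dot{\mathbf X}(t)=-\frac{M}{\delta_S}\int_{\mathbb R}a(\xi-\mathbf X)\Big[u^S_\xi(\xi-\mathbf X)(u-\bar u)+\frac{R\,\theta^S_\xi(\xi-\mathbf X)}{(\gamma-1)\bar\theta}(\theta-\bar\theta)+\frac{\bar p\,v^S_\xi(\xi-\mathbf X)}{\bar v}(v-\bar v)\Big]d\xi .$$ Suppose that $v-\bar v\in C([0,T];H^1(\mathbb R))$, that $u-\bar u$ and $\theta-\bar\theta$ are in $C([0,T];H^1(\mathbb R))\cap L^2(0,T;H^2(\mathbb R))$, and that $\|(v-\bar v,u-\bar u,\theta-\bar\theta)(t)\|_{H^1(\mathbb R)}\le\varepsilon_1$ for all $t\in[0,T]$. Then, for every $t\in[0,T]$, $\mathbf X$ is differentiable at $t$ (one-sidedly at the end points) and $$-\frac{\delta_S}{2M}|\dot{\mathbf X}(t)|^2+\mathbf B_1+\mathbf B_2-\mathbf G-\frac34\mathbf D\le -C_1\,\mathcal G^S(U)+C_2\big(\delta_R^{4/3}+\delta_C^{4/3}\big)\delta_S^{4/3}e^{-C_3\delta_S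 t}.$$ -/

import Mathlib

open MeasureTheory Set Filter Topology
open scoped ContDiff

noncomputable section

namespace NSF

/-- Physical constants of an ideal polytropic viscous heat-conducting gas. -/
structure Gas where
  R : ℝ
  γ : ℝ
  μ : ℝ
  κ : ℝ
  R_pos : 0 < R
  one_lt_γ : 1 < γ
  μ_pos : 0 < μ
  κ_pos : 0 < κ

/-- A state `(v, u, θ)`: specific volume, velocity, temperature. -/
@[ext] structure State where
  v : ℝ
  u : ℝ
  θ : ℝ

/-- The state lies in `ℝ₊ × ℝ × ℝ₊`. -/
def State.Admissible (U : State) : Prop := 0 < U.v ∧ 0 < U.θ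

/-! ### Thermodynamics -/

/-- Pressure of a state, `p = R θ / v`. -/
def Gas.p (g : Gas) (U : State) : ℝ := g.R * U.θ / U.v

/-- Total energy of a state, `E = R θ / (γ - 1) + u² / 2`. -/
def Gas.E (g : Gas) (U : State) : ℝ := g.R / (g.γ - 1) * U.θ + U.u ^ 2 / 2

/-- First characteristic speed `λ₁ = - √(γ p / v)`. -/
def Gas.lam1 (g : Gas) (U : State) : ℝ := -Real.sqrt (g.γ * g.p U / U.v)

/-- Physical entropy `s = R / (γ - 1) * log (θ v ^ (γ - 1))` (up to an additive constant). -/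
def Gas.entropy (g : Gas) (U : State) : ℝ :=
  g.R / (g.γ - 1) * Real.log (U.θ * U.v ^ (g.γ - 1))

/-- The temperature as a function of entropy and specific volume. -/
def Gas.isenTheta (g : Gas) (s v : ℝ) : ℝ :=
  Real.exp ((g.γ - 1) * s / g.R) / v ^ (g.γ - 1)

/-- `λ₁` as a function of entropy and specific volume (it does not depend on the velocity). -/
def Gas.lam1S (g : Gas) (s v : ℝ) : ℝ := g.lam1 ⟨v, 0, g.isenTheta s v⟩

/-! ### Wave curves of the inviscid system -/

/-- The 1-rarefaction curve `R₁(UR)`. -/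
def Gas.R1 (g : Gas) (UR : State) : Set State :=
  {U | U.Admissible ∧ U.v < UR.v ∧ g.entropy U = g.entropy UR ∧
    U.u = UR.u - ∫ y in UR.v..U.v, g.lam1S (g.entropy UR) y}

/-- The 2-contact discontinuity curve `CD₂(UR)`. -/
def Gas.CD2 (g : Gas) (UR : State) : Set State :=
  {U | U.Admissible ∧ U.u = UR.u ∧ g.p U = g.p UR}

/-- The speed `σ = √(-(p_R - p_L) / (v_R - v_L))`. -/
def Gas.shockSpeed (g : Gas) (UL UR : State) : ℝ :=
  Real.sqrt (-((g.p UR - g.p UL) / (UR.v - UL.v)))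

/-- The Rankine--Hugoniot conditions for the speed `σ`. -/
def Gas.RankineHugoniot (g : Gas) (UL UR : State) (σ : ℝ) : Prop :=
  -σ * (UR.v - UL.v) - (UR.u - UL.u) = 0 ∧
  -σ * (UR.u - UL.u) + (g.p UR - g.p UL) = 0 ∧
  -σ * (g.E UR - g.E UL) + (g.p UR * UR.u - g.p UL * UL.u) = 0

/-- The (admissible) 3-shock curve `S₃(UR)`. -/
def Gas.S3 (g : Gas) (UR : State) : Set State :=
  {U | U.Admissible ∧ U.v < UR.v ∧ 0 < g.shockSpeed U UR ∧
    g.RankineHugoniot U UR (g.shockSpeed U UR)}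

/-! ### The three viscous waves -/

/-- `w` is the classical solution, for `t ≥ 0`, of the Burgers equation `w_t + w w_x = 0` with
initial value `(ws + wm) / 2 + (ws - wm) / 2 * tanh x`. -/
structure IsBurgersWave (wm ws : ℝ) (w : ℝ → ℝ → ℝ) : Prop where
  smooth : ContDiffOn ℝ 1 (Function.uncurry w) (Ioi 0 ×ˢ univ)
  cont : ContinuousOn (Function.uncurry w) (Ici 0 ×ˢ univ)
  eqn : ∀ t, 0 < t → ∀ x, deriv (fun s => w s x) t + w t x * deriv (fun y => w t y) x = 0
  init : ∀ x, w 0 x = (ws + wm) / 2 + (ws - wm) / 2 * Real.tanh x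

/-- `W` is the smooth approximate 1-rarefaction wave with end states `Um` and `Us`:
`λ₁(W)(t, x) = w(1 + t, x)`, and the 1-Riemann invariants `z₁ = u + ∫^v λ₁(s, y) dy` and `s`
have the same values as at `Us`. -/
def Gas.IsRarefactionWave (g : Gas) (Um Us : State) (W : ℝ → ℝ → State) : Prop :=
  ∃ w : ℝ → ℝ → ℝ, IsBurgersWave (g.lam1 Um) (g.lam1 Us) w ∧
    ∀ t, 0 ≤ t → ∀ x, (W t x).Admissible ∧
      g.lam1 (W t x) = w (1 + t) x ∧
      (W t x).u + ∫ y in Us.v..(W t x).v, g.lam1S (g.entropy Us) y = Us.u ∧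
      g.entropy (W t x) = g.entropy Us

/-- `Θ` is the profile of the self-similar solution `(t, x) ↦ Θ (x / √(1 + t))` of the nonlinear
diffusion equation `Θ_t = (γ - 1) κ p_* / (R² γ) (Θ_x / Θ)_x` connecting the temperatures of the
states `Us` (at `-∞`) and `Uc` (at `+∞`), where `p_*` is the pressure at `Us`. -/
structure Gas.IsContactProfile (g : Gas) (Us Uc : State) (Θ : ℝ → ℝ) : Prop where
  smooth : ContDiff ℝ 2 Θ
  pos : ∀ z, 0 < Θ z
  eqn : ∀ t, 0 ≤ t → ∀ x,
    deriv (fun s => Θ (x / Real.sqrt (1 + s))) t =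
      (g.γ - 1) * g.κ * g.p Us / (g.R ^ 2 * g.γ) *
        deriv (fun y => deriv (fun z => Θ (z / Real.sqrt (1 + t))) y /
          Θ (y / Real.sqrt (1 + t))) x
  lim_bot : Tendsto Θ atBot (𝓝 Us.θ)
  lim_top : Tendsto Θ atTop (𝓝 Uc.θ)

/-- The viscous contact wave built from the profile `Θ`. -/
def Gas.contactWave (g : Gas) (Us : State) (Θ : ℝ → ℝ) (t x : ℝ) : State where
  v := g.R * Θ (x / Real.sqrt (1 + t)) / g.p Us
  u := Us.u + (g.γ - 1) * g.κ * deriv (fun y => Θ (y / Real.sqrt (1 + t))) x /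
    (g.R * g.γ * Θ (x / Real.sqrt (1 + t)))
  θ := Θ (x / Real.sqrt (1 + t))

/-- `S` is the viscous shock profile (a travelling wave of speed `σ`) from `UL` at `-∞` to `UR`
at `+∞`. A profile is determined only up to a translation, which is fixed by requiring that the
specific volume at the origin be the mean of the two end values. -/
structure Gas.IsShockProfile (g : Gas) (UL UR : State) (σ : ℝ) (S : ℝ → State) : Prop where
  smooth_v : ContDiff ℝ 2 (fun ξ => (S ξ).v)
  smooth_u : ContDiff ℝ 2 (fun ξ => (S ξ).u)
  smooth_θ : ContDiff ℝ 2 (fun ξ => (S ξ).θ)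
  pos : ∀ ξ, (S ξ).Admissible
  mass : ∀ ξ, -σ * deriv (fun x => (S x).v) ξ - deriv (fun x => (S x).u) ξ = 0
  momentum : ∀ ξ, -σ * deriv (fun x => (S x).u) ξ + deriv (fun x => g.p (S x)) ξ =
    deriv (fun x => g.μ * deriv (fun y => (S y).u) x / (S x).v) ξ
  energy : ∀ ξ, -σ * deriv (fun x => g.E (S x)) ξ + deriv (fun x => g.p (S x) * (S x).u) ξ =
    deriv (fun x => g.κ * deriv (fun y => (S y).θ) x / (S x).v) ξ +
      deriv (fun x => g.μ * (S x).u * deriv (fun y => (S y).u) x / (S x).v) ξ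
  lim_bot_v : Tendsto (fun ξ => (S ξ).v) atBot (𝓝 UL.v)
  lim_bot_u : Tendsto (fun ξ => (S ξ).u) atBot (𝓝 UL.u)
  lim_bot_θ : Tendsto (fun ξ => (S ξ).θ) atBot (𝓝 UL.θ)
  lim_top_v : Tendsto (fun ξ => (S ξ).v) atTop (𝓝 UR.v)
  lim_top_u : Tendsto (fun ξ => (S ξ).u) atTop (𝓝 UR.u)
  lim_top_θ : Tendsto (fun ξ => (S ξ).θ) atTop (𝓝 UR.θ)
  center : (S 0).v = (UL.v + UR.v) / 2

/-- The states and waves of a generic Riemann pattern: `Um = U_-`, `Us = U_*`, `Uc = U^*`,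
`Up = U_+`. -/
structure Pattern where
  Um : State
  Us : State
  Uc : State
  Up : State
  rare : ℝ → ℝ → State
  Θ : ℝ → ℝ
  shock : ℝ → State

namespace Pattern

/-- Rarefaction strength `δ_R = |v_* - v_-|`. -/
def δR (W : Pattern) : ℝ := |W.Us.v - W.Um.v|

/-- Contact strength `δ_C = |v^* - v_*|`. -/
def δC (W : Pattern) : ℝ := |W.Uc.v - W.Us.v|

/-- Shock strength `δ_S = |v_+ - v^*|`. -/
def δS (W : Pattern) : ℝ := |W.Up.v - W.Uc.v|

/-- Speed `σ` of the 3-shock. -/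
def σ (W : Pattern) (g : Gas) : ℝ := g.shockSpeed W.Uc W.Up

/-- `p^* = p(v^*, θ^*)`. -/
def pc (W : Pattern) (g : Gas) : ℝ := g.p W.Uc

/-- `σ^* = √(γ p^* / v^*)`. -/
def σc (W : Pattern) (g : Gas) : ℝ := Real.sqrt (g.γ * W.pc g / W.Uc.v)

/-- `U_- ∈ R₁(U_*)`, `U_* ∈ CD₂(U^*)`, `U^* ∈ S₃(U_+)`, together with the approximate
rarefaction wave, the contact profile and the shock profile joining these states. -/
structure IsGeneric (W : Pattern) (g : Gas) : Prop where
  adm : W.Up.Admissible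
  mem_S3 : W.Uc ∈ g.S3 W.Up
  mem_CD2 : W.Us ∈ g.CD2 W.Uc
  mem_R1 : W.Um ∈ g.R1 W.Us
  rare : g.IsRarefactionWave W.Um W.Us W.rare
  contact : g.IsContactProfile W.Us W.Uc W.Θ
  shock : g.IsShockProfile W.Uc W.Up (W.σ g) W.shock

/-- The superposition wave, in the frame `ξ = x - σ t`, with the shift `X` in the shock. -/
def bar (W : Pattern) (g : Gas) (X : ℝ → ℝ) (t ξ : ℝ) : State where
  v := (W.rare t (ξ + W.σ g * t)).v + (g.contactWave W.Us W.Θ t (ξ + W.σ g * t)).v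
    + (W.shock (ξ - X t)).v - W.Us.v - W.Uc.v
  u := (W.rare t (ξ + W.σ g * t)).u + (g.contactWave W.Us W.Θ t (ξ + W.σ g * t)).u
    + (W.shock (ξ - X t)).u - W.Us.u - W.Uc.u
  θ := (W.rare t (ξ + W.σ g * t)).θ + (g.contactWave W.Us W.Θ t (ξ + W.σ g * t)).θ
    + (W.shock (ξ - X t)).θ - W.Us.θ - W.Uc.θ

/-- `v^S_ξ`. -/
def dvS (W : Pattern) (ξ : ℝ) : ℝ := deriv (fun x => (W.shock x).v) ξ

/-- `u^S_ξ`. -/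
def duS (W : Pattern) (ξ : ℝ) : ℝ := deriv (fun x => (W.shock x).u) ξ

/-- `θ^S_ξ`. -/
def dθS (W : Pattern) (ξ : ℝ) : ℝ := deriv (fun x => (W.shock x).θ) ξ

/-- The weight `a(ξ) = 1 + (lam / δ_S) (v^S(ξ) - v^*)`. -/
def a (W : Pattern) (lam ξ : ℝ) : ℝ := 1 + lam / W.δS * ((W.shock ξ).v - W.Uc.v)

/-- `a_ξ`. -/
def da (W : Pattern) (lam ξ : ℝ) : ℝ := deriv (W.a lam) ξ

/-- `γ (γ + 1) p^* / (2 (v^*)² (σ^*)³) * (1 + 2 κ (γ - 1)² / (μ R γ))`. -/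
def shiftConst (W : Pattern) (g : Gas) : ℝ :=
  g.γ * (g.γ + 1) * W.pc g / (2 * W.Uc.v ^ 2 * W.σc g ^ 3) *
    (1 + 2 * g.κ * (g.γ - 1) ^ 2 / (g.μ * g.R * g.γ))

/-- `v - v̄` for a flow `U = (v, u, θ)`. -/
def dv (W : Pattern) (g : Gas) (X : ℝ → ℝ) (U : ℝ → ℝ → State) (t ξ : ℝ) : ℝ :=
  (U t ξ).v - (W.bar g X t ξ).v

/-- `u - ū`. -/
def du (W : Pattern) (g : Gas) (X : ℝ → ℝ) (U : ℝ → ℝ → State) (t ξ : ℝ) : ℝ :=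
  (U t ξ).u - (W.bar g X t ξ).u

/-- `θ - θ̄`. -/
def dθ (W : Pattern) (g : Gas) (X : ℝ → ℝ) (U : ℝ → ℝ → State) (t ξ : ℝ) : ℝ :=
  (U t ξ).θ - (W.bar g X t ξ).θ

/-- Right-hand side of the ODE for the shift. -/
def shiftRHS (W : Pattern) (g : Gas) (lam M : ℝ) (U : ℝ → ℝ → State) (X : ℝ → ℝ) (t : ℝ) : ℝ :=
  -(M / W.δS) * ∫ ξ, W.a lam (ξ - X t) *
    (W.duS (ξ - X t) * W.du g X U t ξ
      + g.R * W.dθS (ξ - X t) / ((g.γ - 1) * (W.bar g X t ξ).θ) * W.dθ g X U t ξ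
      + g.p (W.bar g X t ξ) * W.dvS (ξ - X t) / (W.bar g X t ξ).v * W.dv g X U t ξ)

/-- `X` is an absolutely continuous solution on `[0, T]` of the ODE for the shift. -/
structure IsShift (W : Pattern) (g : Gas) (lam M T : ℝ) (U : ℝ → ℝ → State) (X : ℝ → ℝ) :
    Prop where
  ac : AbsolutelyContinuousOnInterval X 0 T
  init : X 0 = 0
  ode : ∀ᵐ t ∂(volume.restrict (Icc 0 T)), HasDerivAt X (W.shiftRHS g lam M U X t) t

end Pattern

/-! ### Sobolev classes and solutions -/

/-- `f ∈ H¹(ℝ)`, for the continuous representative: `f` is absolutely continuous on bounded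
intervals and `f`, `f'` are in `L²`. -/
structure MemH1 (f : ℝ → ℝ) : Prop where
  ac : ∀ a b, AbsolutelyContinuousOnInterval f a b
  memLp : MemLp f 2 volume
  memLp_deriv : MemLp (deriv f) 2 volume

/-- Square of the `H¹` norm. -/
def h1NormSq (f : ℝ → ℝ) : ℝ := (∫ x, f x ^ 2) + ∫ x, deriv f x ^ 2

/-- `φ ∈ C([0, T]; H¹(ℝ))`. -/
def MemCH1 (T : ℝ) (φ : ℝ → ℝ → ℝ) : Prop :=
  (∀ t ∈ Icc 0 T, MemH1 (φ t)) ∧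
  ∀ t ∈ Icc 0 T, Tendsto (fun s => h1NormSq (fun x => φ s x - φ t x)) (𝓝[Icc 0 T] t) (𝓝 0)

/-- For `φ ∈ C([0, T]; H¹(ℝ))`, this says `φ ∈ L²(0, T; H²(ℝ))`. -/
def MemL2H2 (T : ℝ) (φ : ℝ → ℝ → ℝ) : Prop :=
  (∀ᵐ t ∂(volume.restrict (Icc 0 T)), MemH1 (deriv (φ t))) ∧
  ∫⁻ t in Icc 0 T, ∫⁻ x, ‖deriv (deriv (φ t)) x‖ₑ ^ 2 < ⊤

/-- `U` solves (in the sense of distributions) on `(0, T) × ℝ` the Navier--Stokes--Fourier system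
in the frame moving with speed `σ`:
`v_t - σ v_ξ - u_ξ = 0`,
`u_t - σ u_ξ + p_ξ = (μ u_ξ / v)_ξ`,
`R / (γ - 1) (θ_t - σ θ_ξ) + p u_ξ = (κ θ_ξ / v)_ξ + μ u_ξ² / v`,
with `v, θ > 0`. -/
structure Gas.IsSolution (g : Gas) (σ T : ℝ) (U : ℝ → ℝ → State) : Prop where
  pos : ∀ t ∈ Icc 0 T, ∀ ξ, (U t ξ).Admissible
  mass : ∀ φ : ℝ → ℝ → ℝ, ContDiff ℝ ∞ (Function.uncurry φ) →
    HasCompactSupport (Function.uncurry φ) →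
    tsupport (Function.uncurry φ) ⊆ Ioo 0 T ×ˢ univ →
    ∫ t in (0 : ℝ)..T, ∫ ξ,
      (-(U t ξ).v * deriv (fun s => φ s ξ) t + σ * (U t ξ).v * deriv (φ t) ξ
        + (U t ξ).u * deriv (φ t) ξ) = 0
  momentum : ∀ φ : ℝ → ℝ → ℝ, ContDiff ℝ ∞ (Function.uncurry φ) →
    HasCompactSupport (Function.uncurry φ) →
    tsupport (Function.uncurry φ) ⊆ Ioo 0 T ×ˢ univ →
    ∫ t in (0 : ℝ)..T, ∫ ξ,
      (-(U t ξ).u * deriv (fun s => φ s ξ) t + σ * (U t ξ).u * deriv (φ t) ξ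
        - g.p (U t ξ) * deriv (φ t) ξ
        + g.μ * deriv (fun x => (U t x).u) ξ / (U t ξ).v * deriv (φ t) ξ) = 0
  energy : ∀ φ : ℝ → ℝ → ℝ, ContDiff ℝ ∞ (Function.uncurry φ) →
    HasCompactSupport (Function.uncurry φ) →
    tsupport (Function.uncurry φ) ⊆ Ioo 0 T ×ˢ univ →
    ∫ t in (0 : ℝ)..T, ∫ ξ,
      (g.R / (g.γ - 1) *
          (-(U t ξ).θ * deriv (fun s => φ s ξ) t + σ * (U t ξ).θ * deriv (φ t) ξ)
        + g.p (U t ξ) * deriv (fun x => (U t x).u) ξ * φ t ξ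
        + g.κ * deriv (fun x => (U t x).θ) ξ / (U t ξ).v * deriv (φ t) ξ
        - g.μ * deriv (fun x => (U t x).u) ξ ^ 2 / (U t ξ).v * φ t ξ) = 0

/-- `Φ(z) = z - 1 - log z`. -/
def Phi (z : ℝ) : ℝ := z - 1 - Real.log z

/-- The weighted relative entropy `θ̄ η(U | Ū)`. -/
def Gas.relEntropy (g : Gas) (U Ub : State) : ℝ :=
  g.R * Ub.θ * Phi (U.v / Ub.v) + g.R * Ub.θ / (g.γ - 1) * Phi (U.θ / Ub.θ)
    + (U.u - Ub.u) ^ 2 / 2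

namespace Pattern

/-! ### The functionals at time `t` -/

/-- `B₁(U)`. -/
def B1 (W : Pattern) (g : Gas) (lam : ℝ) (X : ℝ → ℝ) (U : ℝ → ℝ → State) (t : ℝ) : ℝ :=
  ∫ ξ, W.a lam (ξ - X t) * W.dvS (ξ - X t) *
    ((g.γ + 1) * W.pc g * W.σc g / (2 * W.Uc.v ^ 2) * W.dv g X U t ξ ^ 2
      + g.R * W.σc g / (2 * W.Uc.v * W.Uc.θ) * W.dθ g X U t ξ ^ 2
      - W.pc g * W.σc g / (W.Uc.v * W.Uc.θ) * (W.dv g X U t ξ * W.dθ g X U t ξ))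

/-- `B₂(U)`. -/
def B2 (W : Pattern) (g : Gas) (lam : ℝ) (X : ℝ → ℝ) (U : ℝ → ℝ → State) (t : ℝ) : ℝ :=
  ∫ ξ, W.da lam (ξ - X t) * W.du g X U t ξ * (g.p (U t ξ) - g.p (W.bar g X t ξ))

/-- `G(U)`. -/
def G (W : Pattern) (g : Gas) (lam : ℝ) (X : ℝ → ℝ) (U : ℝ → ℝ → State) (t : ℝ) : ℝ :=
  W.σ g * ∫ ξ, W.da lam (ξ - X t) * g.relEntropy (U t ξ) (W.bar g X t ξ)

/-- `D(U)`. -/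
def D (W : Pattern) (g : Gas) (lam : ℝ) (X : ℝ → ℝ) (U : ℝ → ℝ → State) (t : ℝ) : ℝ :=
  ∫ ξ, W.a lam (ξ - X t) *
    (g.μ / (U t ξ).v * deriv (W.du g X U t) ξ ^ 2
      + g.κ / ((U t ξ).v * (U t ξ).θ) * deriv (W.dθ g X U t) ξ ^ 2)

/-- `𝒢^S(U)`. -/
def GS (W : Pattern) (g : Gas) (X : ℝ → ℝ) (U : ℝ → ℝ → State) (t : ℝ) : ℝ :=
  ∫ ξ, |W.dvS (ξ - X t)| *
    (W.dv g X U t ξ ^ 2 + W.du g X U t ξ ^ 2 + W.dθ g X U t ξ ^ 2)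

end Pattern

end NSF

end

/-! The inequality is pointwise in time; only the differentiability of the shift and the bound on
its size use an interval of times. At a fixed time write `(φ, ψ, ζ)` for the perturbation of `(v, u,
θ)`, `ρ` for the shock derivative `v^S_ξ`, `w` for `v^S - v^*`, `d` for the shock strength and `s`
for the sound speed `σ^*`. The 3-wave direction is `φ = -ψ / s`, `ζ = b ψ` with `b = slopeθ`. Split
the perturbation into its component `ψ` along this direction and the transversal parts `φ + ψ / s`,
`ζ - b ψ`, whose weighted energy is `X = ∫ ρ transversal`.

Transversal part. Since `a_ξ = (lam / d) ρ`, the term `B₂ - G` is `lam / d` times the `ρ`-integral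
of the entropy flux minus `σ` times the relative entropy. Its quadratic part is negative
semidefinite with exactly the 3-wave direction as kernel (`quadratic_flux`), so it yields `-c (lam /
d) X`. As `lam / d ≥ 1 / η` is large, this absorbs all transversal errors of the other terms.

Part along the 3-wave. Put `A = ∫ ρ ψ²`, `P = (∫ ρ ψ)² / d` and `α = nonlin`. To leading order `B₁`
costs `α A` and the shift contributes `-2 M s² P ≤ -2 α P`. The dissipation controls the variance `A
- P`: a weak profile satisfies `dissip * ρ ≥ ((γ + 1) / 2 s - τ) w (d - w)`, and in the variable `w
/ d` the sharp Poincaré inequality of the Legendre operator (`weighted_poincare`) gives `D ≥ 2 α (A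
- P)` to leading order. The constants fit because of `dissip_eq` and `nonlin_mul_v`. Since `α A -
3/2 α (A - P) - 2 α P` is negative definite, there is room for losses: the proof keeps the
coefficients `11/10`, `13/10` and `3/2` in place of `1`, `3/2` and `2`.

Errors. What remains is a multiple of `(lam / d) ∫ ρ ((d + N) ψ² + |ψ|³)`, with `N` the distance of
the rarefaction and contact waves from their right end states. The part with `d` costs `lam A`,
which is small. The cubic part is interpolated between the small `L²` norm and the dissipated
derivative, using `lam ≤ K √d`. The part with `N` is at most `‖ψ'‖^(1/2)` times a multiple of `(lam
/ d) ‖ρ N‖`, norms in `L²`; Young's inequality with exponents `4` and `4/3` produces the powers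
`4/3` of the statement. The product `ρ N` decays like `exp(-c d t)` by `interaction_decay`: the slow
waves are tiny ahead of the line `x = m t / 2`, the shock derivative is tiny behind it, and the
shift stays below `m t / 4`.

The profile of the shock comes from a slow-fast planar system, in which an invariant cone around the
slow manifold traps the orbit (`confined`, `exists_weakShock`). The pieces are balanced in
`snapshot_estimate`. -/

namespace NSF

/-! ### Functions in `H¹(ℝ)` -/

namespace MemH1

variable {f h : ℝ → ℝ}

lemma continuous (hf : MemH1 f) : Continuous f := by
  rw [continuous_iff_continuousAt]
  intro x
  have h1 := (hf.ac (x - 1) (x + 1)).continuousOn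
  rw [uIcc_of_le (by linarith)] at h1
  exact h1.continuousAt (Icc_mem_nhds (by linarith) (by linarith))

lemma ae_differentiableAt (hf : MemH1 f) : ∀ᵐ x, DifferentiableAt ℝ f x := by
  have h1 : ∀ n : ℕ, ∀ᵐ x : ℝ, x ∈ uIcc (-(n : ℝ)) n → DifferentiableAt ℝ f x :=
    fun n => (hf.ac _ _).ae_differentiableAt
  rw [← ae_all_iff] at h1
  filter_upwards [h1] with x hx
  obtain ⟨n, hn⟩ := exists_nat_ge |x|
  refine hx n ?_
  rw [uIcc_of_le (by linarith [abs_nonneg x])]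
  exact abs_le.1 hn

lemma sub (hf : MemH1 f) (hh : MemH1 h) : MemH1 (fun x => f x - h x) where
  ac a b := (hf.ac a b).sub (hh.ac a b)
  memLp := hf.memLp.sub hh.memLp
  memLp_deriv := by
    refine (hf.memLp_deriv.sub hh.memLp_deriv).ae_eq ?_
    filter_upwards [hf.ae_differentiableAt, hh.ae_differentiableAt] with x h1 h2
    exact (deriv_fun_sub h1 h2).symm

lemma integrable_sq (hf : MemH1 f) : Integrable (fun x => f x ^ 2) :=
  hf.memLp.integrable_sq

lemma integrable_deriv_sq (hf : MemH1 f) : Integrable (fun x => deriv f x ^ 2) :=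
  hf.memLp_deriv.integrable_sq

lemma integrable_mul_deriv (hf : MemH1 f) : Integrable (fun x => |f x * deriv f x|) :=
  (hf.memLp.integrable_mul hf.memLp_deriv).abs

lemma sq_sub_sq_le (hf : MemH1 f) (x z : ℝ) :
    f x ^ 2 - f z ^ 2 ≤ 2 * ∫ y, |f y * deriv f y| := by
  have h1 := (hf.ac z x).integral_deriv_mul_eq_sub (hf.ac z x)
  have h2 : f x ^ 2 - f z ^ 2 = ∫ y in z..x, 2 * (f y * deriv f y) := by
    rw [pow_two, pow_two, ← h1]
    congr 1; ext y; ring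
  rw [h2, intervalIntegral.integral_const_mul]
  have h3 : |∫ y in z..x, f y * deriv f y| ≤ ∫ y, |f y * deriv f y| := by
    rw [intervalIntegral.abs_integral_eq_abs_integral_uIoc]
    refine (abs_integral_le_integral_abs).trans ?_
    exact setIntegral_le_integral hf.integrable_mul_deriv (ae_of_all _ fun y => abs_nonneg _)
  linarith [le_abs_self (∫ y in z..x, f y * deriv f y)]

/-- If `f x ^ 2` were larger, `sq_sub_sq_le` would keep `f ^ 2` above a positive constant on the
whole line, against its integrability. -/
lemma sq_le_integral (hf : MemH1 f) (x : ℝ) : f x ^ 2 ≤ 2 * ∫ y, |f y * deriv f y| := by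
  by_contra! hlt
  set c := f x ^ 2 - 2 * ∫ y, |f y * deriv f y| with hc
  have hc0 : 0 < c := by linarith
  have h1 : ∀ z, c ≤ f z ^ 2 := fun z => by linarith [hf.sq_sub_sq_le x z]
  have h2 : Integrable (fun _ : ℝ => c) := by
    refine hf.integrable_sq.mono' (by fun_prop) (ae_of_all _ fun z => ?_)
    rw [Real.norm_eq_abs, abs_of_pos hc0]; exact h1 z
  rw [integrable_const_iff] at h2
  rcases h2 with h2 | h2
  · exact hc0.ne' h2
  · have := isFiniteMeasure_iff (volume : Measure ℝ) |>.1 h2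
    simp at this

/-- Cauchy--Schwarz for real functions in `L²`. -/
lemma _root_.NSF.integral_mul_le_sqrt {f h : ℝ → ℝ} (hf : MemLp f 2 volume)
    (hh : MemLp h 2 volume) :
    ∫ x, |f x * h x| ≤ Real.sqrt (∫ x, f x ^ 2) * Real.sqrt (∫ x, h x ^ 2) := by
  have h2 : ENNReal.ofReal 2 = 2 := by norm_num
  have := integral_mul_le_Lp_mul_Lq_of_nonneg (μ := (volume : Measure ℝ)) (p := 2) (q := 2)
    (f := fun x => |f x|) (g := fun x => |h x|) ⟨by norm_num, by norm_num, by norm_num⟩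
    (ae_of_all _ fun x => abs_nonneg _) (ae_of_all _ fun x => abs_nonneg _)
    (by rw [h2]; exact hf.abs) (by rw [h2]; exact hh.abs)
  simp only [Real.rpow_two, sq_abs, ← Real.sqrt_eq_rpow] at this
  simpa [abs_mul] using this

/-- The interpolation form of the sup bound. The two norms are kept apart because later the `L²`
norm is small while the norm of the derivative is paid for by the dissipation. -/
lemma sq_le_sqrt_mul_sqrt (hf : MemH1 f) (x : ℝ) :
    f x ^ 2 ≤ 2 * (Real.sqrt (∫ x, f x ^ 2) * Real.sqrt (∫ x, deriv f x ^ 2)) :=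
  (hf.sq_le_integral x).trans
    (mul_le_mul_of_nonneg_left (integral_mul_le_sqrt hf.memLp hf.memLp_deriv) (by norm_num))

lemma sq_le_h1NormSq (hf : MemH1 f) (x : ℝ) : f x ^ 2 ≤ h1NormSq f := by
  have h1 := hf.sq_le_sqrt_mul_sqrt x
  have ha : 0 ≤ ∫ x, f x ^ 2 := integral_nonneg fun x => sq_nonneg _
  have hb : 0 ≤ ∫ x, deriv f x ^ 2 := integral_nonneg fun x => sq_nonneg _
  have := two_mul_le_add_sq (Real.sqrt (∫ x, f x ^ 2)) (Real.sqrt (∫ x, deriv f x ^ 2))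
  rw [Real.sq_sqrt ha, Real.sq_sqrt hb] at this
  unfold h1NormSq
  linarith

end MemH1

lemma h1NormSq_nonneg (f : ℝ → ℝ) : 0 ≤ h1NormSq f :=
  add_nonneg (integral_nonneg fun _ => sq_nonneg _) (integral_nonneg fun _ => sq_nonneg _)

lemma MemCH1.abs_sub_le {T : ℝ} {φ : ℝ → ℝ → ℝ} (hφ : MemCH1 T φ) {s t : ℝ} (hs : s ∈ Icc 0 T)
    (ht : t ∈ Icc 0 T) (x : ℝ) :
    |φ s x - φ t x| ≤ Real.sqrt (h1NormSq (fun x => φ s x - φ t x)) :=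
  Real.abs_le_sqrt (((hφ.1 s hs).sub (hφ.1 t ht)).sq_le_h1NormSq x)

/-- A function in `C([0, T]; H¹)` is continuous in time along every continuous curve. -/
lemma MemCH1.tendsto_along {T : ℝ} {φ : ℝ → ℝ → ℝ} (hφ : MemCH1 T φ) {X : ℝ → ℝ} {t : ℝ}
    (ht : t ∈ Icc 0 T) (hX : ContinuousWithinAt X (Icc 0 T) t) :
    Tendsto (fun s => φ s (X s)) (𝓝[Icc 0 T] t) (𝓝 (φ t (X t))) := by
  have h1 : Tendsto (fun s => φ t (X s)) (𝓝[Icc 0 T] t) (𝓝 (φ t (X t))) :=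
    ((hφ.1 t ht).continuous.tendsto _).comp hX
  have h2 : Tendsto (fun s => φ s (X s) - φ t (X s)) (𝓝[Icc 0 T] t) (𝓝 0) := by
    have h3 : Tendsto (fun s => Real.sqrt (h1NormSq (fun x => φ s x - φ t x)))
        (𝓝[Icc 0 T] t) (𝓝 0) := by
      have h4 := (Real.continuous_sqrt.tendsto 0).comp (hφ.2 t ht)
      rw [Real.sqrt_zero] at h4
      exact h4
    refine squeeze_zero_norm' ?_ h3
    filter_upwards [self_mem_nhdsWithin] with s hs
    exact hφ.abs_sub_le hs ht _
  simpa using h2.add h1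

/-! ### The weighted Poincaré inequality -/

/-- A nonnegative derivative of a function with finite limits at `±∞` is integrable. -/
lemma integrable_deriv_of_nonneg {y y' : ℝ → ℝ} (hy : ∀ x, HasDerivAt y (y' x) x)
    (hc : Continuous y') (h0 : ∀ x, 0 ≤ y' x) {l₁ l₂ : ℝ} (hbot : Tendsto y atBot (𝓝 l₁))
    (htop : Tendsto y atTop (𝓝 l₂)) : Integrable y' := by
  have hcast : Tendsto (fun n : ℕ => (n : ℝ)) atTop atTop := tendsto_natCast_atTop_atTop
  refine integrable_of_intervalIntegral_norm_tendsto (a := fun n : ℕ => -(n : ℝ))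
    (b := fun n : ℕ => (n : ℝ)) (l₂ - l₁) (fun n => ?_) (tendsto_neg_atTop_atBot.comp hcast)
    hcast ?_
  · exact (hc.intervalIntegrable _ _).1.mono_set (by rfl)
  · have h1 : ∀ n : ℕ, ∫ x in (-(n : ℝ))..n, ‖y' x‖ = y n - y (-(n : ℝ)) := fun n => by
      rw [← intervalIntegral.integral_eq_sub_of_hasDerivAt (fun x _ => hy x)
        (hc.intervalIntegrable _ _)]
      congr 1; ext x
      rw [Real.norm_eq_abs, abs_of_nonneg (h0 x)]
    simp_rw [h1]
    exact (htop.comp hcast).sub (hbot.comp (tendsto_neg_atTop_atBot.comp hcast))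

/-- A strengthened pointwise form of the weighted Poincaré inequality. -/
lemma poincare_pointwise {c a e g F y : ℝ} (hy0 : 0 < y) (hy1 : y < 1) (he : 0 < e)
    (hc : y * (1 - y) ≤ c * e) :
    0 ≤ c / 2 * a ^ 2 - g ^ 2 * e + (2 * (g * e * g + F * a) - ((2 * F * (g * e)) *
      ((1 - 2 * y) / (y * (1 - y))) + F ^ 2 *
        ((-2 * e * (y * (1 - y)) - (1 - 2 * y) * (e * (1 - 2 * y))) / (y * (1 - y)) ^ 2))) := by
  have hy1' : 0 < 1 - y := by linarith
  set p := y * (1 - y) with hp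
  have hp0 : 0 < p := mul_pos hy0 hy1'
  -- Both squares vanish in the extremal case `g = 1 - 2 y`, `F = y (1 - y)`, `a = -2 e`; the first
  -- coefficient is nonnegative by `hc`.
  have key : c / 2 * a ^ 2 - g ^ 2 * e + (2 * (g * e * g + F * a) - ((2 * F * (g * e)) *
      ((1 - 2 * y) / p) + F ^ 2 *
        ((-2 * e * p - (1 - 2 * y) * (e * (1 - 2 * y))) / p ^ 2))) =
      (c * e - p) / (2 * e) * a ^ 2 + 1 / 2 * (p / e) * (a + 2 * F * e / p) ^ 2
        + e * (g - F * ((1 - 2 * y) / p)) ^ 2 := by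
    field_simp
    ring
  rw [key]
  have : 0 ≤ c * e - p := by linarith
  positivity

/-- In the variable `y`, equality in `hc` leads to the Legendre operator on `(0, 1)`, whose first
nonzero eigenvalue is `2` with eigenfunction `1 - 2 y`; hence the factor `c / 2`. The proof is a
calibration: with `F` the primitive of `(f - m) y'`, the function `H = 2 F (f - m) - F² (1 - 2 y) /
(y (1 - y))` vanishes at both ends, so adding `H'` changes no integral, and it makes the integrand
pointwise nonnegative by `poincare_pointwise`. -/
theorem weighted_poincare {f y y' : ℝ → ℝ} {c : ℝ} (hf : MemH1 f)
    (hy : ∀ x, HasDerivAt y (y' x) x) (hyc : Continuous y') (hpos : ∀ x, 0 < y' x)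
    (h0 : ∀ x, 0 < y x) (h1 : ∀ x, y x < 1) (hbot : Tendsto y atBot (𝓝 0))
    (htop : Tendsto y atTop (𝓝 1)) (hc : ∀ x, y x * (1 - y x) ≤ c * y' x) :
    (∫ x, f x ^ 2 * y' x) - (∫ x, f x * y' x) ^ 2 ≤ c / 2 * ∫ x, deriv f x ^ 2 := by
  have hint : Integrable y' := integrable_deriv_of_nonneg hy hyc (fun x => (hpos x).le) hbot htop
  have hone : ∫ x, y' x = 1 := by
    rw [integral_of_hasDerivAt_of_tendsto hy hint hbot htop, sub_zero]
  have hfc := hf.continuous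
  obtain ⟨B, hB⟩ : ∃ B, ∀ x, |f x| ≤ B :=
    ⟨_, fun x => Real.abs_le_sqrt (hf.sq_le_h1NormSq x)⟩
  have hfi : Integrable (fun x => f x * y' x) :=
    hint.bdd_mul hfc.aestronglyMeasurable (ae_of_all _ hB)
  have hf2i : Integrable (fun x => f x ^ 2 * y' x) :=
    hint.bdd_mul (c := B ^ 2) (by fun_prop) (ae_of_all _ fun x => by
      rw [Real.norm_eq_abs, abs_pow]
      exact pow_le_pow_left₀ (abs_nonneg _) (hB x) 2)
  set m := ∫ x, f x * y' x with hm
  set g : ℝ → ℝ := fun x => f x - m with hg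
  have hgc : Continuous g := by fun_prop
  set C := B + |m| with hC
  have hgb : ∀ x, |g x| ≤ C := fun x => (abs_sub _ _).trans (by linarith [hB x])
  have hC0 : 0 ≤ C := (abs_nonneg _).trans (hgb 0)
  have hgyi : Integrable (fun x => g x * y' x) := by
    simp only [hg, sub_mul]
    exact hfi.sub (hint.const_mul m)
  have hgy0 : ∫ x, g x * y' x = 0 := by
    simp only [hg, sub_mul]
    rw [integral_sub hfi (hint.const_mul m), integral_const_mul, hone]
    simp [hm]
  -- This is the integral from `-∞` to `x`, centred at `0` for the sake of differentiation. It tends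
  -- to `0` at `+∞` because `g` has mean zero for the weight `y'`.
  set F : ℝ → ℝ := fun x => (∫ t in (0 : ℝ)..x, g t * y' t) + ∫ t in Iic 0, g t * y' t with hF
  have hFd : ∀ x, HasDerivAt F (g x * y' x) x := fun x =>
    ((hgc.mul hyc).integral_hasStrictDerivAt 0 x).hasDerivAt.add_const _
  have hFbot : Tendsto F atBot (𝓝 0) := by
    have h2 := intervalIntegral_tendsto_integral_Iic (0 : ℝ) hgyi.integrableOn
      (tendsto_id (α := ℝ) (x := atBot))
    have h3 := (h2.neg).add_const (∫ t in Iic 0, g t * y' t)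
    simp only [neg_add_cancel, id, ← intervalIntegral.integral_symm] at h3
    exact h3
  have hFtop : Tendsto F atTop (𝓝 0) := by
    have h2 := intervalIntegral_tendsto_integral_Ioi (0 : ℝ) hgyi.integrableOn
      (tendsto_id (α := ℝ) (x := atTop))
    have h3 := h2.add_const (∫ t in Iic 0, g t * y' t)
    have h4 : (∫ t in Ioi 0, g t * y' t) + ∫ t in Iic 0, g t * y' t = 0 := by
      rw [← hgy0, add_comm, ← setIntegral_union (Iic_disjoint_Ioi le_rfl) measurableSet_Ioi
        hgyi.integrableOn hgyi.integrableOn, Set.Iic_union_Ioi, setIntegral_univ]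
    rw [h4] at h3
    exact h3
  -- Since `|F'| ≤ C y'`, the functions `C y ± F` are monotone. Comparison with their limits at both
  -- ends gives `|F| ≤ C y` and `|F| ≤ C (1 - y)`, so `F s` stays bounded although `s` blows up at
  -- the ends.
  have hmono : ∀ ε : ℝ, |ε| = 1 → Monotone (fun x => C * y x + ε * F x) := fun ε hε => by
    refine monotone_of_hasDerivAt_nonneg
      (fun x => ((hy x).const_mul C).add ((hFd x).const_mul ε)) fun x => ?_
    have h2 : |ε * g x| ≤ C := by rw [abs_mul, hε, one_mul]; exact hgb x
    have h3 := (abs_le.1 h2).1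
    have h4 : C * y' x + ε * (g x * y' x) = (C + ε * g x) * y' x := by ring
    simp only [Pi.zero_apply]
    rw [h4]
    exact mul_nonneg (by linarith) (hpos x).le
  have hlb : ∀ ε : ℝ, |ε| = 1 → ∀ x, 0 ≤ C * y x + ε * F x := fun ε hε x => by
    refine (hmono ε hε).le_of_tendsto ?_ x
    simpa using (hbot.const_mul C).add (hFbot.const_mul ε)
  have hub : ∀ ε : ℝ, |ε| = 1 → ∀ x, C * y x + ε * F x ≤ C := fun ε hε x => by
    refine (hmono ε hε).ge_of_tendsto ?_ x
    simpa using (htop.const_mul C).add (hFtop.const_mul ε)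
  have hF1 : ∀ x, |F x| ≤ C * y x := fun x => by
    have a1 := hlb 1 (by simp) x
    have a2 := hlb (-1) (by simp) x
    rw [abs_le]; constructor <;> linarith
  have hF2 : ∀ x, |F x| ≤ C * (1 - y x) := fun x => by
    have a1 := hub 1 (by simp) x
    have a2 := hub (-1) (by simp) x
    rw [abs_le]; constructor <;> linarith
  set s : ℝ → ℝ := fun x => (1 - 2 * y x) / (y x * (1 - y x)) with hs
  have hp0 : ∀ x, 0 < y x * (1 - y x) := fun x => mul_pos (h0 x) (by linarith [h1 x])
  have hsd : ∀ x, HasDerivAt s ((-2 * y' x * (y x * (1 - y x)) -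
      (1 - 2 * y x) * (y' x * (1 - 2 * y x))) / (y x * (1 - y x)) ^ 2) x := fun x => by
    have a1 : HasDerivAt (fun x => 1 - 2 * y x) (-2 * y' x) x := by
      simpa using ((hy x).const_mul 2).const_sub 1
    have a2 : HasDerivAt (fun x => y x * (1 - y x)) (y' x * (1 - 2 * y x)) x :=
      ((hy x).mul ((hy x).const_sub 1)).congr_deriv (by ring)
    exact a1.div a2 (hp0 x).ne'
  have hFs : ∀ x, |F x * s x| ≤ 2 * C := fun x => by
    have hyx := h0 x
    have hyx1 : 0 < 1 - y x := by linarith [h1 x]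
    have a1 : |1 - 2 * y x| ≤ 1 := abs_le.2 ⟨by linarith, by linarith⟩
    have a2 : |F x| ≤ 2 * C * (y x * (1 - y x)) := by
      rcases le_total (y x) (1 / 2) with h | h
      · refine (hF1 x).trans ?_
        nlinarith [mul_nonneg hC0 hyx.le]
      · refine (hF2 x).trans ?_
        nlinarith [mul_nonneg hC0 hyx1.le]
    simp only [hs]
    rw [abs_mul, abs_div, abs_of_pos (hp0 x), mul_div_assoc', div_le_iff₀ (hp0 x)]
    calc |F x| * |1 - 2 * y x| ≤ |F x| * 1 := by gcongr
      _ ≤ _ := by linarith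
  set H : ℝ → ℝ := fun x => 2 * (F x * f x - F x * m) - F x ^ 2 * s x with hH
  have hH' : ∀ x, H x = 2 * (F x * g x) - F x * (F x * s x) := fun x => by
    simp only [hH, hg]; ring
  have hHb : ∀ x, |H x| ≤ 4 * C * |F x| := fun x => by
    rw [hH']
    refine (abs_sub _ _).trans ?_
    rw [abs_mul, abs_mul, abs_mul (F x) (F x * s x), abs_two]
    nlinarith [abs_nonneg (F x), hgb x, hFs x, mul_le_mul_of_nonneg_left (hgb x) (abs_nonneg (F x)),
      mul_le_mul_of_nonneg_left (hFs x) (abs_nonneg (F x))]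
  have hHlim : ∀ l : Filter ℝ, Tendsto F l (𝓝 0) → Tendsto H l (𝓝 0) := fun l hl => by
    refine squeeze_zero_norm hHb ?_
    simpa using (hl.abs).const_mul (4 * C)
  -- regularity
  have hFc1 : ContDiff ℝ 1 F := contDiff_one_iff_deriv.2
    ⟨fun x => (hFd x).differentiableAt, by
      rw [show deriv F = fun x => g x * y' x from funext fun x => (hFd x).deriv]; fun_prop⟩
  have hycont : Continuous y := continuous_iff_continuousAt.2 fun x => (hy x).continuousAt
  have hsc1 : ContDiff ℝ 1 s := contDiff_one_iff_deriv.2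
    ⟨fun x => (hsd x).differentiableAt, by
      rw [show deriv s = _ from funext fun x => (hsd x).deriv]
      exact Continuous.div (by fun_prop) (by fun_prop) fun x => (pow_pos (hp0 x) 2).ne'⟩
  have hAC : ∀ a b, AbsolutelyContinuousOnInterval H a b := fun a b => by
    have a1 : AbsolutelyContinuousOnInterval F a b :=
      hFc1.contDiffOn.absolutelyContinuousOnInterval
    have a2 : AbsolutelyContinuousOnInterval (fun x => F x * m) a b :=
      (hFc1.mul contDiff_const).contDiffOn.absolutelyContinuousOnInterval
    have a3 : AbsolutelyContinuousOnInterval (fun x => F x ^ 2 * s x) a b :=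
      ((hFc1.pow 2).mul hsc1).contDiffOn.absolutelyContinuousOnInterval
    exact (((a1.fun_mul (hf.ac a b)).sub a2).const_mul 2).sub a3
  have hHd : ∀ᵐ x, 0 ≤ (c / 2 * deriv f x ^ 2 - g x ^ 2 * y' x) + deriv H x := by
    filter_upwards [hf.ae_differentiableAt] with x hx
    have a1 : HasDerivAt H (2 * (g x * y' x * g x + F x * deriv f x) -
        ((2 * F x * (g x * y' x)) * ((1 - 2 * y x) / (y x * (1 - y x))) + F x ^ 2 *
        ((-2 * y' x * (y x * (1 - y x)) - (1 - 2 * y x) * (y' x * (1 - 2 * y x))) /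
          (y x * (1 - y x)) ^ 2))) x := by
      have b1 := (((hFd x).mul hx.hasDerivAt).sub ((hFd x).mul_const m)).const_mul 2
      have b2 := ((hFd x).pow 2).mul (hsd x)
      refine (b1.sub b2).congr_deriv ?_
      simp only [hs, hg, Pi.pow_apply, Nat.cast_ofNat]
      ring
    rw [a1.deriv]
    exact poincare_pointwise (h0 x) (h1 x) (hpos x) (hc x)
  have hg2i : Integrable (fun x => g x ^ 2 * y' x) := by
    have : (fun x => g x ^ 2 * y' x) = fun x =>
        f x ^ 2 * y' x - 2 * m * (f x * y' x) + m ^ 2 * y' x := by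
      ext x; simp only [hg]; ring
    rw [this]
    exact (hf2i.sub (hfi.const_mul _)).add (hint.const_mul _)
  have hvar : ∫ x, g x ^ 2 * y' x = (∫ x, f x ^ 2 * y' x) - m ^ 2 := by
    have : (fun x => g x ^ 2 * y' x) = fun x =>
        f x ^ 2 * y' x - 2 * m * (f x * y' x) + m ^ 2 * y' x := by
      ext x; simp only [hg]; ring
    have b1 : ∫ x, f x ^ 2 * y' x - 2 * m * (f x * y' x) =
        (∫ x, f x ^ 2 * y' x) - ∫ x, 2 * m * (f x * y' x) := integral_sub hf2i (hfi.const_mul _)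
    have b2 : ∫ x, f x ^ 2 * y' x - 2 * m * (f x * y' x) + m ^ 2 * y' x =
        (∫ x, f x ^ 2 * y' x - 2 * m * (f x * y' x)) + ∫ x, m ^ 2 * y' x :=
      integral_add (hf2i.sub (hfi.const_mul _)) (hint.const_mul _)
    rw [this, b2, b1, integral_const_mul, integral_const_mul, hone, ← hm]
    ring
  have hJi : Integrable (fun x => c / 2 * deriv f x ^ 2 - g x ^ 2 * y' x) :=
    (hf.integrable_deriv_sq.const_mul _).sub hg2i
  have hcast : Tendsto (fun n : ℕ => (n : ℝ)) atTop atTop := tendsto_natCast_atTop_atTop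
  have hncast := tendsto_neg_atTop_atBot.comp hcast
  have hlim := intervalIntegral_tendsto_integral hJi hncast hcast
  have hbd : Tendsto (fun n : ℕ => H n - H (-(n : ℝ))) atTop (𝓝 0) := by
    simpa using ((hHlim _ hFtop).comp hcast).sub ((hHlim _ hFbot).comp hncast)
  have hfin : 0 ≤ ∫ x, (c / 2 * deriv f x ^ 2 - g x ^ 2 * y' x) := by
    have hlim2 := hlim.add hbd
    rw [add_zero] at hlim2
    refine ge_of_tendsto' hlim2 fun n => ?_
    rw [← (hAC (-(n : ℝ)) n).integral_deriv_eq_sub]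
    simp only [Function.comp_apply]
    rw [← intervalIntegral.integral_add hJi.intervalIntegrable (hAC _ _).intervalIntegrable_deriv]
    exact intervalIntegral.integral_nonneg_of_ae (by linarith [n.cast_nonneg (α := ℝ)]) hHd
  rw [integral_sub (hf.integrable_deriv_sq.const_mul _) hg2i, integral_const_mul, hvar] at hfin
  linarith

/-! ### One-dimensional comparison lemmas -/

lemma eventually_lt_right_of_deriv_neg {f : ℝ → ℝ} {f' x : ℝ} (h : HasDerivAt f f' x)
    (h' : f' < 0) : ∀ᶠ y in 𝓝[>] x, f y < f x := by
  have h1 := (hasDerivAt_iff_tendsto_slope.1 h).eventually (gt_mem_nhds h')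
  have h2 : ∀ᶠ y in 𝓝[>] x, slope f x y < 0 :=
    h1.filter_mono (nhdsWithin_mono _ fun y hy => ne_of_gt hy)
  filter_upwards [h2, self_mem_nhdsWithin] with y hy hxy
  have hxy' : 0 < y - x := sub_pos.2 hxy
  rw [slope_def_field, div_neg_iff] at hy
  rcases hy with hy | hy <;> linarith [hy.1, hy.2]

lemma eventually_lt_left_of_deriv_neg {f : ℝ → ℝ} {f' x : ℝ} (h : HasDerivAt f f' x)
    (h' : f' < 0) : ∀ᶠ y in 𝓝[<] x, f x < f y := by
  have h1 := (hasDerivAt_iff_tendsto_slope.1 h).eventually (gt_mem_nhds h')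
  have h2 : ∀ᶠ y in 𝓝[<] x, slope f x y < 0 :=
    h1.filter_mono (nhdsWithin_mono _ fun y hy => ne_of_lt hy)
  filter_upwards [h2, self_mem_nhdsWithin] with y hy hxy
  have hxy' : y - x < 0 := sub_neg.2 hxy
  rw [slope_def_field, div_neg_iff] at hy
  rcases hy with hy | hy <;> linarith [hy.1, hy.2]

/-- A function which tends to `0` at `-∞` and decreases wherever it is positive is nonpositive. -/
lemma nonpos_of_deriv_neg_of_pos {f f' : ℝ → ℝ} {b : ℝ}
    (hf : ∀ x ≤ b, HasDerivAt f (f' x) x) (hbot : Tendsto f atBot (𝓝 0))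
    (hneg : ∀ x ≤ b, 0 < f x → f' x < 0) : f b ≤ 0 := by
  by_contra! hb
  obtain ⟨a, ha, hab⟩ := ((hbot.eventually (gt_mem_nhds (half_pos hb))).and
    (eventually_le_atBot b)).exists
  -- The level `f b / 2` is a barrier: `f` starts below it far to the left and has negative slope at
  -- every contact, so it cannot climb to `f b`.
  have h1 := image_le_of_deriv_right_lt_deriv_boundary (f := f) (f' := f') (a := a) (b := b)
    (B := fun _ => f b / 2) (B' := fun _ => 0)
    (fun x hx => (hf x hx.2).continuousAt.continuousWithinAt)
    (fun x hx => (hf x hx.2.le).hasDerivWithinAt) ha.le (fun x => hasDerivAt_const x _)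
    (fun x hx hfx => hneg x hx.2.le (by rw [hfx]; exact half_pos hb)) (right_mem_Icc.2 hab)
  linarith

/-- A solution of a linear differential inequality `|f'| ≤ L |f|` with a zero vanishes. -/
lemma eq_zero_of_abs_deriv_le {f f' : ℝ → ℝ} {L x₀ : ℝ} (hf : ∀ x, HasDerivAt f (f' x) x)
    (hL : ∀ x, |f' x| ≤ L * |f x|) (h0 : f x₀ = 0) (x : ℝ) : f x = 0 := by
  have hff : ∀ x, |f x * f' x| ≤ L * f x ^ 2 := fun x => by
    rw [abs_mul, ← sq_abs (f x)]
    nlinarith [mul_le_mul_of_nonneg_left (hL x) (abs_nonneg (f x))]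
  have hd : ∀ c x, HasDerivAt (fun x => f x ^ 2 * Real.exp (c * x))
      ((2 * (f x * f' x) + c * f x ^ 2) * Real.exp (c * x)) x := fun c x => by
    have h1 := ((hf x).pow 2).mul ((hasDerivAt_id x).const_mul c).exp
    refine h1.congr_deriv ?_
    simp; ring
  have hmono : Monotone (fun x => f x ^ 2 * Real.exp (2 * L * x)) :=
    monotone_of_hasDerivAt_nonneg (hd (2 * L)) fun x =>
      mul_nonneg (by linarith [(abs_le.1 (hff x)).1]) (Real.exp_pos _).le
  have hanti : Antitone (fun x => f x ^ 2 * Real.exp (-(2 * L) * x)) :=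
    antitone_of_hasDerivAt_nonpos (hd (-(2 * L))) fun x =>
      mul_nonpos_of_nonpos_of_nonneg (by linarith [(abs_le.1 (hff x)).2]) (Real.exp_pos _).le
  have key : ∀ c, f x ^ 2 * Real.exp (c * x) ≤ f x₀ ^ 2 * Real.exp (c * x₀) → f x = 0 :=
    fun c hc => by
      rw [h0] at hc
      have := Real.exp_pos (c * x)
      have h2 : f x ^ 2 ≤ 0 := by nlinarith
      exact pow_eq_zero_iff (two_ne_zero) |>.1 (le_antisymm h2 (sq_nonneg _))
  rcases le_total x x₀ with h | h
  · exact key _ (hmono h)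
  · exact key _ (hanti h)

/-! ### The travelling wave system -/

/-- The system satisfied by the specific volume `w` and the deviation `z` of the temperature from
its nullcline, along a viscous shock of strength `δ`. -/
structure SlowFast (A B vs d e k δ : ℝ) (w z : ℝ → ℝ) : Prop where
  hw : ∀ x, HasDerivAt w (A * (k * w x * (δ - w x) - z x)) x
  hz : ∀ x, HasDerivAt z
    (-(B * (vs + w x) * z x) + A * (d - e * w x) * (k * w x * (δ - w x) - z x)) x
  pos : ∀ x, 0 < vs + w x
  w_bot : Tendsto w atBot (𝓝 0)
  w_top : Tendsto w atTop (𝓝 δ)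
  z_bot : Tendsto z atBot (𝓝 0)

namespace SlowFast

variable {A B vs d e k δ : ℝ} {w z : ℝ → ℝ}

/-- A negative minimum of `w` forces `k w (δ - w) = z` and hence `z < 0` there. The derivative of `k
w (δ - w) - z` at that point is then `B (vs + w) z < 0`, so `w` decreases further just after its
minimum. -/
lemma nonneg (h : SlowFast A B vs d e k δ w z) (hA : 0 < A) (hB : 0 < B) (hk : 0 < k)
    (hδ : 0 < δ) (x : ℝ) : 0 ≤ w x := by
  by_contra! hx
  have hwc : Continuous w := continuous_iff_continuousAt.2 fun x => (h.hw x).continuousAt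
  have hzc : Continuous z := continuous_iff_continuousAt.2 fun x => (h.hz x).continuousAt
  obtain ⟨a, ha⟩ : ∃ a, ∀ y, w a ≤ w y := by
    refine hwc.exists_forall_le' x ?_
    rw [cocompact_eq_atBot_atTop, eventually_sup]
    exact ⟨(h.w_bot.eventually (lt_mem_nhds hx)).mono fun y hy => hy.le,
      (h.w_top.eventually (lt_mem_nhds (hx.trans hδ))).mono fun y hy => hy.le⟩
  have hwa : w a < 0 := (ha x).trans_lt hx
  have hwd : A * (k * w a * (δ - w a) - z a) = 0 := by
    have : IsLocalMin w a := Eventually.of_forall ha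
    exact this.hasDerivAt_eq_zero (h.hw a)
  have hqz : k * w a * (δ - w a) - z a = 0 := by
    rcases mul_eq_zero.1 hwd with h1 | h1
    · exact absurd h1 hA.ne'
    · exact h1
  have hza : z a < 0 := by
    have : k * w a * (δ - w a) < 0 :=
      mul_neg_of_neg_of_pos (mul_neg_of_pos_of_neg hk hwa) (by linarith)
    linarith
  have hhd : HasDerivAt (fun x => k * w x * (δ - w x) - z x) (B * (vs + w a) * z a) a := by
    have h1 := (((h.hw a).const_mul k).mul ((h.hw a).const_sub δ)).sub (h.hz a)
    refine h1.congr_deriv ?_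
    rw [hqz]; ring
  have hneg : B * (vs + w a) * z a < 0 := mul_neg_of_pos_of_neg (mul_pos hB (h.pos a)) hza
  have hev := eventually_lt_right_of_deriv_neg hhd hneg
  simp only [hqz] at hev
  obtain ⟨b, hab, hb⟩ := mem_nhdsGT_iff_exists_Ioc_subset.1 hev
  have hanti : StrictAntiOn w (Icc a b) := by
    refine strictAntiOn_of_deriv_neg (convex_Icc _ _) hwc.continuousOn fun y hy => ?_
    rw [interior_Icc] at hy
    rw [(h.hw y).deriv]
    exact mul_neg_of_pos_of_neg hA (hb ⟨hy.1, hy.2.le⟩)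
  exact absurd (ha b) (not_le.2 (hanti (left_mem_Icc.2 (le_of_lt hab))
    (right_mem_Icc.2 (le_of_lt hab)) hab))

/-- This is the derivative of `r² - ε² q²`, where `r` is the deviation from the slow manifold. The
damping `a` has order one, while every other term carries a factor `δ` through `w` or `S`. Outside
the cone `q` is traded for `r` at the cost of a factor `1 / ε`, and `hδ1` lets the damping win. -/
lemma cone_aux {r q w a b c ρ S L m δ ε : ℝ} (hm : 0 < m) (hL : 0 < L) (hδ : 0 < δ) (hε : 0 < ε)
    (hε1 : ε ≤ 1) (hδ1 : δ * (48 * (L + L ^ 2)) < ε * m ^ 2) (hρ0 : 0 ≤ ρ) (hρ1 : ρ ≤ 1)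
    (ha : m ^ 2 ≤ a) (hb : |b| ≤ L + L ^ 2) (hc : |c| ≤ L + L ^ 2) (hS : |S| ≤ 5 * L ^ 2 * δ)
    (hw : |w| ≤ 2 * δ) (hV : ε ^ 2 * q ^ 2 < r ^ 2) :
    2 * r * (-a * r - w * b * r - w * c * q - ρ * (S * ((1 - ρ) * q - r)))
      - ε ^ 2 * (2 * q * (S * ((1 - ρ) * q - r))) < 0 := by
  have hqr : ε * |q| < |r| := by
    have h1 : (ε * |q|) ^ 2 < |r| ^ 2 := by rw [mul_pow, sq_abs, sq_abs]; exact hV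
    exact lt_of_pow_lt_pow_left₀ 2 (abs_nonneg r) h1
  have hr2 : r ^ 2 = |r| ^ 2 := (sq_abs r).symm
  set P := |r| with hP
  set Q := |q| with hQ
  have hQ0 : 0 ≤ Q := abs_nonneg _
  have hP0 : 0 < P := lt_of_le_of_lt (by positivity) hqr
  have hT : |(1 - ρ) * q - r| ≤ Q + P := by
    refine (abs_sub _ _).trans ?_
    rw [abs_mul, abs_of_nonneg (by linarith : 0 ≤ 1 - ρ)]
    nlinarith
  set T := (1 - ρ) * q - r with hTdef
  set M := L + L ^ 2 with hM
  have hM0 : 0 < M := by positivity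
  have hLM : L ^ 2 ≤ M := by linarith
  have hST : |S * T| ≤ 5 * M * δ * (Q + P) := by
    rw [abs_mul]
    have : 5 * L ^ 2 * δ ≤ 5 * M * δ := by gcongr
    exact mul_le_mul (hS.trans this) hT (abs_nonneg _) (by positivity)
  have t2 : |2 * (w * b) * r ^ 2| ≤ 4 * δ * M * P ^ 2 := by
    rw [abs_mul, abs_mul, abs_mul, abs_two, hr2, abs_of_nonneg (sq_nonneg P)]
    have : |w| * |b| ≤ 2 * δ * M := mul_le_mul hw hb (abs_nonneg _) (by positivity)
    nlinarith [sq_nonneg P]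
  have t3 : |2 * (w * c) * (q * r)| ≤ 4 * δ * M * (Q * P) := by
    rw [abs_mul, abs_mul, abs_mul, abs_two, abs_mul q r]
    have : |w| * |c| ≤ 2 * δ * M := mul_le_mul hw hc (abs_nonneg _) (by positivity)
    nlinarith [mul_nonneg hQ0 hP0.le]
  have t4 : |2 * ρ * r * (S * T)| ≤ 2 * P * (5 * M * δ * (Q + P)) := by
    rw [abs_mul]
    refine mul_le_mul ?_ hST (abs_nonneg _) (by positivity)
    rw [abs_mul, abs_mul, abs_two, abs_of_nonneg hρ0]
    nlinarith
  have t5 : |2 * ε ^ 2 * q * (S * T)| ≤ 2 * (ε * P) * (5 * M * δ * (Q + P)) := by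
    rw [abs_mul]
    refine mul_le_mul ?_ hST (abs_nonneg _) (by positivity)
    rw [abs_mul, abs_mul, abs_two, abs_of_nonneg (sq_nonneg ε)]
    nlinarith
  have hsum : ε * (4 * δ * M * P ^ 2 + 4 * δ * M * (Q * P) + 2 * P * (5 * M * δ * (Q + P))
      + 2 * (ε * P) * (5 * M * δ * (Q + P))) ≤ δ * (48 * M) * P ^ 2 := by
    have e1 : ε * (Q * P) ≤ P ^ 2 := by
      rw [← mul_assoc, pow_two]; exact mul_le_mul_of_nonneg_right hqr.le hP0.le
    have e2 : ε * P ^ 2 ≤ P ^ 2 := mul_le_of_le_one_left (by positivity) hε1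
    have e3 : ε * (ε * (Q * P)) ≤ P ^ 2 :=
      (mul_le_of_le_one_left (by positivity) hε1).trans e1
    have e4 : ε * (ε * P ^ 2) ≤ P ^ 2 :=
      (mul_le_of_le_one_left (by positivity) hε1).trans e2
    have hδM : 0 < δ * M := by positivity
    have : ε * (4 * δ * M * P ^ 2 + 4 * δ * M * (Q * P) + 2 * P * (5 * M * δ * (Q + P))
      + 2 * (ε * P) * (5 * M * δ * (Q + P))) = δ * M * (14 * (ε * P ^ 2) + 14 * (ε * (Q * P))
        + 10 * (ε * (ε * (Q * P))) + 10 * (ε * (ε * P ^ 2))) := by ring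
    rw [this, show δ * (48 * M) * P ^ 2 = δ * M * (48 * P ^ 2) by ring]
    exact mul_le_mul_of_nonneg_left (by linarith) hδM.le
  have hfin : 4 * δ * M * P ^ 2 + 4 * δ * M * (Q * P) + 2 * P * (5 * M * δ * (Q + P))
      + 2 * (ε * P) * (5 * M * δ * (Q + P)) < m ^ 2 * P ^ 2 := by
    have h1 : δ * (48 * M) * P ^ 2 < ε * m ^ 2 * P ^ 2 :=
      mul_lt_mul_of_pos_right hδ1 (by positivity)
    have h2 := hsum.trans_lt h1
    rw [mul_assoc ε (m ^ 2)] at h2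
    exact lt_of_mul_lt_mul_left h2 hε.le
  have haP : m ^ 2 * P ^ 2 ≤ a * r ^ 2 := by rw [hr2]; gcongr
  have hmP : 0 < m ^ 2 * P ^ 2 := by positivity
  have heq : 2 * r * (-a * r - w * b * r - w * c * q - ρ * (S * T)) - ε ^ 2 * (2 * q * (S * T))
      = -2 * (a * r ^ 2) - 2 * (w * b) * r ^ 2 - 2 * (w * c) * (q * r) - 2 * ρ * r * (S * T)
        - 2 * ε ^ 2 * q * (S * T) := by ring
  rw [heq]
  linarith [(abs_le.1 t2).1, (abs_le.1 t3).1, (abs_le.1 t4).1, (abs_le.1 t5).1]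

/-- The slope of the slow manifold. -/
lemma abs_sub_le_of_forall_le (h : SlowFast A B vs d e k δ w z) {m L ε : ℝ} (hm : 0 < m)
    (hA : A ∈ Icc m L) (hB : B ∈ Icc m L) (hvs : vs ∈ Icc m L) (hd : d ∈ Icc m L)
    (he : e ∈ Icc m L) (hk : k ∈ Icc m L) (hδ : 0 < δ) (hε : 0 < ε) (hε1 : ε ≤ 1)
    (hδ1 : δ * (48 * (L + L ^ 2)) < ε * m ^ 2) {b : ℝ} (hb : ∀ x ≤ b, |w x| ≤ 2 * δ) :
    |z b - A * d / (B * vs + A * d) * (k * w b * (δ - w b))| ≤ ε * |k * w b * (δ - w b)| := by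
  have hA0 := hm.trans_le hA.1
  have hB0 := hm.trans_le hB.1
  have hvs0 := hm.trans_le hvs.1
  have hd0 := hm.trans_le hd.1
  have he0 := hm.trans_le he.1
  have hk0 := hm.trans_le hk.1
  have hL := hm.trans_le (hA.1.trans hA.2)
  -- At leading order the fast equation balances `-B vs z + A d (q - z) = 0`, that is `z = ρ q`.
  set ρ := A * d / (B * vs + A * d) with hρ
  have hden : 0 < B * vs + A * d := by positivity
  have hρ0 : 0 ≤ ρ := by positivity
  have hρ1 : ρ ≤ 1 := by rw [hρ, div_le_one hden]; nlinarith
  have hρeq : ρ * (B * vs + A * d) = A * d := div_mul_cancel₀ _ hden.ne'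
  set q : ℝ → ℝ := fun x => k * w x * (δ - w x) with hq
  set r : ℝ → ℝ := fun x => z x - ρ * q x with hr
  have hqd : ∀ x, HasDerivAt q (k * (δ - 2 * w x) * (A * ((1 - ρ) * q x - r x))) x := fun x => by
    have h1 := ((h.hw x).const_mul k).mul ((h.hw x).const_sub δ)
    refine h1.congr_deriv ?_
    simp only [hr, hq]; ring
  have hrd : ∀ x, HasDerivAt r (-(B * vs + A * d) * r x - w x * (B - A * e) * r x
      - w x * (B * ρ + A * e * (1 - ρ)) * q x
      - ρ * (k * (δ - 2 * w x) * (A * ((1 - ρ) * q x - r x)))) x := fun x => by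
    have h1 := (h.hz x).sub ((hqd x).const_mul ρ)
    refine h1.congr_deriv ?_
    simp only [hr, hq]
    linear_combination (-(k * w x * (δ - w x))) * hρeq
  have hqbot : Tendsto q atBot (𝓝 0) := by
    have := (h.w_bot.const_mul k).mul (h.w_bot.const_sub δ)
    simpa using this
  have hrbot : Tendsto r atBot (𝓝 0) := by simpa using h.z_bot.sub (hqbot.const_mul ρ)
  have hVd : ∀ x, HasDerivAt (fun x => r x ^ 2 - ε ^ 2 * q x ^ 2)
      (2 * r x * (-(B * vs + A * d) * r x - w x * (B - A * e) * r x
      - w x * (B * ρ + A * e * (1 - ρ)) * q x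
      - ρ * (k * (δ - 2 * w x) * A * ((1 - ρ) * q x - r x))) -
        ε ^ 2 * (2 * q x * (k * (δ - 2 * w x) * A * ((1 - ρ) * q x - r x)))) x := fun x => by
    refine (((hrd x).pow 2).sub (((hqd x).pow 2).const_mul (ε ^ 2))).congr_deriv ?_
    simp only [Nat.cast_ofNat]; ring
  -- The quantity tends to `0` at `-∞` and, by `cone_aux`, decreases wherever it is positive.
  have hV : r b ^ 2 - ε ^ 2 * q b ^ 2 ≤ 0 := by
    refine nonpos_of_deriv_neg_of_pos (f := fun x => r x ^ 2 - ε ^ 2 * q x ^ 2)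
      (fun x _ => hVd x) ?_ ?_
    · simpa using (hrbot.pow 2).sub ((hqbot.pow 2).const_mul (ε ^ 2))
    · intro x hx hVx
      have hwx := hb x hx
      have hBv : m ^ 2 ≤ B * vs := by
        rw [pow_two]; exact mul_le_mul hB.1 hvs.1 hm.le hB0.le
      have hAd : 0 < A * d := by positivity
      have hAe : A * e ≤ L ^ 2 := by
        rw [pow_two]; exact mul_le_mul hA.2 he.2 he0.le hL.le
      have hAe0 : 0 < A * e := by positivity
      refine cone_aux hm hL hδ hε hε1 hδ1 hρ0 hρ1 (by linarith) ?_ ?_ ?_ hwx (by linarith)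
      · rw [abs_le]; constructor <;> linarith [hB.2, hAe]
      · have h1 : 0 ≤ B * ρ + A * e * (1 - ρ) :=
          add_nonneg (by positivity) (mul_nonneg hAe0.le (by linarith))
        rw [abs_of_nonneg h1]
        nlinarith [hB.2]
      · rw [abs_mul, abs_mul, abs_of_pos hk0, abs_of_pos hA0]
        have h1 : |δ - 2 * w x| ≤ 5 * δ := by
          have := abs_le.1 hwx
          rw [abs_le]; constructor <;> linarith
        calc k * |δ - 2 * w x| * A ≤ L * (5 * δ) * L := by
              gcongr
              · exact hk.2
              · exact hA.2
          _ = _ := by ring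
  have h3 : |r b| ≤ |ε * q b| := sq_le_sq.1 (by rw [mul_pow]; linarith)
  rwa [abs_mul, abs_of_pos hε] at h3

/-- The orbit stays in the strip between the end states and close to the slow manifold. -/
theorem confined (h : SlowFast A B vs d e k δ w z) {m L ε : ℝ} (hm : 0 < m)
    (hA : A ∈ Icc m L) (hB : B ∈ Icc m L) (hvs : vs ∈ Icc m L) (hd : d ∈ Icc m L)
    (he : e ∈ Icc m L) (hk : k ∈ Icc m L) (hδ : 0 < δ) (hε : 0 < ε) (hε1 : ε ≤ 1)
    (hερ : ε < m ^ 2 / (2 * L ^ 2))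
    (hδ1 : δ * (48 * (L + L ^ 2)) < ε * m ^ 2) :
    (∀ x, 0 < w x ∧ w x < δ) ∧
    ∀ x, |z x - A * d / (B * vs + A * d) * (k * w x * (δ - w x))| ≤ ε * (k * w x * (δ - w x)) := by
  have hA0 := hm.trans_le hA.1
  have hB0 := hm.trans_le hB.1
  have hvs0 := hm.trans_le hvs.1
  have hd0 := hm.trans_le hd.1
  have hk0 := hm.trans_le hk.1
  have hL := hm.trans_le (hA.1.trans hA.2)
  set ρ := A * d / (B * vs + A * d) with hρ
  have hden : 0 < B * vs + A * d := by positivity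
  -- This makes `q - z`, and with it `w'`, take the sign of `q` inside the cone.
  have h1ρ : ε < 1 - ρ := by
    have h1 : 1 - ρ = B * vs / (B * vs + A * d) := by rw [hρ]; field_simp; ring
    rw [h1]
    refine hερ.trans_le ?_
    have : B * vs + A * d ≤ 2 * L ^ 2 := by
      have := mul_le_mul hB.2 hvs.2 hvs0.le hL.le
      have := mul_le_mul hA.2 hd.2 hd0.le hL.le
      nlinarith
    have h2 : m ^ 2 ≤ B * vs := by rw [pow_two]; exact mul_le_mul hB.1 hvs.1 hm.le hB0.le
    exact div_le_div₀ (by positivity) h2 hden this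
  have hρ0 : 0 ≤ ρ := by positivity
  have hwc : Continuous w := continuous_iff_continuousAt.2 fun x => (h.hw x).continuousAt
  have hnn := h.nonneg hA0 hB0 hk0 hδ
  have hcone : ∀ b, (∀ x ≤ b, |w x| ≤ 2 * δ) →
      |z b - ρ * (k * w b * (δ - w b))| ≤ ε * |k * w b * (δ - w b)| := fun b hb =>
    h.abs_sub_le_of_forall_le hm hA hB hvs hd he hk hδ hε hε1 hδ1 hb
  -- Continuation: the cone estimate at `b` only needs `|w| ≤ 2 δ` up to `b`, so it holds at the
  -- first point where `w = 3/2 δ`. There `q < 0`, hence `w' < 0`, and `w` would have exceeded this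
  -- level earlier.
  have hlt : ∀ x, w x < 3 / 2 * δ := by
    by_contra! hx
    set S := {x | 3 / 2 * δ ≤ w x} with hS
    have hSc : IsClosed S := isClosed_le continuous_const hwc
    have hSne : S.Nonempty := hx
    have hSb : BddBelow S := by
      obtain ⟨a, ha⟩ := eventually_atBot.1
        (h.w_bot.eventually (gt_mem_nhds (by linarith : (0 : ℝ) < 3 / 2 * δ)))
      exact ⟨a, fun y hy => le_of_not_gt fun hya => absurd (ha y hya.le) (not_lt.2 hy)⟩
    have hmem : sInf S ∈ S := hSc.csInf_mem hSne hSb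
    set b := sInf S with hb
    have hbef : ∀ x < b, w x < 3 / 2 * δ := fun x hx => not_le.1 fun hxS =>
      absurd (csInf_le hSb hxS) (not_le.2 hx)
    have hbe : w b ≤ 3 / 2 * δ := by
      have h1 : Tendsto w (𝓝[<] b) (𝓝 (w b)) := hwc.continuousAt.tendsto.mono_left inf_le_left
      refine le_of_tendsto h1 ?_
      filter_upwards [self_mem_nhdsWithin] with x hx using (hbef x hx).le
    have hbw : w b = 3 / 2 * δ := le_antisymm hbe hmem
    have hc := hcone b fun x hx => by
      rw [abs_of_nonneg (hnn x)]
      rcases hx.lt_or_eq with h1 | h1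
      · linarith [hbef x h1]
      · rw [h1]; linarith
    rw [hbw] at hc
    have hq : k * (3 / 2 * δ) * (δ - 3 / 2 * δ) < 0 := by
      have : k * (3 / 2 * δ) * (δ - 3 / 2 * δ) = -(3 / 4 * (k * δ ^ 2)) := by ring
      rw [this, neg_lt_zero]; positivity
    rw [abs_of_neg hq] at hc
    have hd := h.hw b
    rw [hbw] at hd
    have hneg : A * (k * (3 / 2 * δ) * (δ - 3 / 2 * δ) - z b) < 0 := by
      refine mul_neg_of_pos_of_neg hA0 ?_
      have := (abs_le.1 hc).1
      nlinarith
    have hev := eventually_lt_left_of_deriv_neg hd hneg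
    obtain ⟨y, hy1, hy2⟩ := (hev.and self_mem_nhdsWithin).exists
    have := hbef y hy2
    linarith
  have hcone' : ∀ x, |z x - ρ * (k * w x * (δ - w x))| ≤ ε * |k * w x * (δ - w x)| := fun b =>
    hcone b fun x _ => by rw [abs_of_nonneg (hnn x)]; linarith [hlt x]
  -- A bound of `w'` that is linear both in `w` and in `|δ - w|`. By `eq_zero_of_abs_deriv_le` the
  -- orbit that touches an end value is constant, which contradicts its limit at the opposite end.
  have hder : ∀ x, |A * (k * w x * (δ - w x) - z x)| ≤ 2 * A * (k * (w x * |δ - w x|)) := by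
    intro x
    rw [abs_mul, abs_of_pos hA0, mul_comm 2 A, mul_assoc A 2]
    refine mul_le_mul_of_nonneg_left ?_ hA0.le
    have h1 := hcone' x
    have h2 : |k * w x * (δ - w x)| = k * (w x * |δ - w x|) := by
      rw [abs_mul, abs_mul, abs_of_pos hk0, abs_of_nonneg (hnn x), mul_assoc]
    set q := k * w x * (δ - w x)
    have h3 : |q - z x| ≤ |(1 - ρ) * q| + |z x - ρ * q| := by
      have : q - z x = (1 - ρ) * q - (z x - ρ * q) := by ring
      rw [this]; exact abs_sub _ _
    rw [abs_mul, abs_of_pos (hε.trans h1ρ)] at h3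
    rw [← h2]
    nlinarith [abs_nonneg q]
  have hne0 : ∀ x, w x ≠ 0 := fun x hx => by
    have h1 := eq_zero_of_abs_deriv_le (L := 2 * A * (k * δ)) h.hw (fun y => (hder y).trans ?_) hx
    · have : Tendsto w atTop (𝓝 0) := by
        rw [show w = fun _ => 0 from funext h1]; exact tendsto_const_nhds
      exact hδ.ne' (tendsto_nhds_unique h.w_top this)
    · have h2 : |δ - w y| ≤ δ := abs_le.2 ⟨by linarith [hlt y], by linarith [hnn y]⟩
      rw [abs_of_nonneg (hnn y)]
      have : k * (w y * |δ - w y|) ≤ k * (w y * δ) := by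
        have := hnn y
        gcongr
      calc 2 * A * (k * (w y * |δ - w y|)) ≤ 2 * A * (k * (w y * δ)) := by gcongr
        _ = _ := by ring
  have hneδ : ∀ x, w x - δ ≠ 0 := fun x hx => by
    have h1 := eq_zero_of_abs_deriv_le (L := 2 * A * (k * (3 / 2 * δ)))
      (f := fun x => w x - δ) (fun y => (h.hw y).sub_const δ) (fun y => (hder y).trans ?_) hx
    · have : Tendsto w atBot (𝓝 δ) := by
        rw [show w = fun _ => δ from funext fun y => sub_eq_zero.1 (h1 y)]
        exact tendsto_const_nhds
      exact hδ.ne (tendsto_nhds_unique h.w_bot this)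
    · rw [abs_sub_comm]
      have : k * (w y * |w y - δ|) ≤ k * (3 / 2 * δ * |w y - δ|) := by
        have := (hlt y).le
        gcongr
      calc 2 * A * (k * (w y * |w y - δ|)) ≤ 2 * A * (k * (3 / 2 * δ * |w y - δ|)) := by gcongr
        _ = _ := by ring
  have hpos : ∀ x, 0 < w x := fun x => lt_of_le_of_ne (hnn x) (hne0 x).symm
  have hltδ : ∀ x, w x < δ := fun x => by
    by_contra! hx
    obtain ⟨a, ha1, ha2⟩ := ((h.w_bot.eventually (gt_mem_nhds hδ)).and
      (eventually_le_atBot x)).exists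
    obtain ⟨y, -, hy⟩ := intermediate_value_Icc ha2 hwc.continuousOn ⟨ha1.le, hx⟩
    exact hneδ y (by rw [hy, sub_self])
  refine ⟨fun x => ⟨hpos x, hltδ x⟩, fun x => ?_⟩
  have := hcone' x
  rwa [abs_of_nonneg (mul_nonneg (mul_nonneg hk0.le (hnn x)) (by linarith [hltδ x]))] at this

end SlowFast
/-! ### Rankine--Hugoniot conditions -/

/-- Inserting the first two conditions into the energy condition leaves `σ [v]` times an expression
that must vanish. The resulting last relation measures by how much `σ²` falls short of the squared
sound speed `γ p / v` on the left: an amount of first order in the strength. -/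
lemma Gas.RankineHugoniot.relations {g : Gas} {UL UR : State} {σ : ℝ}
    (h : g.RankineHugoniot UL UR σ) (hL : UL.Admissible) (hR : UR.Admissible) (hσ : 0 < σ)
    (hv : UL.v < UR.v) :
    UR.u = UL.u - σ * (UR.v - UL.v) ∧ g.p UR = g.p UL - σ ^ 2 * (UR.v - UL.v) ∧
    g.γ * g.p UL - σ ^ 2 * UL.v = (g.γ + 1) / 2 * σ ^ 2 * (UR.v - UL.v) := by
  obtain ⟨h1, h2, h3⟩ := h
  have hγ : g.γ - 1 ≠ 0 := by linarith [g.one_lt_γ]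
  have e1 : UR.u = UL.u - σ * (UR.v - UL.v) := by linarith
  have e2 : g.p UR = g.p UL - σ ^ 2 * (UR.v - UL.v) := by rw [e1] at h2; linarith
  refine ⟨e1, e2, ?_⟩
  have pL : g.R * UL.θ = g.p UL * UL.v := by
    unfold Gas.p; field_simp [hL.1.ne']
  have pR : g.R * UR.θ = g.p UR * UR.v := by
    unfold Gas.p; field_simp [hR.1.ne']
  have eE : g.E UR - g.E UL = (g.p UR * UR.v - g.p UL * UL.v) / (g.γ - 1)
      + (UR.u ^ 2 / 2 - UL.u ^ 2 / 2) := by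
    unfold Gas.E
    rw [← pL, ← pR]
    ring
  rw [eE, e1, e2] at h3
  have h4 : σ * (UR.v - UL.v) * (g.γ * g.p UL - σ ^ 2 * UL.v
      - (g.γ + 1) / 2 * σ ^ 2 * (UR.v - UL.v)) = 0 := by
    field_simp at h3
    linear_combination (-1 / 2) * h3
  have h5 : σ * (UR.v - UL.v) ≠ 0 := mul_ne_zero hσ.ne' (sub_pos.2 hv).ne'
  have := (mul_eq_zero.1 h4).resolve_left h5
  linarith

/-! ### First integrals of the travelling wave equations -/

/-- A shock profile comes without information on its derivatives at `-∞`; this shows that they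
vanish there as soon as they converge. By the mean value theorem `f x - f (x - 1)`, which tends to
`0`, is a value of the derivative near `x`. -/
lemma deriv_limit_eq_zero {f : ℝ → ℝ} {l l' : ℝ} (hf : Differentiable ℝ f)
    (h : Tendsto f atBot (𝓝 l)) (h' : Tendsto (deriv f) atBot (𝓝 l')) : l' = 0 := by
  have h1 : ∀ x : ℝ, ∃ c ∈ Ioo (x - 1) x, deriv f c = f x - f (x - 1) := fun x => by
    obtain ⟨c, hc, h2⟩ := exists_deriv_eq_slope f (by linarith : x - 1 < x)
      hf.continuous.continuousOn hf.differentiableOn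
    exact ⟨c, hc, by rw [h2]; ring⟩
  choose c hc hcd using h1
  have hcb : Tendsto c atBot atBot := tendsto_atBot_mono (fun x => (hc x).2.le) tendsto_id
  have h2 : Tendsto (fun x => f x - f (x - 1)) atBot (𝓝 l') := by
    refine (h'.comp hcb).congr fun x => ?_
    exact hcd x
  have h3 : Tendsto (fun x => f x - f (x - 1)) atBot (𝓝 (l - l)) :=
    h.sub (h.comp (tendsto_atBot_add_const_right _ (-1) tendsto_id))
  rw [sub_self] at h3
  exact tendsto_nhds_unique h2 h3

lemma eq_of_deriv_eq_zero_of_tendsto {f : ℝ → ℝ} {l : ℝ} (hf : Differentiable ℝ f)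
    (h0 : ∀ x, deriv f x = 0) (h : Tendsto f atBot (𝓝 l)) (x : ℝ) : f x = l := by
  have h1 : f = fun _ => f x := funext fun y => is_const_of_deriv_eq_zero hf h0 y x
  rw [h1] at h
  exact tendsto_nhds_unique tendsto_const_nhds h

lemma ContDiff.differentiable_deriv_two {f : ℝ → ℝ} (hf : ContDiff ℝ 2 f) :
    Differentiable ℝ (deriv f) := by
  have h1 : ContDiff ℝ (1 + 1) f := hf
  exact ((contDiff_succ_iff_deriv.1 h1).2.2).differentiable one_ne_zero

namespace Gas.IsShockProfile

variable {g : Gas} {UL UR : State} {σ : ℝ} {S : ℝ → State}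

/-- Each profile equation is a total derivative, and the constants of integration are read off at
`-∞`. The velocity and the viscous stress found first then eliminate `u` from the energy integral.
-/
lemma first_integrals (h : g.IsShockProfile UL UR σ S) (hL : UL.Admissible) (ξ : ℝ) :
    (S ξ).u = UL.u - σ * ((S ξ).v - UL.v) ∧
    deriv (fun x => (S x).u) ξ = -σ * deriv (fun x => (S x).v) ξ ∧
    g.μ * deriv (fun x => (S x).u) ξ / (S ξ).v =
      -σ * ((S ξ).u - UL.u) + (g.p (S ξ) - g.p UL) ∧
    g.κ * deriv (fun x => (S x).θ) ξ / (S ξ).v =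
      -σ * (g.R / (g.γ - 1) * ((S ξ).θ - UL.θ) + g.p UL * ((S ξ).v - UL.v)
        - σ ^ 2 * ((S ξ).v - UL.v) ^ 2 / 2) := by
  have dv : Differentiable ℝ (fun x => (S x).v) := h.smooth_v.differentiable two_ne_zero
  have du : Differentiable ℝ (fun x => (S x).u) := h.smooth_u.differentiable two_ne_zero
  have dθ : Differentiable ℝ (fun x => (S x).θ) := h.smooth_θ.differentiable two_ne_zero
  have ddu := ContDiff.differentiable_deriv_two h.smooth_u
  have ddθ := ContDiff.differentiable_deriv_two h.smooth_θ
  have hv0 : ∀ x, (S x).v ≠ 0 := fun x => (h.pos x).1.ne'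
  have dp : Differentiable ℝ (fun x => g.p (S x)) := by
    unfold Gas.p
    exact (dθ.const_mul _).div dv hv0
  have dE : Differentiable ℝ (fun x => g.E (S x)) := by
    unfold Gas.E
    exact (dθ.const_mul _).add ((du.pow 2).div_const 2)
  have lp : Tendsto (fun x => g.p (S x)) atBot (𝓝 (g.p UL)) := by
    unfold Gas.p
    exact (h.lim_bot_θ.const_mul _).div h.lim_bot_v hL.1.ne'
  have lE : Tendsto (fun x => g.E (S x)) atBot (𝓝 (g.E UL)) := by
    unfold Gas.E
    exact (h.lim_bot_θ.const_mul _).add ((h.lim_bot_u.pow 2).div_const 2)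
  have hu : ∀ x, σ * (S x).v + (S x).u = σ * UL.v + UL.u := by
    refine eq_of_deriv_eq_zero_of_tendsto ((dv.const_mul σ).add du) (fun x => ?_)
      ((h.lim_bot_v.const_mul σ).add h.lim_bot_u)
    have e1 : deriv ((fun y => σ * (S y).v) + fun y => (S y).u) x
        = σ * deriv (fun y => (S y).v) x + deriv (fun y => (S y).u) x := by
      rw [deriv_add ((dv x).const_mul σ) (du x), deriv_const_mul σ (dv x)]
    refine e1.trans ?_
    linarith [h.mass x]
  -- momentum
  set J : ℝ → ℝ := fun x => g.μ * deriv (fun y => (S y).u) x / (S x).v with hJ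
  have dJ : Differentiable ℝ J := (ddu.const_mul _).div dv hv0
  set M : ℝ → ℝ := fun x => -σ * (S x).u + g.p (S x) - J x with hM
  have dM : Differentiable ℝ M := ((du.const_mul _).add dp).sub dJ
  have hM0 : ∀ x, deriv M x = 0 := fun x => by
    have e1 : HasDerivAt M (-σ * deriv (fun y => (S y).u) x + deriv (fun y => g.p (S y)) x
        - deriv J x) x :=
      (((du x).hasDerivAt.const_mul (-σ)).add (dp x).hasDerivAt).sub (dJ x).hasDerivAt
    rw [e1.deriv, sub_eq_zero]
    exact h.momentum x
  have hMc : ∀ x, M x = M 0 := fun x => is_const_of_deriv_eq_zero dM hM0 x 0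
  -- Constancy of `M` makes the stress converge at `-∞`, so `u'` converges and its limit is zero;
  -- this identifies `M 0`. The heat flux is treated in the same way.
  have lJ : Tendsto J atBot (𝓝 (-σ * UL.u + g.p UL - M 0)) := by
    have h1 := ((h.lim_bot_u.const_mul (-σ)).add lp).sub_const (M 0)
    refine h1.congr fun x => ?_
    rw [← hMc x, hM]; ring
  have lu' : Tendsto (deriv fun y => (S y).u) atBot
      (𝓝 ((-σ * UL.u + g.p UL - M 0) * UL.v / g.μ)) := by
    refine ((lJ.mul h.lim_bot_v).div_const g.μ).congr fun x => ?_
    simp only [hJ]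
    have := hv0 x
    have := g.μ_pos.ne'
    field_simp
  have hM1 : -σ * UL.u + g.p UL - M 0 = 0 := by
    have h1 := deriv_limit_eq_zero du h.lim_bot_u lu'
    rw [div_eq_zero_iff, mul_eq_zero] at h1
    rcases h1 with (h1 | h1) | h1
    · exact h1
    · exact absurd h1 hL.1.ne'
    · exact absurd h1 g.μ_pos.ne'
  rw [hM1] at lJ
  have hJx : ∀ x, J x = -σ * ((S x).u - UL.u) + (g.p (S x) - g.p UL) := fun x => by
    have := hMc x
    simp only [hM] at this hM1
    linarith
  -- energy
  set K : ℝ → ℝ := fun x => g.κ * deriv (fun y => (S y).θ) x / (S x).v with hK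
  have dK : Differentiable ℝ K := (ddθ.const_mul _).div dv hv0
  have hJu : ∀ x, g.μ * (S x).u * deriv (fun y => (S y).u) x / (S x).v = (S x).u * J x :=
    fun x => by simp only [hJ]; ring
  set N : ℝ → ℝ := fun x => -σ * g.E (S x) + g.p (S x) * (S x).u - (K x + (S x).u * J x) with hN
  have dN : Differentiable ℝ N :=
    ((dE.const_mul _).add (dp.mul du)).sub (dK.add (du.mul dJ))
  have hN0 : ∀ x, deriv N x = 0 := fun x => by
    have e1 : HasDerivAt N (-σ * deriv (fun y => g.E (S y)) x
        + deriv (fun y => g.p (S y) * (S y).u) x - (deriv K x + deriv (fun y => (S y).u * J y) x)) x :=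
      (((dE x).hasDerivAt.const_mul (-σ)).add ((dp x).mul (du x)).hasDerivAt).sub
        ((dK x).hasDerivAt.add ((du x).mul (dJ x)).hasDerivAt)
    rw [e1.deriv, sub_eq_zero]
    have e2 := h.energy x
    simp only [hJu] at e2
    exact e2
  have hNc : ∀ x, N x = N 0 := fun x => is_const_of_deriv_eq_zero dN hN0 x 0
  have lK : Tendsto K atBot (𝓝 (-σ * g.E UL + g.p UL * UL.u - N 0)) := by
    have h1 := (((lE.const_mul (-σ)).add (lp.mul h.lim_bot_u)).sub
      (h.lim_bot_u.mul lJ)).sub_const (N 0)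
    rw [mul_zero, sub_zero] at h1
    refine h1.congr fun x => ?_
    rw [← hNc x, hN]; ring
  have lθ' : Tendsto (deriv fun y => (S y).θ) atBot
      (𝓝 ((-σ * g.E UL + g.p UL * UL.u - N 0) * UL.v / g.κ)) := by
    refine ((lK.mul h.lim_bot_v).div_const g.κ).congr fun x => ?_
    simp only [hK]
    have := hv0 x
    have := g.κ_pos.ne'
    field_simp
  have hN1 : -σ * g.E UL + g.p UL * UL.u - N 0 = 0 := by
    have h1 := deriv_limit_eq_zero dθ h.lim_bot_θ lθ'
    rw [div_eq_zero_iff, mul_eq_zero] at h1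
    rcases h1 with (h1 | h1) | h1
    · exact h1
    · exact absurd h1 hL.1.ne'
    · exact absurd h1 g.κ_pos.ne'
  have huξ : (S ξ).u = UL.u - σ * ((S ξ).v - UL.v) := by linarith [hu ξ]
  refine ⟨huξ, by linarith [h.mass ξ], hJx ξ, ?_⟩
  have e1 := hNc ξ
  have e2 := hJx ξ
  change K ξ = _
  have e3 : K ξ = -σ * (g.E (S ξ) - g.E UL) + (g.p (S ξ) * (S ξ).u - g.p UL * UL.u)
      - (S ξ).u * J ξ := by
    simp only [hN] at e1 hN1
    linarith
  rw [e3, e2, huξ]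
  unfold Gas.E
  rw [huξ]
  ring

/-- The deviation of the temperature from its nullcline along a shock profile. -/
noncomputable def dev (g : Gas) (UL : State) (σ : ℝ) (S : ℝ → State) (ξ : ℝ) : ℝ :=
  (S ξ).θ - UL.θ + (g.γ - 1) / g.R *
    (g.p UL * ((S ξ).v - UL.v) - σ ^ 2 * ((S ξ).v - UL.v) ^ 2 / 2)

lemma deriv_θ (h : g.IsShockProfile UL UR σ S) (hL : UL.Admissible) (ξ : ℝ) :
    deriv (fun x => (S x).θ) ξ =
      -(σ * g.R / (g.κ * (g.γ - 1)) * ((UL.v + ((S ξ).v - UL.v)) * dev g UL σ S ξ)) := by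
  obtain ⟨-, -, -, h4⟩ := h.first_integrals hL ξ
  have hv := (h.pos ξ).1.ne'
  have hκ := g.κ_pos.ne'
  have hR := g.R_pos.ne'
  have hγ : g.γ - 1 ≠ 0 := by linarith [g.one_lt_γ]
  rw [div_eq_iff hv] at h4
  rw [← mul_right_inj' hκ, h4]
  unfold dev
  field_simp
  ring

/-- After multiplication by `v`, the momentum integral is quadratic in `v - v_L` up to the deviation
of the temperature. One root is the left state, and `hrel` places the other at the right state. -/
lemma deriv_v (h : g.IsShockProfile UL UR σ S) (hL : UL.Admissible) (hσ : 0 < σ)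
    (hrel : g.γ * g.p UL - σ ^ 2 * UL.v = (g.γ + 1) / 2 * σ ^ 2 * (UR.v - UL.v)) (ξ : ℝ) :
    deriv (fun x => (S x).v) ξ =
      g.R / (g.μ * σ) * ((g.γ + 1) * σ ^ 2 / (2 * g.R) * ((S ξ).v - UL.v) *
        ((UR.v - UL.v) - ((S ξ).v - UL.v)) - dev g UL σ S ξ) := by
  obtain ⟨h1, h2, h3, -⟩ := h.first_integrals hL ξ
  have hv := (h.pos ξ).1.ne'
  have hμ := g.μ_pos.ne'
  have hR := g.R_pos.ne'
  have hp : g.p (S ξ) * (S ξ).v = g.R * (S ξ).θ := by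
    unfold Gas.p; field_simp
  have hpL : g.R * UL.θ = g.p UL * UL.v := by
    unfold Gas.p; field_simp [hL.1.ne']
  rw [h2, h1, div_eq_iff hv] at h3
  have h5 : g.μ * σ * deriv (fun x => (S x).v) ξ =
      (S ξ).v * (g.p UL - σ ^ 2 * ((S ξ).v - UL.v)) - g.R * (S ξ).θ := by
    linear_combination -h3 - hp
  have hμσ : g.μ * σ ≠ 0 := mul_ne_zero hμ hσ.ne'
  rw [← mul_right_inj' hμσ, h5]
  unfold dev
  field_simp
  linear_combination (2 * ((S ξ).v - UL.v)) * hrel - 2 * hpL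

/-- The specific volume is the slow variable, while `dev` is damped at a rate of order one as the
strength tends to zero. -/
lemma slowFast (h : g.IsShockProfile UL UR σ S) (hL : UL.Admissible) (hσ : 0 < σ)
    (hrel : g.γ * g.p UL - σ ^ 2 * UL.v = (g.γ + 1) / 2 * σ ^ 2 * (UR.v - UL.v)) :
    SlowFast (g.R / (g.μ * σ)) (σ * g.R / (g.κ * (g.γ - 1))) UL.v
      ((g.γ - 1) / g.R * g.p UL) ((g.γ - 1) / g.R * σ ^ 2) ((g.γ + 1) * σ ^ 2 / (2 * g.R))
      (UR.v - UL.v) (fun ξ => (S ξ).v - UL.v) (dev g UL σ S) where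
  hw x := by
    rw [← h.deriv_v hL hσ hrel x]
    exact ((h.smooth_v.differentiable two_ne_zero) x).hasDerivAt.sub_const _
  hz x := by
    have hw : HasDerivAt (fun ξ => (S ξ).v - UL.v) (deriv (fun x => (S x).v) x) x :=
      ((h.smooth_v.differentiable two_ne_zero) x).hasDerivAt.sub_const _
    have hθ : HasDerivAt (fun ξ => (S ξ).θ - UL.θ) (deriv (fun x => (S x).θ) x) x :=
      ((h.smooth_θ.differentiable two_ne_zero) x).hasDerivAt.sub_const _
    have h1 := hθ.add (((hw.const_mul (g.p UL)).sub
      (((hw.pow 2).const_mul (σ ^ 2)).div_const 2)).const_mul ((g.γ - 1) / g.R))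
    refine h1.congr_deriv ?_
    rw [h.deriv_v hL hσ hrel x, h.deriv_θ hL x]
    simp only [Nat.cast_ofNat]
    ring
  pos x := by have := (h.pos x).1; linarith
  w_bot := by simpa using h.lim_bot_v.sub_const UL.v
  w_top := h.lim_top_v.sub_const UL.v
  z_bot := by
    have hw : Tendsto (fun ξ => (S ξ).v - UL.v) atBot (𝓝 0) := by
      simpa using h.lim_bot_v.sub_const UL.v
    have hθ : Tendsto (fun ξ => (S ξ).θ - UL.θ) atBot (𝓝 0) := by
      simpa using h.lim_bot_θ.sub_const UL.θ
    have := hθ.add (((hw.const_mul (g.p UL)).sub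
      (((hw.pow 2).const_mul (σ ^ 2)).div_const 2)).const_mul ((g.γ - 1) / g.R))
    simp only [ne_eq, OfNat.ofNat_ne_zero, not_false_eq_true, zero_pow, mul_zero, zero_div,
      sub_zero, add_zero] at this
    exact this

end Gas.IsShockProfile
-- ### Weak viscous shock profiles
/-- The state `U`, its pressure and its sound speed `s` (in Lagrangian mass coordinates) lie
between the positive bounds `m` and `L`. -/
structure Gas.IsBase (g : Gas) (m L : ℝ) (U : State) (s : ℝ) : Prop where
  m_pos : 0 < m
  v_mem : U.v ∈ Icc m L
  θ_mem : U.θ ∈ Icc m L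
  p_mem : g.p U ∈ Icc m L
  s_mem : s ∈ Icc m L
  sq_s : s ^ 2 * U.v = g.γ * g.p U

lemma Gas.IsBase.adm {g : Gas} {m L s : ℝ} {U : State} (h : g.IsBase m L U s) : U.Admissible :=
  ⟨h.m_pos.trans_le h.v_mem.1, h.m_pos.trans_le h.θ_mem.1⟩

/-- The effective dissipation `μ + κ (γ - 1)² / (R γ)`. -/
noncomputable def Gas.dissip (g : Gas) : ℝ := g.μ + g.κ * (g.γ - 1) ^ 2 / (g.R * g.γ)

lemma Gas.γ_pos (g : Gas) : 0 < g.γ := by linarith [g.one_lt_γ]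

lemma Gas.γ_sub_pos (g : Gas) : 0 < g.γ - 1 := by linarith [g.one_lt_γ]

lemma Gas.dissip_pos (g : Gas) : 0 < g.dissip := by
  have := g.μ_pos; have := g.κ_pos; have := g.R_pos; have := g.γ_pos; have := g.γ_sub_pos
  unfold Gas.dissip; positivity

/-- By `hrel`, `(s² - σ²) v` is `(γ + 1) / 2 * σ² δ`, and `(s + σ) v ≥ 2 m²`. -/
lemma abs_sub_speed_le {γ σ s v p m L δ : ℝ} (hγ : 0 < γ) (hm : 0 < m) (hσ : σ ∈ Icc m L)
    (hs : s ∈ Icc m L)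
    (hv : v ∈ Icc m L) (hsq : s ^ 2 * v = γ * p) (hδ : 0 < δ)
    (hrel : γ * p - σ ^ 2 * v = (γ + 1) / 2 * σ ^ 2 * δ) :
    |σ - s| ≤ (γ + 1) * L ^ 2 / (4 * m ^ 2) * δ := by
  have hσ0 := hm.trans_le hσ.1
  have hs0 := hm.trans_le hs.1
  have hv0 := hm.trans_le hv.1
  have h1 : (s - σ) * ((s + σ) * v) = (γ + 1) / 2 * σ ^ 2 * δ := by
    rw [← hrel, ← hsq]; ring
  have h2 : 0 ≤ s - σ := by
    by_contra! hlt
    have : (s - σ) * ((s + σ) * v) < 0 := mul_neg_of_neg_of_pos hlt (by positivity)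
    have : 0 < (γ + 1) / 2 * σ ^ 2 * δ := by positivity
    linarith
  rw [abs_sub_comm, abs_of_nonneg h2]
  have h3 : 2 * m ^ 2 ≤ (s + σ) * v := by
    have : (m + m) * m ≤ (s + σ) * v :=
      mul_le_mul (add_le_add hs.1 hσ.1) hv.1 hm.le (by positivity)
    linarith
  have h4 : (s - σ) * (2 * m ^ 2) ≤ (γ + 1) / 2 * L ^ 2 * δ := by
    calc (s - σ) * (2 * m ^ 2) ≤ (s - σ) * ((s + σ) * v) := by gcongr
      _ = (γ + 1) / 2 * σ ^ 2 * δ := h1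
      _ ≤ _ := by gcongr; exact hσ.2
  rw [div_mul_eq_mul_div, le_div_iff₀ (by positivity)]
  linarith

/-- The factor multiplied by `dissip` is `A (1 - ρ) k`, the logistic rate of the flow on the slow
manifold. For `σ = s` the product is exactly `(γ + 1) / 2 * s`; the rest is Lipschitz dependence on
`σ`. -/
lemma slow_rate {g : Gas} {σ s v p m L : ℝ} (hm : 0 < m) (hσ : σ ∈ Icc m L) (hs : s ∈ Icc m L)
    (hv : v ∈ Icc m L) (hp : p ∈ Icc m L) (hsq : s ^ 2 * v = g.γ * p) :
    |g.dissip * (g.R / (g.μ * σ) * (1 - g.R / (g.μ * σ) * ((g.γ - 1) / g.R * p) /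
      (σ * g.R / (g.κ * (g.γ - 1)) * v + g.R / (g.μ * σ) * ((g.γ - 1) / g.R * p))) *
        ((g.γ + 1) * σ ^ 2 / (2 * g.R))) - (g.γ + 1) / 2 * s| ≤
      (g.γ + 1) / 2 * (5 * L ^ 2 * (g.R * L ^ 3 * g.μ + g.κ * (g.γ - 1) ^ 2 * L) /
        (m ^ 2 * (g.κ * (g.γ - 1) ^ 2 * m))) * |σ - s| := by
  have hσ0 := hm.trans_le hσ.1
  have hs0 := hm.trans_le hs.1
  have hv0 := hm.trans_le hv.1
  have hp0 := hm.trans_le hp.1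
  have hL := hp0.trans_le hp.2
  have hμ := g.μ_pos
  have hκ := g.κ_pos
  have hR := g.R_pos
  have hγ := g.γ_pos
  have hγ1 := g.γ_sub_pos
  set D1 := g.R * v * σ ^ 2 * g.μ + g.κ * (g.γ - 1) ^ 2 * p with hD1
  set D0 := g.R * v * s ^ 2 * g.μ + g.κ * (g.γ - 1) ^ 2 * p with hD0
  have hD1pos : 0 < D1 := by positivity
  have hdis : g.dissip = D0 / (g.R * (s ^ 2 * v)) := by
    rw [hsq, hD0, show g.R * v * s ^ 2 * g.μ = g.R * (s ^ 2 * v) * g.μ by ring, hsq]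
    unfold Gas.dissip
    field_simp
  have e1 : g.R / (g.μ * σ) * (1 - g.R / (g.μ * σ) * ((g.γ - 1) / g.R * p) /
      (σ * g.R / (g.κ * (g.γ - 1)) * v + g.R / (g.μ * σ) * ((g.γ - 1) / g.R * p))) *
        ((g.γ + 1) * σ ^ 2 / (2 * g.R)) = (g.γ + 1) / 2 * (g.R * v * σ ^ 3 / D1) := by
    have : σ * g.R / (g.κ * (g.γ - 1)) * v + g.R / (g.μ * σ) * ((g.γ - 1) / g.R * p) =
        D1 / (g.κ * (g.γ - 1) * (g.μ * σ)) := by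
      rw [hD1]; field_simp
    rw [this]
    have h1 : 1 - g.R / (g.μ * σ) * ((g.γ - 1) / g.R * p) / (D1 / (g.κ * (g.γ - 1) * (g.μ * σ)))
        = g.R * v * σ ^ 2 * g.μ / D1 := by
      field_simp
      rw [hD1]; ring
    rw [h1]
    field_simp
  rw [e1, hdis]
  have e2 : D0 / (g.R * (s ^ 2 * v)) * ((g.γ + 1) / 2 * (g.R * v * σ ^ 3 / D1)) -
      (g.γ + 1) / 2 * s = (g.γ + 1) / 2 * ((σ ^ 3 * (D0 - D1) + (σ ^ 3 - s ^ 3) * D1) /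
        (s ^ 2 * D1)) := by
    field_simp
    ring
  rw [e2, abs_mul, abs_of_pos (by positivity : 0 < (g.γ + 1) / 2), mul_assoc]
  refine mul_le_mul_of_nonneg_left ?_ (by positivity)
  rw [abs_div, abs_of_pos (by positivity : 0 < s ^ 2 * D1), div_mul_eq_mul_div]
  have hsub : D0 - D1 = -(g.R * v * g.μ * (σ + s)) * (σ - s) := by rw [hD0, hD1]; ring
  have hsub3 : σ ^ 3 - s ^ 3 = (σ ^ 2 + σ * s + s ^ 2) * (σ - s) := by ring
  have hD1le : D1 ≤ g.R * L ^ 3 * g.μ + g.κ * (g.γ - 1) ^ 2 * L := by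
    have : g.R * v * σ ^ 2 * g.μ ≤ g.R * L * L ^ 2 * g.μ := by
      gcongr
      · exact hv.2
      · exact hσ.2
    have : g.κ * (g.γ - 1) ^ 2 * p ≤ g.κ * (g.γ - 1) ^ 2 * L := by gcongr; exact hp.2
    rw [hD1]; linarith
  have hnum : |σ ^ 3 * (D0 - D1) + (σ ^ 3 - s ^ 3) * D1| ≤
      5 * L ^ 2 * (g.R * L ^ 3 * g.μ + g.κ * (g.γ - 1) ^ 2 * L) * |σ - s| := by
    rw [hsub, hsub3, show σ ^ 3 * (-(g.R * v * g.μ * (σ + s)) * (σ - s)) +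
      (σ ^ 2 + σ * s + s ^ 2) * (σ - s) * D1 =
      (-(σ ^ 3 * (g.R * v * g.μ * (σ + s))) + (σ ^ 2 + σ * s + s ^ 2) * D1) * (σ - s) by ring,
      abs_mul]
    refine mul_le_mul_of_nonneg_right ?_ (abs_nonneg _)
    have hb1 : σ ^ 3 * (g.R * v * g.μ * (σ + s)) ≤ L ^ 3 * (g.R * L * g.μ * (L + L)) := by
      gcongr
      · exact hσ.2
      · exact hv.2
      · exact hσ.2
      · exact hs.2
    have hb2 : (σ ^ 2 + σ * s + s ^ 2) * D1 ≤ (L ^ 2 + L * L + L ^ 2) *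
        (g.R * L ^ 3 * g.μ + g.κ * (g.γ - 1) ^ 2 * L) := by
      gcongr
      · exact hσ.2
      · exact hσ.2
      · exact hs.2
      · exact hs.2
    have hb3 : 0 ≤ σ ^ 3 * (g.R * v * g.μ * (σ + s)) := by positivity
    have hb4 : 0 ≤ (σ ^ 2 + σ * s + s ^ 2) * D1 := by positivity
    have hb5 : 0 ≤ L ^ 2 * (g.κ * (g.γ - 1) ^ 2 * L) := by positivity
    have hb6 : 0 ≤ L ^ 2 * (g.R * L ^ 3 * g.μ) := by positivity
    rw [abs_le]; constructor <;> nlinarith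
  refine div_le_div₀ (by positivity) hnum (by positivity) ?_
  have h1 : g.κ * (g.γ - 1) ^ 2 * m ≤ D1 := by
    have : g.κ * (g.γ - 1) ^ 2 * m ≤ g.κ * (g.γ - 1) ^ 2 * p := by gcongr; exact hp.1
    have : 0 < g.R * v * σ ^ 2 * g.μ := by positivity
    rw [hD1]; linarith
  exact mul_le_mul (pow_le_pow_left₀ hm.le hs.1 2) h1 (by positivity) (by positivity)

/-- Quantitative description of a weak viscous shock profile `S` with left state `UL`, strength
`δ`, speed `σ` and left sound speed `s`. -/
structure Gas.WeakShock (g : Gas) (UL : State) (S : ℝ → State) (δ σ s τ C c : ℝ) : Prop where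
  smooth_v : ContDiff ℝ 2 (fun ξ => (S ξ).v)
  smooth_θ : ContDiff ℝ 2 (fun ξ => (S ξ).θ)
  lim_bot : Tendsto (fun ξ => (S ξ).v) atBot (𝓝 UL.v)
  lim_top : Tendsto (fun ξ => (S ξ).v) atTop (𝓝 (UL.v + δ))
  gt : ∀ ξ, 0 < (S ξ).v - UL.v
  lt : ∀ ξ, (S ξ).v - UL.v < δ
  pos : ∀ ξ, 0 < deriv (fun x => (S x).v) ξ
  deriv_u : ∀ ξ, deriv (fun x => (S x).u) ξ = -σ * deriv (fun x => (S x).v) ξ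
  rate : ∀ ξ, ((g.γ + 1) / 2 * s - τ) * (((S ξ).v - UL.v) * (δ - ((S ξ).v - UL.v))) ≤
    g.dissip * deriv (fun x => (S x).v) ξ
  deriv_θ : ∀ ξ, |deriv (fun x => (S x).θ) ξ +
    (g.γ - 1) / g.R * g.p UL * deriv (fun x => (S x).v) ξ| ≤ τ * deriv (fun x => (S x).v) ξ
  θ_le : ∀ ξ, |(S ξ).θ - UL.θ| ≤ C * δ
  deriv_le : ∀ ξ, deriv (fun x => (S x).v) ξ ≤ C * δ ^ 2
  decay : ∀ ξ ≤ 0, deriv (fun x => (S x).v) ξ ≤ C * δ ^ 2 * Real.exp (c * δ * ξ)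

/-- Finitely many positive quantities ranging over compact intervals have common bounds. -/
lemma exists_common_bounds (a₁ a₂ a₃ a₄ a₅ a₆ b₁ b₂ b₃ b₄ b₅ b₆ : ℝ) (h₁ : 0 < a₁) (h₂ : 0 < a₂)
    (h₃ : 0 < a₃) (h₄ : 0 < a₄) (h₅ : 0 < a₅) (h₆ : 0 < a₆) :
    ∃ m L : ℝ, 0 < m ∧ 0 < L ∧ Icc a₁ b₁ ⊆ Icc m L ∧ Icc a₂ b₂ ⊆ Icc m L ∧ Icc a₃ b₃ ⊆ Icc m L ∧
      Icc a₄ b₄ ⊆ Icc m L ∧ Icc a₅ b₅ ⊆ Icc m L ∧ Icc a₆ b₆ ⊆ Icc m L := by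
  refine ⟨min a₁ (min a₂ (min a₃ (min a₄ (min a₅ a₆)))),
    1 + (|b₁| + |b₂| + |b₃| + |b₄| + |b₅| + |b₆|), by simp [*], by positivity,
    ?_, ?_, ?_, ?_, ?_, ?_⟩ <;>
  · refine Icc_subset_Icc (by simp) ?_
    linarith [le_abs_self b₁, le_abs_self b₂, le_abs_self b₃, le_abs_self b₄, le_abs_self b₅,
      le_abs_self b₆, abs_nonneg b₁, abs_nonneg b₂, abs_nonneg b₃, abs_nonneg b₄, abs_nonneg b₅,
      abs_nonneg b₆]

-- The constants depend on the box `[m, L]`, on `τ` and on the gas only. By `confined` the orbit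
-- stays in a thin cone about the slow manifold, so `v'` is `A (1 - ρ) k w (δ - w)` with a small
-- relative error. The rate, the slope of the temperature and the exponential tail all follow from
-- this.
set_option maxHeartbeats 2000000 in
theorem exists_weakShock (g : Gas) {m L τ : ℝ} (hm : 0 < m) (hτ : 0 < τ) :
    ∃ δ₁ C c : ℝ, 0 < δ₁ ∧ 0 < C ∧ 0 < c ∧ ∀ (UL UR : State) (σ s : ℝ) (S : ℝ → State),
      g.IsBase m L UL s → σ ∈ Icc m L → UR.Admissible → UL.v < UR.v →
      g.RankineHugoniot UL UR σ → UR.v - UL.v < δ₁ → g.IsShockProfile UL UR σ S →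
      g.WeakShock UL S (UR.v - UL.v) σ s τ C c := by
  -- For `L < m` the box is empty and nothing is claimed; otherwise `L` is positive.
  rcases lt_or_ge L m with hLm | hLm
  · exact ⟨1, 1, 1, one_pos, one_pos, one_pos, fun UL UR σ s S hb => absurd
      (hb.v_mem.1.trans hb.v_mem.2) (not_le.2 hLm)⟩
  have hL : 0 < L := hm.trans_le hLm
  have hμ := g.μ_pos
  have hκ := g.κ_pos
  have hR := g.R_pos
  have hγ := g.γ_pos
  have hγ1 := g.γ_sub_pos
  have hb := g.dissip_pos
  obtain ⟨m₀, L₀, hm₀, hL₀, i₁, i₂, i₃, i₄, i₅, i₆⟩ := exists_common_bounds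
    (g.R / (g.μ * L)) (m * g.R / (g.κ * (g.γ - 1))) m ((g.γ - 1) / g.R * m)
    ((g.γ - 1) / g.R * m ^ 2) ((g.γ + 1) * m ^ 2 / (2 * g.R))
    (g.R / (g.μ * m)) (L * g.R / (g.κ * (g.γ - 1))) L ((g.γ - 1) / g.R * L)
    ((g.γ - 1) / g.R * L ^ 2) ((g.γ + 1) * L ^ 2 / (2 * g.R))
    (by positivity) (by positivity) (by positivity) (by positivity) (by positivity)
    (by positivity)
  set C₁ := (g.γ + 1) / 2 * (5 * L ^ 2 * (g.R * L ^ 3 * g.μ + g.κ * (g.γ - 1) ^ 2 * L) /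
        (m ^ 2 * (g.κ * (g.γ - 1) ^ 2 * m))) with hC₁
  set C₂ := (g.γ + 1) * L ^ 2 / (4 * m ^ 2) with hC₂
  have hC₁0 : 0 < C₁ := by positivity
  have hC₂0 : 0 < C₂ := by positivity
  set κ₁ := m₀ ^ 2 / (2 * L₀ ^ 2) with hκ₁
  have hκ₁0 : 0 < κ₁ := by positivity
  -- The opening of the cone: `κ₁ / 2` keeps `1 - ρ - ε ≥ κ₁ / 2`, the next bound limits the error
  -- in the rate to `τ / 2`, the last one limits half of the error in the slope of the temperature.
  obtain ⟨ε, hε0, hε1, hε2, hε3, hε4⟩ : ∃ ε : ℝ, 0 < ε ∧ ε ≤ 1 ∧ ε ≤ κ₁ / 2 ∧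
      ε ≤ τ / (2 * (g.dissip * L₀ ^ 2)) ∧ ε ≤ τ * (m₀ * κ₁) / (8 * L₀ ^ 2) :=
    ⟨min 1 (min (κ₁ / 2) (min (τ / (2 * (g.dissip * L₀ ^ 2))) (τ * (m₀ * κ₁) / (8 * L₀ ^ 2)))),
      lt_min one_pos (lt_min (by positivity) (lt_min (by positivity) (by positivity))),
      by simp, by simp, by simp, by simp⟩
  -- The second bound is the condition of `confined`, the third makes the effect of `σ ≠ s` on the
  -- rate at most `τ / 2`, the fourth handles the term `B w z` in the slope of the temperature.
  obtain ⟨δ₁, hδ0, hδ1, hδ2, hδ3, hδ4⟩ : ∃ δ : ℝ, 0 < δ ∧ δ ≤ 1 ∧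
      δ ≤ ε * m₀ ^ 2 / (48 * (L₀ + L₀ ^ 2)) ∧ δ ≤ τ / (2 * (C₁ * C₂)) ∧
      δ ≤ τ * (m₀ * κ₁) / (8 * L₀) :=
    ⟨min 1 (min (ε * m₀ ^ 2 / (48 * (L₀ + L₀ ^ 2))) (min (τ / (2 * (C₁ * C₂)))
      (τ * (m₀ * κ₁) / (8 * L₀)))),
      lt_min one_pos (lt_min (by positivity) (lt_min (by positivity) (by positivity))),
      by simp, by simp, by simp, by simp⟩
  have hcl : 0 < m₀ * (κ₁ / 2) * m₀ := by positivity
  refine ⟨δ₁, 4 * L₀ + 2 * L₀ ^ 2, m₀ * (κ₁ / 2) * m₀ / 2, hδ0, by positivity, by positivity,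
    fun UL UR σ s S hbase hσ hR' hv hRH hδ hS => ?_⟩
  have hadm := hbase.adm
  have hσ0 : 0 < σ := hm.trans_le hσ.1
  obtain ⟨-, -, hrel⟩ := hRH.relations hadm hR' hσ0 hv
  have hsf := hS.slowFast hadm hσ0 hrel
  set δ := UR.v - UL.v with hδdef
  have hδpos : 0 < δ := sub_pos.2 hv
  have hp := hbase.p_mem
  set A := g.R / (g.μ * σ) with hA
  set B := σ * g.R / (g.κ * (g.γ - 1)) with hB
  set d := (g.γ - 1) / g.R * g.p UL with hd
  set e := (g.γ - 1) / g.R * σ ^ 2 with he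
  set k := (g.γ + 1) * σ ^ 2 / (2 * g.R) with hk
  have hAm : A ∈ Icc m₀ L₀ := i₁ ⟨by rw [hA]; gcongr; exact hσ.2, by rw [hA]; gcongr; exact hσ.1⟩
  have hBm : B ∈ Icc m₀ L₀ := i₂ ⟨by rw [hB]; gcongr; exact hσ.1, by rw [hB]; gcongr; exact hσ.2⟩
  have hvm : UL.v ∈ Icc m₀ L₀ := i₃ hbase.v_mem
  have hdm : d ∈ Icc m₀ L₀ := i₄ ⟨by rw [hd]; gcongr; exact hp.1, by rw [hd]; gcongr; exact hp.2⟩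
  have hem : e ∈ Icc m₀ L₀ := i₅ ⟨by rw [he]; gcongr; exact hσ.1, by rw [he]; gcongr; exact hσ.2⟩
  have hkm : k ∈ Icc m₀ L₀ := i₆ ⟨by rw [hk]; gcongr; exact hσ.1, by rw [hk]; gcongr; exact hσ.2⟩
  obtain ⟨hw, hz⟩ := hsf.confined hm₀ hAm hBm hvm hdm hem hkm hδpos hε0 hε1
    (by rw [← hκ₁]; linarith) (by
      have := hδ.trans_le hδ2
      rwa [lt_div_iff₀ (by positivity)] at this)
  have hA0 := hm₀.trans_le hAm.1
  have hB0 := hm₀.trans_le hBm.1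
  have hd0 := hm₀.trans_le hdm.1
  have he0 := hm₀.trans_le hem.1
  have hk0 := hm₀.trans_le hkm.1
  have hv0 := hm₀.trans_le hvm.1
  set ρ := A * d / (B * UL.v + A * d) with hρ
  have hden : 0 < B * UL.v + A * d := by positivity
  have hden2 : B * UL.v + A * d ≤ 2 * L₀ ^ 2 := by
    have := mul_le_mul hBm.2 hvm.2 hv0.le hL₀.le
    have := mul_le_mul hAm.2 hdm.2 hd0.le hL₀.le
    linarith
  have hρ0 : 0 ≤ ρ := by positivity
  have h1ρ : κ₁ ≤ 1 - ρ := by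
    have h1 : 1 - ρ = B * UL.v / (B * UL.v + A * d) := by rw [hρ]; field_simp; ring
    rw [h1, hκ₁]
    have h2 : m₀ ^ 2 ≤ B * UL.v := by
      rw [pow_two]; exact mul_le_mul hBm.1 hvm.1 hm₀.le hB0.le
    exact div_le_div₀ (by positivity) h2 hden hden2
  have hρeq : ρ * (B * UL.v + A * d) = A * d := div_mul_cancel₀ _ hden.ne'
  -- pointwise quantities
  set w : ℝ → ℝ := fun ξ => (S ξ).v - UL.v with hwdef
  set z := Gas.IsShockProfile.dev g UL σ S with hzdef
  have hdv : ∀ ξ, deriv (fun x => (S x).v) ξ = A * (k * w ξ * (δ - w ξ) - z ξ) :=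
    hS.deriv_v hadm hσ0 hrel
  have hP : ∀ ξ, 0 < w ξ * (δ - w ξ) := fun ξ => mul_pos (hw ξ).1 (sub_pos.2 (hw ξ).2)
  set q : ℝ → ℝ := fun ξ => k * w ξ * (δ - w ξ) with hq
  have hq0 : ∀ ξ, 0 < q ξ := fun ξ => by
    have := mul_pos hk0 (hP ξ); rw [hq]; linarith
  have hqP : ∀ ξ, q ξ = k * (w ξ * (δ - w ξ)) := fun ξ => by rw [hq]; ring
  have hlow : ∀ ξ, A * (κ₁ / 2 * q ξ) ≤ deriv (fun x => (S x).v) ξ := fun ξ => by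
    rw [hdv]
    refine mul_le_mul_of_nonneg_left ?_ hA0.le
    have h1 := (abs_le.1 (hz ξ)).2
    have h2 := hq0 ξ
    change _ ≤ q ξ - z ξ
    change z ξ - ρ * q ξ ≤ ε * q ξ at h1
    have h3 := mul_nonneg (by linarith : 0 ≤ 1 - ρ - ε - κ₁ / 2) h2.le
    linarith
  have hupz : ∀ ξ, |z ξ| ≤ 2 * q ξ := fun ξ => by
    have h1 := abs_le.1 (hz ξ)
    change -(ε * q ξ) ≤ z ξ - ρ * q ξ ∧ z ξ - ρ * q ξ ≤ ε * q ξ at h1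
    have h2 := hq0 ξ
    have h3 := mul_nonneg (by linarith : 0 ≤ 2 - ρ - ε) h2.le
    have h4 := mul_nonneg (by linarith : 0 ≤ 2 + ρ - ε) h2.le
    rw [abs_le]; constructor <;> linarith [h1.1, h1.2]
  have hpos : ∀ ξ, 0 < deriv (fun x => (S x).v) ξ := fun ξ =>
    (by have := hq0 ξ; positivity : 0 < A * (κ₁ / 2 * q ξ)).trans_le (hlow ξ)
  have hlowP : ∀ ξ, m₀ * (κ₁ / 2) * m₀ * (w ξ * (δ - w ξ)) ≤ deriv (fun x => (S x).v) ξ :=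
    fun ξ => by
      refine le_trans ?_ (hlow ξ)
      rw [hqP]
      have := hP ξ
      calc m₀ * (κ₁ / 2) * m₀ * (w ξ * (δ - w ξ)) = m₀ * (κ₁ / 2 * (m₀ * (w ξ * (δ - w ξ)))) := by
            ring
        _ ≤ _ := by
          gcongr
          · exact hAm.1
          · exact hkm.1
  have hup : ∀ ξ, deriv (fun x => (S x).v) ξ ≤ 2 * L₀ ^ 2 * (w ξ * (δ - w ξ)) := fun ξ => by
    rw [hdv]
    have h1 := (abs_le.1 (hz ξ)).1
    change -(ε * q ξ) ≤ z ξ - ρ * q ξ at h1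
    have h2 := hq0 ξ
    have h3 : q ξ - z ξ ≤ 2 * q ξ := by
      have h4 := mul_nonneg (by linarith : 0 ≤ 1 + ρ - ε) h2.le
      linarith
    have h4 : q ξ ≤ L₀ * (w ξ * (δ - w ξ)) := by
      rw [hqP]; exact mul_le_mul_of_nonneg_right hkm.2 (hP ξ).le
    calc A * (q ξ - z ξ) ≤ A * (2 * q ξ) := by gcongr
      _ ≤ L₀ * (2 * (L₀ * (w ξ * (δ - w ξ)))) := by
        gcongr
        exact hAm.2
      _ = _ := by ring
  have hPδ : ∀ ξ, w ξ * (δ - w ξ) ≤ w ξ * δ := fun ξ =>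
    mul_le_mul_of_nonneg_left (by linarith [(hw ξ).1]) (hw ξ).1.le
  have hdiff : Differentiable ℝ (fun x => (S x).v) := hS.smooth_v.differentiable two_ne_zero
  refine ⟨hS.smooth_v, hS.smooth_θ, hS.lim_bot_v, ?_, fun ξ => (hw ξ).1, fun ξ => (hw ξ).2, hpos,
    fun ξ => (hS.first_integrals hadm ξ).2.1, fun ξ => ?_, fun ξ => ?_, fun ξ => ?_, fun ξ => ?_,
    fun ξ hξ => ?_⟩
  · rw [hδdef, add_sub_cancel]; exact hS.lim_top_v
  · -- rate
    have h1 := slow_rate (g := g) hm hσ hbase.s_mem hbase.v_mem hp hbase.sq_s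
    have h2 := abs_sub_speed_le hγ hm hσ hbase.s_mem hbase.v_mem hbase.sq_s hδpos hrel
    rw [← hC₁] at h1
    rw [← hC₂] at h2
    have h3 := (abs_le.1 h1).1
    have h4 : C₁ * |σ - s| ≤ τ / 2 := by
      calc C₁ * |σ - s| ≤ C₁ * (C₂ * δ) := by gcongr
        _ = δ * (C₁ * C₂) := by ring
        _ ≤ τ / (2 * (C₁ * C₂)) * (C₁ * C₂) := by gcongr; exact hδ.le.trans hδ3
        _ = τ / 2 := by field_simp
    change -(C₁ * |σ - s|) ≤ g.dissip * (A * (1 - ρ) * k) - (g.γ + 1) / 2 * s at h3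
    have h5 : g.dissip * (L₀ ^ 2 * ε) ≤ τ / 2 := by
      calc g.dissip * (L₀ ^ 2 * ε) ≤ g.dissip * (L₀ ^ 2 * (τ / (2 * (g.dissip * L₀ ^ 2)))) := by
            gcongr
        _ = τ / 2 := by field_simp
    have h6 : A * (1 - ρ) * k * (w ξ * (δ - w ξ)) - L₀ ^ 2 * ε * (w ξ * (δ - w ξ))
        ≤ deriv (fun x => (S x).v) ξ := by
      rw [hdv]
      have h7 := (abs_le.1 (hz ξ)).2
      change z ξ - ρ * q ξ ≤ ε * q ξ at h7
      change _ ≤ A * (q ξ - z ξ)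
      have h8 : A * ((1 - ρ) * q ξ - ε * q ξ) ≤ A * (q ξ - z ξ) :=
        mul_le_mul_of_nonneg_left (by linarith) hA0.le
      have h9 : A * k ≤ L₀ ^ 2 := by
        rw [pow_two]; exact mul_le_mul hAm.2 hkm.2 hk0.le hL₀.le
      have h10 : A * k * (ε * (w ξ * (δ - w ξ))) ≤ L₀ ^ 2 * (ε * (w ξ * (δ - w ξ))) := by
        have := hP ξ
        gcongr
      rw [hqP] at h8
      rw [hqP]
      linarith
    have h11 := mul_le_mul_of_nonneg_left h6 hb.le
    have h12 := hP ξ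
    change ((g.γ + 1) / 2 * s - τ) * (w ξ * (δ - w ξ)) ≤ _
    refine le_trans ?_ h11
    have h13 : 0 ≤ (g.dissip * (A * (1 - ρ) * k) - g.dissip * (L₀ ^ 2 * ε)
      - ((g.γ + 1) / 2 * s - τ)) * (w ξ * (δ - w ξ)) := mul_nonneg (by linarith) h12.le
    linarith
  · -- temperature
    have h1 := hz ξ
    change |z ξ - ρ * q ξ| ≤ ε * q ξ at h1
    -- By the choice of `ρ` the two derivatives cancel on the slow manifold. What is left is the
    -- distance to the manifold and a term with an additional factor `w ≤ δ`.
    have h2 : deriv (fun x => (S x).θ) ξ + (g.γ - 1) / g.R * g.p UL * deriv (fun x => (S x).v) ξ =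
        -((B * UL.v + A * d) * (z ξ - ρ * q ξ)) - B * w ξ * z ξ := by
      rw [hS.deriv_θ hadm ξ, hdv]
      change -(B * ((UL.v + w ξ) * z ξ)) + d * (A * (q ξ - z ξ)) = _
      linear_combination (-(q ξ)) * hρeq
    rw [h2]
    have h3 := hq0 ξ
    have h4 : |(B * UL.v + A * d) * (z ξ - ρ * q ξ)| ≤ 2 * L₀ ^ 2 * (ε * q ξ) := by
      rw [abs_mul, abs_of_pos hden]
      exact mul_le_mul hden2 h1 (abs_nonneg _) (by positivity)
    have h5 : |B * w ξ * z ξ| ≤ L₀ * δ * (2 * q ξ) := by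
      rw [abs_mul, abs_mul, abs_of_pos hB0, abs_of_pos (hw ξ).1]
      refine mul_le_mul (mul_le_mul hBm.2 (hw ξ).2.le (hw ξ).1.le hL₀.le) (hupz ξ) (abs_nonneg _)
        (by positivity)
    have h6 : 2 * L₀ ^ 2 * ε ≤ τ * (m₀ * κ₁) / 4 := by
      have := mul_le_mul_of_nonneg_left hε4 (by positivity : 0 ≤ 2 * L₀ ^ 2)
      refine this.trans (le_of_eq ?_)
      field_simp; ring
    have h7 : 2 * L₀ * δ ≤ τ * (m₀ * κ₁) / 4 := by
      have := mul_le_mul_of_nonneg_left (hδ.le.trans hδ4) (by positivity : 0 ≤ 2 * L₀)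
      refine this.trans (le_of_eq ?_)
      field_simp; ring
    have h8 : τ * (m₀ * (κ₁ / 2 * q ξ)) ≤ τ * deriv (fun x => (S x).v) ξ := by
      have := hlow ξ
      have h9 : m₀ * (κ₁ / 2 * q ξ) ≤ A * (κ₁ / 2 * q ξ) := by gcongr; exact hAm.1
      gcongr
      linarith
    refine (abs_sub _ _).trans ?_
    rw [abs_neg]
    have h10 := mul_le_mul_of_nonneg_right h6 h3.le
    have h11 := mul_le_mul_of_nonneg_right h7 h3.le
    linarith
  · -- distance of the temperatures
    have h1 : (S ξ).θ - UL.θ = z ξ - (d * w ξ - e * w ξ ^ 2 / 2) := by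
      simp only [hzdef, Gas.IsShockProfile.dev, hd, he, hwdef]; ring
    have h2 := abs_le.1 (hupz ξ)
    have h3 : q ξ ≤ L₀ * δ := by
      rw [hqP]
      have h4 := hPδ ξ
      have h5 : w ξ * δ ≤ 1 * δ := mul_le_mul_of_nonneg_right
        (by linarith [(hw ξ).2]) hδpos.le
      exact mul_le_mul hkm.2 (by linarith) (hP ξ).le hL₀.le
    have h6 : d * w ξ ≤ L₀ * δ := mul_le_mul hdm.2 (hw ξ).2.le (hw ξ).1.le hL₀.le
    have h7 : 0 ≤ d * w ξ := mul_nonneg hd0.le (hw ξ).1.le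
    have h8 : e * w ξ ^ 2 ≤ L₀ * δ := by
      refine mul_le_mul hem.2 ?_ (sq_nonneg _) hL₀.le
      have h4 : w ξ * w ξ ≤ δ * 1 := mul_le_mul (hw ξ).2.le (by linarith [(hw ξ).2])
        (hw ξ).1.le hδpos.le
      rwa [pow_two, ← mul_one δ]
    have h9 : 0 ≤ e * w ξ ^ 2 := by positivity
    have h10 : 0 ≤ L₀ ^ 2 * δ := by positivity
    have h11 : 0 < L₀ * δ := by positivity
    have h12 : (4 * L₀ + 2 * L₀ ^ 2) * δ = 4 * (L₀ * δ) + 2 * (L₀ ^ 2 * δ) := by ring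
    rw [h1, h12, abs_le]; constructor <;> linarith [h2.1, h2.2]
  · have h1 := hup ξ
    have h2 : w ξ * (δ - w ξ) ≤ δ * δ := by
      exact mul_le_mul (hw ξ).2.le (by linarith [(hw ξ).1]) (sub_pos.2 (hw ξ).2).le hδpos.le
    have h3 : 2 * L₀ ^ 2 * (w ξ * (δ - w ξ)) ≤ 2 * L₀ ^ 2 * (δ * δ) := by gcongr
    have h4 : 0 < L₀ * (δ * δ) := by positivity
    have h5 : (4 * L₀ + 2 * L₀ ^ 2) * δ ^ 2 = 4 * (L₀ * (δ * δ)) + 2 * L₀ ^ 2 * (δ * δ) := by ring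
    rw [h5]
    linarith
  · -- exponential decay
    have hmono : StrictMono w := strictMono_of_deriv_pos fun x => by
      rw [show deriv w x = deriv (fun x => (S x).v) x from deriv_sub_const _]; exact hpos x
    have hw0 : w 0 = δ / 2 := by simp only [hwdef, hδdef, hS.center]; ring
    set c := m₀ * (κ₁ / 2) * m₀ / 2 with hc
    have hder : ∀ x, HasDerivAt (fun x => w x * Real.exp (-(c * δ) * x))
        ((deriv (fun x => (S x).v) x - c * δ * w x) * Real.exp (-(c * δ) * x)) x := fun x => by
      have h1 := ((hdiff x).hasDerivAt.sub_const UL.v).mul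
        ((hasDerivAt_id x).const_mul (-(c * δ))).exp
      refine h1.congr_deriv ?_
      simp [hwdef]; ring
    -- Left of the centre the normalisation gives `δ - w ≥ δ / 2`, so the logistic lower bound
    -- becomes `w' ≥ c δ w`; this is why `c` is half of the logistic rate.
    have hmon : MonotoneOn (fun x => w x * Real.exp (-(c * δ) * x)) (Iic 0) := by
      refine monotoneOn_of_deriv_nonneg (convex_Iic 0)
        (fun x _ => (hder x).continuousAt.continuousWithinAt)
        (fun x _ => (hder x).differentiableAt.differentiableWithinAt) fun x hx => ?_
      rw [(hder x).deriv]
      rw [interior_Iic] at hx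
      refine mul_nonneg ?_ (Real.exp_pos _).le
      have h1 := hlowP x
      have h2 : w x ≤ δ / 2 := by rw [← hw0]; exact (hmono hx).le
      have h3 : w x * (δ / 2) ≤ w x * (δ - w x) :=
        mul_le_mul_of_nonneg_left (by linarith) (hw x).1.le
      have h4 := mul_le_mul_of_nonneg_left h3 hcl.le
      have h5 : m₀ * (κ₁ / 2) * m₀ * (w x * (δ / 2)) = c * δ * w x := by rw [hc]; ring
      linarith
    have h1 := hmon hξ (mem_Iic.2 le_rfl) hξ
    simp only [mul_zero, Real.exp_zero, mul_one, hw0] at h1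
    have h2 : w ξ ≤ δ / 2 * Real.exp (c * δ * ξ) := by
      have h3 : Real.exp (-(c * δ) * ξ) * Real.exp (c * δ * ξ) = 1 := by
        rw [← Real.exp_add]; simp
      calc w ξ = w ξ * Real.exp (-(c * δ) * ξ) * Real.exp (c * δ * ξ) := by
            rw [mul_assoc, h3, mul_one]
        _ ≤ _ := by gcongr
    have h3 := (hup ξ).trans (mul_le_mul_of_nonneg_left (hPδ ξ) (by positivity))
    have h4 : w ξ * δ ≤ δ / 2 * Real.exp (c * δ * ξ) * δ := by gcongr
    have h5 := mul_le_mul_of_nonneg_left h4 (by positivity : 0 ≤ 2 * L₀ ^ 2)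
    have h6 : 0 < L₀ * (δ ^ 2 * Real.exp (c * δ * ξ)) := by positivity
    have h7 : 0 < L₀ ^ 2 * (δ ^ 2 * Real.exp (c * δ * ξ)) := by positivity
    linarith

/-! ### The rarefaction wave -/

lemma one_sub_tanh_pos (y : ℝ) : 0 < 1 - Real.tanh y := sub_pos.2 (Real.tanh_lt_one y)

lemma one_sub_tanh_le (y : ℝ) : 1 - Real.tanh y ≤ 2 * Real.exp (-2 * y) := by
  have h1 : 1 - Real.tanh y = 2 * Real.exp (-y) / (Real.exp y + Real.exp (-y)) := by
    have h0 : 0 < Real.exp y + Real.exp (-y) := by positivity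
    rw [Real.tanh_eq_sinh_div_cosh, Real.sinh_eq, Real.cosh_eq]
    field_simp
    ring
  have h2 : Real.exp (-2 * y) = Real.exp (-y) / Real.exp y := by
    rw [← Real.exp_sub]; congr 1; ring
  rw [h1, h2, ← mul_div_assoc]
  gcongr
  linarith [Real.exp_pos (-y)]

namespace IsBurgersWave

variable {wm ws : ℝ} {w : ℝ → ℝ → ℝ}

/-- Classical solutions of the Burgers equation are constant along characteristics. -/
lemma eq_init (h : IsBurgersWave wm ws w) {τ : ℝ} (hτ : 0 < τ) (x : ℝ) :
    w τ x = w 0 (x - w τ x * τ) := by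
  set c := w τ x with hc
  set X : ℝ → ℝ := fun s => x + c * (s - τ) with hX
  set f : ℝ → ℝ := fun s => w s (X s) - c with hf
  have hopen : IsOpen ((Ioi (0 : ℝ)) ×ˢ (univ : Set ℝ)) := isOpen_Ioi.prod isOpen_univ
  have hmem : ∀ {s y : ℝ}, 0 < s → (s, y) ∈ (Ioi (0 : ℝ)) ×ˢ (univ : Set ℝ) :=
    fun hs => ⟨hs, mem_univ _⟩
  set D := fderiv ℝ (Function.uncurry w) with hD
  have hd : ∀ s y, 0 < s → HasFDerivAt (Function.uncurry w) (D (s, y)) (s, y) := fun s y hs =>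
    ((h.smooth.contDiffAt (hopen.mem_nhds (hmem hs))).differentiableAt one_ne_zero).hasFDerivAt
  have hXd : ∀ s, HasDerivAt X c s := fun s =>
    (((hasDerivAt_id s).sub_const τ).const_mul c).const_add x |>.congr_deriv (mul_one c)
  -- On the straight line of slope `c` the equation reads `w_t + c w_x = (c - w) w_x`, a linear
  -- homogeneous equation for `f = w - c`, which vanishes at time `τ`.
  have hfd : ∀ s, 0 < s → HasDerivAt f (-(f s) * D (s, X s) (0, 1)) s := fun s hs => by
    have h1 : HasDerivAt (fun r => w r (X r)) (D (s, X s) (1, c)) s :=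
      HasFDerivAt.comp_hasDerivAt (f := fun r => (r, X r)) s (hd s (X s) hs)
        ((hasDerivAt_id' s).prodMk (hXd s))
    have h2 : deriv (fun r => w r (X s)) s = D (s, X s) (1, 0) := by
      have : HasDerivAt (fun r => w r (X s)) (D (s, X s) (1, 0)) s :=
        HasFDerivAt.comp_hasDerivAt (f := fun r => (r, X s)) s (hd s (X s) hs)
          ((hasDerivAt_id' s).prodMk (hasDerivAt_const s (X s)))
      exact this.deriv
    have h3 : deriv (fun y => w s y) (X s) = D (s, X s) (0, 1) := by
      have : HasDerivAt (fun y => w s y) (D (s, X s) (0, 1)) (X s) :=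
        HasFDerivAt.comp_hasDerivAt (f := fun y => (s, y)) (X s) (hd s (X s) hs)
          ((hasDerivAt_const (X s) s).prodMk (hasDerivAt_id' (X s)))
      exact this.deriv
    have h4 := h.eqn s hs (X s)
    rw [h2, h3] at h4
    refine (h1.sub_const c).congr_deriv ?_
    have h5 : ((1 : ℝ), c) = (1, 0) + c • ((0 : ℝ), (1 : ℝ)) := by simp
    rw [h5, map_add, map_smul, smul_eq_mul]
    simp only [hf]
    linear_combination h4
  have hfτ : f τ = 0 := by simp [hf, hX, hc]
  have hDc : ContinuousOn (fun s => D (s, X s) (0, 1)) (Ioi 0) := by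
    have h1 : ContinuousOn D ((Ioi (0 : ℝ)) ×ˢ (univ : Set ℝ)) :=
      h.smooth.continuousOn_fderiv_of_isOpen hopen le_rfl
    have h2 : ContinuousOn (fun s => (s, X s)) (Ioi (0 : ℝ)) := by fun_prop
    exact (h1.comp h2 fun s hs => hmem hs).clm_apply continuousOn_const
  -- Grönwall backwards in time. The coefficient `w_x` is bounded only on compact subintervals of
  -- `(0, τ]`; time `0` is reached afterwards through continuity of `w`.
  have hzero : ∀ s ∈ Ioc 0 τ, f s = 0 := fun s hs => by
    obtain ⟨L, hL⟩ := (isCompact_Icc (a := s) (b := τ)).exists_bound_of_continuousOn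
      (hDc.mono fun r hr => hs.1.trans_le hr.1)
    have hder : ∀ r, 0 < r → HasDerivAt (fun r => f r ^ 2 * Real.exp (2 * L * r))
        (2 * f r ^ 2 * (L - D (r, X r) (0, 1)) * Real.exp (2 * L * r)) r := fun r hr => by
      have h1 := ((hfd r hr).pow 2).mul ((hasDerivAt_id r).const_mul (2 * L)).exp
      refine h1.congr_deriv ?_
      simp; ring
    have hmon : MonotoneOn (fun r => f r ^ 2 * Real.exp (2 * L * r)) (Icc s τ) := by
      refine monotoneOn_of_deriv_nonneg (convex_Icc _ _)
        (fun r hr => (hder r (hs.1.trans_le hr.1)).continuousAt.continuousWithinAt)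
        (fun r hr => ?_) fun r hr => ?_
      · rw [interior_Icc] at hr
        exact (hder r (hs.1.trans hr.1)).differentiableAt.differentiableWithinAt
      · rw [interior_Icc] at hr
        rw [(hder r (hs.1.trans hr.1)).deriv]
        have := (abs_le.1 (hL r ⟨hr.1.le, hr.2.le⟩)).2
        exact mul_nonneg (mul_nonneg (by positivity) (by linarith)) (Real.exp_pos _).le
    have h1 := hmon (left_mem_Icc.2 hs.2) (right_mem_Icc.2 hs.2) hs.2
    simp only [hfτ] at h1
    have h2 := Real.exp_pos (2 * L * s)
    have h3 : f s ^ 2 ≤ 0 := by nlinarith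
    exact pow_eq_zero_iff (two_ne_zero) |>.1 (le_antisymm h3 (sq_nonneg _))
  have hlim : Tendsto (fun s => w s (X s)) (𝓝[>] 0) (𝓝 (w 0 (X 0))) := by
    have h1 : ContinuousWithinAt (Function.uncurry w) (Ici 0 ×ˢ univ) (0, X 0) :=
      h.cont (0, X 0) ⟨self_mem_Ici, mem_univ _⟩
    have h2 : Tendsto (fun s => (s, X s)) (𝓝[>] 0) (𝓝[Ici 0 ×ˢ univ] (0, X 0)) := by
      refine tendsto_nhdsWithin_iff.2 ⟨?_, ?_⟩
      · have : Continuous fun s => (s, X s) := by fun_prop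
        exact (this.tendsto 0).mono_left inf_le_left
      · filter_upwards [self_mem_nhdsWithin] with s hs using
          ⟨mem_Ici.2 (mem_Ioi.1 hs).le, mem_univ _⟩
    exact h1.tendsto.comp h2
  have hev : ∀ᶠ s in 𝓝[>] (0 : ℝ), w s (X s) = c := by
    filter_upwards [Ioc_mem_nhdsGT hτ] with s hs
    exact sub_eq_zero.1 (hzero s hs)
  have h3 : w 0 (X 0) = c := tendsto_nhds_unique hlim (tendsto_const_nhds.congr' (hev.mono
    fun s hs => hs.symm))
  refine h3.symm.trans ?_
  simp only [hX]
  congr 1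
  ring

lemma eq_tanh (h : IsBurgersWave wm ws w) {τ : ℝ} (hτ : 0 < τ) (x : ℝ) :
    w τ x = ws - (ws - wm) / 2 * (1 - Real.tanh (x - w τ x * τ)) := by
  conv_lhs => rw [h.eq_init hτ x, h.init]
  ring

lemma mem_Ioo (h : IsBurgersWave wm ws w) (hlt : wm < ws) {τ : ℝ} (hτ : 0 < τ) (x : ℝ) :
    w τ x ∈ Ioo wm ws := by
  have h1 := h.eq_tanh hτ x
  have h2 := one_sub_tanh_pos (x - w τ x * τ)
  have h3 : 1 - Real.tanh (x - w τ x * τ) < 2 := by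
    linarith [Real.neg_one_lt_tanh (x - w τ x * τ)]
  constructor <;> nlinarith

/-- The characteristic through `(τ, x)` starts at `x - w τ ≥ -ws τ`. For `ws < 0`, the case of the
first family, the initial datum at that point is exponentially close to its right limit. -/
lemma sub_le (h : IsBurgersWave wm ws w) (hlt : wm < ws) {τ x : ℝ} (hτ : 0 < τ)
    (hx : 0 ≤ x) : ws - w τ x ≤ (ws - wm) * Real.exp (2 * ws * τ) := by
  have h1 := h.eq_tanh hτ x
  have h2 := one_sub_tanh_le (x - w τ x * τ)
  have h3 := (h.mem_Ioo hlt hτ x).2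
  have h4 : Real.exp (-2 * (x - w τ x * τ)) ≤ Real.exp (2 * ws * τ) := by
    apply Real.exp_le_exp.2
    nlinarith
  have h5 : (ws - wm) / 2 * (1 - Real.tanh (x - w τ x * τ)) ≤
      (ws - wm) / 2 * (2 * Real.exp (2 * ws * τ)) := by
    refine mul_le_mul_of_nonneg_left (by linarith) (by linarith)
  linarith

end IsBurgersWave

/-! #### Isentropes -/

lemma Gas.lam1_sq {g : Gas} {U : State} (hU : U.Admissible) :
    g.lam1 U ^ 2 = g.γ * g.R * U.θ / U.v ^ 2 := by
  have := g.γ_pos; have := g.R_pos; have := hU.1; have := hU.2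
  unfold Gas.lam1 Gas.p
  rw [neg_sq, Real.sq_sqrt (by positivity)]
  field_simp

lemma Gas.lam1_neg {g : Gas} {U : State} (hU : U.Admissible) : g.lam1 U < 0 := by
  have := g.γ_pos; have := g.R_pos; have := hU.1; have := hU.2
  unfold Gas.lam1 Gas.p
  rw [neg_lt_zero, Real.sqrt_pos]
  positivity

lemma Gas.θ_eq_of_entropy_eq {g : Gas} {U V : State} (hU : U.Admissible) (hV : V.Admissible)
    (h : g.entropy U = g.entropy V) : U.θ = V.θ * (V.v / U.v) ^ (g.γ - 1) := by
  have hR := g.R_pos; have hγ := g.γ_sub_pos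
  have hu := Real.rpow_pos_of_pos hU.1 (g.γ - 1)
  have hv := Real.rpow_pos_of_pos hV.1 (g.γ - 1)
  unfold Gas.entropy at h
  have h1 := mul_left_cancel₀ (by positivity : g.R / (g.γ - 1) ≠ 0) h
  have h2 := Real.log_injOn_pos (mul_pos hU.2 hu) (mul_pos hV.2 hv) h1
  rw [Real.div_rpow hV.1.le hU.1.le]
  field_simp
  exact h2

/-- Along an isentrope the squared speed is proportional to `v ^ (-(γ + 1))`; this converts what is
known of the Burgers wave into the specific volume. -/
lemma Gas.lam1_sq_div {g : Gas} {U V : State} (hU : U.Admissible) (hV : V.Admissible)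
    (h : g.entropy U = g.entropy V) :
    (V.v / U.v) ^ (g.γ + 1) = g.lam1 U ^ 2 / g.lam1 V ^ 2 := by
  have hR := g.R_pos; have hγ := g.γ_pos
  have h1 : g.γ + 1 = (g.γ - 1) + 2 := by ring
  have h0 : 0 < V.v / U.v := div_pos hV.1 hU.1
  rw [Gas.lam1_sq hU, Gas.lam1_sq hV, h1, Real.rpow_add h0, Gas.θ_eq_of_entropy_eq hU hV h,
    Real.rpow_two]
  have := hU.1; have := hV.1; have := hV.2
  field_simp

lemma rpow_sub_one_le {a y : ℝ} (ha : 1 ≤ a) (h1 : 1 ≤ y) (h2 : y ≤ 2) :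
    y ^ a - 1 ≤ (2 ^ a - 1) * (y - 1) := by
  have hc := (convexOn_rpow ha).2 (show (1 : ℝ) ∈ Ici 0 by simp) (show (2 : ℝ) ∈ Ici 0 by simp)
    (by linarith : 0 ≤ 2 - y) (by linarith : 0 ≤ y - 1) (by ring)
  simp only [smul_eq_mul, Real.one_rpow, mul_one] at hc
  rw [show 2 - y + (y - 1) * 2 = y by ring] at hc
  linarith

/-- The relative excess of the squared characteristic speed along a rarefaction wave. -/
theorem rarefaction_bounds (g : Gas) {m L : ℝ} (hm : 0 < m) :
    ∃ C : ℝ, 0 < C ∧ ∀ (Um Us : State) (W : ℝ → ℝ → State), Us.v ∈ Icc m L → Us.θ ∈ Icc m L →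
      Um ∈ g.R1 Us → Us.v - Um.v ≤ m / 2 → g.IsRarefactionWave Um Us W →
      ContinuousOn (fun z : ℝ × ℝ => (W z.1 z.2).v) (Ici 0 ×ˢ univ) ∧
      ContinuousOn (fun z : ℝ × ℝ => (W z.1 z.2).θ) (Ici 0 ×ˢ univ) ∧
      ∀ t, 0 ≤ t → ∀ x, |(W t x).v - Us.v| ≤ C * (Us.v - Um.v) ∧
        |(W t x).θ - Us.θ| ≤ C * (Us.v - Um.v) ∧
        (0 ≤ x → |(W t x).v - Us.v| ≤ C * (Us.v - Um.v) * Real.exp (2 * g.lam1 Us * t) ∧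
          |(W t x).θ - Us.θ| ≤ C * (Us.v - Um.v) * Real.exp (2 * g.lam1 Us * t)) := by
  have hγ := g.γ_pos
  have hγ1 := g.γ_sub_pos
  have h2γ : 0 < (2 : ℝ) ^ (g.γ + 1) - 1 := by
    have := Real.one_lt_rpow (by norm_num : (1 : ℝ) < 2) (by linarith : 0 < g.γ + 1)
    linarith
  refine ⟨(|L| + 1) * ((2 ^ (g.γ + 1) - 1) * (2 / m)),
    mul_pos (by positivity) (mul_pos h2γ (by positivity)),
    fun Um Us W hv hθ hR hδ hW => ?_⟩
  obtain ⟨w, hw, hW⟩ := hW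
  obtain ⟨hUm, hlt, hent, -⟩ := hR
  have hUs : Us.Admissible := ⟨hm.trans_le hv.1, hm.trans_le hθ.1⟩
  have hls := Gas.lam1_neg (g := g) hUs
  have hlm := Gas.lam1_neg (g := g) hUm
  have hls2 : 0 < g.lam1 Us ^ 2 := by have := hls.ne; positivity
  -- the left state
  set y := Us.v / Um.v with hy
  have hy1 : 1 < y := (one_lt_div hUm.1).2 hlt
  have hUmv : m / 2 ≤ Um.v := by linarith [hv.1]
  have hy2 : y ≤ 2 := by
    rw [hy, div_le_iff₀ hUm.1]
    linarith
  have hyp := Gas.lam1_sq_div hUm hUs hent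
  rw [← hy] at hyp
  have hexc : g.lam1 Um ^ 2 / g.lam1 Us ^ 2 - 1 ≤
      (2 ^ (g.γ + 1) - 1) * (2 / m) * (Us.v - Um.v) := by
    rw [← hyp]
    refine (rpow_sub_one_le (by linarith) hy1.le hy2).trans ?_
    rw [mul_assoc]
    refine mul_le_mul_of_nonneg_left ?_ h2γ.le
    have h1 : y - 1 = (Us.v - Um.v) / Um.v := by rw [hy]; field_simp [hUm.1.ne']
    rw [h1, div_mul_eq_mul_div, div_le_div_iff₀ hUm.1 hm]
    nlinarith
  have hlms : g.lam1 Um < g.lam1 Us := by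
    have h1 : 1 < y ^ (g.γ + 1) := Real.one_lt_rpow hy1 (by linarith)
    rw [hyp, one_lt_div hls2] at h1
    nlinarith
  -- the wave
  have hwm : ∀ t, 0 ≤ t → ∀ x, w (1 + t) x ∈ Ioo (g.lam1 Um) (g.lam1 Us) := fun t ht x =>
    hw.mem_Ioo hlms (by linarith) x
  have hyW : ∀ t, 0 ≤ t → ∀ x, (Us.v / (W t x).v) ^ (g.γ + 1) = w (1 + t) x ^ 2 / g.lam1 Us ^ 2 :=
    fun t ht x => by
      obtain ⟨h1, h2, -, h4⟩ := hW t ht x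
      rw [Gas.lam1_sq_div h1 hUs h4, h2]
  have hvW : ∀ t, 0 ≤ t → ∀ x, (W t x).v =
      Us.v / (w (1 + t) x ^ 2 / g.lam1 Us ^ 2) ^ (g.γ + 1)⁻¹ := fun t ht x => by
    obtain ⟨h1, -⟩ := hW t ht x
    have h0 := div_pos hUs.1 h1.1
    rw [← hyW t ht x, Real.rpow_rpow_inv h0.le (by linarith)]
    have := hUs.1; have := h1.1
    field_simp
  have hθW : ∀ t, 0 ≤ t → ∀ x, (W t x).θ = Us.θ * (Us.v / (W t x).v) ^ (g.γ - 1) :=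
    fun t ht x => by
      obtain ⟨h1, -, -, h4⟩ := hW t ht x
      exact Gas.θ_eq_of_entropy_eq h1 hUs h4
  have hwc : ContinuousOn (fun z : ℝ × ℝ => w (1 + z.1) z.2) (Ici 0 ×ˢ univ) := by
    have h1 : ContinuousOn (fun z : ℝ × ℝ => ((1 + z.1, z.2) : ℝ × ℝ)) (Ici 0 ×ˢ univ) := by fun_prop
    exact hw.cont.comp h1 fun z hz => ⟨by have := hz.1; simp only [mem_Ici] at this ⊢; linarith,
      mem_univ _⟩
  have hexcpos : ∀ t, 0 ≤ t → ∀ x, 0 < w (1 + t) x ^ 2 / g.lam1 Us ^ 2 := fun t ht x => by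
    have h1 := (hwm t ht x).2
    have : w (1 + t) x ≠ 0 := (h1.trans hls).ne
    positivity
  have hvc : ContinuousOn (fun z : ℝ × ℝ => (W z.1 z.2).v) (Ici 0 ×ˢ univ) := by
    have h1 : ContinuousOn (fun z : ℝ × ℝ =>
        Us.v / (w (1 + z.1) z.2 ^ 2 / g.lam1 Us ^ 2) ^ (g.γ + 1)⁻¹) (Ici 0 ×ˢ univ) := by
      refine continuousOn_const.div (((hwc.pow 2).div_const _).rpow_const fun z hz => ?_)
        fun z hz => ?_
      · exact Or.inl (hexcpos _ hz.1 _).ne'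
      · exact (Real.rpow_pos_of_pos (hexcpos _ hz.1 _) _).ne'
    exact h1.congr fun z hz => hvW _ hz.1 _
  refine ⟨hvc, ?_, fun t ht x => ?_⟩
  · have h1 : ContinuousOn (fun z : ℝ × ℝ => Us.θ * (Us.v / (W z.1 z.2).v) ^ (g.γ - 1))
        (Ici 0 ×ˢ univ) := by
      refine continuousOn_const.mul ((continuousOn_const.div hvc fun z hz => ?_).rpow_const
        fun z hz => ?_)
      · exact (hW _ hz.1 _).1.1.ne'
      · exact Or.inl (div_pos hUs.1 (hW _ hz.1 _).1.1).ne'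
    exact h1.congr fun z hz => hθW _ hz.1 _
  · obtain ⟨hadm, -⟩ := hW t ht x
    -- The relative excess of the squared speed over its value at the right state. As `Y ≥ 1` and `Y
    -- ^ (γ + 1) = 1 + e`, both `Y` and `Y ^ (γ - 1)` are at most `1 + e`, so `e` controls volume
    -- and temperature alike.
    set e := w (1 + t) x ^ 2 / g.lam1 Us ^ 2 - 1 with he
    have hwmem := hwm t ht x
    set Y := Us.v / (W t x).v with hY
    have hYp : 0 < Y := div_pos hUs.1 hadm.1
    have hYe : Y ^ (g.γ + 1) = 1 + e := by rw [he, hY, hyW t ht x]; ring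
    have he0 : 0 ≤ e := by
      have h1 : g.lam1 Us ^ 2 ≤ w (1 + t) x ^ 2 := by nlinarith [hwmem.2]
      have := (one_le_div hls2).2 h1
      rw [he]; linarith
    have hY1 : 1 ≤ Y := by
      by_contra! hlt
      have := Real.rpow_lt_one hYp.le hlt (by linarith : 0 < g.γ + 1)
      linarith
    have hYle : Y ≤ 1 + e := by
      rw [← hYe]
      calc Y = Y ^ (1 : ℝ) := (Real.rpow_one Y).symm
        _ ≤ _ := Real.rpow_le_rpow_of_exponent_le hY1 (by linarith)
    have hL : |L| + 1 ≥ Us.v := by linarith [hv.2, le_abs_self L]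
    have hLθ : |L| + 1 ≥ Us.θ := by linarith [hθ.2, le_abs_self L]
    have hvle : |(W t x).v - Us.v| ≤ (|L| + 1) * e := by
      have h1 : Us.v = (W t x).v * Y := by rw [hY]; field_simp [hadm.1.ne']
      have h2 : (W t x).v ≤ Us.v := by
        rw [h1]; exact le_mul_of_one_le_right hadm.1.le hY1
      rw [abs_sub_comm, abs_of_nonneg (by linarith)]
      calc Us.v - (W t x).v = (W t x).v * (Y - 1) := by rw [h1]; ring
        _ ≤ (|L| + 1) * e := by
          refine mul_le_mul (by linarith) (by linarith) (by linarith) (by positivity)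
    have hθle : |(W t x).θ - Us.θ| ≤ (|L| + 1) * e := by
      rw [hθW t ht x, ← hY]
      have h1 : Y ^ (g.γ - 1) ≤ 1 + e := by
        rw [← hYe]
        exact Real.rpow_le_rpow_of_exponent_le hY1 (by linarith)
      have h2 : 1 ≤ Y ^ (g.γ - 1) := Real.one_le_rpow hY1 hγ1.le
      have h3 : Us.θ * Y ^ (g.γ - 1) - Us.θ = Us.θ * (Y ^ (g.γ - 1) - 1) := by ring
      rw [h3, abs_of_nonneg (mul_nonneg hUs.2.le (by linarith))]
      exact mul_le_mul (by linarith) (by linarith) (by linarith) (by positivity)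
    have hele : e ≤ (2 ^ (g.γ + 1) - 1) * (2 / m) * (Us.v - Um.v) := by
      refine le_trans ?_ hexc
      rw [he]
      have h1 : w (1 + t) x ^ 2 ≤ g.lam1 Um ^ 2 := by nlinarith [hwmem.1, hwmem.2]
      gcongr
    -- The excess is compared with the one at the left end state, which is of order `δ_R`;
    -- differences of squares are factored so that `sub_le` applies. Time `1 + t` may be replaced by
    -- `t` because the speed is negative.
    have heexp : 0 ≤ x → e ≤ (2 ^ (g.γ + 1) - 1) * (2 / m) * (Us.v - Um.v) *
        Real.exp (2 * g.lam1 Us * t) := fun hx => by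
      have h1 := hw.sub_le hlms (by linarith : 0 < 1 + t) hx
      have h2 : Real.exp (2 * g.lam1 Us * (1 + t)) ≤ Real.exp (2 * g.lam1 Us * t) := by
        apply Real.exp_le_exp.2; nlinarith
      set E := Real.exp (2 * g.lam1 Us * t) with hE
      have hE0 : 0 < E := Real.exp_pos _
      have h3 : g.lam1 Us - w (1 + t) x ≤ (g.lam1 Us - g.lam1 Um) * E :=
        h1.trans (mul_le_mul_of_nonneg_left h2 (by linarith))
      have h4 : e ≤ (g.lam1 Um ^ 2 / g.lam1 Us ^ 2 - 1) * E := by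
        have e1 : e = (w (1 + t) x ^ 2 - g.lam1 Us ^ 2) / g.lam1 Us ^ 2 := by
          rw [he, div_sub_one hls2.ne']
        have e2 : (g.lam1 Um ^ 2 / g.lam1 Us ^ 2 - 1) * E =
            (g.lam1 Um ^ 2 - g.lam1 Us ^ 2) * E / g.lam1 Us ^ 2 := by
          rw [div_sub_one hls2.ne', div_mul_eq_mul_div]
        rw [e1, e2]
        refine div_le_div_of_nonneg_right ?_ hls2.le
        have e3 : w (1 + t) x ^ 2 - g.lam1 Us ^ 2 =
            (g.lam1 Us - w (1 + t) x) * (-(w (1 + t) x) - g.lam1 Us) := by ring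
        have e4 : (g.lam1 Um ^ 2 - g.lam1 Us ^ 2) * E =
            (g.lam1 Us - g.lam1 Um) * E * (-(g.lam1 Um) - g.lam1 Us) := by ring
        rw [e3, e4]
        refine mul_le_mul h3 (by linarith [hwmem.1]) (by linarith [hwmem.2]) ?_
        exact mul_nonneg (by linarith) hE0.le
      exact h4.trans (mul_le_mul_of_nonneg_right hexc hE0.le)
    refine ⟨?_, ?_, fun hx => ⟨?_, ?_⟩⟩
    · refine hvle.trans ?_
      rw [mul_assoc]; gcongr
    · refine hθle.trans ?_
      rw [mul_assoc]; gcongr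
    · refine hvle.trans ?_
      rw [mul_assoc (|L| + 1), mul_assoc (|L| + 1)]; gcongr; exact heexp hx
    · refine hθle.trans ?_
      rw [mul_assoc (|L| + 1), mul_assoc (|L| + 1)]; gcongr; exact heexp hx

/-! ### The viscous contact wave -/

lemma mem_uIcc_of_deriv_sign {f k : ℝ → ℝ} {c l₁ l₂ : ℝ} (hf : ∀ x, HasDerivAt f (c * k x) x)
    (hk : ∀ x, 0 ≤ k x) (h₁ : Tendsto f atBot (𝓝 l₁)) (h₂ : Tendsto f atTop (𝓝 l₂)) (x : ℝ) :
    f x ∈ uIcc l₁ l₂ := by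
  rcases le_total 0 c with hc | hc
  · have hm : Monotone f := monotone_of_hasDerivAt_nonneg hf fun x => mul_nonneg hc (hk x)
    exact Icc_subset_uIcc ⟨hm.le_of_tendsto h₁ x, hm.ge_of_tendsto h₂ x⟩
  · have hm : Antitone f := antitone_of_hasDerivAt_nonpos hf fun x =>
      mul_nonpos_of_nonpos_of_nonneg hc (hk x)
    exact Icc_subset_uIcc' ⟨hm.le_of_tendsto h₂ x, hm.ge_of_tendsto h₁ x⟩

/-- The equation at `t = 0` alone is already the ordinary differential equation of the profile:
there the time derivative of `Θ (x / √(1 + t))` is `-(x / 2) Θ'`. -/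
lemma Gas.IsContactProfile.hasDerivAt_logDeriv {g : Gas} {Us Uc : State} {Θ : ℝ → ℝ}
    (h : g.IsContactProfile Us Uc Θ) (hp : 0 < g.p Us) (x : ℝ) :
    HasDerivAt (fun y => deriv Θ y / Θ y)
      (-(x * Θ x / (2 * ((g.γ - 1) * g.κ * g.p Us / (g.R ^ 2 * g.γ)))) * (deriv Θ x / Θ x)) x := by
  have hR := g.R_pos; have hγ := g.γ_pos; have hγ1 := g.γ_sub_pos; have hκ := g.κ_pos
  set a := (g.γ - 1) * g.κ * g.p Us / (g.R ^ 2 * g.γ) with ha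
  have ha0 : 0 < a := by positivity
  have h1 := h.eqn 0 le_rfl x
  simp only [add_zero, Real.sqrt_one, div_one] at h1
  have hd : Differentiable ℝ Θ := h.smooth.differentiable two_ne_zero
  have h2 : HasDerivAt (fun s => Θ (x / Real.sqrt (1 + s))) (deriv Θ x * (-x / 2)) 0 := by
    have e1 : HasDerivAt (fun s : ℝ => Real.sqrt (1 + s)) (1 / 2) 0 := by
      have := ((hasDerivAt_id (0 : ℝ)).const_add 1).sqrt (by simp)
      simpa using this
    have e2 : HasDerivAt (fun s : ℝ => x / Real.sqrt (1 + s)) (-x / 2) 0 := by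
      have := (hasDerivAt_const (0 : ℝ) x).div e1 (by simp)
      refine this.congr_deriv ?_
      simp; ring
    have e3 : HasDerivAt Θ (deriv Θ x) (x / Real.sqrt (1 + 0)) := by
      simpa using (hd x).hasDerivAt
    exact e3.comp 0 e2
  rw [h2.deriv] at h1
  have hq : Differentiable ℝ (fun y => deriv Θ y / Θ y) :=
    (ContDiff.differentiable_deriv_two h.smooth).div hd fun y => (h.pos y).ne'
  refine (hq x).hasDerivAt.congr_deriv ?_
  have hΘ := (h.pos x).ne'
  field_simp
  linear_combination (-2) * h1

/-- The logarithmic derivative of `Θ` solves a linear equation, so it equals `h0 * exp (-I)` and has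
one sign. Hence `Θ` stays between the end temperatures, which in turn bounds `I z` between `c z²`
and `G z²` for `z ≥ 0` and gives Gaussian decay. -/
theorem contact_bounds (g : Gas) {m L : ℝ} (hm : 0 < m) :
    ∃ C c : ℝ, 0 < C ∧ 0 < c ∧ ∀ (Us Uc : State) (Θ : ℝ → ℝ), g.p Us ∈ Icc m L →
      Us.θ ∈ Icc m L → Uc.θ ∈ Icc m L → g.IsContactProfile Us Uc Θ →
      (∀ z, |Θ z - Uc.θ| ≤ C * |Uc.θ - Us.θ|) ∧
      ∀ z, 0 ≤ z → |Θ z - Uc.θ| ≤ C * |Uc.θ - Us.θ| * Real.exp (-(c * z ^ 2)) := by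
  rcases lt_or_ge L m with hLm | hLm
  · exact ⟨1, 1, one_pos, one_pos, fun Us Uc Θ hp => absurd (hp.1.trans hp.2) (not_le.2 hLm)⟩
  have hL : 0 < L := hm.trans_le hLm
  have hR := g.R_pos; have hγ := g.γ_pos; have hγ1 := g.γ_sub_pos; have hκ := g.κ_pos
  set A := (g.γ - 1) * g.κ / (g.R ^ 2 * g.γ) with hA
  have hA0 : 0 < A := by positivity
  set c := m / (4 * (A * L)) with hc
  set G := L / (4 * (A * m)) with hG
  have hc0 : 0 < c := by positivity
  -- The first summand covers `0 ≤ z ≤ 1`, where the Gaussian is at least `exp (-c)`; the second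
  -- covers `z ≥ 1`.
  set C := Real.exp c + Real.exp G / m * (L / (2 * c)) with hC
  have hC1 : 1 ≤ C := by
    have : 1 ≤ Real.exp c := Real.one_le_exp hc0.le
    have : 0 < Real.exp G / m * (L / (2 * c)) := by positivity
    linarith
  refine ⟨C, c, by linarith, hc0, fun Us Uc Θ hp hs hu h => ?_⟩
  have hp0 := hm.trans_le hp.1
  set a := A * g.p Us with ha
  have ha0 : 0 < a := by positivity
  have haeq : (g.γ - 1) * g.κ * g.p Us / (g.R ^ 2 * g.γ) = a := by rw [ha, hA]; ring
  have haL : a ≤ A * L := by rw [ha]; gcongr; exact hp.2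
  have ham : A * m ≤ a := by rw [ha]; gcongr; exact hp.1
  have hdΘ : Differentiable ℝ Θ := h.smooth.differentiable two_ne_zero
  have hΘc : Continuous Θ := hdΘ.continuous
  set I : ℝ → ℝ := fun z => ∫ s in (0 : ℝ)..z, s * Θ s / (2 * a) with hI
  have hId : ∀ z, HasDerivAt I (z * Θ z / (2 * a)) z := fun z => by
    have : Continuous fun s => s * Θ s / (2 * a) := by fun_prop
    exact (this.integral_hasStrictDerivAt 0 z).hasDerivAt
  have hI0 : I 0 = 0 := by simp [hI]
  set h0 := deriv Θ 0 / Θ 0 with hh0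
  have hsol : ∀ z, deriv Θ z / Θ z = h0 * Real.exp (-(I z)) := fun z => by
    have hd : ∀ x, HasDerivAt (fun y => deriv Θ y / Θ y * Real.exp (I y)) 0 x := fun x => by
      refine ((h.hasDerivAt_logDeriv hp0 x).mul (hId x).exp).congr_deriv ?_
      rw [haeq]; ring
    have h1 := is_const_of_deriv_eq_zero (fun x => (hd x).differentiableAt)
      (fun x => (hd x).deriv) z 0
    simp only [hI0, Real.exp_zero, mul_one] at h1
    rw [hh0, ← h1, mul_assoc, ← Real.exp_add]
    simp
  have hΘd : ∀ z, HasDerivAt Θ (h0 * (Real.exp (-(I z)) * Θ z)) z := fun z => by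
    refine (hdΘ z).hasDerivAt.congr_deriv ?_
    have h1 := hsol z
    rw [div_eq_iff (h.pos z).ne'] at h1
    rw [h1]; ring
  have hmem : ∀ z, Θ z ∈ uIcc Us.θ Uc.θ := mem_uIcc_of_deriv_sign hΘd
    (fun z => mul_nonneg (Real.exp_pos _).le (h.pos z).le) h.lim_bot h.lim_top
  have hbox : ∀ z, Θ z ∈ Icc m L := fun z => uIcc_subset_Icc hs hu (hmem z)
  set D := |Uc.θ - Us.θ| with hD
  have hD0 : 0 ≤ D := abs_nonneg _
  have hbd : ∀ z, |Θ z - Uc.θ| ≤ D := fun z => by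
    rw [abs_sub_comm]; exact abs_sub_right_of_mem_uIcc (hmem z)
  have hIlow : ∀ z, 0 ≤ z → c * z ^ 2 ≤ I z := fun z hz => by
    have hmon : MonotoneOn (fun z => I z - c * z ^ 2) (Ici 0) := by
      have hder : ∀ x, HasDerivAt (fun z => I z - c * z ^ 2)
          (x * Θ x / (2 * a) - c * (2 * x)) x := fun x => by
        refine ((hId x).sub ((hasDerivAt_pow 2 x).const_mul c)).congr_deriv ?_
        simp
      refine monotoneOn_of_deriv_nonneg (convex_Ici 0)
        (fun x _ => (hder x).continuousAt.continuousWithinAt)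
        (fun x _ => (hder x).differentiableAt.differentiableWithinAt) fun x hx => ?_
      rw [interior_Ici] at hx
      have hx0 : 0 < x := hx
      rw [(hder x).deriv, sub_nonneg]
      have : c * (2 * x) = x * m / (2 * (A * L)) := by rw [hc]; field_simp; ring
      rw [this]
      have := h.pos x
      have := (hbox x).1
      gcongr
    have := hmon self_mem_Ici (mem_Ici.2 hz) hz
    simp [hI0] at this
    linarith
  have hIup : ∀ z, 0 ≤ z → I z ≤ G * z ^ 2 := fun z hz => by
    have hmon : MonotoneOn (fun z => G * z ^ 2 - I z) (Ici 0) := by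
      have hder : ∀ x, HasDerivAt (fun z => G * z ^ 2 - I z)
          (G * (2 * x) - x * Θ x / (2 * a)) x := fun x => by
        refine (((hasDerivAt_pow 2 x).const_mul G).sub (hId x)).congr_deriv ?_
        simp
      refine monotoneOn_of_deriv_nonneg (convex_Ici 0)
        (fun x _ => (hder x).continuousAt.continuousWithinAt)
        (fun x _ => (hder x).differentiableAt.differentiableWithinAt) fun x hx => ?_
      rw [interior_Ici] at hx
      have hx0 : 0 < x := hx
      rw [(hder x).deriv, sub_nonneg]
      have : G * (2 * x) = x * L / (2 * (A * m)) := by rw [hG]; field_simp; ring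
      rw [this]
      gcongr
      exact (hbox x).2
    have := hmon self_mem_Ici (mem_Ici.2 hz) hz
    simp [hI0] at this
    linarith
  -- The slope at `0` is bounded by the change of `Θ` over `[0, 1]`: the slope has one sign and, by
  -- the upper bound on `I`, cannot shrink by more than a fixed factor there.
  have hh : |h0| ≤ D * (Real.exp G / m) := by
    obtain ⟨z, hz, hz'⟩ := exists_hasDerivAt_eq_slope Θ _ zero_lt_one hΘc.continuousOn
      fun z _ => hΘd z
    have h1 : |Θ 1 - Θ 0| ≤ D :=
      abs_sub_le_of_uIcc_subset_uIcc (uIcc_subset_uIcc (hmem 0) (hmem 1))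
    have h2 : |h0| * (Real.exp (-(I z)) * Θ z) ≤ D := by
      rw [sub_zero, div_one] at hz'
      rw [← hz', abs_mul, abs_of_pos (mul_pos (Real.exp_pos _) (h.pos z))] at h1
      exact h1
    have h3 : Real.exp (-G) * m ≤ Real.exp (-(I z)) * Θ z := by
      refine mul_le_mul (Real.exp_le_exp.2 ?_) (hbox z).1 hm.le (Real.exp_pos _).le
      have := hIup z hz.1.le
      have hG0 : 0 < G := by positivity
      have hz2 : z ^ 2 ≤ 1 := pow_le_one₀ hz.1.le hz.2.le
      have := mul_le_mul_of_nonneg_left hz2 hG0.le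
      linarith
    have h4 : |h0| * (Real.exp (-G) * m) ≤ D :=
      (mul_le_mul_of_nonneg_left h3 (abs_nonneg _)).trans h2
    rw [Real.exp_neg] at h4
    have hE := Real.exp_pos G
    rw [mul_div_assoc', le_div_iff₀ hm]
    calc |h0| * m = |h0| * ((Real.exp G)⁻¹ * m) * Real.exp G := by field_simp
      _ ≤ _ := by gcongr
  refine ⟨fun z => (hbd z).trans (le_mul_of_one_le_left hD0 hC1), fun z hz => ?_⟩
  have hE : 0 < Real.exp (-(c * z ^ 2)) := Real.exp_pos _
  rcases le_total z 1 with hz1 | hz1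
  · refine (hbd z).trans ?_
    have h1 : 1 ≤ Real.exp c * Real.exp (-(c * z ^ 2)) := by
      rw [← Real.exp_add]
      refine Real.one_le_exp ?_
      have := mul_le_mul_of_nonneg_left (pow_le_one₀ hz hz1 : z ^ 2 ≤ 1) hc0.le
      linarith
    calc D = D * 1 := (mul_one D).symm
      _ ≤ D * (Real.exp c * Real.exp (-(c * z ^ 2))) := by gcongr
      _ ≤ D * (C * Real.exp (-(c * z ^ 2))) := by
        gcongr
        rw [hC]
        have : 0 < Real.exp G / m * (L / (2 * c)) := by positivity
        linarith
      _ = _ := by ring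
  -- With this `B`, the slope of the barrier `B exp (-c z²)` dominates `|Θ'|` as soon as `z ≥ 1`, so
  -- the barrier plus or minus `Θ` is decreasing up to its limit at `+∞`.
  · set B := |h0| * L / (2 * c) with hB
    have hder : ∀ ε x, HasDerivAt (fun z => ε * Θ z + B * Real.exp (-(c * z ^ 2)))
        (ε * (h0 * (Real.exp (-(I x)) * Θ x)) - |h0| * L * x * Real.exp (-(c * x ^ 2))) x :=
      fun ε x => by
        have e1 : HasDerivAt (fun z : ℝ => -(c * z ^ 2)) (-(c * (2 * x))) x := by
          exact ((hasDerivAt_pow 2 x).const_mul c).fun_neg.congr_deriv (by simp)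
        refine (((hΘd x).const_mul ε).add (e1.exp.const_mul B)).congr_deriv ?_
        rw [hB]; field_simp; ring
    have hanti : ∀ ε : ℝ, |ε| = 1 →
        AntitoneOn (fun z => ε * Θ z + B * Real.exp (-(c * z ^ 2))) (Ici 1) := fun ε hε => by
      refine antitoneOn_of_deriv_nonpos (convex_Ici 1)
        (fun x _ => (hder ε x).continuousAt.continuousWithinAt)
        (fun x _ => (hder ε x).differentiableAt.differentiableWithinAt) fun x hx => ?_
      rw [interior_Ici] at hx
      have hx1 : 1 < x := hx
      rw [(hder ε x).deriv, sub_nonpos]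
      refine (le_abs_self _).trans ?_
      rw [abs_mul, abs_mul, hε, one_mul, abs_of_pos (mul_pos (Real.exp_pos _) (h.pos x))]
      have e1 : Real.exp (-(I x)) ≤ Real.exp (-(c * x ^ 2)) :=
        Real.exp_le_exp.2 (neg_le_neg (hIlow x (by linarith)))
      have e2 := (hbox x).2
      have e3 := h.pos x
      calc |h0| * (Real.exp (-(I x)) * Θ x) ≤ |h0| * (Real.exp (-(c * x ^ 2)) * L) := by gcongr
        _ = |h0| * L * 1 * Real.exp (-(c * x ^ 2)) := by ring
        _ ≤ _ := by gcongr
    have hlimE : Tendsto (fun z : ℝ => Real.exp (-(c * z ^ 2))) atTop (𝓝 0) := by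
      refine Real.tendsto_exp_atBot.comp (tendsto_neg_atTop_atBot.comp ?_)
      exact (tendsto_pow_atTop two_ne_zero).const_mul_atTop hc0
    have hge : ∀ ε : ℝ, |ε| = 1 → ε * Uc.θ ≤ ε * Θ z + B * Real.exp (-(c * z ^ 2)) :=
      fun ε hε => by
        have e1 : Tendsto (fun z => ε * Θ z + B * Real.exp (-(c * z ^ 2))) atTop
            (𝓝 (ε * Uc.θ)) := by
          simpa using (h.lim_top.const_mul ε).add (hlimE.const_mul B)
        refine le_of_tendsto e1 ?_
        filter_upwards [eventually_ge_atTop z] with y hy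
        exact hanti ε hε (mem_Ici.2 hz1) (mem_Ici.2 (hz1.trans hy)) hy
    have h1 := hge 1 (by simp)
    have h2 := hge (-1) (by simp)
    have h3 : |Θ z - Uc.θ| ≤ B * Real.exp (-(c * z ^ 2)) := by
      rw [abs_le]; constructor <;> linarith
    refine h3.trans (mul_le_mul_of_nonneg_right ?_ hE.le)
    calc B = |h0| * (L / (2 * c)) := by rw [hB]; ring
      _ ≤ D * (Real.exp G / m) * (L / (2 * c)) := by gcongr
      _ = (Real.exp G / m * (L / (2 * c))) * D := by ring
      _ ≤ C * D := by
        gcongr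
        rw [hC]
        linarith [Real.exp_pos c]

/-! ### Uniform bounds on the end states -/

/-- The intermediate states and the speeds of a weak pattern lie in a fixed compact box. -/
structure Pattern.IsBox (W : Pattern) (g : Gas) (m L : ℝ) : Prop where
  base : g.IsBase m L W.Uc (W.σc g)
  v_mem : W.Uc.v ∈ Icc (2 * m) (L - m)
  θ_mem : W.Uc.θ ∈ Icc (2 * m) (L - m)
  σ_mem : W.σ g ∈ Icc m L
  Us_v : W.Us.v ∈ Icc m L
  Us_θ : W.Us.θ ∈ Icc m L
  p_eq : g.p W.Us = g.p W.Uc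
  δS_eq : W.δS = W.Up.v - W.Uc.v
  δS_pos : 0 < W.δS
  δR_eq : W.δR = W.Us.v - W.Um.v
  δR_le : W.δR ≤ m / 2
  θ_sub : |W.Uc.θ - W.Us.θ| = g.p W.Uc / g.R * W.δC
  speed : |W.σ g - W.σc g| ≤ (g.γ + 1) * L ^ 2 / (4 * m ^ 2) * W.δS

lemma sqrt_mem_Icc {a x : ℝ} (h : x ∈ Icc a (4 * a)) : √x ∈ Icc √a (2 * √a) := by
  refine ⟨Real.sqrt_le_sqrt h.1, ?_⟩
  have : 2 * √a = √(4 * a) := by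
    rw [Real.sqrt_mul (by norm_num), show (4 : ℝ) = 2 ^ 2 by norm_num,
      Real.sqrt_sq (by norm_num)]
  rw [this]
  exact Real.sqrt_le_sqrt h.2

/-- Only `U_+` is fixed. The Rankine–Hugoniot relations confine `σ`, `p^*` and `v^*` in terms of it
when the shock is weak; the contact relation then confines `U_*`. -/
theorem exists_isBox (g : Gas) {Up : State} (hUp : Up.Admissible) :
    ∃ m L δ₁ : ℝ, 0 < m ∧ 0 < δ₁ ∧ ∀ W : Pattern, W.Up = Up → W.IsGeneric g →
      W.δR < δ₁ → W.δC < δ₁ → W.δS < δ₁ → W.IsBox g m L := by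
  have hR := g.R_pos; have hγ := g.γ_pos; have hγ1 := g.γ_sub_pos
  obtain ⟨hv, hθ⟩ := hUp
  set v := Up.v with hvd
  set p := g.p Up with hp
  have hp0 : 0 < p := by rw [hp]; unfold Gas.p; positivity
  set a := g.γ * p / v with ha
  have ha0 : 0 < a := by positivity
  obtain ⟨m, L, hm, hL, i₁, i₂, i₃, i₄, -, -⟩ := exists_common_bounds (v / 4) (p * v / (4 * g.R)) p
    (√a) 1 1 (2 * v) (4 * (p * v / g.R)) (2 * p) (2 * √a) 1 1 (by positivity) (by positivity) hp0
    (Real.sqrt_pos.2 ha0) one_pos one_pos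
  -- Halving the lower bound and enlarging the upper one leaves a margin around the intermediate
  -- state, needed later for the superposition wave and the solution.
  refine ⟨m / 2, L + m, min (v / (2 * (g.γ + 1))) (min (v / 4) (m / 4)), by positivity,
    by positivity, fun W hWp hW hdR hdC hdS => ?_⟩
  rw [lt_min_iff, lt_min_iff] at hdR hdC hdS
  obtain ⟨hUc, hlt, hσ, hRH⟩ := hW.mem_S3
  obtain ⟨hUs, -, hps⟩ := hW.mem_CD2
  obtain ⟨hUm, hltR, -, -⟩ := hW.mem_R1
  rw [hWp] at hlt hσ hRH
  have hσe : W.σ g = g.shockSpeed W.Uc Up := by rw [← hWp]; rfl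
  rw [← hσe] at hσ hRH
  obtain ⟨-, e2, e3⟩ := hRH.relations hUc ⟨hv, hθ⟩ hσ hlt
  have hδ : W.δS = v - W.Uc.v := by
    unfold Pattern.δS; rw [hWp]; exact abs_of_pos (sub_pos.2 hlt)
  have hδ0 : 0 < W.δS := by rw [hδ]; exact sub_pos.2 hlt
  rw [← hvd, ← hδ] at e2 e3
  set d := W.δS with hd
  set σ := W.σ g with hσd
  set vc := W.Uc.v with hvc
  set pc := g.p W.Uc with hpc
  have hvcd : vc = v - d := by linarith
  have hp1 : p = pc - σ ^ 2 * d := e2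
  have hd1 : (g.γ + 1) * d ≤ v / 2 := by
    have := hdS.1.le
    rw [le_div_iff₀ (by positivity)] at this
    linarith
  -- The speed relation rewritten at the right state, whose values are fixed; it pins down `σ²`
  -- before anything is known about the left state.
  have key : g.γ * p = σ ^ 2 * (v - (g.γ + 1) / 2 * d) := by
    rw [hp1]; rw [hvcd] at e3; linarith
  have hσ2 : 0 < σ ^ 2 := by positivity
  have hd0 : 0 ≤ (g.γ + 1) * d := by positivity
  have hσlow : a ≤ σ ^ 2 := by
    rw [ha, div_le_iff₀ hv, key]
    exact mul_le_mul_of_nonneg_left (by linarith) hσ2.le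
  have hσup0 : σ ^ 2 * (3 / 4 * v) ≤ g.γ * p := by
    rw [key]; exact mul_le_mul_of_nonneg_left (by linarith) hσ2.le
  have hσup : σ ^ 2 ≤ 4 * a := by
    rw [ha, mul_div_assoc', le_div_iff₀ hv]
    have : 0 < σ ^ 2 * v := by positivity
    have : 0 < g.γ * p := by positivity
    linarith
  have hσmem : σ ∈ Icc √a (2 * √a) := by
    rw [← Real.sqrt_sq hσ.le]; exact sqrt_mem_Icc ⟨hσlow, hσup⟩
  have hσd1 : σ ^ 2 * d ≤ p := by
    have h1 : σ ^ 2 * ((g.γ + 1) * d) ≤ σ ^ 2 * (v / 2) := mul_le_mul_of_nonneg_left hd1 hσ2.le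
    have h3 : 0 < g.γ * p := by positivity
    have h2 : (g.γ + 1) * (σ ^ 2 * d) ≤ (g.γ + 1) * p := by linarith
    exact le_of_mul_le_mul_left h2 (by linarith)
  have hσd0 : 0 < σ ^ 2 * d := by positivity
  have hpcm : pc ∈ Icc p (2 * p) := ⟨by linarith, by linarith⟩
  have hdv : d ≤ v / 4 := hdS.2.1.le
  have hvcm : vc ∈ Icc (3 / 4 * v) v := ⟨by linarith, by linarith⟩
  have hvc0 : 0 < vc := hUc.1
  have hpc0 : 0 < pc := hp0.trans_le hpcm.1
  have hθc : W.Uc.θ = pc * vc / g.R := by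
    have : W.Uc.v ≠ 0 := hvc0.ne'
    rw [hpc, hvc]; unfold Gas.p; field_simp
  have hθs : W.Us.θ = pc * W.Us.v / g.R := by
    rw [← hps]; unfold Gas.p; have := hUs.1.ne'; field_simp
  have hδC : |vc - W.Us.v| ≤ v / 4 := hdC.2.1.le
  rw [abs_le] at hδC
  have hsv : W.Us.v ∈ Icc (v / 2) (5 / 4 * v) := ⟨by linarith [hvcm.1], by linarith [hvcm.2]⟩
  have hs2 : g.γ * pc / vc ∈ Icc a (4 * a) := by
    constructor
    · rw [ha]; gcongr; exact hpcm.1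
    · have : 4 * a = g.γ * (2 * p) / (v / 2) := by rw [ha]; field_simp; norm_num
      rw [this]; gcongr; exacts [hpcm.2, by linarith [hvcm.1]]
  have hsmem : W.σc g ∈ Icc √a (2 * √a) := sqrt_mem_Icc hs2
  have hθbox : ∀ y ∈ Icc (v / 2) (5 / 4 * v), pc * y / g.R ∈ Icc m L := fun y hy => by
    have hy0 : 0 < y := lt_of_lt_of_le (by positivity) hy.1
    refine i₂ ⟨?_, ?_⟩
    · have : p * v / (4 * g.R) = p * (v / 4) / g.R := by field_simp
      rw [this]; gcongr; exacts [hpcm.1, by linarith [hy.1]]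
    · have : 4 * (p * v / g.R) = (2 * p) * (2 * v) / g.R := by field_simp; ring
      rw [this]; gcongr; exacts [hpcm.2, by linarith [hy.2]]
  have hsub : Icc m L ⊆ Icc (m / 2) (L + m) := Icc_subset_Icc (by linarith) (by linarith)
  have hsub2 : Icc m L ⊆ Icc (2 * (m / 2)) (L + m - m / 2) :=
    Icc_subset_Icc (by linarith) (by linarith)
  have hvcL : vc ∈ Icc m L := i₁ ⟨by linarith [hvcm.1], by linarith [hvcm.2]⟩
  have hθcL : W.Uc.θ ∈ Icc m L := hθc ▸ hθbox vc ⟨by linarith [hvcm.1], by linarith [hvcm.2]⟩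
  have hsq : W.σc g ^ 2 * vc = g.γ * pc := by
    have : W.σc g ^ 2 = g.γ * pc / vc := Real.sq_sqrt (by positivity)
    rw [this]; field_simp
  exact
    { base :=
        { m_pos := by positivity
          v_mem := hsub hvcL
          θ_mem := hsub hθcL
          p_mem := hsub (i₃ hpcm)
          s_mem := hsub (i₄ hsmem)
          sq_s := hsq }
      v_mem := hsub2 hvcL
      θ_mem := hsub2 hθcL
      σ_mem := hsub (i₄ hσmem)
      Us_v := hsub (i₁ ⟨by linarith [hsv.1], by linarith [hsv.2]⟩)
      Us_θ := hsub (hθs ▸ hθbox _ hsv)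
      p_eq := hps
      δS_eq := by rw [hWp, ← hvd]; exact hδ
      δS_pos := hδ0
      δR_eq := abs_of_pos (sub_pos.2 hltR)
      δR_le := by linarith [hdR.2.2]
      θ_sub := by
        have : W.Uc.θ - W.Us.θ = pc / g.R * (vc - W.Us.v) := by rw [hθc, hθs]; field_simp
        rw [this, abs_mul, abs_of_pos (by positivity)]; rfl
      speed := by
        refine abs_sub_speed_le hγ (by positivity) (hsub (i₄ hσmem)) (hsub (i₄ hsmem))
          (hsub hvcL) hsq hδ0 e3 }

/-! ### Pointwise algebra near the base state -/

lemma half_sq_sub_le_Phi {x : ℝ} (hx : |x| ≤ 1 / 2) : x ^ 2 / 2 - 2 * |x| ^ 3 ≤ Phi (1 + x) := by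
  have h := Real.abs_log_sub_add_sum_range_le (x := -x) (by rw [abs_neg]; linarith) 2
  simp only [Finset.sum_range_succ, Finset.sum_range_zero, abs_neg, sub_neg_eq_add] at h
  norm_num at h
  have h1 : |x| ^ 3 / (1 - |x|) ≤ 2 * |x| ^ 3 := by
    rw [div_le_iff₀ (by linarith)]
    have : 0 ≤ |x| ^ 3 := by positivity
    have := mul_le_mul_of_nonneg_left (show 1 / 2 ≤ 1 - |x| by linarith) this
    linarith
  have h2 := (abs_le.1 (h.trans h1)).2
  unfold Phi
  linarith

lemma abs_mul_sub_mul_le {a a' b b' A B x y : ℝ} (ha : |a| ≤ A) (hb : |b'| ≤ B)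
    (hx : |a - a'| ≤ x) (hy : |b - b'| ≤ y) : |a * b - a' * b'| ≤ A * y + B * x := by
  have h0 : a * b - a' * b' = a * (b - b') + b' * (a - a') := by ring
  rw [h0]
  refine (abs_add_le _ _).trans (add_le_add ?_ ?_) <;> rw [abs_mul] <;> gcongr
  · exact (abs_nonneg _).trans ha
  · exact (abs_nonneg _).trans hb

lemma abs_inv_sub_inv_le {a b m : ℝ} (hm : 0 < m) (ha : m ≤ a) (hb : m ≤ b) :
    |a⁻¹ - b⁻¹| ≤ |a - b| * m⁻¹ ^ 2 := by
  have ha0 := hm.trans_le ha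
  have hb0 := hm.trans_le hb
  have : a⁻¹ - b⁻¹ = (b - a) * (a⁻¹ * b⁻¹) := by field_simp
  rw [this, abs_mul, abs_sub_comm, abs_of_pos (show 0 < a⁻¹ * b⁻¹ by positivity), sq]
  gcongr

/-- The relative slope of the temperature with respect to the velocity along the 3-wave. -/
noncomputable def Gas.slopeθ (g : Gas) (U : State) (s : ℝ) : ℝ := (g.γ - 1) * g.p U / (g.R * s)

section Base

variable {g : Gas} {m L s : ℝ} {U : State}

namespace Gas.IsBase

lemma s_pos (h : g.IsBase m L U s) : 0 < s := h.m_pos.trans_le h.s_mem.1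

lemma p_pos (h : g.IsBase m L U s) : 0 < g.p U := h.m_pos.trans_le h.p_mem.1

lemma L_pos (h : g.IsBase m L U s) : 0 < L := h.s_pos.trans_le h.s_mem.2

lemma R_mul_θ (h : g.IsBase m L U s) : g.R * U.θ = g.p U * U.v := by
  have := h.adm.1.ne'
  unfold Gas.p; field_simp

lemma slopeθ_pos (h : g.IsBase m L U s) : 0 < g.slopeθ U s := by
  have := g.γ_sub_pos; have := h.p_pos; have := h.s_pos; have := g.R_pos
  unfold Gas.slopeθ; positivity

lemma slopeθ_le (h : g.IsBase m L U s) : g.slopeθ U s ≤ (g.γ - 1) * L / (g.R * m) := by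
  have := g.γ_sub_pos; have := h.p_pos; have := h.s_pos; have := g.R_pos; have := h.L_pos
  have := h.m_pos
  unfold Gas.slopeθ
  gcongr
  exacts [h.p_mem.2, h.s_mem.1]

/-- The quadratic part of the entropy flux minus the speed times the entropy is negative
semidefinite, with the 3-wave direction as its kernel. -/
lemma quadratic_flux (h : g.IsBase m L U s) (φ ψ ζ : ℝ) :
    g.R * (ψ * ζ) * U.v⁻¹ - g.R * (ψ * φ) * (U.θ * U.v⁻¹ * U.v⁻¹)
      - g.R / 2 * φ ^ 2 * (s * U.θ * U.v⁻¹ * U.v⁻¹) - g.R / (2 * (g.γ - 1)) * ζ ^ 2 * (s * U.θ⁻¹)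
      - 1 / 2 * ψ ^ 2 * s
    = -(s / 2 * (g.p U / U.v * (φ + ψ / s) ^ 2
        + g.R / ((g.γ - 1) * U.θ) * (ζ - g.slopeθ U s * ψ) ^ 2)) := by
  have hs := h.s_pos.ne'
  have hv := h.adm.1.ne'
  have hθ := h.adm.2.ne'
  have hR := g.R_pos.ne'
  have hγ := g.γ_sub_pos.ne'
  have hp : g.p U = g.R * U.θ / U.v := rfl
  have hsq := h.sq_s
  rw [hp] at hsq
  have hsq' : g.R * U.θ * g.γ = s ^ 2 * U.v ^ 2 := by
    field_simp at hsq; linarith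
  unfold Gas.slopeθ
  rw [hp]
  field_simp
  linear_combination (ψ ^ 2 * (g.γ - 1) * U.θ) * hsq'

end Gas.IsBase

end Base

/-- Lipschitz bounds, on a compact box, for the coefficients of the quadratic expansions. -/
lemma coefficient_bounds {m : ℝ} (L : ℝ) (hm : 0 < m) : ∃ C : ℝ, 0 < C ∧
    ∀ v vb θb σ v₀ θ₀ s h : ℝ, v ∈ Icc m L → vb ∈ Icc m L → θb ∈ Icc m L → σ ∈ Icc m L →
      v₀ ∈ Icc m L → θ₀ ∈ Icc m L → s ∈ Icc m L → |v - v₀| ≤ h → |vb - v₀| ≤ h → |θb - θ₀| ≤ h →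
      |σ - s| ≤ h →
      |v⁻¹ - v₀⁻¹| ≤ C * h ∧ |θb * vb⁻¹ * v⁻¹ - θ₀ * v₀⁻¹ * v₀⁻¹| ≤ C * h ∧
      |σ * θb * vb⁻¹ * vb⁻¹ - s * θ₀ * v₀⁻¹ * v₀⁻¹| ≤ C * h ∧
      |σ * θb⁻¹ - s * θ₀⁻¹| ≤ C * h ∧ |σ - s| ≤ C * h ∧ |θb⁻¹ - θ₀⁻¹| ≤ C * h ∧
      |θb * vb⁻¹ * vb⁻¹ - θ₀ * v₀⁻¹ * v₀⁻¹| ≤ C * h := by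
  rcases lt_or_ge L m with hLm | hLm
  · exact ⟨1, one_pos, fun v vb θb σ v₀ θ₀ s h hv => absurd (hv.1.trans hv.2) (not_le.2 hLm)⟩
  have hL := hm.trans_le hLm
  set J := m⁻¹ with hJ
  have hJ0 : 0 < J := inv_pos.2 hm
  set E₁ := L * J ^ 2 + J * 1 with hE₁
  set E₂ := L * J * J ^ 2 + J * E₁ with hE₂
  set E₃ := L * L * J ^ 2 + J * (L * 1 + L * 1) with hE₃
  set E₄ := L * L * J * J ^ 2 + J * E₃ with hE₄
  have hE₁0 : 0 < E₁ := by positivity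
  have hE₂0 : 0 < E₂ := by positivity
  have hE₃0 : 0 < E₃ := by positivity
  have hE₄0 : 0 < E₄ := by positivity
  refine ⟨J ^ 2 + E₁ + E₂ + E₄ + 1, by positivity,
    fun v vb θb σ v₀ θ₀ s h hv hvb hθb hσ hv0 hθ0 hs h1 h2 h3 h4 => ?_⟩
  have hh : 0 ≤ h := (abs_nonneg _).trans h1
  have bd : ∀ x ∈ Icc m L, |x| ≤ L := fun x hx => by
    rw [abs_of_pos (hm.trans_le hx.1)]; exact hx.2
  have bi : ∀ x ∈ Icc m L, |x⁻¹| ≤ J := fun x hx => by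
    rw [abs_of_pos (inv_pos.2 (hm.trans_le hx.1))]; exact inv_anti₀ hm hx.1
  have iv : ∀ x ∈ Icc m L, ∀ y ∈ Icc m L, |x - y| ≤ h → |x⁻¹ - y⁻¹| ≤ h * J ^ 2 :=
    fun x hx y hy hxy => (abs_inv_sub_inv_le hm hx.1 hy.1).trans (by gcongr)
  have pb : ∀ {x y A B : ℝ}, 0 ≤ A → |x| ≤ A → |y| ≤ B → |x * y| ≤ A * B :=
    fun hA hx hy => by rw [abs_mul]; exact mul_le_mul hx hy (abs_nonneg _) hA
  have q1 := iv v hv v₀ hv0 h1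
  have q2 := iv vb hvb v₀ hv0 h2
  have q3 := iv θb hθb θ₀ hθ0 h3
  have r1 := abs_mul_sub_mul_le (bd _ hθb) (bi _ hv0) h3 q2
  have r2 := abs_mul_sub_mul_le (pb hL.le (bd _ hθb) (bi _ hvb)) (bi _ hv0) r1 q1
  have r2' := abs_mul_sub_mul_le (pb hL.le (bd _ hθb) (bi _ hvb)) (bi _ hv0) r1 q2
  have r3 := abs_mul_sub_mul_le (bd _ hσ) (bd _ hθ0) h4 h3
  have r4 := abs_mul_sub_mul_le (pb hL.le (bd _ hσ) (bd _ hθb)) (bi _ hv0) r3 q2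
  have r5 := abs_mul_sub_mul_le (pb (by positivity) (pb hL.le (bd _ hσ) (bd _ hθb)) (bi _ hvb))
    (bi _ hv0) r4 q2
  have r6 := abs_mul_sub_mul_le (bd _ hσ) (bi _ hθ0) h4 q3
  have hh1 := mul_nonneg (sq_nonneg J) hh
  have hh2 := mul_nonneg hE₁0.le hh
  have hh3 := mul_nonneg hE₂0.le hh
  have hh4 := mul_nonneg hE₄0.le hh
  have e : (J ^ 2 + E₁ + E₂ + E₄ + 1) * h = J ^ 2 * h + E₁ * h + E₂ * h + E₄ * h + h := by ring
  rw [e]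
  refine ⟨?_, ?_, ?_, ?_, ?_, ?_, ?_⟩
  · linarith
  · refine r2.trans ?_
    have : L * J * (h * J ^ 2) + J * (L * (h * J ^ 2) + J * h) = E₂ * h := by
      rw [hE₂, hE₁]; ring
    linarith
  · refine r5.trans ?_
    have : L * L * J * (h * J ^ 2) + J * (L * L * (h * J ^ 2) + J * (L * h + L * h)) = E₄ * h := by
      rw [hE₄, hE₃]; ring
    linarith
  · refine r6.trans ?_
    have : L * (h * J ^ 2) + J * h = E₁ * h := by rw [hE₁]; ring
    linarith
  · linarith
  · linarith
  · refine r2'.trans ?_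
    have : L * J * (h * J ^ 2) + J * (L * (h * J ^ 2) + J * h) = E₂ * h := by
      rw [hE₂, hE₁]; ring
    linarith

lemma add_add_sq_le (x y z : ℝ) : (x + y + z) ^ 2 ≤ 3 * (x ^ 2 + y ^ 2 + z ^ 2) := by
  nlinarith [sq_nonneg (x - y), sq_nonneg (x - z), sq_nonneg (y - z)]

lemma add_add_pow_three_le {x y z : ℝ} (hx : 0 ≤ x) (hy : 0 ≤ y) (hz : 0 ≤ z) :
    (x + y + z) ^ 3 ≤ 9 * (x ^ 3 + y ^ 3 + z ^ 3) := by
  have a1 := mul_nonneg (add_nonneg hx hy) (sq_nonneg (x - y))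
  have a2 := mul_nonneg (add_nonneg hy hz) (sq_nonneg (y - z))
  have a3 := mul_nonneg (add_nonneg hx hz) (sq_nonneg (x - z))
  have a4 := mul_nonneg hx (sq_nonneg (y - z))
  have a5 := mul_nonneg hy (sq_nonneg (x - z))
  have a6 := mul_nonneg hz (sq_nonneg (x - y))
  nlinarith

set_option maxHeartbeats 1000000 in
/-- The difference between the entropy flux and the entropy production, up to terms of third
order, controls the components transversal to the 3-wave. -/
theorem flux_sub_entropy_le (g : Gas) {m : ℝ} (L : ℝ) (hm : 0 < m) :
    ∃ c₀ C n₀ : ℝ, 0 < c₀ ∧ 0 < C ∧ 0 < n₀ ∧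
    ∀ (U : State) (s σ vb θb φ ψ ζ n : ℝ), g.IsBase m L U s → σ ∈ Icc m L →
      vb ∈ Icc m L → θb ∈ Icc m L → vb + φ ∈ Icc m L →
      |vb - U.v| ≤ n → |θb - U.θ| ≤ n → |σ - s| ≤ n → n ≤ n₀ → |φ| ≤ n₀ → |ψ| ≤ n₀ → |ζ| ≤ n₀ →
      ψ * (g.R * (θb + ζ) / (vb + φ) - g.R * θb / vb)
        - σ * (g.R * θb * Phi ((vb + φ) / vb) + g.R * θb / (g.γ - 1) * Phi ((θb + ζ) / θb)
          + ψ ^ 2 / 2)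
      ≤ -c₀ * ((φ + ψ / s) ^ 2 + (ζ - g.slopeθ U s * ψ) ^ 2) + C * (n * ψ ^ 2 + |ψ| ^ 3) := by
  rcases lt_or_ge L m with hLm | hLm
  · exact ⟨1, 1, 1, one_pos, one_pos, one_pos, fun U s σ vb θb φ ψ ζ n hb => absurd
      (hb.v_mem.1.trans hb.v_mem.2) (not_le.2 hLm)⟩
  have hL := hm.trans_le hLm
  have hR := g.R_pos; have hγ := g.γ_sub_pos
  obtain ⟨C₁, hC₁, hcoef⟩ := coefficient_bounds L hm
  set C₂ := (g.R + g.R + g.R / 2 + g.R / (2 * (g.γ - 1)) + 1 / 2) * C₁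
    + L * g.R * L * 2 * m⁻¹ ^ 3 * (1 + 1 / (g.γ - 1)) with hC₂
  have hC₂0 : 0 < C₂ := by positivity
  -- lower bound of the quadratic form
  set c₀ := m / 2 * min (m / L) (g.R / ((g.γ - 1) * L)) / 2 with hc₀
  have hc₀0 : 0 < c₀ := by positivity
  -- Chosen so that `|φ| + |ψ| + |ζ| ≤ B (|x| + |z| + |ψ|)` with the transversal variables `x`, `z`.
  set B := 1 + (g.γ - 1) * L / (g.R * m) + m⁻¹ + 1 with hB
  have hB0 : 0 < B := by positivity
  set C₃ := C₂ * (3 * B ^ 2) + C₂ * (9 * B ^ 3) * (1 + B) with hC₃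
  have hC₃0 : 0 < C₃ := by positivity
  -- The bound `m / 2` keeps `φ / vb` and `ζ / θb` in the range of the Taylor estimate for `Phi`.
  -- The bound `c₀ / C₃` lets half of the available `2 c₀` absorb the transversal part of the
  -- errors.
  refine ⟨c₀, C₃, min (c₀ / C₃) (m / 2), hc₀0, hC₃0, by positivity,
    fun U s σ vb θb φ ψ ζ n hb hσ hvb hθb hv hn1 hn2 hn3 hn hφ hψ hζ => ?_⟩
  have hs := hb.s_pos
  have hvb0 := hm.trans_le hvb.1
  have hθb0 := hm.trans_le hθb.1
  have hσ0 := hm.trans_le hσ.1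
  have hv0 := hm.trans_le hv.1
  have hn0 : 0 ≤ n := (abs_nonneg _).trans hn1
  set n₀ := min (c₀ / C₃) (m / 2) with hn₀
  have hn₀1 : n₀ ≤ c₀ / C₃ := min_le_left _ _
  have hn₀2 : n₀ ≤ m / 2 := min_le_right _ _
  set b := g.slopeθ U s with hbdef
  have hb0 : 0 < b := hb.slopeθ_pos
  set x := φ + ψ / s with hx
  set z := ζ - b * ψ with hz
  set ϖ := |φ| + |ψ| + |ζ| with hω
  have hω0 : 0 ≤ ϖ := by positivity
  have aφ : |φ| ≤ ϖ := by rw [hω]; linarith [abs_nonneg ψ, abs_nonneg ζ]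
  have aψ : |ψ| ≤ ϖ := by rw [hω]; linarith [abs_nonneg φ, abs_nonneg ζ]
  have aζ : |ζ| ≤ ϖ := by rw [hω]; linarith [abs_nonneg ψ, abs_nonneg φ]
  obtain ⟨k1, k2, k3, k4, k5, -, -⟩ := hcoef (vb + φ) vb θb σ U.v U.θ s (n + ϖ) hv hvb hθb hσ
    hb.v_mem hb.θ_mem hb.s_mem
    (by have := abs_add_le (vb - U.v) φ
        rw [show vb + φ - U.v = vb - U.v + φ by ring]; linarith)
    (by linarith) (by linarith) (by linarith)
  -- the logarithmic terms
  have hPv : (φ / vb) ^ 2 / 2 - 2 * |φ / vb| ^ 3 ≤ Phi ((vb + φ) / vb) := by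
    have : (vb + φ) / vb = 1 + φ / vb := by field_simp
    rw [this]
    refine half_sq_sub_le_Phi ?_
    rw [abs_div, abs_of_pos hvb0, div_le_iff₀ hvb0]
    linarith [hvb.1]
  have hPθ : (ζ / θb) ^ 2 / 2 - 2 * |ζ / θb| ^ 3 ≤ Phi ((θb + ζ) / θb) := by
    have : (θb + ζ) / θb = 1 + ζ / θb := by field_simp
    rw [this]
    refine half_sq_sub_le_Phi ?_
    rw [abs_div, abs_of_pos hθb0, div_le_iff₀ hθb0]
    linarith [hθb.1]
  have cub : ∀ y q : ℝ, m ≤ q → |y| ≤ ϖ → |y / q| ^ 3 ≤ m⁻¹ ^ 3 * ϖ ^ 3 := fun y q hq hy => by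
    rw [← mul_pow]
    refine pow_le_pow_left₀ (abs_nonneg _) ?_ 3
    rw [abs_div, abs_of_pos (hm.trans_le hq), div_eq_inv_mul]
    gcongr
  have cφ := cub φ vb hvb.1 aφ
  have cζ := cub ζ θb hθb.1 aζ
  have hω3 : 0 ≤ ϖ ^ 3 := by positivity
  have hω2 : 0 ≤ ϖ ^ 2 := by positivity
  set E₀ := g.R * (ψ * ζ) * U.v⁻¹ - g.R * (ψ * φ) * (U.θ * U.v⁻¹ * U.v⁻¹)
      - g.R / 2 * φ ^ 2 * (s * U.θ * U.v⁻¹ * U.v⁻¹) - g.R / (2 * (g.γ - 1)) * ζ ^ 2 * (s * U.θ⁻¹)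
      - 1 / 2 * ψ ^ 2 * s with hE₀
  have hE₀eq := hb.quadratic_flux φ ψ ζ
  rw [← hE₀, ← hbdef, ← hx, ← hz] at hE₀eq
  have hquad : E₀ ≤ -(2 * c₀ * (x ^ 2 + z ^ 2)) := by
    rw [hE₀eq, neg_le_neg_iff]
    have l1 : m / L ≤ g.p U / U.v := by
      have := hb.adm.1
      have := hb.p_pos
      gcongr
      exacts [hb.p_mem.1, hb.v_mem.2]
    have l2 : g.R / ((g.γ - 1) * L) ≤ g.R / ((g.γ - 1) * U.θ) := by
      have := hb.adm.2
      gcongr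
      exact hb.θ_mem.2
    set q := min (m / L) (g.R / ((g.γ - 1) * L)) with hq
    have hq0 : 0 < q := by positivity
    have e1 : q * x ^ 2 ≤ g.p U / U.v * x ^ 2 :=
      mul_le_mul_of_nonneg_right ((min_le_left _ _).trans l1) (sq_nonneg _)
    have e2 : q * z ^ 2 ≤ g.R / ((g.γ - 1) * U.θ) * z ^ 2 :=
      mul_le_mul_of_nonneg_right ((min_le_right _ _).trans l2) (sq_nonneg _)
    calc 2 * c₀ * (x ^ 2 + z ^ 2) = m / 2 * (q * x ^ 2 + q * z ^ 2) := by rw [hc₀]; ring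
      _ ≤ s / 2 * (q * x ^ 2 + q * z ^ 2) := by gcongr; exact hb.s_mem.1
      _ ≤ _ := by gcongr
  -- the flux and the quadratic parts
  have hmain : ψ * (g.R * (θb + ζ) / (vb + φ) - g.R * θb / vb)
        - σ * (g.R * θb * Phi ((vb + φ) / vb) + g.R * θb / (g.γ - 1) * Phi ((θb + ζ) / θb)
          + ψ ^ 2 / 2) ≤ E₀ + C₂ * ((n + ϖ) * ϖ ^ 2) := by
    have hflux : ψ * (g.R * (θb + ζ) / (vb + φ) - g.R * θb / vb) =
        g.R * (ψ * ζ) * (vb + φ)⁻¹ - g.R * (ψ * φ) * (θb * vb⁻¹ * (vb + φ)⁻¹) := by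
      field_simp; ring
    have hv1 : σ * (g.R * θb) * ((φ / vb) ^ 2 / 2 - 2 * |φ / vb| ^ 3) ≤
        σ * (g.R * θb) * Phi ((vb + φ) / vb) := by gcongr
    have hθ1 : σ * (g.R * θb / (g.γ - 1)) * ((ζ / θb) ^ 2 / 2 - 2 * |ζ / θb| ^ 3) ≤
        σ * (g.R * θb / (g.γ - 1)) * Phi ((θb + ζ) / θb) := by gcongr
    have ev : σ * (g.R * θb) * ((φ / vb) ^ 2 / 2) =
        g.R / 2 * φ ^ 2 * (σ * θb * vb⁻¹ * vb⁻¹) := by field_simp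
    have eθ : σ * (g.R * θb / (g.γ - 1)) * ((ζ / θb) ^ 2 / 2) =
        g.R / (2 * (g.γ - 1)) * ζ ^ 2 * (σ * θb⁻¹) := by field_simp
    have rv : σ * (g.R * θb) * (2 * |φ / vb| ^ 3) ≤ L * (g.R * L) * (2 * (m⁻¹ ^ 3 * ϖ ^ 3)) := by
      gcongr; exacts [hσ.2, hθb.2]
    have rθ : σ * (g.R * θb / (g.γ - 1)) * (2 * |ζ / θb| ^ 3) ≤
        L * (g.R * L / (g.γ - 1)) * (2 * (m⁻¹ ^ 3 * ϖ ^ 3)) := by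
      gcongr; exacts [hσ.2, hθb.2]
    have aux : ∀ y k k' : ℝ, |y| ≤ ϖ ^ 2 → |k - k'| ≤ C₁ * (n + ϖ) →
        |y * k - y * k'| ≤ C₁ * ((n + ϖ) * ϖ ^ 2) := fun y k k' hy hk => by
      rw [← mul_sub, abs_mul]
      calc |y| * |k - k'| ≤ ϖ ^ 2 * (C₁ * (n + ϖ)) := by gcongr
        _ = _ := by ring
    have p2 : ∀ y y' : ℝ, |y| ≤ ϖ → |y'| ≤ ϖ → |y * y'| ≤ ϖ ^ 2 := fun y y' h1 h2 => by
      rw [abs_mul, sq]; gcongr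
    have t1 := (abs_le.1 (aux _ _ _ (p2 ψ ζ aψ aζ) k1)).2
    have t2 := (abs_le.1 (aux _ _ _ (p2 ψ φ aψ aφ) k2)).1
    have t3 := (abs_le.1 (aux (φ ^ 2) _ _ (by rw [sq φ]; exact p2 _ _ aφ aφ) k3)).1
    have t4 := (abs_le.1 (aux (ζ ^ 2) _ _ (by rw [sq ζ]; exact p2 _ _ aζ aζ) k4)).1
    have t5 := (abs_le.1 (aux (ψ ^ 2) _ _ (by rw [sq ψ]; exact p2 _ _ aψ aψ) k5)).1
    set H := (n + ϖ) * ϖ ^ 2 with hH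
    have hH3 : ϖ ^ 3 ≤ H := by
      rw [hH, pow_succ' ϖ 2]; gcongr; linarith
    have t1' := mul_le_mul_of_nonneg_left t1 hR.le
    have t2' := mul_le_mul_of_nonneg_left t2 hR.le
    have t3' := mul_le_mul_of_nonneg_left t3 (show 0 ≤ g.R / 2 by positivity)
    have t4' := mul_le_mul_of_nonneg_left t4 (show 0 ≤ g.R / (2 * (g.γ - 1)) by positivity)
    have t6 : L * (g.R * L) * (2 * (m⁻¹ ^ 3 * ϖ ^ 3)) +
        L * (g.R * L / (g.γ - 1)) * (2 * (m⁻¹ ^ 3 * ϖ ^ 3)) ≤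
        L * g.R * L * 2 * m⁻¹ ^ 3 * (1 + 1 / (g.γ - 1)) * H := by
      have : L * (g.R * L) * (2 * (m⁻¹ ^ 3 * ϖ ^ 3)) +
        L * (g.R * L / (g.γ - 1)) * (2 * (m⁻¹ ^ 3 * ϖ ^ 3)) =
        L * g.R * L * 2 * m⁻¹ ^ 3 * (1 + 1 / (g.γ - 1)) * ϖ ^ 3 := by ring
      rw [this]; gcongr
    have hC₂H : C₂ * H = g.R * (C₁ * H) + g.R * (C₁ * H) + g.R / 2 * (C₁ * H)
        + g.R / (2 * (g.γ - 1)) * (C₁ * H) + 1 / 2 * (C₁ * H)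
        + L * g.R * L * 2 * m⁻¹ ^ 3 * (1 + 1 / (g.γ - 1)) * H := by rw [hC₂]; ring
    rw [hflux, hE₀, hC₂H]
    clear_value H ϖ E₀ C₂ n₀ c₀
    linarith
  -- conversion to the transversal variables
  have hxψ : |φ| ≤ |x| + m⁻¹ * |ψ| := by
    have : φ = x - ψ / s := by rw [hx]; ring
    rw [this]
    refine (abs_sub _ _).trans (add_le_add le_rfl ?_)
    rw [abs_div, abs_of_pos hs, div_eq_inv_mul]
    gcongr; exact hb.s_mem.1
  have hbB : b ≤ (g.γ - 1) * L / (g.R * m) := hb.slopeθ_le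
  have hzψ : |ζ| ≤ |z| + (g.γ - 1) * L / (g.R * m) * |ψ| := by
    have : ζ = z + b * ψ := by rw [hz]; ring
    rw [this]
    refine (abs_add_le _ _).trans (add_le_add le_rfl ?_)
    rw [abs_mul, abs_of_pos hb0]
    gcongr
  have hx1 : |x| ≤ B * n₀ := by
    have h1 : |x| ≤ |φ| + m⁻¹ * |ψ| := by
      rw [hx]
      refine (abs_add_le _ _).trans (add_le_add le_rfl ?_)
      rw [abs_div, abs_of_pos hs, div_eq_inv_mul]
      gcongr; exact hb.s_mem.1
    have h2 : m⁻¹ * |ψ| ≤ m⁻¹ * n₀ := by gcongr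
    have h3 : 0 ≤ (g.γ - 1) * L / (g.R * m) * n₀ :=
      mul_nonneg (by positivity) ((abs_nonneg _).trans hφ)
    have h4 := (abs_nonneg _).trans hφ
    have : B * n₀ = n₀ + (g.γ - 1) * L / (g.R * m) * n₀ + m⁻¹ * n₀ + n₀ := by rw [hB]; ring
    linarith
  have hz1 : |z| ≤ B * n₀ := by
    have h1 : |z| ≤ |ζ| + (g.γ - 1) * L / (g.R * m) * |ψ| := by
      rw [hz]
      refine (abs_sub _ _).trans (add_le_add le_rfl ?_)
      rw [abs_mul, abs_of_pos hb0]
      gcongr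
    have h2 : (g.γ - 1) * L / (g.R * m) * |ψ| ≤ (g.γ - 1) * L / (g.R * m) * n₀ := by gcongr
    have h3 : 0 ≤ m⁻¹ * n₀ := mul_nonneg (by positivity) ((abs_nonneg _).trans hφ)
    have h4 := (abs_nonneg _).trans hφ
    have : B * n₀ = n₀ + (g.γ - 1) * L / (g.R * m) * n₀ + m⁻¹ * n₀ + n₀ := by rw [hB]; ring
    linarith
  have hωB : ϖ ≤ B * (|x| + |z| + |ψ|) := by
    have e : B * (|x| + |z| + |ψ|) = |x| + |z| + |ψ| + (B - 1) * (|x| + |z|) + (B - 1) * |ψ| := by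
      ring
    have hB1 : 0 ≤ B - 1 := by
      rw [hB]
      have : 0 < (g.γ - 1) * L / (g.R * m) + m⁻¹ := by positivity
      linarith
    have e2 : (B - 1) * |ψ| = (g.γ - 1) * L / (g.R * m) * |ψ| + m⁻¹ * |ψ| + |ψ| := by
      rw [hB]; ring
    have e3 := mul_nonneg hB1 (add_nonneg (abs_nonneg x) (abs_nonneg z))
    rw [e, e2, hω]
    linarith [abs_nonneg ψ]
  set X := x ^ 2 + z ^ 2 with hX
  have hX0 : 0 ≤ X := by positivity
  have hsq : ϖ ^ 2 ≤ 3 * B ^ 2 * (X + ψ ^ 2) := by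
    have h1 : ϖ ^ 2 ≤ (B * (|x| + |z| + |ψ|)) ^ 2 := pow_le_pow_left₀ hω0 hωB 2
    have h2 : (|x| + |z| + |ψ|) ^ 2 ≤ 3 * (X + ψ ^ 2) := by
      rw [hX, ← sq_abs x, ← sq_abs z, ← sq_abs ψ]
      exact add_add_sq_le _ _ _
    calc ϖ ^ 2 ≤ B ^ 2 * (|x| + |z| + |ψ|) ^ 2 := by rw [← mul_pow]; exact h1
      _ ≤ B ^ 2 * (3 * (X + ψ ^ 2)) := by gcongr
      _ = _ := by ring
  -- The cube of a transversal variable is a small multiple of its square; only the cube of `ψ` has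
  -- to be kept.
  have hcube : ϖ ^ 3 ≤ 9 * B ^ 3 * (B * n₀ * X + |ψ| ^ 3) := by
    have h1 : ϖ ^ 3 ≤ (B * (|x| + |z| + |ψ|)) ^ 3 := pow_le_pow_left₀ hω0 hωB 3
    have h2 := add_add_pow_three_le (abs_nonneg x) (abs_nonneg z) (abs_nonneg ψ)
    have h3 : ∀ y : ℝ, |y| ≤ B * n₀ → |y| ^ 3 ≤ B * n₀ * y ^ 2 := fun y hy => by
      rw [← sq_abs y, pow_succ' |y| 2]; gcongr
    have h4 := h3 x hx1
    have h5 := h3 z hz1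
    calc ϖ ^ 3 ≤ B ^ 3 * (|x| + |z| + |ψ|) ^ 3 := by rw [← mul_pow]; exact h1
      _ ≤ B ^ 3 * (9 * (|x| ^ 3 + |z| ^ 3 + |ψ| ^ 3)) := by gcongr
      _ ≤ B ^ 3 * (9 * (B * n₀ * x ^ 2 + B * n₀ * z ^ 2 + |ψ| ^ 3)) := by gcongr
      _ = _ := by rw [hX]; ring
  have hψ3 : 0 ≤ |ψ| ^ 3 := by positivity
  have hn₀0 : 0 ≤ n₀ := (abs_nonneg _).trans hφ
  have hfin : C₂ * ((n + ϖ) * ϖ ^ 2) ≤ c₀ * X + C₃ * (n * ψ ^ 2 + |ψ| ^ 3) := by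
    have e1 : n * ϖ ^ 2 ≤ n * (3 * B ^ 2 * (X + ψ ^ 2)) := by gcongr
    have e2 : n * X ≤ n₀ * X := by gcongr
    have e3 : C₃ * n₀ ≤ c₀ := by
      calc C₃ * n₀ ≤ C₃ * (c₀ / C₃) := by gcongr
        _ = c₀ := by field_simp
    calc C₂ * ((n + ϖ) * ϖ ^ 2) = C₂ * (n * ϖ ^ 2 + ϖ ^ 3) := by ring
      _ ≤ C₂ * (n * (3 * B ^ 2 * (X + ψ ^ 2)) + 9 * B ^ 3 * (B * n₀ * X + |ψ| ^ 3)) := by gcongr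
      _ = C₂ * (3 * B ^ 2) * (n * X) + C₂ * (9 * B ^ 3) * B * (n₀ * X)
          + C₂ * (3 * B ^ 2) * (n * ψ ^ 2) + C₂ * (9 * B ^ 3) * |ψ| ^ 3 := by ring
      _ ≤ C₂ * (3 * B ^ 2) * (n₀ * X) + C₂ * (9 * B ^ 3) * (1 + B) * (n₀ * X)
          + C₃ * (n * ψ ^ 2) + C₃ * |ψ| ^ 3 := by
        gcongr
        · linarith
        · rw [hC₃]
          have : 0 < C₂ * (9 * B ^ 3) * (1 + B) := by positivity
          linarith
        · rw [hC₃]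
          have : 0 < C₂ * (9 * B ^ 3) * B := by positivity
          have : 0 < C₂ * (3 * B ^ 2) := by positivity
          linarith
      _ = C₃ * n₀ * X + C₃ * (n * ψ ^ 2 + |ψ| ^ 3) := by rw [hC₃]; ring
      _ ≤ _ := by gcongr
  linarith

/-! ### ### Quadratic interaction along the 3-wave -/

/-- The coefficient `γ (γ + 1) p / (2 v² s)` of the quadratic interaction along the 3-wave. -/
noncomputable def Gas.nonlin (g : Gas) (U : State) (s : ℝ) : ℝ :=
  g.γ * (g.γ + 1) * g.p U / (2 * U.v ^ 2 * s)

section Base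

variable {g : Gas} {m L s : ℝ} {U : State}

namespace Gas.IsBase

/-- The right-hand side is the logistic rate of the shock profile times `dissip`. This links the
cost of `B₁` to the Poincaré constant of the front. -/
lemma nonlin_mul_v (h : g.IsBase m L U s) : g.nonlin U s * U.v = (g.γ + 1) / 2 * s := by
  have hs := h.s_pos.ne'
  have hv := h.adm.1.ne'
  have hsq := h.sq_s
  unfold Gas.nonlin
  field_simp
  linear_combination (-(g.γ + 1)) * hsq

lemma nonlin_pos (h : g.IsBase m L U s) : 0 < g.nonlin U s := by
  have := g.γ_pos; have := h.p_pos; have := h.s_pos; have := h.adm.1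
  unfold Gas.nonlin; positivity

/-- Coefficients of the quadratic form in `B₁`. -/
lemma quadratic_wave (h : g.IsBase m L U s) (φ ψ ζ : ℝ) :
    (g.γ + 1) * g.p U * s / (2 * U.v ^ 2) * φ ^ 2 + g.R * s / (2 * U.v * U.θ) * ζ ^ 2
        - g.p U * s / (U.v * U.θ) * (φ * ζ)
      ≤ 21 / 20 * g.nonlin U s * ψ ^ 2
        + 21 * ((g.γ + 1) * L * L / m ^ 2 + g.R * L / m ^ 2 + L * L / m ^ 2)
          * ((φ + ψ / s) ^ 2 + (ζ - g.slopeθ U s * ψ) ^ 2) := by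
  have hm := h.m_pos; have hL := h.L_pos
  have hR := g.R_pos; have hγ := g.γ_pos; have hγ1 := g.γ_sub_pos
  obtain ⟨hv0, hθ0⟩ := h.adm
  have hs0 := h.s_pos; have hp0 := h.p_pos
  set x := φ + ψ / s with hx
  set z := ζ - g.slopeθ U s * ψ with hz
  set A := (g.γ + 1) * g.p U * s / (2 * U.v ^ 2) with hA
  set B := g.R * s / (2 * U.v * U.θ) with hB
  set C := g.p U * s / (U.v * U.θ) with hC
  have hA0 : 0 < A := by positivity
  have hB0 : 0 < B := by positivity
  have hC0 : 0 < C := by positivity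
  -- The quadratic form is positive, so Young's inequality may be applied to it as a whole.
  have hdisc : C ^ 2 ≤ 4 * A * B := by
    have e : 4 * A * B - C ^ 2 = g.p U * s ^ 2 / (U.v ^ 3 * U.θ ^ 2) *
        ((g.γ + 1) * (g.R * U.θ) - g.p U * U.v) := by
      rw [hA, hB, hC]; field_simp; ring
    rw [h.R_mul_θ] at e
    have e2 : (g.γ + 1) * (g.p U * U.v) - g.p U * U.v = g.γ * (g.p U * U.v) := by ring
    rw [e2] at e
    have : 0 < g.p U * s ^ 2 / (U.v ^ 3 * U.θ ^ 2) * (g.γ * (g.p U * U.v)) := by positivity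
    linarith
  have hpsd : ∀ a b : ℝ, 0 ≤ A * a ^ 2 + B * b ^ 2 - C * (a * b) := fun a b => by
    have e : 4 * A * (A * a ^ 2 + B * b ^ 2 - C * (a * b)) =
        (2 * A * a - C * b) ^ 2 + (4 * A * B - C ^ 2) * b ^ 2 := by ring
    have h1 : 0 ≤ (4 * A * B - C ^ 2) * b ^ 2 := mul_nonneg (by linarith) (sq_nonneg _)
    have h2 := sq_nonneg (2 * A * a - C * b)
    by_contra! hlt
    have := mul_neg_of_pos_of_neg (show 0 < 4 * A by positivity) hlt
    linarith
  have hφ : φ = -(ψ / s) + x := by rw [hx]; ring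
  have hζ : ζ = g.slopeθ U s * ψ + z := by rw [hz]; ring
  have hkey : A * (-(ψ / s)) ^ 2 + B * (g.slopeθ U s * ψ) ^ 2 -
      C * (-(ψ / s) * (g.slopeθ U s * ψ)) = g.nonlin U s * ψ ^ 2 := by
    have hRθ := h.R_mul_θ
    have hθe : U.θ = g.p U * U.v / g.R := by field_simp; linarith
    rw [hA, hB, hC]
    unfold Gas.slopeθ Gas.nonlin
    rw [hθe]
    field_simp
    ring
  -- Nonnegativity of the form at `p - 20 x` is Young's inequality `Q (p + x) ≤ 21/20 Q p + 21 Q x`;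
  -- with `hkey` the first term is the interaction coefficient.
  have h3 := hpsd (-(ψ / s) - 20 * x) (g.slopeθ U s * ψ - 20 * z)
  have h4 : A * φ ^ 2 + B * ζ ^ 2 - C * (φ * ζ) ≤ 21 / 20 * (g.nonlin U s * ψ ^ 2)
      + 21 * (A * x ^ 2 + B * z ^ 2 - C * (x * z)) := by
    rw [← hkey, hφ, hζ]
    generalize -(ψ / s) = p at h3 ⊢
    generalize g.slopeθ U s * ψ = q at h3 ⊢
    clear_value A B C x z
    linarith
  have hAL : A ≤ (g.γ + 1) * L * L / m ^ 2 := by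
    rw [hA]
    have h5 := h.v_mem.1
    have : m ^ 2 ≤ 2 * U.v ^ 2 := by
      have := pow_le_pow_left₀ hm.le h5 2
      linarith [sq_nonneg m]
    gcongr
    exacts [h.p_mem.2, h.s_mem.2]
  have hmm : m ^ 2 ≤ U.v * U.θ := by
    rw [sq]; exact mul_le_mul h.v_mem.1 h.θ_mem.1 hm.le hv0.le
  have hvθ : 0 < U.v * U.θ := by positivity
  have hBL : B ≤ g.R * L / m ^ 2 := by
    rw [hB, mul_assoc]
    have : m ^ 2 ≤ 2 * (U.v * U.θ) := by linarith
    gcongr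
    exact h.s_mem.2
  have hCL : C ≤ L * L / m ^ 2 := by
    rw [hC]
    gcongr
    exacts [h.p_mem.2, h.s_mem.2]
  have h5 : A * x ^ 2 + B * z ^ 2 - C * (x * z) ≤ (A + B + C) * (x ^ 2 + z ^ 2) := by
    have e1 := mul_nonneg hC0.le (sq_nonneg (x + z))
    have e2 := mul_nonneg hA0.le (sq_nonneg z)
    have e3 := mul_nonneg hB0.le (sq_nonneg x)
    have e4 := mul_nonneg hC0.le (sq_nonneg x)
    have e5 := mul_nonneg hC0.le (sq_nonneg z)
    linarith
  have h6 : (A + B + C) * (x ^ 2 + z ^ 2) ≤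
      ((g.γ + 1) * L * L / m ^ 2 + g.R * L / m ^ 2 + L * L / m ^ 2) * (x ^ 2 + z ^ 2) := by
    gcongr
  linarith

/-- `μ / v + κ β² / (v θ)` is the effective dissipation divided by `v`. -/
lemma dissip_eq (h : g.IsBase m L U s) :
    g.μ + g.κ / U.θ * g.slopeθ U s ^ 2 = g.dissip := by
  have hs := h.s_pos.ne'
  have hv := h.adm.1.ne'
  have hp := h.p_pos.ne'
  have hR := g.R_pos.ne'
  have hγ := g.γ_pos.ne'
  have hsq := h.sq_s
  have hθe : U.θ = g.p U * U.v / g.R := by have := h.R_mul_θ; field_simp; linarith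
  unfold Gas.slopeθ Gas.dissip
  rw [hθe]
  field_simp
  linear_combination (-(g.κ * (g.γ - 1) ^ 2)) * hsq

end Gas.IsBase

end Base

/-- Expansion of the integrand in the equation for the shift. -/
theorem shift_integrand_bound (g : Gas) {m : ℝ} (L : ℝ) (hm : 0 < m) :
    ∃ C : ℝ, 0 < C ∧
    ∀ (U : State) (s σ vb θb φ ψ ζ n a l τ ρ ϑ : ℝ), g.IsBase m L U s → σ ∈ Icc m L →
      vb ∈ Icc m L → θb ∈ Icc m L → |vb - U.v| ≤ n → |θb - U.θ| ≤ n → |σ - s| ≤ n → n ≤ 1 →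
      1 ≤ a → a ≤ 1 + l → l ≤ 1 → τ ≤ 1 → 0 ≤ ρ → |ϑ + (g.γ - 1) / g.R * g.p U * ρ| ≤ τ * ρ →
      |a * (-σ * ρ * ψ + g.R * ϑ / ((g.γ - 1) * θb) * ζ + g.R * θb / vb * ρ / vb * φ)
        + 2 * s * (ρ * ψ)|
      ≤ C * (ρ * (|φ + ψ / s| + |ζ - g.slopeθ U s * ψ|)) + C * (n + τ + l) * (ρ * |ψ|) := by
  rcases lt_or_ge L m with hLm | hLm
  · exact ⟨1, one_pos, fun U s σ vb θb φ ψ ζ n a l τ ρ ϑ hb => absurd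
      (hb.v_mem.1.trans hb.v_mem.2) (not_le.2 hLm)⟩
  have hL := hm.trans_le hLm
  have hR := g.R_pos; have hγ := g.γ_sub_pos
  obtain ⟨C₁, hC₁, hcoef⟩ := coefficient_bounds L hm
  set K := 1 + L + 2 * (L * C₁ + g.R / (g.γ - 1) * m⁻¹) + L / m + 2 * (g.R * C₁) with hK
  have hK0 : 0 < K := by positivity
  set B := (g.γ - 1) * L / (g.R * m) with hB
  have hB0 : 0 < B := by positivity
  set C := (L / m + 3 * K) + K * (1 + m⁻¹ + B) with hC
  have hLm0 : 0 < L / m := by positivity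
  refine ⟨C, by positivity, fun U s σ vb θb φ ψ ζ n a l τ ρ ϑ hb hσ hvb hθb hn1 hn2 hn3 hn ha1 ha2
    hl hτ hρ hϑ => ?_⟩
  have hs := hb.s_pos
  have hp := hb.p_pos
  obtain ⟨hv0, hθ0⟩ := hb.adm
  have hvb0 := hm.trans_le hvb.1
  have hθb0 := hm.trans_le hθb.1
  have hσ0 := hm.trans_le hσ.1
  have hn0 : 0 ≤ n := (abs_nonneg _).trans hn1
  have hl0 : 0 ≤ l := by linarith
  obtain ⟨-, -, -, -, -, k6, k7⟩ := hcoef vb vb θb σ U.v U.θ s n hvb hvb hθb hσ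
    hb.v_mem hb.θ_mem hb.s_mem hn1 hn1 hn2 hn3
  have hτρ : 0 ≤ τ * ρ := (abs_nonneg _).trans hϑ
  set b := g.slopeθ U s with hbdef
  have hb0 : 0 < b := hb.slopeθ_pos
  have hbB : b ≤ B := hb.slopeθ_le
  set x := φ + ψ / s with hx
  set z := ζ - b * ψ with hz
  have hpθ : g.p U / U.θ ≤ L / m := by
    gcongr
    exacts [hb.p_mem.2, hb.θ_mem.1]
  have hpv : g.p U / U.v ≤ L / m := by
    gcongr
    exacts [hb.p_mem.2, hb.v_mem.1]
  have hpv' : g.R * (U.θ * U.v⁻¹ * U.v⁻¹) = g.p U / U.v := by unfold Gas.p; field_simp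
  -- the three coefficients
  have c1 : |a * σ * ρ - s * ρ| ≤ (l * L + n) * ρ := by
    have : a * σ * ρ - s * ρ = ((a - 1) * σ + (σ - s)) * ρ := by ring
    rw [this, abs_mul, abs_of_nonneg hρ]
    refine mul_le_mul_of_nonneg_right ((abs_add_le _ _).trans (add_le_add ?_ hn3)) hρ
    rw [abs_mul, abs_of_nonneg (by linarith), abs_of_pos hσ0]
    exact mul_le_mul (by linarith) hσ.2 hσ0.le hl0
  have hmul : ∀ y y₀ D E : ℝ, |y - y₀| ≤ D → |y₀| ≤ E → |a * y - y₀| ≤ 2 * D + l * E :=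
    fun y y₀ D E h1 h2 => by
      have : a * y - y₀ = a * (y - y₀) + (a - 1) * y₀ := by ring
      rw [this]
      refine (abs_add_le _ _).trans (add_le_add ?_ ?_)
      · rw [abs_mul, abs_of_nonneg (by linarith)]
        exact mul_le_mul (by linarith) h1 (abs_nonneg _) (by norm_num)
      · rw [abs_mul, abs_of_nonneg (by linarith)]
        exact mul_le_mul (by linarith) h2 (abs_nonneg _) hl0
  have c2 : |a * (g.R * ϑ / ((g.γ - 1) * θb)) - -(g.p U / U.θ * ρ)| ≤
      2 * (L * (C₁ * n) * ρ + g.R / (g.γ - 1) * m⁻¹ * (τ * ρ)) + l * (L / m * ρ) := by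
    refine hmul _ _ _ _ ?_ ?_
    · have : g.R * ϑ / ((g.γ - 1) * θb) - -(g.p U / U.θ * ρ) =
          -(g.p U * (θb⁻¹ - U.θ⁻¹) * ρ) +
          g.R / (g.γ - 1) * θb⁻¹ * (ϑ + (g.γ - 1) / g.R * g.p U * ρ) := by
        field_simp; ring
      rw [this]
      refine (abs_add_le _ _).trans (add_le_add ?_ ?_)
      · rw [abs_neg, abs_mul, abs_mul, abs_of_pos hp, abs_of_nonneg hρ]
        gcongr
        exact hb.p_mem.2
      · rw [abs_mul, abs_of_pos (by positivity)]
        gcongr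
        exact hθb.1
    · rw [abs_neg, abs_of_nonneg (by positivity)]
      gcongr
  have c3 : |a * (g.R * θb / vb * ρ / vb) - g.p U / U.v * ρ| ≤
      2 * (g.R * (C₁ * n) * ρ) + l * (L / m * ρ) := by
    refine hmul _ _ _ _ ?_ ?_
    · have : g.R * θb / vb * ρ / vb - g.p U / U.v * ρ =
          g.R * (θb * vb⁻¹ * vb⁻¹ - U.θ * U.v⁻¹ * U.v⁻¹) * ρ := by
        rw [← hpv']; field_simp
      rw [this, abs_mul, abs_mul, abs_of_pos hR, abs_of_nonneg hρ]
      gcongr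
    · rw [abs_of_nonneg (by positivity)]
      gcongr
  set h := n + τ + l with hh
  have bd : ∀ q : ℝ, 0 ≤ q → ∀ y : ℝ, 0 ≤ y → 0 ≤ q * (y * ρ) := fun q hq y hy => by positivity
  have hKh : K * (h * ρ) = (1 + L + 2 * (L * C₁ + g.R / (g.γ - 1) * m⁻¹) + L / m + 2 * (g.R * C₁))
      * (n * ρ) + (1 + L + 2 * (L * C₁ + g.R / (g.γ - 1) * m⁻¹) + L / m + 2 * (g.R * C₁)) * (τ * ρ)
      + (1 + L + 2 * (L * C₁ + g.R / (g.γ - 1) * m⁻¹) + L / m + 2 * (g.R * C₁)) * (l * ρ) := by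
    rw [hK, hh]; ring
  have hnρ := mul_nonneg hn0 hρ
  have hlρ := mul_nonneg hl0 hρ
  have v1 : ∀ w : ℝ, 0 ≤ w → 0 ≤ L * w ∧ 0 ≤ L * C₁ * w ∧ 0 ≤ g.R / (g.γ - 1) * m⁻¹ * w ∧
      0 ≤ L / m * w ∧ 0 ≤ g.R * C₁ * w := fun w hw =>
    ⟨by positivity, by positivity, by positivity, by positivity, by positivity⟩
  obtain ⟨n1, n2, n3, n4, n5⟩ := v1 _ hnρ
  obtain ⟨t1, t2, t3, t4, t5⟩ := v1 _ hτρ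
  obtain ⟨l1, l2, l3, l4, l5⟩ := v1 _ hlρ
  have d1 : |a * σ * ρ - s * ρ| ≤ K * (h * ρ) := by rw [hKh]; linarith
  have d2 : |a * (g.R * ϑ / ((g.γ - 1) * θb)) - -(g.p U / U.θ * ρ)| ≤ K * (h * ρ) := by
    rw [hKh]; linarith
  have d3 : |a * (g.R * θb / vb * ρ / vb) - g.p U / U.v * ρ| ≤ K * (h * ρ) := by
    rw [hKh]; linarith
  have hsplit : a * (-σ * ρ * ψ + g.R * ϑ / ((g.γ - 1) * θb) * ζ + g.R * θb / vb * ρ / vb * φ)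
        + 2 * s * (ρ * ψ) = -((a * σ * ρ - s * ρ) * ψ)
        + (a * (g.R * ϑ / ((g.γ - 1) * θb)) - -(g.p U / U.θ * ρ)) * ζ
        + (a * (g.R * θb / vb * ρ / vb) - g.p U / U.v * ρ) * φ
        + (-(g.p U / U.θ * (ρ * z)) + g.p U / U.v * (ρ * x)) := by
    -- On the 3-wave the temperature and volume terms together contribute as much as the velocity
    -- term. This doubles the shift and explains the leading term `-2 s ρ ψ`.
    have e : s * ψ = g.p U / U.θ * (b * ψ) + g.p U / U.v * (ψ / s) := by
      have hθe : U.θ = g.p U * U.v / g.R := by have := hb.R_mul_θ; field_simp; linarith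
      rw [hbdef]; unfold Gas.slopeθ
      rw [hθe]
      field_simp
      linear_combination ψ * hb.sq_s
    rw [hz, hx]
    linear_combination ρ * e
  have hφ : |φ| ≤ |x| + m⁻¹ * |ψ| := by
    have : φ = x - ψ / s := by rw [hx]; ring
    rw [this]
    refine (abs_sub _ _).trans (add_le_add le_rfl ?_)
    rw [abs_div, abs_of_pos hs, div_eq_inv_mul]
    gcongr; exact hb.s_mem.1
  have hζ : |ζ| ≤ |z| + B * |ψ| := by
    have : ζ = z + b * ψ := by rw [hz]; ring
    rw [this]
    refine (abs_add_le _ _).trans (add_le_add le_rfl ?_)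
    rw [abs_mul, abs_of_pos hb0]
    gcongr
  have hh3 : h ≤ 3 := by rw [hh]; linarith
  have hhρ : 0 ≤ h * ρ := by rw [hh]; linarith [add_mul n τ ρ, add_mul (n + τ) l ρ]
  rw [hsplit]
  have f1 : |-((a * σ * ρ - s * ρ) * ψ)| ≤ K * (h * ρ) * |ψ| := by
    rw [abs_neg, abs_mul]; gcongr
  have f2 : |(a * (g.R * ϑ / ((g.γ - 1) * θb)) - -(g.p U / U.θ * ρ)) * ζ| ≤
      K * (h * ρ) * (|z| + B * |ψ|) := by
    rw [abs_mul]; gcongr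
  have f3 : |(a * (g.R * θb / vb * ρ / vb) - g.p U / U.v * ρ) * φ| ≤
      K * (h * ρ) * (|x| + m⁻¹ * |ψ|) := by
    rw [abs_mul]; gcongr
  have f4 : |-(g.p U / U.θ * (ρ * z)) + g.p U / U.v * (ρ * x)| ≤
      L / m * (ρ * |z|) + L / m * (ρ * |x|) := by
    refine (abs_add_le _ _).trans (add_le_add ?_ ?_)
    · rw [abs_neg, abs_mul, abs_mul, abs_of_nonneg hρ, abs_of_pos (by positivity)]
      gcongr
    · rw [abs_mul, abs_mul, abs_of_nonneg hρ, abs_of_pos (by positivity)]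
      gcongr
  have f5 : K * (h * ρ) * (|x| + |z|) ≤ 3 * K * (ρ * (|x| + |z|)) := by
    have := mul_le_mul_of_nonneg_right hh3
      (show 0 ≤ K * (ρ * (|x| + |z|)) by positivity)
    linarith
  have f6 : 0 ≤ K * (1 + m⁻¹ + B) * (ρ * (|x| + |z|)) := by positivity
  have f7 : 0 ≤ (L / m + 3 * K) * (h * ρ * |ψ|) := by positivity
  have f8 : C * (ρ * (|x| + |z|)) + C * h * (ρ * |ψ|) =
      L / m * (ρ * |z|) + L / m * (ρ * |x|) + 3 * K * (ρ * (|x| + |z|))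
      + K * (1 + m⁻¹ + B) * (ρ * (|x| + |z|)) + (L / m + 3 * K) * (h * ρ * |ψ|)
      + K * (1 + m⁻¹ + B) * (h * ρ * |ψ|) := by rw [hC]; ring
  refine (abs_add_le _ _).trans ((add_le_add (abs_add_three _ _ _) le_rfl).trans ?_)
  rw [f8]
  clear_value C K B h x z b
  linarith

/-! ### Integrals against the derivative of a monotone front -/

/-- Bounded continuous functions on the line. -/
def IsBC (f : ℝ → ℝ) : Prop := Continuous f ∧ ∃ B, ∀ x, |f x| ≤ B

namespace IsBC

variable {f h : ℝ → ℝ}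

lemma const (c : ℝ) : IsBC fun _ => c := ⟨continuous_const, |c|, fun _ => le_rfl⟩

lemma add (hf : IsBC f) (hh : IsBC h) : IsBC fun x => f x + h x := by
  obtain ⟨hf, A, hA⟩ := hf
  obtain ⟨hh, B, hB⟩ := hh
  exact ⟨hf.add hh, A + B, fun x => (abs_add_le _ _).trans (add_le_add (hA x) (hB x))⟩

lemma mul (hf : IsBC f) (hh : IsBC h) : IsBC fun x => f x * h x := by
  obtain ⟨hf, A, hA⟩ := hf
  obtain ⟨hh, B, hB⟩ := hh
  refine ⟨hf.mul hh, A * B, fun x => ?_⟩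
  rw [abs_mul]
  exact mul_le_mul (hA x) (hB x) (abs_nonneg _) ((abs_nonneg _).trans (hA x))

lemma const_mul (hf : IsBC f) (c : ℝ) : IsBC fun x => c * f x := (const c).mul hf

lemma neg (hf : IsBC f) : IsBC fun x => -f x := by simpa using hf.const_mul (-1)

lemma sub (hf : IsBC f) (hh : IsBC h) : IsBC fun x => f x - h x := by
  simpa [sub_eq_add_neg] using hf.add hh.neg

lemma abs (hf : IsBC f) : IsBC fun x => |f x| := by
  obtain ⟨hf, A, hA⟩ := hf
  exact ⟨hf.abs, A, fun x => by rw [abs_abs]; exact hA x⟩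

lemma pow (hf : IsBC f) (n : ℕ) : IsBC fun x => f x ^ n := by
  induction n with
  | zero => simpa using const 1
  | succ n ih => simpa [pow_succ] using ih.mul hf

lemma inv {m : ℝ} (hf : Continuous f) (hm : 0 < m) (h : ∀ x, m ≤ f x) : IsBC fun x => (f x)⁻¹ :=
  ⟨hf.inv₀ fun x => (hm.trans_le (h x)).ne', m⁻¹, fun x => by
    rw [abs_of_pos (inv_pos.2 (hm.trans_le (h x)))]; exact inv_anti₀ hm (h x)⟩

lemma of_mem_Icc {a b : ℝ} (hf : Continuous f) (h : ∀ x, f x ∈ Icc a b) : IsBC f :=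
  ⟨hf, max |a| |b|, fun x => abs_le_max_abs_abs (h x).1 (h x).2⟩

lemma _root_.NSF.MemH1.isBC (hf : MemH1 f) : IsBC f :=
  ⟨hf.continuous, _, fun x => Real.abs_le_sqrt (hf.sq_le_h1NormSq x)⟩

end IsBC

/-- `w` is an increasing front from `0` to `d` with derivative `ρ`. -/
structure IsFront (d : ℝ) (w ρ : ℝ → ℝ) : Prop where
  d_pos : 0 < d
  hasDerivAt : ∀ x, HasDerivAt w (ρ x) x
  cont : Continuous ρ
  pos : ∀ x, 0 < ρ x
  gt : ∀ x, 0 < w x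
  lt : ∀ x, w x < d
  lim_bot : Tendsto w atBot (𝓝 0)
  lim_top : Tendsto w atTop (𝓝 d)

namespace IsFront

variable {d : ℝ} {w ρ f h : ℝ → ℝ}

lemma integrable (F : IsFront d w ρ) : Integrable ρ :=
  integrable_deriv_of_nonneg F.hasDerivAt F.cont (fun x => (F.pos x).le) F.lim_bot F.lim_top

lemma integral_eq (F : IsFront d w ρ) : ∫ x, ρ x = d := by
  rw [integral_of_hasDerivAt_of_tendsto F.hasDerivAt F.integrable F.lim_bot F.lim_top, sub_zero]

lemma integrable_mul (F : IsFront d w ρ) (hf : IsBC f) : Integrable fun x => ρ x * f x := by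
  obtain ⟨hf, B, hB⟩ := hf
  exact F.integrable.mul_bdd hf.aestronglyMeasurable (ae_of_all _ hB)

lemma integral_mono (F : IsFront d w ρ) (hf : IsBC f) (hh : IsBC h) (hle : ∀ x, f x ≤ h x) :
    ∫ x, ρ x * f x ≤ ∫ x, ρ x * h x :=
  MeasureTheory.integral_mono (F.integrable_mul hf) (F.integrable_mul hh)
    fun x => mul_le_mul_of_nonneg_left (hle x) (F.pos x).le

lemma integral_nonneg (F : IsFront d w ρ) (hle : ∀ x, 0 ≤ f x) : 0 ≤ ∫ x, ρ x * f x :=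
  MeasureTheory.integral_nonneg fun x => mul_nonneg (F.pos x).le (hle x)

lemma integral_add (F : IsFront d w ρ) (hf : IsBC f) (hh : IsBC h) :
    ∫ x, ρ x * (f x + h x) = (∫ x, ρ x * f x) + ∫ x, ρ x * h x := by
  simp only [mul_add]
  exact MeasureTheory.integral_add (F.integrable_mul hf) (F.integrable_mul hh)

lemma integral_const_mul (c : ℝ) :
    ∫ x, ρ x * (c * f x) = c * ∫ x, ρ x * f x := by
  rw [← MeasureTheory.integral_const_mul]
  congr 1; ext x; ring

lemma integral_sub_const_sq (F : IsFront d w ρ) (hf : IsBC f) (c : ℝ) :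
    ∫ x, ρ x * (f x - c) ^ 2 =
      (∫ x, ρ x * f x ^ 2) - 2 * c * (∫ x, ρ x * f x) + c ^ 2 * d := by
  have e : ∀ x, ρ x * (f x - c) ^ 2 = ρ x * (f x ^ 2 + ((-(2 * c)) * f x + c ^ 2)) :=
    fun x => by ring
  simp only [e]
  rw [F.integral_add (hf.pow 2) ((hf.const_mul _).add (IsBC.const _)),
    F.integral_add (hf.const_mul _) (IsBC.const _), integral_const_mul, integral_mul_const,
    F.integral_eq]
  ring

/-- The two sides differ by `((∫ ρ f) - c d)² / d`. -/
lemma variance_le (F : IsFront d w ρ) (hf : IsBC f) (c : ℝ) :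
    (∫ x, ρ x * f x ^ 2) - (∫ x, ρ x * f x) ^ 2 / d ≤ ∫ x, ρ x * (f x - c) ^ 2 := by
  rw [F.integral_sub_const_sq hf]
  have hd := F.d_pos
  have : 0 ≤ ((∫ x, ρ x * f x) - c * d) ^ 2 / d := by positivity
  have e : ((∫ x, ρ x * f x) - c * d) ^ 2 / d =
      (∫ x, ρ x * f x) ^ 2 / d - 2 * c * (∫ x, ρ x * f x) + c ^ 2 * d := by
    field_simp; ring
  linarith

lemma variance_eq (F : IsFront d w ρ) (hf : IsBC f) :
    (∫ x, ρ x * f x ^ 2) - (∫ x, ρ x * f x) ^ 2 / d =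
      ∫ x, ρ x * (f x - (∫ x, ρ x * f x) / d) ^ 2 := by
  rw [F.integral_sub_const_sq hf]
  have hd := F.d_pos
  field_simp; ring

lemma sq_integral_le (F : IsFront d w ρ) (hf : IsBC f) :
    (∫ x, ρ x * f x) ^ 2 ≤ d * ∫ x, ρ x * f x ^ 2 := by
  have h1 := F.variance_eq hf
  have h2 : 0 ≤ ∫ x, ρ x * (f x - (∫ x, ρ x * f x) / d) ^ 2 :=
    F.integral_nonneg fun x => sq_nonneg _
  rw [← h1, sub_nonneg, div_le_iff₀ F.d_pos] at h2
  linarith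

/-- The sharp weighted Poincaré inequality for a front of logistic type. -/
lemma poincare (F : IsFront d w ρ) {f : ℝ → ℝ} (hf : MemH1 f) {b r : ℝ} (hr : 0 < r)
    (hrate : ∀ x, r * (w x * (d - w x)) ≤ b * ρ x) :
    2 * r * ((∫ x, ρ x * f x ^ 2) - (∫ x, ρ x * f x) ^ 2 / d) ≤ b * ∫ x, deriv f x ^ 2 := by
  have hd := F.d_pos
  -- The normalised front `w / d` runs from `0` to `1`, and the rate hypothesis takes the required
  -- form with `c = b / (d r)`.
  have h := weighted_poincare (y := fun x => w x / d) (y' := fun x => ρ x / d)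
    (c := b / (d * r)) hf (fun x => (F.hasDerivAt x).div_const d) (by have := F.cont; fun_prop)
    (fun x => div_pos (F.pos x) hd) (fun x => div_pos (F.gt x) hd)
    (fun x => (div_lt_one hd).2 (F.lt x)) (by simpa using F.lim_bot.div_const d)
    (by simpa [hd.ne'] using F.lim_top.div_const d) (fun x => by
      have e1 : w x / d * (1 - w x / d) = r * (w x * (d - w x)) / (d ^ 2 * r) := by field_simp
      have e2 : b / (d * r) * (ρ x / d) = b * ρ x / (d ^ 2 * r) := by field_simp
      rw [e1, e2]
      exact div_le_div_of_nonneg_right (hrate x) (by positivity))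
  have e1 : ∫ x, f x ^ 2 * (ρ x / d) = (∫ x, ρ x * f x ^ 2) / d := by
    rw [← integral_div]; congr 1; ext x; ring
  have e2 : ∫ x, f x * (ρ x / d) = (∫ x, ρ x * f x) / d := by
    rw [← integral_div]; congr 1; ext x; ring
  rw [e1, e2] at h
  have h2 := mul_le_mul_of_nonneg_left h (show 0 ≤ 2 * r * d by positivity)
  calc _ = 2 * r * d * ((∫ x, ρ x * f x ^ 2) / d - ((∫ x, ρ x * f x) / d) ^ 2) := by
        field_simp
    _ ≤ 2 * r * d * (b / (d * r) / 2 * ∫ x, deriv f x ^ 2) := h2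
    _ = _ := by field_simp

/-- Comparison of the variances of `f` and of `h`, when `h - c f` is small. -/
lemma variance_comparison (F : IsFront d w ρ) (hf : IsBC f) (hh : IsBC h) (c : ℝ) :
    24 / 25 * c ^ 2 * ((∫ x, ρ x * f x ^ 2) - (∫ x, ρ x * f x) ^ 2 / d) ≤
      ((∫ x, ρ x * h x ^ 2) - (∫ x, ρ x * h x) ^ 2 / d)
        + 24 * ∫ x, ρ x * (h x - c * f x) ^ 2 := by
  rw [F.variance_eq hh]
  set k := (∫ x, ρ x * h x) / d
  have h1 := F.variance_le (hf.const_mul c) k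
  have e1 : ∫ x, ρ x * (c * f x) ^ 2 = c ^ 2 * ∫ x, ρ x * f x ^ 2 := by
    simp only [mul_pow]; exact integral_const_mul _
  rw [e1, integral_const_mul] at h1
  have h2 : ∫ x, ρ x * (24 / 25 * (c * f x - k) ^ 2) ≤
      ∫ x, ρ x * ((h x - k) ^ 2 + 24 * (h x - c * f x) ^ 2) := by
    refine F.integral_mono ((((hf.const_mul c).sub (IsBC.const k)).pow 2).const_mul _)
      (((hh.sub (IsBC.const k)).pow 2).add (((hh.sub (hf.const_mul c)).pow 2).const_mul _))
      fun x => ?_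
    -- Since `c f - k = (h - k) - (h - c f)`, completing the square gives a loss of only one part in
    -- `25` of the variance.
    have := sq_nonneg (h x - k + 24 * (h x - c * f x))
    have e : (h x - k) ^ 2 + 24 * (h x - c * f x) ^ 2 - 24 / 25 * (c * f x - k) ^ 2 =
      (h x - k + 24 * (h x - c * f x)) ^ 2 / 25 := by ring
    linarith
  rw [integral_const_mul, F.integral_add ((hh.sub (IsBC.const k)).pow 2)
    (((hh.sub (hf.const_mul c)).pow 2).const_mul _), integral_const_mul] at h2
  have e3 : (c * ∫ x, ρ x * f x) ^ 2 / d = c ^ 2 * ((∫ x, ρ x * f x) ^ 2 / d) := by ring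
  rw [e3] at h1
  linarith

end IsFront

/-! ### The estimate at a fixed time -/

/-- The data of the perturbation problem at a fixed time: a front `w` with derivative `ρ`, the
derivative `ϑ` of its temperature, a background `(vb, θb)` close to the base state `U` up to the
strength `d` of the front and the size `N` of the other waves, and a perturbation `(φ, ψ, ζ)`. -/
structure Snapshot (g : Gas) (m L τ C₀ ε : ℝ) (U : State) (s σ d : ℝ)
    (w ρ ϑ N vb θb φ ψ ζ : ℝ → ℝ) : Prop where
  base : g.IsBase m L U s
  σ_mem : σ ∈ Icc m L
  speed : |σ - s| ≤ C₀ * d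
  front : IsFront d w ρ
  d_le : d ≤ ε
  rate : ∀ x, ((g.γ + 1) / 2 * s - τ) * (w x * (d - w x)) ≤ g.dissip * ρ x
  ϑ_cont : Continuous ϑ
  ϑ_near : ∀ x, |ϑ x + (g.γ - 1) / g.R * g.p U * ρ x| ≤ τ * ρ x
  vb_cont : Continuous vb
  θb_cont : Continuous θb
  vb_mem : ∀ x, vb x ∈ Icc m L
  θb_mem : ∀ x, θb x ∈ Icc m L
  v_mem : ∀ x, vb x + φ x ∈ Icc m L
  θ_mem : ∀ x, θb x + ζ x ∈ Icc m L
  vb_near : ∀ x, |vb x - U.v| ≤ C₀ * (d + N x)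
  θb_near : ∀ x, |θb x - U.θ| ≤ C₀ * (d + N x)
  N_cont : Continuous N
  N_nonneg : ∀ x, 0 ≤ N x
  N_le : ∀ x, N x ≤ ε
  φ_mem : MemH1 φ
  ψ_mem : MemH1 ψ
  ζ_mem : MemH1 ζ
  φ_le : ∀ x, |φ x| ≤ ε
  ψ_le : ∀ x, |ψ x| ≤ ε
  ζ_le : ∀ x, |ζ x| ≤ ε
  ψ_sq : ∫ x, ψ x ^ 2 ≤ ε ^ 2

/-- The entropy flux minus `σ` times the relative entropy. -/
noncomputable def Gas.fluxDefect (g : Gas) (σ vb θb φ ψ ζ : ℝ) : ℝ :=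
  ψ * (g.R * (θb + ζ) / (vb + φ) - g.R * θb / vb)
    - σ * (g.R * θb * Phi ((vb + φ) / vb) + g.R * θb / (g.γ - 1) * Phi ((θb + ζ) / θb)
      + ψ ^ 2 / 2)

/-- The square of the part of the perturbation transversal to the 3-wave. -/
noncomputable def Gas.transversal (g : Gas) (U : State) (s φ ψ ζ : ℝ) : ℝ :=
  (φ + ψ / s) ^ 2 + (ζ - g.slopeθ U s * ψ) ^ 2

lemma Gas.transversal_nonneg (g : Gas) (U : State) (s φ ψ ζ : ℝ) :
    0 ≤ g.transversal U s φ ψ ζ := by unfold Gas.transversal; positivity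

namespace Snapshot

variable {g : Gas} {m L τ C₀ ε : ℝ} {U : State} {s σ d : ℝ} {w ρ ϑ N vb θb φ ψ ζ : ℝ → ℝ}

lemma ε_pos (S : Snapshot g m L τ C₀ ε U s σ d w ρ ϑ N vb θb φ ψ ζ) : 0 < ε :=
  S.front.d_pos.trans_le S.d_le

lemma isBC_transversal (S : Snapshot g m L τ C₀ ε U s σ d w ρ ϑ N vb θb φ ψ ζ) :
    IsBC fun x => g.transversal U s (φ x) (ψ x) (ζ x) := by
  unfold Gas.transversal
  simp only [div_eq_mul_inv]
  exact ((S.φ_mem.isBC.add (S.ψ_mem.isBC.mul (IsBC.const _))).pow 2).add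
    ((S.ζ_mem.isBC.sub (S.ψ_mem.isBC.const_mul _)).pow 2)

lemma isBC_w (S : Snapshot g m L τ C₀ ε U s σ d w ρ ϑ N vb θb φ ψ ζ) : IsBC w :=
  IsBC.of_mem_Icc (continuous_iff_continuousAt.2 fun x => (S.front.hasDerivAt x).continuousAt)
    fun x => ⟨(S.front.gt x).le, (S.front.lt x).le⟩

lemma isBC_weight (S : Snapshot g m L τ C₀ ε U s σ d w ρ ϑ N vb θb φ ψ ζ) (lam : ℝ) :
    IsBC fun x => 1 + lam / d * w x := (IsBC.const _).add (S.isBC_w.const_mul _)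

lemma weight_mem (S : Snapshot g m L τ C₀ ε U s σ d w ρ ϑ N vb θb φ ψ ζ) {lam : ℝ} (hl : 0 ≤ lam)
    (x : ℝ) : 1 + lam / d * w x ∈ Icc 1 (1 + lam) := by
  have hd := S.front.d_pos
  have h1 := S.front.gt x
  have h2 := S.front.lt x
  refine ⟨by have : 0 ≤ lam / d * w x := by positivity
             linarith, ?_⟩
  have : lam / d * w x ≤ lam / d * d := by gcongr
  rw [div_mul_cancel₀ _ hd.ne'] at this
  linarith

lemma continuous_shift_integrand (S : Snapshot g m L τ C₀ ε U s σ d w ρ ϑ N vb θb φ ψ ζ)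
    (lam : ℝ) : Continuous fun x => (1 + lam / d * w x) * (-σ * ρ x * ψ x
        + g.R * ϑ x / ((g.γ - 1) * θb x) * ζ x + g.R * θb x / vb x * ρ x / vb x * φ x) := by
  have hm := S.base.m_pos
  have h1 := S.isBC_w.1
  have h2 := S.front.cont
  have h3 := S.ϑ_cont
  have h4 := S.φ_mem.continuous
  have h5 := S.ψ_mem.continuous
  have h6 := S.ζ_mem.continuous
  have h7 := S.vb_cont
  have h8 := S.θb_cont
  have h9 : ∀ x, vb x ≠ 0 := fun x => (hm.trans_le (S.vb_mem x).1).ne'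
  have h10 : ∀ x, (g.γ - 1) * θb x ≠ 0 := fun x =>
    mul_ne_zero g.γ_sub_pos.ne' (hm.trans_le (S.θb_mem x).1).ne'
  fun_prop (disch := assumption)

end Snapshot

/-- Bound for the contribution of the shift. -/
theorem shift_contribution (g : Gas) {m : ℝ} (L : ℝ) (hm : 0 < m) : ∃ C : ℝ, 0 < C ∧
    ∀ {τ C₀ ε : ℝ} {U : State} {s σ d : ℝ} {w ρ ϑ N vb θb φ ψ ζ : ℝ → ℝ},
    Snapshot g m L τ C₀ ε U s σ d w ρ ϑ N vb θb φ ψ ζ → ∀ lam M n : ℝ, 0 ≤ lam → lam ≤ 1 → τ ≤ 1 →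
      0 ≤ τ → 0 ≤ C₀ → 2 * C₀ * ε ≤ n → n ≤ 1 → 0 ≤ M →
    -(M / (2 * d)) * (∫ x, (1 + lam / d * w x) * (-σ * ρ x * ψ x
        + g.R * ϑ x / ((g.γ - 1) * θb x) * ζ x + g.R * θb x / vb x * ρ x / vb x * φ x)) ^ 2
      ≤ -(3 / 2 * (M * s ^ 2)) * ((∫ x, ρ x * ψ x) ^ 2 / d)
        + M * C * ((∫ x, ρ x * g.transversal U s (φ x) (ψ x) (ζ x))
          + (n + τ + lam) ^ 2 * ∫ x, ρ x * ψ x ^ 2) := by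
  obtain ⟨C, hC, hbd⟩ := shift_integrand_bound g L hm
  refine ⟨9 / 2 * C ^ 2, by positivity, fun {τ C₀ ε U s σ d w ρ ϑ N vb θb φ ψ ζ} S lam M n hl hl1 hτ
    hτ0 hC₀ hn hn1 hM => ?_⟩
  have F := S.front
  have hd := F.d_pos
  set b := g.slopeθ U s
  set P := ∫ x, ρ x * ψ x
  set A := ∫ x, ρ x * ψ x ^ 2
  set X := ∫ x, ρ x * g.transversal U s (φ x) (ψ x) (ζ x)
  set h := n + τ + lam
  set J : ℝ → ℝ := fun x => (1 + lam / d * w x) * (-σ * ρ x * ψ x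
        + g.R * ϑ x / ((g.γ - 1) * θb x) * ζ x + g.R * θb x / vb x * ρ x / vb x * φ x) with hJ
  set f : ℝ → ℝ := fun x => C * (|φ x + ψ x / s| + |ζ x - b * ψ x| + h * |ψ x|) with hf
  have hfx : IsBC fun x => |φ x + ψ x / s| := by
    simp only [div_eq_mul_inv]
    exact (S.φ_mem.isBC.add (S.ψ_mem.isBC.mul (IsBC.const _))).abs
  have hfz : IsBC fun x => |ζ x - b * ψ x| := (S.ζ_mem.isBC.sub (S.ψ_mem.isBC.const_mul _)).abs
  have hfBC : IsBC f := ((hfx.add hfz).add (S.ψ_mem.isBC.abs.const_mul h)).const_mul C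
  have hεn : ∀ x, C₀ * (d + N x) ≤ n := fun x => by
    refine le_trans ?_ hn
    have : d + N x ≤ 2 * ε := by linarith [S.d_le, S.N_le x]
    calc C₀ * (d + N x) ≤ C₀ * (2 * ε) := by gcongr
      _ = _ := by ring
  have hpt : ∀ x, |J x + 2 * s * (ρ x * ψ x)| ≤ ρ x * f x := fun x => by
    have hw := S.weight_mem hl x
    have := hbd U s σ (vb x) (θb x) (φ x) (ψ x) (ζ x) n (1 + lam / d * w x) lam τ (ρ x) (ϑ x)
      S.base S.σ_mem (S.vb_mem x) (S.θb_mem x) ((S.vb_near x).trans (hεn x))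
      ((S.θb_near x).trans (hεn x)) (S.speed.trans (le_trans (by
        gcongr; linarith [S.N_nonneg x]) (hεn x))) hn1 hw.1 hw.2 hl1 hτ (F.pos x).le (S.ϑ_near x)
    refine this.trans (le_of_eq ?_)
    simp only [hf]
    ring
  have hJc : Continuous J := S.continuous_shift_integrand lam
  have hPi := F.integrable_mul S.ψ_mem.isBC
  have hsum : Integrable fun x => J x + 2 * s * (ρ x * ψ x) :=
    (F.integrable_mul hfBC).mono' (by have := F.cont; have := S.ψ_mem.continuous; fun_prop)
      (ae_of_all _ fun x => hpt x)
  have hJi : Integrable J := by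
    have := hsum.sub (hPi.const_mul (2 * s))
    refine this.congr (ae_of_all _ fun x => ?_)
    simp
  have hI : |(∫ x, J x) + 2 * s * P| ≤ ∫ x, ρ x * f x := by
    have e : (∫ x, J x) + 2 * s * P = ∫ x, (J x + 2 * s * (ρ x * ψ x)) := by
      rw [integral_add hJi (hPi.const_mul _), integral_const_mul]
    rw [e]
    exact abs_integral_le_integral_abs.trans
      (integral_mono hsum.abs (F.integrable_mul hfBC) hpt)
  have hf2 : ∫ x, ρ x * f x ^ 2 ≤ 3 * C ^ 2 * (X + h ^ 2 * A) := by
    have e : 3 * C ^ 2 * (X + h ^ 2 * A) = ∫ x, ρ x * (3 * C ^ 2 *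
        (g.transversal U s (φ x) (ψ x) (ζ x) + h ^ 2 * ψ x ^ 2)) := by
      rw [IsFront.integral_const_mul, F.integral_add S.isBC_transversal
        ((S.ψ_mem.isBC.pow 2).const_mul _), IsFront.integral_const_mul]
    rw [e]
    refine F.integral_mono (hfBC.pow 2) ((S.isBC_transversal.add
        ((S.ψ_mem.isBC.pow 2).const_mul _)).const_mul _) fun x => ?_
    have := add_add_sq_le |φ x + ψ x / s| |ζ x - b * ψ x| (h * |ψ x|)
    rw [sq_abs, sq_abs, mul_pow, sq_abs] at this
    simp only [hf, Gas.transversal, mul_pow]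
    calc C ^ 2 * _ ≤ C ^ 2 * _ := mul_le_mul_of_nonneg_left this (sq_nonneg C)
      _ = _ := by ring
  have hsq : ((∫ x, J x) + 2 * s * P) ^ 2 ≤ d * (3 * C ^ 2 * (X + h ^ 2 * A)) := by
    have h1 : ((∫ x, J x) + 2 * s * P) ^ 2 ≤ (∫ x, ρ x * f x) ^ 2 := by
      rw [← sq_abs]; exact pow_le_pow_left₀ (abs_nonneg _) hI 2
    exact (h1.trans (F.sq_integral_le hfBC)).trans (mul_le_mul_of_nonneg_left hf2 hd.le)
  generalize (∫ x, J x) = I at hsq ⊢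
  -- With `J = I + 2 s P`, expanding `(2 J - s P)² ≥ 0` gives `I² ≥ 3 s² P² - 3 J²`: the ideal
  -- coefficient `4` is lowered to `3`.
  have h1 : 3 * s ^ 2 * P ^ 2 - 3 * (d * (3 * C ^ 2 * (X + h ^ 2 * A))) ≤ I ^ 2 := by
    have := sq_nonneg (2 * (I + 2 * s * P) - s * P)
    linarith
  have h2 := mul_le_mul_of_nonneg_left h1 (show 0 ≤ M / (2 * d) by positivity)
  have h3 : M / (2 * d) * (3 * s ^ 2 * P ^ 2 - 3 * (d * (3 * C ^ 2 * (X + h ^ 2 * A)))) =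
      3 / 2 * (M * s ^ 2) * (P ^ 2 / d) - M * (9 / 2 * C ^ 2) * (X + h ^ 2 * A) := by
    field_simp
    ring
  linarith

namespace Snapshot

variable {g : Gas} {m L τ C₀ ε : ℝ} {U : State} {s σ d : ℝ} {w ρ ϑ N vb θb φ ψ ζ : ℝ → ℝ}

/-- Bound for the contribution of the shock derivative. -/
theorem wave_contribution (S : Snapshot g m L τ C₀ ε U s σ d w ρ ϑ N vb θb φ ψ ζ) {lam : ℝ}
    (hl : 0 ≤ lam) :
    ∫ x, (1 + lam / d * w x) * ρ x * ((g.γ + 1) * g.p U * s / (2 * U.v ^ 2) * φ x ^ 2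
        + g.R * s / (2 * U.v * U.θ) * ζ x ^ 2 - g.p U * s / (U.v * U.θ) * (φ x * ζ x))
      ≤ (1 + lam) * (21 / 20 * g.nonlin U s * (∫ x, ρ x * ψ x ^ 2)
        + 21 * ((g.γ + 1) * L * L / m ^ 2 + g.R * L / m ^ 2 + L * L / m ^ 2)
          * ∫ x, ρ x * g.transversal U s (φ x) (ψ x) (ζ x)) := by
  have F := S.front
  have hα := S.base.nonlin_pos
  have hL := S.base.L_pos
  have hm := S.base.m_pos
  have hR := g.R_pos
  have hγ := g.γ_pos
  set K := 21 * ((g.γ + 1) * L * L / m ^ 2 + g.R * L / m ^ 2 + L * L / m ^ 2) with hK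
  have hK0 : 0 < K := by positivity
  set q : ℝ → ℝ := fun x => (g.γ + 1) * g.p U * s / (2 * U.v ^ 2) * φ x ^ 2
        + g.R * s / (2 * U.v * U.θ) * ζ x ^ 2 - g.p U * s / (U.v * U.θ) * (φ x * ζ x) with hq
  have hqBC : IsBC q := (((S.φ_mem.isBC.pow 2).const_mul _).add
    ((S.ζ_mem.isBC.pow 2).const_mul _)).sub ((S.φ_mem.isBC.mul S.ζ_mem.isBC).const_mul _)
  have e1 : (1 + lam) * (21 / 20 * g.nonlin U s * (∫ x, ρ x * ψ x ^ 2)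
        + K * ∫ x, ρ x * g.transversal U s (φ x) (ψ x) (ζ x)) =
      ∫ x, ρ x * ((1 + lam) * (21 / 20 * g.nonlin U s * ψ x ^ 2
        + K * g.transversal U s (φ x) (ψ x) (ζ x))) := by
    rw [IsFront.integral_const_mul, F.integral_add ((S.ψ_mem.isBC.pow 2).const_mul _)
      (S.isBC_transversal.const_mul _), IsFront.integral_const_mul, IsFront.integral_const_mul]
  have e2 : ∀ x, (1 + lam / d * w x) * ρ x * q x = ρ x * ((1 + lam / d * w x) * q x) :=
    fun x => by ring
  change ∫ x, (1 + lam / d * w x) * ρ x * q x ≤ _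
  rw [e1]
  simp only [e2]
  refine F.integral_mono ((S.isBC_weight lam).mul hqBC) ((((S.ψ_mem.isBC.pow 2).const_mul _).add
    (S.isBC_transversal.const_mul _)).const_mul _) fun x => ?_
  obtain ⟨h1, h2⟩ := S.weight_mem hl x
  have h3 := S.base.quadratic_wave (φ x) (ψ x) (ζ x)
  have h4 : 0 ≤ 21 / 20 * g.nonlin U s * ψ x ^ 2 + K * g.transversal U s (φ x) (ψ x) (ζ x) := by
    have := g.transversal_nonneg U s (φ x) (ψ x) (ζ x)
    positivity
  calc (1 + lam / d * w x) * q x ≤ (1 + lam / d * w x) * (21 / 20 * g.nonlin U s * ψ x ^ 2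
        + K * g.transversal U s (φ x) (ψ x) (ζ x)) :=
        mul_le_mul_of_nonneg_left h3 (by linarith)
    _ ≤ _ := mul_le_mul_of_nonneg_right h2 h4

lemma integrable_dissipation (S : Snapshot g m L τ C₀ ε U s σ d w ρ ϑ N vb θb φ ψ ζ) (lam : ℝ) :
    Integrable fun x => (1 + lam / d * w x) * (g.μ / (vb x + φ x) * deriv ψ x ^ 2
      + g.κ / ((vb x + φ x) * (θb x + ζ x)) * deriv ζ x ^ 2) := by
  have hm := S.base.m_pos
  have hv := IsBC.inv (S.vb_cont.add S.φ_mem.continuous) hm fun x => (S.v_mem x).1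
  have hθ := IsBC.inv (S.θb_cont.add S.ζ_mem.continuous) hm fun x => (S.θ_mem x).1
  have key : ∀ {f h : ℝ → ℝ}, IsBC f → Integrable h → Integrable fun x => f x * h x :=
    fun hf hh => by
      obtain ⟨hf, B, hB⟩ := hf
      exact hh.bdd_mul hf.aestronglyMeasurable (ae_of_all _ hB)
  refine key (S.isBC_weight lam) ((key (f := fun x => g.μ / (vb x + φ x)) ?_
    S.ψ_mem.integrable_deriv_sq).add (key (f := fun x => g.κ / ((vb x + φ x) * (θb x + ζ x))) ?_
    S.ζ_mem.integrable_deriv_sq))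
  · simp only [div_eq_mul_inv]; exact hv.const_mul _
  · simp only [div_eq_mul_inv, mul_inv]; exact (hv.mul hθ).const_mul _

/-- Lower bound for the dissipation: the sharp Poincaré inequality and a remainder. -/
theorem dissipation_contribution (S : Snapshot g m L τ C₀ ε U s σ d w ρ ϑ N vb θb φ ψ ζ) {lam : ℝ}
    (hl : 0 ≤ lam) (hC₀ : 0 ≤ C₀) (hε : (2 * C₀ + 1) * ε ≤ m / 49) (hτ0 : 0 ≤ τ)
    (hτ : τ ≤ (g.γ + 1) * m / 50) :
    13 / 10 * (g.nonlin U s * ((∫ x, ρ x * ψ x ^ 2) - (∫ x, ρ x * ψ x) ^ 2 / d))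
        + 18 / 1250 * g.μ / L * ∫ x, deriv ψ x ^ 2 ≤
      3 / 4 * (∫ x, (1 + lam / d * w x) * (g.μ / (vb x + φ x) * deriv ψ x ^ 2
        + g.κ / ((vb x + φ x) * (θb x + ζ x)) * deriv ζ x ^ 2))
      + 24 * ((g.γ + 1) * L) * g.κ / (m ^ 2 * g.dissip)
        * ∫ x, ρ x * g.transversal U s (φ x) (ψ x) (ζ x) := by
  have F := S.front
  have hd := F.d_pos
  have hL := S.base.L_pos
  have hm := S.base.m_pos
  have hγ := g.γ_pos
  have hμ := g.μ_pos
  have hκ := g.κ_pos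
  have hs := S.base.s_pos
  have hb := g.dissip_pos
  have hα := S.base.nonlin_pos
  obtain ⟨hv0, hθ0⟩ := S.base.adm
  have hv0m := S.base.v_mem
  have hθ0m := S.base.θ_mem
  set X := ∫ x, ρ x * g.transversal U s (φ x) (ψ x) (ζ x) with hX
  have hX0 : 0 ≤ X := F.integral_nonneg fun x => g.transversal_nonneg _ _ _ _ _
  set DD := ∫ x, (1 + lam / d * w x) * (g.μ / (vb x + φ x) * deriv ψ x ^ 2
        + g.κ / ((vb x + φ x) * (θb x + ζ x)) * deriv ζ x ^ 2) with hDD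
  set E := ∫ x, deriv ψ x ^ 2 with hE
  have hE0 : 0 ≤ E := MeasureTheory.integral_nonneg fun _ => sq_nonneg _
  set Z := ∫ x, deriv ζ x ^ 2 with hZ
  set V := (∫ x, ρ x * ψ x ^ 2) - (∫ x, ρ x * ψ x) ^ 2 / d with hV
  have hV0 : 0 ≤ V := by
    rw [hV, F.variance_eq S.ψ_mem.isBC]; exact F.integral_nonneg fun _ => sq_nonneg _
  set Vz := (∫ x, ρ x * ζ x ^ 2) - (∫ x, ρ x * ζ x) ^ 2 / d with hVz
  -- reduction to constant coefficients
  have hnear : ∀ x y y₀ z, |y - y₀| ≤ C₀ * (d + N x) → |z| ≤ ε → m ≤ y₀ →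
      y + z ≤ 50 / 49 * y₀ := fun x y y₀ z h1 h2 h3 => by
    have h4 : C₀ * (d + N x) ≤ C₀ * (2 * ε) := by
      gcongr; linarith [S.d_le, S.N_le x]
    have h5 := (abs_le.1 h1).2
    have h6 := (abs_le.1 h2).2
    linarith
  -- The tolerance `50/49` on volume and temperature is such that two factors of it, from the
  -- product `v θ`, still cost no more than `24/25`.
  have hDlow : 24 / 25 / U.v * (g.μ * E + g.κ / U.θ * Z) ≤ DD := by
    have e : 24 / 25 / U.v * (g.μ * E + g.κ / U.θ * Z) =
        ∫ x, 24 / 25 / U.v * (g.μ * deriv ψ x ^ 2 + g.κ / U.θ * deriv ζ x ^ 2) := by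
      rw [integral_const_mul, integral_add (S.ψ_mem.integrable_deriv_sq.const_mul _)
        (S.ζ_mem.integrable_deriv_sq.const_mul _), integral_const_mul, integral_const_mul]
    rw [e, hDD]
    refine integral_mono (((S.ψ_mem.integrable_deriv_sq.const_mul _).add
      (S.ζ_mem.integrable_deriv_sq.const_mul _)).const_mul _) (S.integrable_dissipation lam)
      fun x => ?_
    have hv := hnear x (vb x) U.v (φ x) (S.vb_near x) (S.φ_le x) hv0m.1
    have hθ := hnear x (θb x) U.θ (ζ x) (S.θb_near x) (S.ζ_le x) hθ0m.1
    have hvp := hm.trans_le (S.v_mem x).1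
    have hθp := hm.trans_le (S.θ_mem x).1
    have hw := (S.weight_mem hl x).1
    have c1 : 24 / 25 / U.v * g.μ ≤ g.μ / (vb x + φ x) := by
      rw [le_div_iff₀ hvp]
      have : 24 / 25 / U.v * g.μ * (vb x + φ x) ≤ 24 / 25 / U.v * g.μ * (50 / 49 * U.v) := by
        gcongr
      refine this.trans ?_
      have : 24 / 25 / U.v * g.μ * (50 / 49 * U.v) = 48 / 49 * g.μ := by field_simp; norm_num
      rw [this]; linarith
    have c2 : 24 / 25 / U.v * (g.κ / U.θ) ≤ g.κ / ((vb x + φ x) * (θb x + ζ x)) := by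
      rw [le_div_iff₀ (mul_pos hvp hθp)]
      have : 24 / 25 / U.v * (g.κ / U.θ) * ((vb x + φ x) * (θb x + ζ x)) ≤
          24 / 25 / U.v * (g.κ / U.θ) * ((50 / 49 * U.v) * (50 / 49 * U.θ)) := by
        gcongr
      refine this.trans ?_
      have : 24 / 25 / U.v * (g.κ / U.θ) * ((50 / 49 * U.v) * (50 / 49 * U.θ)) =
          2400 / 2401 * g.κ := by field_simp; norm_num
      rw [this]; linarith
    have e1 := mul_le_mul_of_nonneg_right c1 (sq_nonneg (deriv ψ x))
    have e2 := mul_le_mul_of_nonneg_right c2 (sq_nonneg (deriv ζ x))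
    have e3 : 0 ≤ g.μ / (vb x + φ x) * deriv ψ x ^ 2
        + g.κ / ((vb x + φ x) * (θb x + ζ x)) * deriv ζ x ^ 2 := by positivity
    have e4 := mul_le_mul_of_nonneg_right hw e3
    rw [one_mul] at e4
    refine le_trans ?_ e4
    linarith
  -- the Poincaré inequality
  set r := (g.γ + 1) / 2 * s - τ with hr
  -- The allowed `τ` costs another factor `24/25` in the rate.
  have hr1 : 24 / 25 * (g.nonlin U s * U.v) ≤ r := by
    rw [S.base.nonlin_mul_v, hr]
    have : (g.γ + 1) * m ≤ (g.γ + 1) * s := by gcongr; exact S.base.s_mem.1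
    linarith
  have hr0 : 0 < r := lt_of_lt_of_le (by positivity) hr1
  have hrL : 2 * r ≤ (g.γ + 1) * L := by
    have : (g.γ + 1) * s ≤ (g.γ + 1) * L := by gcongr; exact S.base.s_mem.2
    rw [hr]; linarith
  have p1 := F.poincare S.ψ_mem hr0 S.rate
  have p2 := F.poincare S.ζ_mem hr0 S.rate
  have p3 := F.variance_comparison S.ψ_mem.isBC S.ζ_mem.isBC (g.slopeθ U s)
  have p4 : ∫ x, ρ x * (ζ x - g.slopeθ U s * ψ x) ^ 2 ≤ X :=
    F.integral_mono ((S.ζ_mem.isBC.sub (S.ψ_mem.isBC.const_mul _)).pow 2) S.isBC_transversal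
      fun x => by unfold Gas.transversal; linarith [sq_nonneg (φ x + ψ x / s)]
  rw [← hV] at p1 p3
  rw [← hVz] at p2 p3
  have hκθ : 0 < g.κ / U.θ := by positivity
  have hdis := S.base.dissip_eq
  -- Poincaré is used for both `ψ` and `ζ`. The variance of `ζ` is at least `24/25 b²` times that of
  -- `ψ` up to transversal terms, and `μ + κ b² / θ` adds up to `dissip`, which explains the
  -- effective dissipation.
  have q1 : 2 * r * (24 / 25 * g.dissip * V - 24 * (g.κ / U.θ) * X) ≤
      g.dissip * (g.μ * E + g.κ / U.θ * Z) := by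
    have h1 := mul_le_mul_of_nonneg_left p1 hμ.le
    have h2 := mul_le_mul_of_nonneg_left p2 hκθ.le
    have h3 : 24 / 25 * g.slopeθ U s ^ 2 * V ≤ Vz + 24 * X := by linarith
    have h4 := mul_le_mul_of_nonneg_left h3 (show 0 ≤ 2 * r * (g.κ / U.θ) by positivity)
    have h5 : 0 ≤ r * (g.μ * V) := by positivity
    have h6 : 2 * r * (24 / 25 * g.dissip * V) = 24 / 25 * (2 * r * (g.μ * V))
        + 2 * r * (g.κ / U.θ) * (24 / 25 * g.slopeθ U s ^ 2 * V) := by rw [← hdis]; ring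
    linarith
  have q2 : 24 / 25 * (2 * r * V) - 24 * ((g.γ + 1) * L) * g.κ / (m * g.dissip) * X ≤
      g.μ * E + g.κ / U.θ * Z := by
    have h1 : 2 * r * (24 / 25 * g.dissip * V - 24 * (g.κ / U.θ) * X) / g.dissip ≤
        g.μ * E + g.κ / U.θ * Z := by
      rw [div_le_iff₀ hb]; linarith
    have h2 : 2 * r * (24 / 25 * g.dissip * V - 24 * (g.κ / U.θ) * X) / g.dissip =
        24 / 25 * (2 * r * V) - 24 * (2 * r) * (g.κ / U.θ) / g.dissip * X := by
      field_simp
    have h3 : 24 * (2 * r) * (g.κ / U.θ) / g.dissip * X ≤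
        24 * ((g.γ + 1) * L) * (g.κ / m) / g.dissip * X := by
      gcongr
      exact hθ0m.1
    have h4 : 24 * ((g.γ + 1) * L) * (g.κ / m) / g.dissip =
        24 * ((g.γ + 1) * L) * g.κ / (m * g.dissip) := by field_simp
    rw [h4] at h3
    linarith
  have hZ0 : 0 ≤ g.κ / U.θ * Z :=
    mul_nonneg hκθ.le (MeasureTheory.integral_nonneg fun _ => sq_nonneg _)
  set KX := 24 * ((g.γ + 1) * L) * g.κ / (m * g.dissip) * X with hKX
  have hKX0 : 0 ≤ KX := by positivity
  -- One fiftieth of the viscous dissipation is saved; it later absorbs the derivative terms created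
  -- by the interpolations.
  have q3 : 49 / 50 * (24 / 25 * (2 * r * V) - KX) + 1 / 50 * (g.μ * E) ≤
      g.μ * E + g.κ / U.θ * Z := by linarith
  have q4 : 2 * (24 / 25 * (g.nonlin U s * U.v)) * V ≤ 2 * r * V := by gcongr
  have q5 := mul_le_mul_of_nonneg_left q3 (show 0 ≤ 24 / 25 / U.v by positivity)
  have q6 : 24 / 25 / U.v * (49 / 50 * (24 / 25 * (2 * (24 / 25 * (g.nonlin U s * U.v)) * V) - KX)
      + 1 / 50 * (g.μ * E)) ≤ 24 / 25 / U.v *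
      (49 / 50 * (24 / 25 * (2 * r * V) - KX) + 1 / 50 * (g.μ * E)) := by gcongr
  -- After the factor `3/4` the coefficient of the variance is `3/4 * 2 * (24/25)^3 * (49/50)`, just
  -- above `13/10`.
  have q7 : 24 / 25 / U.v * (49 / 50 * (24 / 25 * (2 * (24 / 25 * (g.nonlin U s * U.v)) * V) - KX)
      + 1 / 50 * (g.μ * E)) = 24 / 25 * (49 / 50) * (24 / 25) * 2 * (24 / 25) * (g.nonlin U s * V)
      - 24 / 25 * (49 / 50) * (KX / U.v) + 24 / 1250 * (g.μ * E / U.v) := by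
    field_simp; ring
  have q8 : KX / U.v ≤ 24 * ((g.γ + 1) * L) * g.κ / (m ^ 2 * g.dissip) * X := by
    have : 24 * ((g.γ + 1) * L) * g.κ / (m ^ 2 * g.dissip) * X = KX / m := by
      rw [hKX]; field_simp
    rw [this]; gcongr; exact hv0m.1
  have q9 : g.μ / L * E ≤ g.μ * E / U.v := by
    rw [div_mul_eq_mul_div]; gcongr; exact hv0m.2
  have q10 : 0 ≤ g.nonlin U s * V := by positivity
  have q11 : 0 ≤ KX / U.v := by positivity
  have q12 : 18 / 1250 * g.μ / L * E = 18 / 1250 * (g.μ / L * E) := by ring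
  rw [q12]
  clear_value DD KX V X E
  linarith

end Snapshot

lemma IsBC.log {f : ℝ → ℝ} {a b : ℝ} (hf : Continuous f) (ha : 0 < a) (h : ∀ x, f x ∈ Icc a b) :
    IsBC fun x => Real.log (f x) :=
  IsBC.of_mem_Icc (hf.log fun x => (ha.trans_le (h x).1).ne') fun x =>
    ⟨Real.log_le_log ha (h x).1, Real.log_le_log (ha.trans_le (h x).1) (h x).2⟩

namespace Snapshot

variable {g : Gas} {m L τ C₀ ε : ℝ} {U : State} {s σ d : ℝ} {w ρ ϑ N vb θb φ ψ ζ : ℝ → ℝ}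

lemma isBC_N (S : Snapshot g m L τ C₀ ε U s σ d w ρ ϑ N vb θb φ ψ ζ) : IsBC N :=
  IsBC.of_mem_Icc S.N_cont fun x => ⟨S.N_nonneg x, S.N_le x⟩

lemma isBC_Phi {m L : ℝ} {f h : ℝ → ℝ} (hm : 0 < m) (hf : Continuous f) (hh : Continuous h)
    (hfm : ∀ x, f x ∈ Icc m L) (hhm : ∀ x, h x ∈ Icc m L) : IsBC fun x => Phi (f x / h x) := by
  have hL : 0 < L := hm.trans_le ((hfm 0).1.trans (hfm 0).2)
  have hq : ∀ x, f x / h x ∈ Icc (m / L) (L / m) := fun x => by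
    have h1 := hm.trans_le (hfm x).1
    have h2 := hm.trans_le (hhm x).1
    exact ⟨div_le_div₀ h1.le (hfm x).1 h2 (hhm x).2, div_le_div₀ hL.le (hfm x).2 hm (hhm x).1⟩
  have hc : Continuous fun x => f x / h x := hf.div hh fun x => (hm.trans_le (hhm x).1).ne'
  exact ((IsBC.of_mem_Icc hc hq).sub (IsBC.const 1)).sub (IsBC.log hc (div_pos hm hL) hq)

lemma isBC_pressure {m L : ℝ} {f h : ℝ → ℝ} (c : ℝ) (hm : 0 < m) (hf : Continuous f)
    (hh : Continuous h) (hfm : ∀ x, f x ∈ Icc m L) (hhm : ∀ x, h x ∈ Icc m L) :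
    IsBC fun x => c * f x / h x := by
  simp only [div_eq_mul_inv]
  exact ((IsBC.of_mem_Icc hf hfm).const_mul c).mul (IsBC.inv hh hm fun x => (hhm x).1)

lemma isBC_flux (S : Snapshot g m L τ C₀ ε U s σ d w ρ ϑ N vb θb φ ψ ζ) :
    IsBC fun x => ψ x * (g.R * (θb x + ζ x) / (vb x + φ x) - g.R * θb x / vb x) :=
  S.ψ_mem.isBC.mul ((isBC_pressure g.R S.base.m_pos (S.θb_cont.add S.ζ_mem.continuous)
    (S.vb_cont.add S.φ_mem.continuous) S.θ_mem S.v_mem).sub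
    (isBC_pressure g.R S.base.m_pos S.θb_cont S.vb_cont S.θb_mem S.vb_mem))

lemma isBC_entropy (S : Snapshot g m L τ C₀ ε U s σ d w ρ ϑ N vb θb φ ψ ζ) :
    IsBC fun x => g.R * θb x * Phi ((vb x + φ x) / vb x)
      + g.R * θb x / (g.γ - 1) * Phi ((θb x + ζ x) / θb x) + ψ x ^ 2 / 2 := by
  have hm := S.base.m_pos
  have h1 := isBC_Phi hm (S.vb_cont.add S.φ_mem.continuous) S.vb_cont S.v_mem S.vb_mem
  have h2 := isBC_Phi hm (S.θb_cont.add S.ζ_mem.continuous) S.θb_cont S.θ_mem S.θb_mem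
  have h3 := (IsBC.of_mem_Icc S.θb_cont S.θb_mem).const_mul g.R
  have h4 : IsBC fun x => g.R * θb x / (g.γ - 1) := by
    simp only [div_eq_mul_inv]; exact h3.mul (IsBC.const _)
  have h5 : IsBC fun x => ψ x ^ 2 / 2 := by
    simp only [div_eq_mul_inv]; exact (S.ψ_mem.isBC.pow 2).mul (IsBC.const _)
  exact ((h3.mul h1).add (h4.mul h2)).add h5

lemma isBC_fluxDefect (S : Snapshot g m L τ C₀ ε U s σ d w ρ ϑ N vb θb φ ψ ζ) :
    IsBC fun x => g.fluxDefect σ (vb x) (θb x) (φ x) (ψ x) (ζ x) :=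
  S.isBC_flux.sub (S.isBC_entropy.const_mul σ)

lemma sq_le (S : Snapshot g m L τ C₀ ε U s σ d w ρ ϑ N vb θb φ ψ ζ) (x : ℝ) :
    ψ x ^ 2 ≤ 2 * ε * √(∫ x, deriv ψ x ^ 2) := by
  have h1 := S.ψ_mem.sq_le_sqrt_mul_sqrt x
  have h2 : √(∫ x, ψ x ^ 2) ≤ ε := by
    rw [← Real.sqrt_sq S.ε_pos.le]; exact Real.sqrt_le_sqrt S.ψ_sq
  refine h1.trans ?_
  rw [mul_assoc]
  gcongr

/-- The cubic term, by interpolation. -/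
lemma cubic_le (S : Snapshot g m L τ C₀ ε U s σ d w ρ ϑ N vb θb φ ψ ζ) {lam K : ℝ}
    (hl : 0 ≤ lam) (hK : lam ≤ K * √d) :
    lam / d * ∫ x, ρ x * |ψ x| ^ 3 ≤
      K * ε * ((∫ x, deriv ψ x ^ 2) + ∫ x, ρ x * ψ x ^ 2) := by
  have F := S.front
  have hd := F.d_pos
  have hε := S.ε_pos
  set E := ∫ x, deriv ψ x ^ 2
  have hE0 : 0 ≤ E := MeasureTheory.integral_nonneg fun _ => sq_nonneg _
  set A := ∫ x, ρ x * ψ x ^ 2 with hA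
  have hA0 : 0 ≤ A := F.integral_nonneg fun _ => sq_nonneg _
  have h1 : ∫ x, ρ x * |ψ x| ^ 3 ≤ 2 * ε * √E * ∫ x, ρ x * |ψ x| := by
    rw [← IsFront.integral_const_mul]
    refine F.integral_mono (S.ψ_mem.isBC.abs.pow 3) (S.ψ_mem.isBC.abs.const_mul _) fun x => ?_
    rw [pow_succ, sq_abs]
    exact mul_le_mul_of_nonneg_right (S.sq_le x) (abs_nonneg _)
  have h2 : ∫ x, ρ x * |ψ x| ≤ √d * √A := by
    rw [← Real.sqrt_mul hd.le]
    refine Real.le_sqrt_of_sq_le ?_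
    have := F.sq_integral_le S.ψ_mem.isBC.abs
    simpa only [sq_abs] using this
  have hK0 : 0 ≤ K := by
    by_contra! hneg
    have := mul_neg_of_neg_of_pos hneg (Real.sqrt_pos.2 hd)
    linarith
  calc lam / d * ∫ x, ρ x * |ψ x| ^ 3 ≤ (K * √d) / d * (2 * ε * √E * (√d * √A)) := by
        gcongr
        · exact F.integral_nonneg fun x => by positivity
        · exact h1.trans (by gcongr)
    _ = K * ε * (2 * √E * √A) * (√d * √d / d) := by ring
    _ = K * ε * (2 * √E * √A) := by rw [Real.mul_self_sqrt hd.le, div_self hd.ne', mul_one]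
    _ ≤ K * ε * (√E ^ 2 + √A ^ 2) := by gcongr; exact two_mul_le_add_sq _ _
    _ = _ := by rw [Real.sq_sqrt hE0, Real.sq_sqrt hA0]

/-- The interaction with the other waves, by interpolation. -/
lemma interaction_le (S : Snapshot g m L τ C₀ ε U s σ d w ρ ϑ N vb θb φ ψ ζ) {lam q Λ : ℝ}
    (hl : 0 ≤ lam) (hρ : IsBC ρ) (hq : 0 ≤ q) (hε : ε ≤ 1 / 2) (hΛ : 1 ≤ Λ)
    (hQ : (lam / d) ^ 2 * ∫ x, (ρ x * N x) ^ 2 ≤ (q ^ 3) ^ 2) :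
    lam / d * ∫ x, ρ x * (N x * ψ x ^ 2) ≤ Λ * q ^ 4 + (∫ x, deriv ψ x ^ 2) / Λ := by
  have F := S.front
  have hd := F.d_pos
  have hε0 := S.ε_pos
  set E := ∫ x, deriv ψ x ^ 2
  have hE0 : 0 ≤ E := MeasureTheory.integral_nonneg fun _ => sq_nonneg _
  -- The fourth root of the squared norm of `ψ'`; interpolation with a small `L²` norm makes it a
  -- bound for `|ψ|`.
  set k := √(√E) with hk
  have hk0 : 0 ≤ k := Real.sqrt_nonneg _
  have hk4 : k ^ 4 = E := by
    have : k ^ 4 = (k ^ 2) ^ 2 := by ring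
    rw [this, hk, Real.sq_sqrt (Real.sqrt_nonneg _), Real.sq_sqrt hE0]
  have hψk : ∀ x, |ψ x| ≤ k := fun x => by
    refine Real.abs_le_sqrt ((S.sq_le x).trans ?_)
    have := mul_le_mul_of_nonneg_right hε (Real.sqrt_nonneg E)
    linarith
  have hNBC := S.isBC_N
  have hL2 : MemLp (fun x => ρ x * N x) 2 volume := by
    have hc : Continuous fun x => ρ x * N x := F.cont.mul S.N_cont
    rw [memLp_two_iff_integrable_sq hc.aestronglyMeasurable]
    refine (F.integrable_mul (hρ.mul (hNBC.pow 2))).congr (ae_of_all _ fun x => ?_)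
    ring
  have hψ2 : √(∫ x, ψ x ^ 2) ≤ 1 := by
    have : √(∫ x, ψ x ^ 2) ≤ ε := by
      rw [← Real.sqrt_sq hε0.le]; exact Real.sqrt_le_sqrt S.ψ_sq
    linarith
  have h1 : ∫ x, ρ x * (N x * |ψ x|) ≤ √(∫ x, (ρ x * N x) ^ 2) := by
    have h := integral_mul_le_sqrt hL2 S.ψ_mem.memLp
    have e : ∀ x, |ρ x * N x * ψ x| = ρ x * (N x * |ψ x|) := fun x => by
      rw [abs_mul, abs_mul, abs_of_pos (F.pos x), abs_of_nonneg (S.N_nonneg x)]; ring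
    simp only [e] at h
    exact h.trans (mul_le_of_le_one_right (Real.sqrt_nonneg _) hψ2)
  have h2 : ∫ x, ρ x * (N x * ψ x ^ 2) ≤ k * ∫ x, ρ x * (N x * |ψ x|) := by
    rw [← IsFront.integral_const_mul]
    refine F.integral_mono (hNBC.mul (S.ψ_mem.isBC.pow 2))
      ((hNBC.mul S.ψ_mem.isBC.abs).const_mul _) fun x => ?_
    have := mul_le_mul_of_nonneg_right (hψk x) (mul_nonneg (S.N_nonneg x) (abs_nonneg (ψ x)))
    rw [← sq_abs]
    linarith
  have h3 : lam / d * √(∫ x, (ρ x * N x) ^ 2) ≤ q ^ 3 := by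
    have h0 : 0 ≤ lam / d := by positivity
    rw [← Real.sqrt_sq h0, ← Real.sqrt_mul (sq_nonneg _), ← Real.sqrt_sq (pow_nonneg hq 3)]
    exact Real.sqrt_le_sqrt hQ
  have h4 : lam / d * ∫ x, ρ x * (N x * ψ x ^ 2) ≤ k * q ^ 3 := by
    calc lam / d * ∫ x, ρ x * (N x * ψ x ^ 2) ≤ lam / d * (k * √(∫ x, (ρ x * N x) ^ 2)) := by
          gcongr; exact h2.trans (by gcongr)
      _ = k * (lam / d * √(∫ x, (ρ x * N x) ^ 2)) := by ring
      _ ≤ _ := by gcongr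
  have hΛ0 : 0 < Λ := by linarith
  have hq4 : 0 ≤ q ^ 4 := by positivity
  refine h4.trans ?_
  -- Young's inequality for `k * q ^ 3` with exponents `4` and `4/3`, by cases on which factor
  -- dominates.
  rcases le_total k (Λ * q) with h | h
  · have : k * q ^ 3 ≤ Λ * q * q ^ 3 := by gcongr
    have : 0 ≤ E / Λ := by positivity
    have : Λ * q * q ^ 3 = Λ * q ^ 4 := by ring
    linarith
  · have h5 : q ≤ k / Λ := by rw [le_div_iff₀ hΛ0]; linarith
    have h6 : k * q ^ 3 ≤ k * (k / Λ) ^ 3 := by gcongr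
    have h7 : k * (k / Λ) ^ 3 = E / Λ ^ 3 := by rw [← hk4]; ring
    have h8 : E / Λ ^ 3 ≤ E / Λ := by
      gcongr
      exact le_self_pow₀ hΛ (by norm_num)
    have : 0 ≤ Λ * q ^ 4 := by positivity
    linarith

end Snapshot

/-- Bound for the contribution of the weight. -/
theorem flux_contribution (g : Gas) {m : ℝ} (L : ℝ) (hm : 0 < m) :
    ∃ c₀ C n₀ : ℝ, 0 < c₀ ∧ 0 < C ∧ 0 < n₀ ∧
    ∀ {τ C₀ ε : ℝ} {U : State} {s σ d : ℝ} {w ρ ϑ N vb θb φ ψ ζ : ℝ → ℝ},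
    Snapshot g m L τ C₀ ε U s σ d w ρ ϑ N vb θb φ ψ ζ → 0 ≤ C₀ → ε ≤ n₀ → 2 * C₀ * ε ≤ n₀ →
    ∫ x, ρ x * g.fluxDefect σ (vb x) (θb x) (φ x) (ψ x) (ζ x) ≤
      -c₀ * (∫ x, ρ x * g.transversal U s (φ x) (ψ x) (ζ x))
      + C * (C₀ * d * (∫ x, ρ x * ψ x ^ 2) + C₀ * (∫ x, ρ x * (N x * ψ x ^ 2))
        + ∫ x, ρ x * |ψ x| ^ 3) := by
  obtain ⟨c₀, C, n₀, hc₀, hC, hn₀, h⟩ := flux_sub_entropy_le g L hm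
  refine ⟨c₀, C, n₀, hc₀, hC, hn₀, fun {τ C₀ ε U s σ d w ρ ϑ N vb θb φ ψ ζ} S hC₀ hε hε' => ?_⟩
  have F := S.front
  have hψ2 := S.ψ_mem.isBC.pow 2
  have hN := S.isBC_N
  have e : -c₀ * (∫ x, ρ x * g.transversal U s (φ x) (ψ x) (ζ x))
      + C * (C₀ * d * (∫ x, ρ x * ψ x ^ 2) + C₀ * (∫ x, ρ x * (N x * ψ x ^ 2))
        + ∫ x, ρ x * |ψ x| ^ 3) =
      ∫ x, ρ x * (-c₀ * g.transversal U s (φ x) (ψ x) (ζ x) + C * (C₀ * d * ψ x ^ 2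
        + C₀ * (N x * ψ x ^ 2) + |ψ x| ^ 3)) := by
    rw [F.integral_add (S.isBC_transversal.const_mul _) ((((hψ2.const_mul _).add
        ((hN.mul hψ2).const_mul _)).add (S.ψ_mem.isBC.abs.pow 3)).const_mul _),
      IsFront.integral_const_mul, IsFront.integral_const_mul,
      F.integral_add ((hψ2.const_mul _).add ((hN.mul hψ2).const_mul _)) (S.ψ_mem.isBC.abs.pow 3),
      F.integral_add (hψ2.const_mul _) ((hN.mul hψ2).const_mul _), IsFront.integral_const_mul,
      IsFront.integral_const_mul]
  rw [e]
  refine F.integral_mono S.isBC_fluxDefect ((S.isBC_transversal.const_mul _).add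
    ((((hψ2.const_mul _).add ((hN.mul hψ2).const_mul _)).add
      (S.ψ_mem.isBC.abs.pow 3)).const_mul _)) fun x => ?_
  have hn : C₀ * (d + N x) ≤ n₀ := by
    refine le_trans ?_ hε'
    have : d + N x ≤ 2 * ε := by linarith [S.d_le, S.N_le x]
    calc C₀ * (d + N x) ≤ C₀ * (2 * ε) := by gcongr
      _ = _ := by ring
  have h1 := h U s σ (vb x) (θb x) (φ x) (ψ x) (ζ x) (C₀ * (d + N x)) S.base S.σ_mem (S.vb_mem x)
    (S.θb_mem x) (S.v_mem x) (S.vb_near x) (S.θb_near x)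
    (S.speed.trans (by gcongr; linarith [S.N_nonneg x])) hn ((S.φ_le x).trans hε)
    ((S.ψ_le x).trans hε) ((S.ζ_le x).trans hε)
  unfold Gas.fluxDefect Gas.transversal
  refine h1.trans (le_of_eq ?_)
  ring

lemma Gas.IsBase.le_nonlin {g : Gas} {m L s : ℝ} {U : State} (h : g.IsBase m L U s) :
    (g.γ + 1) * m / (2 * L) ≤ g.nonlin U s := by
  have hγ := g.γ_pos
  have hm := h.m_pos
  have hL := h.L_pos
  have hv := h.adm.1
  have e : g.nonlin U s = (g.γ + 1) * s / (2 * U.v) := by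
    have := h.nonlin_mul_v
    rw [eq_div_iff (by positivity)]; linarith
  rw [e]
  have := h.s_pos
  gcongr
  exacts [h.s_mem.1, h.v_mem.2]

/-- The shock functional is controlled by the 3-wave component and the transversal part. -/
lemma Snapshot.functional_le {g : Gas} {m L τ C₀ ε : ℝ} {U : State} {s σ d : ℝ}
    {w ρ ϑ N vb θb φ ψ ζ : ℝ → ℝ} (S : Snapshot g m L τ C₀ ε U s σ d w ρ ϑ N vb θb φ ψ ζ) :
    ∫ x, ρ x * (φ x ^ 2 + ψ x ^ 2 + ζ x ^ 2) ≤
      (2 + 2 * m⁻¹ ^ 2 + 2 * ((g.γ - 1) * L / (g.R * m)) ^ 2 + 1) *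
        ((∫ x, ρ x * ψ x ^ 2) + ∫ x, ρ x * g.transversal U s (φ x) (ψ x) (ζ x)) := by
  have F := S.front
  have hψ2 := S.ψ_mem.isBC.pow 2
  set B := (g.γ - 1) * L / (g.R * m)
  rw [← F.integral_add hψ2 S.isBC_transversal, ← IsFront.integral_const_mul]
  refine F.integral_mono (((S.φ_mem.isBC.pow 2).add hψ2).add (S.ζ_mem.isBC.pow 2))
    ((hψ2.add S.isBC_transversal).const_mul _) fun x => ?_
  have hs := S.base.s_pos
  have hm := S.base.m_pos
  have hb0 := S.base.slopeθ_pos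
  have hbB := S.base.slopeθ_le
  set X := φ x + ψ x / s with hX
  set Z := ζ x - g.slopeθ U s * ψ x with hZ
  have h1 : φ x ^ 2 ≤ 2 * X ^ 2 + 2 * (m⁻¹ ^ 2 * ψ x ^ 2) := by
    have e : φ x = X - ψ x / s := by rw [hX]; ring
    have h2 : (ψ x / s) ^ 2 ≤ m⁻¹ ^ 2 * ψ x ^ 2 := by
      rw [div_eq_inv_mul, mul_pow]
      gcongr
      exact S.base.s_mem.1
    have h3 := sq_nonneg (X + ψ x / s)
    rw [e]
    linarith
  have h2 : ζ x ^ 2 ≤ 2 * Z ^ 2 + 2 * (B ^ 2 * ψ x ^ 2) := by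
    have e : ζ x = Z + g.slopeθ U s * ψ x := by rw [hZ]; ring
    have h2 : (g.slopeθ U s * ψ x) ^ 2 ≤ B ^ 2 * ψ x ^ 2 := by
      rw [mul_pow]; gcongr
    have h3 := sq_nonneg (Z - g.slopeθ U s * ψ x)
    rw [e]
    linarith
  unfold Gas.transversal
  rw [← hX, ← hZ]
  have h3 : 0 ≤ ψ x ^ 2 := sq_nonneg _
  have h4 : 0 ≤ m⁻¹ ^ 2 * X ^ 2 := by positivity
  have h5 : 0 ≤ m⁻¹ ^ 2 * Z ^ 2 := by positivity
  have h6 : 0 ≤ B ^ 2 * X ^ 2 := by positivity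
  have h7 : 0 ≤ B ^ 2 * Z ^ 2 := by positivity
  have h8 := sq_nonneg X
  have h9 := sq_nonneg Z
  linarith

set_option maxHeartbeats 1000000 in
/-- The estimate at a fixed time. -/
theorem snapshot_estimate (g : Gas) {m K Mm : ℝ} (L : ℝ) (hm : 0 < m) (hK : 0 < K) (hMm : 0 < Mm) :
    ∃ τ : ℝ, 0 < τ ∧ τ ≤ 1 ∧ ∀ C₀ : ℝ, 0 < C₀ → ∃ ε η c C : ℝ, 0 < ε ∧ 0 < η ∧ 0 < c ∧ 0 < C ∧
    ∀ {U : State} {s σ d : ℝ} {w ρ ϑ N vb θb φ ψ ζ : ℝ → ℝ},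
    Snapshot g m L τ C₀ ε U s σ d w ρ ϑ N vb θb φ ψ ζ → ∀ lam M q : ℝ, d ≤ η * lam →
      lam ≤ K * √d → g.nonlin U s ≤ M * s ^ 2 → M ≤ Mm → IsBC ρ → 0 ≤ q →
      (lam / d) ^ 2 * ∫ x, (ρ x * N x) ^ 2 ≤ (q ^ 3) ^ 2 →
    -(M / (2 * d)) * (∫ x, (1 + lam / d * w x) * (-σ * ρ x * ψ x
        + g.R * ϑ x / ((g.γ - 1) * θb x) * ζ x + g.R * θb x / vb x * ρ x / vb x * φ x)) ^ 2
      + (∫ x, (1 + lam / d * w x) * ρ x * ((g.γ + 1) * g.p U * s / (2 * U.v ^ 2) * φ x ^ 2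
        + g.R * s / (2 * U.v * U.θ) * ζ x ^ 2 - g.p U * s / (U.v * U.θ) * (φ x * ζ x)))
      + lam / d * (∫ x, ρ x * g.fluxDefect σ (vb x) (θb x) (φ x) (ψ x) (ζ x))
      - 3 / 4 * (∫ x, (1 + lam / d * w x) * (g.μ / (vb x + φ x) * deriv ψ x ^ 2
        + g.κ / ((vb x + φ x) * (θb x + ζ x)) * deriv ζ x ^ 2))
      ≤ -c * (∫ x, ρ x * (φ x ^ 2 + ψ x ^ 2 + ζ x ^ 2)) + C * q ^ 4 := by
  rcases lt_or_ge L m with hLm | hLm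
  · exact ⟨1, one_pos, le_rfl, fun C₀ _ => ⟨1, 1, 1, 1, one_pos, one_pos, one_pos, one_pos,
      fun S => absurd (S.base.v_mem.1.trans S.base.v_mem.2) (not_le.2 hLm)⟩⟩
  have hL := hm.trans_le hLm
  have hγ := g.γ_pos
  have hR := g.R_pos
  have hμ := g.μ_pos
  have hκ := g.κ_pos
  have hb := g.dissip_pos
  have hγ1 := g.γ_sub_pos
  obtain ⟨Cs, hCs, hshift⟩ := shift_contribution g L hm
  obtain ⟨c₀, Cf, n₀, hc₀, hCf, hn₀, hflux⟩ := flux_contribution g L hm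
  set α₀ := (g.γ + 1) * m / (2 * L) with hα₀
  have hα₀0 : 0 < α₀ := by positivity
  set KB := 21 * ((g.γ + 1) * L * L / m ^ 2 + g.R * L / m ^ 2 + L * L / m ^ 2) with hKB
  have hKB0 : 0 < KB := by positivity
  set KD := 24 * ((g.γ + 1) * L) * g.κ / (m ^ 2 * g.dissip) with hKD
  have hKD0 : 0 < KD := by positivity
  set c₁ := 18 / 1250 * g.μ / L with hc₁
  have hc₁0 : 0 < c₁ := by positivity
  -- Bounds the relative error in the shift integrand, so that its square costs at most `α₀ / 30`.
  set h₀ := min 1 (α₀ / (30 * (Mm * Cs))) with hh₀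
  have hh₀0 : 0 < h₀ := by positivity
  have hh1 : h₀ ≤ 1 := min_le_left _ _
  -- The tolerance `τ` must not depend on `C₀`: the latter contains constants of the shock profile,
  -- which are produced only after `τ` is given.
  refine ⟨min ((g.γ + 1) * m / 50) (h₀ / 3), by positivity,
    (min_le_right _ _).trans (by linarith), fun C₀ hC₀ => ?_⟩
  set τ := min ((g.γ + 1) * m / 50) (h₀ / 3) with hτ
  have hτ0 : 0 < τ := by positivity
  -- The allowed size of `lam`. The bound `1/21` turns `21/20 (1 + lam)` into at most `11/10`; the
  -- last bound makes the flux error of order `lam` cost `α₀ / 30`.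
  set e₁ := min (h₀ / 3) (min (1 / 21) (α₀ / (30 * (Cf * C₀)))) with he₁
  have he₁0 : 0 < e₁ := by positivity
  -- With this weight the interaction term consumes at most a quarter of the saved dissipation `c₁
  -- E`.
  set Λ := 1 + 4 * (Cf * C₀) / c₁ with hΛ
  have hΛ1 : 1 ≤ Λ := by rw [hΛ]; have : 0 < 4 * (Cf * C₀) / c₁ := by positivity
                         linarith
  -- The first entry forces `lam ≤ e₁` through `lam ≤ K √d` and `d ≤ ε`; the others are the
  -- smallness conditions of the four contributions and of the two interpolations.
  set ε := min ((e₁ / K) ^ 2) (min n₀ (min (n₀ / (2 * C₀)) (min (m / 49 / (2 * C₀ + 1))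
    (min (h₀ / 3 / (2 * C₀)) (min (α₀ / (30 * (Cf * K))) (min (c₁ / (4 * (Cf * K))) (1 / 2)))))))
    with hε
  have hε0 : 0 < ε := by positivity
  -- The denominator is the sum of all transversal costs plus one, so that a full `X` is left over.
  set η := c₀ / (Mm * Cs + 2 * KB + KD + 1) with hη
  have hη0 : 0 < η := by positivity
  set Cg := 2 + 2 * m⁻¹ ^ 2 + 2 * ((g.γ - 1) * L / (g.R * m)) ^ 2 + 1 with hCg
  have hCg0 : 0 < Cg := by positivity
  refine ⟨ε, η, min (α₀ / 10) 1 / Cg, Cf * C₀ * Λ, hε0, hη0, by positivity, by positivity,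
    fun {U s σ d w ρ ϑ N vb θb φ ψ ζ} S lam M q hdl hlK hMs hM hρ hq hQ => ?_⟩
  have F := S.front
  have hd := F.d_pos
  have hs := S.base.s_pos
  have hl0 : 0 < lam := by
    by_contra! hneg
    have := mul_nonpos_of_nonneg_of_nonpos hη0.le hneg
    linarith
  have hα := S.base.nonlin_pos
  have hαα₀ : α₀ ≤ g.nonlin U s := S.base.le_nonlin
  have hM0 : 0 ≤ M := by
    by_contra! hneg
    have := mul_neg_of_neg_of_pos hneg (pow_pos hs 2)
    linarith
  -- smallness
  have ε1 : ε ≤ (e₁ / K) ^ 2 := min_le_left _ _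
  have ε' : ε ≤ _ := min_le_right _ _
  simp only [le_min_iff] at ε'
  obtain ⟨ε2, ε3, ε4, ε5, ε6, ε7, ε8⟩ := ε'
  rw [le_div_iff₀ (by positivity)] at ε3 ε4 ε5 ε6 ε7
  have hle₁ : lam ≤ e₁ := by
    have h1 : √d ≤ e₁ / K := by
      rw [← Real.sqrt_sq (show 0 ≤ e₁ / K by positivity)]
      exact Real.sqrt_le_sqrt (S.d_le.trans ε1)
    calc lam ≤ K * √d := hlK
      _ ≤ K * (e₁ / K) := by gcongr
      _ = e₁ := by field_simp
  have hle' := hle₁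
  rw [he₁] at hle'
  simp only [le_min_iff] at hle'
  obtain ⟨l1, l2, l3⟩ := hle'
  rw [le_div_iff₀ (by positivity)] at l3
  have hh2 : h₀ * (30 * (Mm * Cs)) ≤ α₀ := by
    rw [← le_div_iff₀ (by positivity)]; exact min_le_right _ _
  have hτ1 : τ ≤ (g.γ + 1) * m / 50 := min_le_left _ _
  have hτ2 : τ ≤ h₀ / 3 := min_le_right _ _
  -- the four contributions
  have s1 := hshift S lam M (2 * C₀ * ε) hl0.le (by linarith) (by linarith) hτ0.le hC₀.le le_rfl
    (by linarith) hM0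
  have s2 := S.wave_contribution hl0.le
  have s3 := hflux S hC₀.le ε2 (by linarith)
  have s4 := S.dissipation_contribution hl0.le hC₀.le (by linarith) hτ0.le hτ1
  have s5 := S.cubic_le hl0.le hlK
  have s6 := S.interaction_le hl0.le hρ hq ε8 hΛ1 hQ
  have s7 := S.functional_le
  set X := ∫ x, ρ x * g.transversal U s (φ x) (ψ x) (ζ x) with hX
  have hX0 : 0 ≤ X := F.integral_nonneg fun x => g.transversal_nonneg _ _ _ _ _
  set A := ∫ x, ρ x * ψ x ^ 2 with hA
  have hA0 : 0 ≤ A := F.integral_nonneg fun _ => sq_nonneg _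
  set E := ∫ x, deriv ψ x ^ 2 with hE
  have hE0 : 0 ≤ E := MeasureTheory.integral_nonneg fun _ => sq_nonneg _
  set P := (∫ x, ρ x * ψ x) ^ 2 / d with hP
  have hP0 : 0 ≤ P := by positivity
  rw [← hKB] at s2
  rw [← hKD, ← hc₁] at s4
  rw [← hCg] at s7
  generalize (∫ x, (1 + lam / d * w x) * (-σ * ρ x * ψ x
        + g.R * ϑ x / ((g.γ - 1) * θb x) * ζ x + g.R * θb x / vb x * ρ x / vb x * φ x)) = I at s1 ⊢
  generalize (∫ x, (1 + lam / d * w x) * ρ x * ((g.γ + 1) * g.p U * s / (2 * U.v ^ 2) * φ x ^ 2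
        + g.R * s / (2 * U.v * U.θ) * ζ x ^ 2 - g.p U * s / (U.v * U.θ) * (φ x * ζ x))) = B₁
    at s2 ⊢
  generalize (∫ x, ρ x * g.fluxDefect σ (vb x) (θb x) (φ x) (ψ x) (ζ x)) = F₁ at s3 ⊢
  generalize (∫ x, (1 + lam / d * w x) * (g.μ / (vb x + φ x) * deriv ψ x ^ 2
        + g.κ / ((vb x + φ x) * (θb x + ζ x)) * deriv ζ x ^ 2)) = D₁ at s4 ⊢
  generalize (∫ x, ρ x * (φ x ^ 2 + ψ x ^ 2 + ζ x ^ 2)) = G₁ at s7 ⊢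
  generalize (∫ x, ρ x * (N x * ψ x ^ 2)) = N₁ at s3 s6
  generalize (∫ x, ρ x * |ψ x| ^ 3) = T₁ at s3 s5
  set α := g.nonlin U s with hαdef
  -- shift
  have t1 : -(3 / 2 * (M * s ^ 2)) * P ≤ -(3 / 2 * α) * P := by
    have := mul_le_mul_of_nonneg_right hMs hP0
    linarith
  have t2 : M * Cs * (X + (2 * C₀ * ε + τ + lam) ^ 2 * A) ≤ Mm * Cs * X + α₀ / 30 * A := by
    have h1 : (2 * C₀ * ε + τ + lam) ^ 2 ≤ h₀ := by
      have h2 : 2 * C₀ * ε + τ + lam ≤ h₀ := by linarith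
      have h3 : 0 ≤ 2 * C₀ * ε + τ + lam := by positivity
      calc (2 * C₀ * ε + τ + lam) ^ 2 ≤ h₀ ^ 2 := pow_le_pow_left₀ h3 h2 2
        _ = h₀ * h₀ := sq h₀
        _ ≤ h₀ * 1 := by gcongr
        _ = h₀ := mul_one _
    calc M * Cs * (X + (2 * C₀ * ε + τ + lam) ^ 2 * A) ≤ Mm * Cs * (X + h₀ * A) := by gcongr
      _ = Mm * Cs * X + (h₀ * (30 * (Mm * Cs))) / 30 * A := by ring
      _ ≤ _ := by gcongr
  -- wave
  have t3 : (1 + lam) * (21 / 20 * α * A + KB * X) ≤ 11 / 10 * (α * A) + 2 * KB * X := by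
    have h1 : 0 ≤ α * A := by positivity
    have h2 : 0 ≤ KB * X := by positivity
    have h3 := mul_le_mul_of_nonneg_right l2 h1
    have h4 := mul_le_mul_of_nonneg_right l2 h2
    linarith
  -- flux
  have hld : 0 < lam / d := by positivity
  have t4 : lam / d * F₁ ≤ -(c₀ * (lam / d)) * X + Cf * C₀ * lam * A
      + Cf * C₀ * (lam / d * N₁) + Cf * (lam / d * T₁) := by
    have h1 := mul_le_mul_of_nonneg_left s3 hld.le
    have h2 : lam / d * (-c₀ * X + Cf * (C₀ * d * A + C₀ * N₁ + T₁)) =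
        -(c₀ * (lam / d)) * X + Cf * C₀ * (lam / d * d) * A
      + Cf * C₀ * (lam / d * N₁) + Cf * (lam / d * T₁) := by ring
    rw [div_mul_cancel₀ _ hd.ne'] at h2
    linarith
  have t5 : Cf * C₀ * (lam / d * N₁) ≤ Cf * C₀ * Λ * q ^ 4 + c₁ / 4 * E := by
    have h1 := mul_le_mul_of_nonneg_left s6 (show 0 ≤ Cf * C₀ by positivity)
    have h2 : Cf * C₀ * (E / Λ) ≤ c₁ / 4 * E := by
      have hΛ0 : 0 < Λ := by linarith
      rw [mul_div_assoc', div_le_iff₀ hΛ0]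
      have h3 : c₁ / 4 * E * Λ = c₁ / 4 * E + Cf * C₀ * E := by rw [hΛ]; field_simp
      have h4 : 0 ≤ c₁ / 4 * E := by positivity
      linarith
    linarith
  have t6 : Cf * (lam / d * T₁) ≤ c₁ / 4 * E + α₀ / 30 * A := by
    have h1 := mul_le_mul_of_nonneg_left s5 hCf.le
    have h2 := mul_le_mul_of_nonneg_right ε6 hA0
    have h3 := mul_le_mul_of_nonneg_right ε7 hE0
    linarith
  have t7 : Cf * C₀ * lam * A ≤ α₀ / 30 * A := by
    have h1 := mul_le_mul_of_nonneg_right l3 hA0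
    linarith
  have t8 : (Mm * Cs + 2 * KB + KD + 1) * X ≤ c₀ * (lam / d) * X := by
    refine mul_le_mul_of_nonneg_right ?_ hX0
    rw [mul_div_assoc', le_div_iff₀ hd]
    have : (Mm * Cs + 2 * KB + KD + 1) * (η * lam) = c₀ * lam := by
      rw [hη]; field_simp
    have h2 := mul_le_mul_of_nonneg_left hdl (show 0 ≤ Mm * Cs + 2 * KB + KD + 1 by positivity)
    linarith
  have t9 : α₀ * A ≤ α * A := by gcongr
  have t10 : min (α₀ / 10) 1 / Cg * G₁ ≤ α₀ / 10 * A + X := by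
    rw [div_mul_eq_mul_div, div_le_iff₀ hCg0]
    set k := min (α₀ / 10) 1 with hk
    have hk0 : 0 < k := by positivity
    have h1 : k * A ≤ α₀ / 10 * A := mul_le_mul_of_nonneg_right (min_le_left _ _) hA0
    have h2 : k * X ≤ 1 * X := mul_le_mul_of_nonneg_right (min_le_right _ _) hX0
    have h3 := mul_le_mul_of_nonneg_left s7 hk0.le
    have h4 := mul_le_mul_of_nonneg_right (add_le_add h1 h2) hCg0.le
    linarith
  have t11 : 0 ≤ α * P := by positivity
  have t12 : 0 ≤ c₁ * E := by positivity
  -- The balance: `11/10 α A - 13/10 α (A - P) - 3/2 α P = -1/5 α (A + P)`. The three errors of size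
  -- `α₀ / 30` use half of the gain in `A`; the other half, together with the spare `X`, bounds the
  -- shock functional.
  clear_value X A E P α KB KD c₁ Λ Cg α₀ e₁ h₀ η ε
  linarith

/-- The integrand in the equation for the shift is dominated by the front. -/
theorem shift_integrand_le (g : Gas) {m : ℝ} (L : ℝ) (hm : 0 < m) : ∃ C : ℝ, 0 < C ∧
    ∀ {τ C₀ ε : ℝ} {U : State} {s σ d : ℝ} {w ρ ϑ N vb θb φ ψ ζ : ℝ → ℝ},
    Snapshot g m L τ C₀ ε U s σ d w ρ ϑ N vb θb φ ψ ζ → ∀ lam : ℝ, 0 ≤ lam → lam ≤ 1 → τ ≤ 1 →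
      0 ≤ τ → 0 ≤ C₀ → 2 * C₀ * ε ≤ 1 → ∀ x,
    |(1 + lam / d * w x) * (-σ * ρ x * ψ x
        + g.R * ϑ x / ((g.γ - 1) * θb x) * ζ x + g.R * θb x / vb x * ρ x / vb x * φ x)|
      ≤ C * ε * ρ x := by
  rcases lt_or_ge L m with hLm | hLm
  · exact ⟨1, one_pos, fun S => absurd (S.base.v_mem.1.trans S.base.v_mem.2) (not_le.2 hLm)⟩
  have hL := hm.trans_le hLm
  have hR := g.R_pos; have hγ := g.γ_sub_pos
  obtain ⟨C, hC, hbd⟩ := shift_integrand_bound g L hm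
  set B := (g.γ - 1) * L / (g.R * m) with hB
  have hB0 : 0 < B := by positivity
  refine ⟨C * (1 + m⁻¹ + (1 + B)) + 3 * C + 2 * L, by positivity,
    fun {τ C₀ ε U s σ d w ρ ϑ N vb θb φ ψ ζ} S lam hl hl1 hτ hτ0 hC₀ hn x => ?_⟩
  have F := S.front
  have hε := S.ε_pos
  have hs := S.base.s_pos
  have hb := S.base.slopeθ_pos
  have hεn : C₀ * (d + N x) ≤ 1 := by
    refine le_trans ?_ hn
    have : d + N x ≤ 2 * ε := by linarith [S.d_le, S.N_le x]
    calc C₀ * (d + N x) ≤ C₀ * (2 * ε) := by gcongr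
      _ = _ := by ring
  have hw := S.weight_mem hl x
  have h1 := hbd U s σ (vb x) (θb x) (φ x) (ψ x) (ζ x) 1 (1 + lam / d * w x) lam τ (ρ x) (ϑ x)
      S.base S.σ_mem (S.vb_mem x) (S.θb_mem x) ((S.vb_near x).trans hεn)
      ((S.θb_near x).trans hεn) (S.speed.trans (le_trans (by
        gcongr; linarith [S.N_nonneg x]) hεn)) le_rfl hw.1 hw.2 hl1 hτ (F.pos x).le (S.ϑ_near x)
  set J := (1 + lam / d * w x) * (-σ * ρ x * ψ x
        + g.R * ϑ x / ((g.γ - 1) * θb x) * ζ x + g.R * θb x / vb x * ρ x / vb x * φ x)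
  have hρ := F.pos x
  have hφ := S.φ_le x
  have hψ := S.ψ_le x
  have hζ := S.ζ_le x
  have h2 : |φ x + ψ x / s| ≤ (1 + m⁻¹) * ε := by
    refine (abs_add_le _ _).trans ?_
    have : |ψ x / s| ≤ m⁻¹ * ε := by
      rw [abs_div, abs_of_pos hs, div_eq_inv_mul]
      gcongr; exact S.base.s_mem.1
    linarith
  have h3 : |ζ x - g.slopeθ U s * ψ x| ≤ (1 + B) * ε := by
    refine (abs_sub _ _).trans ?_
    have : |g.slopeθ U s * ψ x| ≤ B * ε := by
      rw [abs_mul, abs_of_pos hb]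
      gcongr; exact S.base.slopeθ_le
    linarith
  have h4 : C * (1 + τ + lam) * (ρ x * |ψ x|) ≤ C * (1 + 1 + 1) * (ρ x * ε) := by gcongr
  have h5 : C * (ρ x * (|φ x + ψ x / s| + |ζ x - g.slopeθ U s * ψ x|)) ≤
      C * (ρ x * ((1 + m⁻¹) * ε + (1 + B) * ε)) := by gcongr
  have h6 : |2 * s * (ρ x * ψ x)| ≤ 2 * L * (ρ x * ε) := by
    rw [abs_mul, abs_mul (ρ x), abs_of_pos hρ, abs_of_pos (by positivity)]
    gcongr; exact S.base.s_mem.2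
  have h7 : |J| ≤ |J + 2 * s * (ρ x * ψ x)| + |2 * s * (ρ x * ψ x)| := by
    have := abs_sub (J + 2 * s * (ρ x * ψ x)) (2 * s * (ρ x * ψ x))
    rwa [add_sub_cancel_right] at this
  calc |J| ≤ _ := h7
    _ ≤ C * (ρ x * ((1 + m⁻¹) * ε + (1 + B) * ε)) + C * (1 + 1 + 1) * (ρ x * ε)
        + 2 * L * (ρ x * ε) := by linarith
    _ = _ := by ring

/-! ### Interaction of the waves -/

namespace Pattern

/-- Distance of the rarefaction wave and of the contact wave from their right end states. -/
noncomputable def waveDist (W : Pattern) (t x : ℝ) : ℝ :=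
  |(W.rare t x).v - W.Us.v| + |(W.rare t x).θ - W.Us.θ| + |W.Θ (x / √(1 + t)) - W.Uc.θ|

lemma waveDist_nonneg (W : Pattern) (t x : ℝ) : 0 ≤ W.waveDist t x := by
  unfold waveDist; positivity

/-- The shock derivative and the distance of the other waves from their right end states are
not simultaneously large. -/
theorem interaction_decay (g : Gas) {m CS cS : ℝ} (L : ℝ) (hm : 0 < m) (hCS : 0 < CS)
    (hcS : 0 < cS) : ∃ C c : ℝ, 0 < C ∧ 0 < c ∧ ∀ (W : Pattern) (τ : ℝ), W.IsBox g m L →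
      W.IsGeneric g → g.WeakShock W.Uc W.shock W.δS (W.σ g) (W.σc g) τ CS cS → W.δS ≤ 1 →
      ContinuousOn (fun z : ℝ × ℝ => (W.rare z.1 z.2).v) (Ici 0 ×ˢ univ) ∧
      ContinuousOn (fun z : ℝ × ℝ => (W.rare z.1 z.2).θ) (Ici 0 ×ˢ univ) ∧
      (∀ t, 0 ≤ t → ∀ x, W.waveDist t x ≤ C * (W.δR + W.δC)) ∧
      ∀ t X, 0 ≤ t → |X| ≤ m / 4 * t → ∀ ξ, W.dvS (ξ - X) * W.waveDist t (ξ + W.σ g * t) ^ 2 ≤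
        C * W.δS ^ 2 * (W.δR + W.δC) ^ 2 * Real.exp (-(c * W.δS * t)) := by
  rcases lt_or_ge L m with hLm | hLm
  · exact ⟨1, 1, one_pos, one_pos, fun W τ hB => absurd
      (hB.base.v_mem.1.trans hB.base.v_mem.2) (not_le.2 hLm)⟩
  have hL := hm.trans_le hLm
  have hR := g.R_pos; have hγ := g.γ_pos
  obtain ⟨CR, hCR, hrare⟩ := rarefaction_bounds (L := L) g hm
  obtain ⟨CC, cC, hCC, hcC, hcont⟩ := contact_bounds (L := L) g hm
  set k := √(g.γ * m / L) with hk
  have hk0 : 0 < k := Real.sqrt_pos.2 (by positivity)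
  -- The smaller of the decay rates of the rarefaction wave and of the contact wave along `x ≥ m t /
  -- 2`.
  set c₂ := min (2 * k) (cC * m ^ 2 / 4) with hc₂
  have hc₂0 : 0 < c₂ := by positivity
  set CN := 2 * CR + CC * (L / g.R) with hCN
  have hCN0 : 0 < CN := by positivity
  set CN' := 2 * CR + CC * (L / g.R) * Real.exp (cC * m ^ 2 / 4) with hCN'
  have hCN'0 : 0 < CN' := by positivity
  refine ⟨CN + CS * CN' ^ 2 + CS * CN ^ 2, min (2 * c₂) (cS * m / 4), by positivity, by positivity,
    fun W τ hB hW hS hd1 => ?_⟩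
  have hd := hB.δS_pos
  have hps : g.p W.Us ∈ Icc m L := by rw [hB.p_eq]; exact hB.base.p_mem
  obtain ⟨r1, r2, r3⟩ := hrare W.Um W.Us W.rare hB.Us_v hB.Us_θ hW.mem_R1
    (by rw [← hB.δR_eq]; exact hB.δR_le) hW.rare
  rw [← hB.δR_eq] at r3
  obtain ⟨k1, k2⟩ := hcont W.Us W.Uc W.Θ hps hB.Us_θ hB.base.θ_mem hW.contact
  have hθC : |W.Uc.θ - W.Us.θ| ≤ L / g.R * W.δC := by
    rw [hB.θ_sub]
    have : 0 ≤ W.δC := abs_nonneg _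
    gcongr
    exact hB.base.p_mem.2
  have hδR : 0 ≤ W.δR := abs_nonneg _
  have hδC : 0 ≤ W.δC := abs_nonneg _
  set Δ := W.δR + W.δC with hΔ
  have hΔ0 : 0 ≤ Δ := add_nonneg hδR hδC
  have hθC' : |W.Uc.θ - W.Us.θ| ≤ L / g.R * Δ :=
    hθC.trans (by gcongr; linarith)
  have hNb : ∀ t, 0 ≤ t → ∀ x, W.waveDist t x ≤ CN * Δ := fun t ht x => by
    obtain ⟨a1, a2, -⟩ := r3 t ht x
    have a3 := k1 (x / √(1 + t))
    have a4 : CC * |W.Uc.θ - W.Us.θ| ≤ CC * (L / g.R * Δ) := by gcongr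
    have a5 : CR * W.δR ≤ CR * Δ := by gcongr; linarith
    have : CN * Δ = 2 * (CR * Δ) + CC * (L / g.R * Δ) := by rw [hCN]; ring
    unfold waveDist
    linarith
  refine ⟨r1, r2, fun t ht x => (hNb t ht x).trans ?_, fun t X ht hX ξ => ?_⟩
  · have : 0 ≤ CS * CN' ^ 2 + CS * CN ^ 2 := by positivity
    gcongr
    linarith
  have hσ := hB.σ_mem.1
  have hρ : 0 < W.dvS (ξ - X) := hS.pos _
  have hN0 := W.waveDist_nonneg t (ξ + W.σ g * t)
  have hσt : m * t ≤ W.σ g * t := by gcongr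
  set x := ξ + W.σ g * t with hx
  set c := min (2 * c₂) (cS * m / 4) with hc
  have hc0 : 0 < c := by positivity
  have hd2 : 0 ≤ W.δS ^ 2 := sq_nonneg _
  -- The centre of the shifted shock lies at `σ t + X ≥ 3/4 m t`, so the line `x = m t / 2`
  -- separates it from the slower waves.
  rcases le_or_gt (m * t / 2) x with hxt | hxt
  · -- ahead of the shock the other waves are exponentially close to their end states
    have hmt : 0 ≤ m * t := by positivity
    have hx0 : 0 ≤ x := by linarith
    obtain ⟨-, -, a3⟩ := r3 t ht x
    obtain ⟨a1, a2⟩ := a3 hx0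
    have hE : Real.exp (2 * g.lam1 W.Us * t) ≤ Real.exp (-(c₂ * t)) := by
      refine Real.exp_le_exp.2 ?_
      have hlam : g.lam1 W.Us ≤ -k := by
        unfold Gas.lam1
        rw [neg_le_neg_iff, hk]
        refine Real.sqrt_le_sqrt ?_
        have := hB.Us_v.1
        have : 0 < W.Us.v := hm.trans_le this
        have := hm.trans_le hps.1
        gcongr
        exacts [hps.1, hB.Us_v.2]
      have h1 : c₂ * t ≤ 2 * k * t := by gcongr; exact min_le_left _ _
      have h2 : g.lam1 W.Us * t ≤ -k * t := by gcongr
      linarith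
    have hz : 0 ≤ x / √(1 + t) := by positivity
    have hE2 : Real.exp (-(cC * (x / √(1 + t)) ^ 2)) ≤
        Real.exp (cC * m ^ 2 / 4) * Real.exp (-(c₂ * t)) := by
      rw [← Real.exp_add]
      refine Real.exp_le_exp.2 ?_
      have h1 : c₂ * t ≤ cC * m ^ 2 / 4 * t := by gcongr; exact min_le_right _ _
      -- The lower bound is `t - 1` rather than `t` because of the denominator `1 + t`; the defect
      -- is the constant factor `exp (cC m² / 4)`.
      have h2 : m ^ 2 / 4 * (t - 1) ≤ (x / √(1 + t)) ^ 2 := by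
        rw [div_pow, Real.sq_sqrt (by linarith), le_div_iff₀ (by linarith)]
        have h3 : (m * t / 2) ^ 2 ≤ x ^ 2 := pow_le_pow_left₀ (by positivity) hxt 2
        have h4 : m ^ 2 / 4 * (t - 1) * (1 + t) = (m * t / 2) ^ 2 - m ^ 2 / 4 := by ring
        have h5 : 0 ≤ m ^ 2 / 4 := by positivity
        linarith
      have h3 := mul_le_mul_of_nonneg_left h2 hcC.le
      linarith
    have hN : W.waveDist t x ≤ CN' * Δ * Real.exp (-(c₂ * t)) := by
      have b1 : CR * W.δR * Real.exp (2 * g.lam1 W.Us * t) ≤ CR * Δ * Real.exp (-(c₂ * t)) := by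
        have : W.δR ≤ Δ := by linarith
        gcongr
      have b2 := k2 (x / √(1 + t)) hz
      have b3 : CC * |W.Uc.θ - W.Us.θ| * Real.exp (-(cC * (x / √(1 + t)) ^ 2)) ≤
          CC * (L / g.R * Δ) * (Real.exp (cC * m ^ 2 / 4) * Real.exp (-(c₂ * t))) := by gcongr
      have b4 : CN' * Δ * Real.exp (-(c₂ * t)) = 2 * (CR * Δ * Real.exp (-(c₂ * t))) +
          CC * (L / g.R * Δ) * (Real.exp (cC * m ^ 2 / 4) * Real.exp (-(c₂ * t))) := by
        rw [hCN']; ring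
      unfold waveDist
      linarith
    -- Here a decay rate of order one is weakened to one proportional to the strength, using `δ_S ≤
    -- 1`; the part behind the line decays no faster.
    have hexp : Real.exp (-(c₂ * t)) ^ 2 ≤ Real.exp (-(c * W.δS * t)) := by
      rw [← Real.exp_nat_mul]
      refine Real.exp_le_exp.2 ?_
      have h1 : c * W.δS ≤ 2 * c₂ * 1 := by gcongr; exact min_le_left _ _
      have h2 := mul_le_mul_of_nonneg_right h1 ht
      push_cast
      linarith
    calc W.dvS (ξ - X) * W.waveDist t x ^ 2
        ≤ CS * W.δS ^ 2 * (CN' * Δ * Real.exp (-(c₂ * t))) ^ 2 := by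
          gcongr; exact hS.deriv_le _
      _ = CS * CN' ^ 2 * (W.δS ^ 2 * Δ ^ 2 * Real.exp (-(c₂ * t)) ^ 2) := by ring
      _ ≤ (CN + CS * CN' ^ 2 + CS * CN ^ 2) * (W.δS ^ 2 * Δ ^ 2 * Real.exp (-(c * W.δS * t))) := by
          have : 0 ≤ CS * CN ^ 2 := by positivity
          gcongr
          linarith
      _ = _ := by ring
  · -- behind, the shock derivative is exponentially small
    have hξ : ξ - X ≤ -(m / 4 * t) := by
      have := (abs_le.1 hX).1
      linarith
    have hdec := hS.decay (ξ - X) (hξ.trans (by have : 0 ≤ m / 4 * t := by positivity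
                                                linarith))
    have hexp : Real.exp (cS * W.δS * (ξ - X)) ≤ Real.exp (-(c * W.δS * t)) := by
      refine Real.exp_le_exp.2 ?_
      have h1 : cS * W.δS * (ξ - X) ≤ cS * W.δS * -(m / 4 * t) := by gcongr
      have h2 : c * (W.δS * t) ≤ cS * m / 4 * (W.δS * t) := by gcongr; exact min_le_right _ _
      linarith
    calc W.dvS (ξ - X) * W.waveDist t x ^ 2
        ≤ CS * W.δS ^ 2 * Real.exp (-(c * W.δS * t)) * (CN * Δ) ^ 2 := by
          gcongr
          · exact hdec.trans (by gcongr)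
          · exact hNb t ht x
      _ = CS * CN ^ 2 * (W.δS ^ 2 * Δ ^ 2 * Real.exp (-(c * W.δS * t))) := by ring
      _ ≤ (CN + CS * CN' ^ 2 + CS * CN ^ 2) * (W.δS ^ 2 * Δ ^ 2 * Real.exp (-(c * W.δS * t))) := by
          have : 0 ≤ CS * CN' ^ 2 := by positivity
          gcongr
          linarith
      _ = _ := by ring

end Pattern

/-! ### ### The superposition wave as a background -/

namespace Pattern

variable {W : Pattern} {g : Gas} {m L τ CS cS : ℝ}

/-- Each wave is measured from the end state facing its neighbour. Because the pressure is the same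
on both sides of the contact, the volume of the contact wave deviates in proportion to its
temperature. -/
lemma bar_v_sub (hB : W.IsBox g m L) (X : ℝ → ℝ) (t ξ : ℝ) :
    (W.bar g X t ξ).v - W.Uc.v = ((W.rare t (ξ + W.σ g * t)).v - W.Us.v)
      + g.R / g.p W.Uc * (W.Θ ((ξ + W.σ g * t) / √(1 + t)) - W.Uc.θ)
      + ((W.shock (ξ - X t)).v - W.Uc.v) := by
  have hp := hB.base.p_pos
  have h : W.Uc.v = g.R / g.p W.Uc * W.Uc.θ := by
    have := hB.base.R_mul_θ
    field_simp
    linarith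
  have e : (W.bar g X t ξ).v = (W.rare t (ξ + W.σ g * t)).v
      + g.R * W.Θ ((ξ + W.σ g * t) / √(1 + t)) / g.p W.Us
      + (W.shock (ξ - X t)).v - W.Us.v - W.Uc.v := rfl
  rw [e, hB.p_eq, mul_sub, ← h]
  ring

lemma bar_θ_sub (X : ℝ → ℝ) (t ξ : ℝ) :
    (W.bar g X t ξ).θ - W.Uc.θ = ((W.rare t (ξ + W.σ g * t)).θ - W.Us.θ)
      + (W.Θ ((ξ + W.σ g * t) / √(1 + t)) - W.Uc.θ)
      + ((W.shock (ξ - X t)).θ - W.Uc.θ) := by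
  change (W.rare t (ξ + W.σ g * t)).θ + W.Θ ((ξ + W.σ g * t) / √(1 + t))
      + (W.shock (ξ - X t)).θ - W.Us.θ - W.Uc.θ - W.Uc.θ = _
  ring

lemma isFront (hB : W.IsBox g m L)
    (hS : g.WeakShock W.Uc W.shock W.δS (W.σ g) (W.σc g) τ CS cS) (X : ℝ) :
    IsFront W.δS (fun x => (W.shock (x - X)).v - W.Uc.v) (fun x => W.dvS (x - X)) where
  d_pos := hB.δS_pos
  hasDerivAt x := by
    have h := ((hS.smooth_v.differentiable (by norm_num)) (x - X)).hasDerivAt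
    exact (h.comp_sub_const x X).sub_const _
  cont := (hS.smooth_v.continuous_deriv (by norm_num)).comp (by fun_prop)
  pos x := hS.pos _
  gt x := hS.gt _
  lt x := hS.lt _
  lim_bot := by
    have h := (hS.lim_bot.comp (tendsto_atBot_add_const_right atBot (-X) tendsto_id)).sub_const
      W.Uc.v
    rw [sub_self] at h
    exact h
  lim_top := by
    have h := (hS.lim_top.comp (tendsto_atTop_add_const_right atTop (-X) tendsto_id)).sub_const
      W.Uc.v
    rw [add_sub_cancel_left] at h
    exact h

/-- The Lipschitz constant with which the superposition wave approaches the base state. -/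
noncomputable def nearConst (g : Gas) (m L CS : ℝ) : ℝ :=
  1 + g.R / m + CS + (g.γ + 1) * L ^ 2 / (4 * m ^ 2)

lemma nearConst_pos (hm : 0 < m) (hCS : 0 < CS) : 0 < nearConst g m L CS := by
  have := g.R_pos; have := g.γ_pos
  unfold nearConst; positivity

/-- The perturbation at a fixed time is a snapshot. -/
theorem snapshot (hB : W.IsBox g m L) (hW : W.IsGeneric g) (hCS : 0 < CS)
    (hS : g.WeakShock W.Uc W.shock W.δS (W.σ g) (W.σc g) τ CS cS)
    (hrv : ContinuousOn (fun z : ℝ × ℝ => (W.rare z.1 z.2).v) (Ici 0 ×ˢ univ))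
    (hrθ : ContinuousOn (fun z : ℝ × ℝ => (W.rare z.1 z.2).θ) (Ici 0 ×ˢ univ))
    {ε : ℝ} {t : ℝ} (ht : 0 ≤ t) (hd : W.δS ≤ ε) (hN : ∀ x, W.waveDist t x ≤ ε)
    (hε : nearConst g m L CS * (2 * ε) ≤ m / 2) (hε' : ε ≤ m / 2) {X : ℝ → ℝ}
    {U : ℝ → ℝ → State} (hφ : MemH1 (W.dv g X U t)) (hψ : MemH1 (W.du g X U t))
    (hζ : MemH1 (W.dθ g X U t)) (hφε : ∀ x, |W.dv g X U t x| ≤ ε)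
    (hψε : ∀ x, |W.du g X U t x| ≤ ε) (hζε : ∀ x, |W.dθ g X U t x| ≤ ε)
    (hψ2 : ∫ x, W.du g X U t x ^ 2 ≤ ε ^ 2) :
    Snapshot g m L τ (nearConst g m L CS) ε W.Uc (W.σc g) (W.σ g) W.δS
      (fun x => (W.shock (x - X t)).v - W.Uc.v) (fun x => W.dvS (x - X t))
      (fun x => W.dθS (x - X t)) (fun x => W.waveDist t (x + W.σ g * t))
      (fun x => (W.bar g X t x).v) (fun x => (W.bar g X t x).θ)
      (W.dv g X U t) (W.du g X U t) (W.dθ g X U t) := by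
  have hm := hB.base.m_pos
  have hR := g.R_pos
  have hγ := g.γ_pos
  have hL := hB.base.L_pos
  have hδ := hB.δS_pos
  set C₀ := nearConst g m L CS with hC₀
  have hC₀0 : 0 < C₀ := nearConst_pos hm hCS
  have hRm : 0 < g.R / m := by positivity
  have hsp : 0 < (g.γ + 1) * L ^ 2 / (4 * m ^ 2) := by positivity
  have hrv' : Continuous fun x => (W.rare t (x + W.σ g * t)).v :=
    hrv.comp_continuous (f := fun x : ℝ => (t, x + W.σ g * t)) (by fun_prop)
      fun x => ⟨ht, mem_univ _⟩
  have hrθ' : Continuous fun x => (W.rare t (x + W.σ g * t)).θ :=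
    hrθ.comp_continuous (f := fun x : ℝ => (t, x + W.σ g * t)) (by fun_prop)
      fun x => ⟨ht, mem_univ _⟩
  have hΘ : Continuous fun x => W.Θ ((x + W.σ g * t) / √(1 + t)) :=
    hW.contact.smooth.continuous.comp (by fun_prop)
  have hSv : Continuous fun x => (W.shock (x - X t)).v :=
    hS.smooth_v.continuous.comp (f := fun x => x - X t) (by fun_prop)
  have hSθ : Continuous fun x => (W.shock (x - X t)).θ :=
    hS.smooth_θ.continuous.comp (f := fun x => x - X t) (by fun_prop)
  have hvn : ∀ x, |(W.bar g X t x).v - W.Uc.v| ≤ C₀ * (W.δS + W.waveDist t (x + W.σ g * t)) :=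
    fun x => by
      rw [bar_v_sub hB]
      set r := (W.rare t (x + W.σ g * t)).v - W.Us.v with hr
      set r' := (W.rare t (x + W.σ g * t)).θ - W.Us.θ with hr'
      set y := W.Θ ((x + W.σ g * t) / √(1 + t)) - W.Uc.θ with hy
      have e : W.waveDist t (x + W.σ g * t) = |r| + |r'| + |y| := rfl
      have h1 : |g.R / g.p W.Uc * y| ≤ g.R / m * |y| := by
        have := hB.base.p_pos
        rw [abs_mul, abs_of_pos (by positivity)]
        gcongr
        exact hB.base.p_mem.1
      have h2 : |(W.shock (x - X t)).v - W.Uc.v| ≤ W.δS := by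
        rw [abs_of_pos (hS.gt _)]; exact (hS.lt _).le
      refine (abs_add_three _ _ _).trans ?_
      rw [e]
      have f1 : C₀ * (W.δS + (|r| + |r'| + |y|)) = W.δS + |r| + |r'| + |y|
          + g.R / m * (W.δS + |r| + |r'|) + g.R / m * |y|
          + (CS + (g.γ + 1) * L ^ 2 / (4 * m ^ 2)) * (W.δS + (|r| + |r'| + |y|)) := by
        rw [hC₀]; unfold nearConst; ring
      have f2 : 0 ≤ g.R / m * (W.δS + |r| + |r'|) := by positivity
      have f3 : 0 ≤ (CS + (g.γ + 1) * L ^ 2 / (4 * m ^ 2)) * (W.δS + (|r| + |r'| + |y|)) := by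
        positivity
      rw [f1]
      linarith [abs_nonneg r', abs_nonneg y]
  have hθn : ∀ x, |(W.bar g X t x).θ - W.Uc.θ| ≤ C₀ * (W.δS + W.waveDist t (x + W.σ g * t)) :=
    fun x => by
      rw [bar_θ_sub]
      set r := (W.rare t (x + W.σ g * t)).v - W.Us.v with hr
      set r' := (W.rare t (x + W.σ g * t)).θ - W.Us.θ with hr'
      set y := W.Θ ((x + W.σ g * t) / √(1 + t)) - W.Uc.θ with hy
      have e : W.waveDist t (x + W.σ g * t) = |r| + |r'| + |y| := rfl
      have h2 := hS.θ_le (x - X t)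
      refine (abs_add_three _ _ _).trans ?_
      rw [e]
      have f1 : C₀ * (W.δS + (|r| + |r'| + |y|)) = W.δS + |r| + |r'| + |y|
          + CS * W.δS + CS * (|r| + |r'| + |y|)
          + (g.R / m + (g.γ + 1) * L ^ 2 / (4 * m ^ 2)) * (W.δS + (|r| + |r'| + |y|)) := by
        rw [hC₀]; unfold nearConst; ring
      have f2 : 0 ≤ CS * (|r| + |r'| + |y|) := by positivity
      have f3 : 0 ≤ (g.R / m + (g.γ + 1) * L ^ 2 / (4 * m ^ 2)) *
          (W.δS + (|r| + |r'| + |y|)) := by positivity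
      rw [f1]
      linarith [abs_nonneg r]
  have hsmall : ∀ x, C₀ * (W.δS + W.waveDist t (x + W.σ g * t)) ≤ m / 2 := fun x => by
    refine le_trans ?_ hε
    gcongr
    linarith [hN (x + W.σ g * t)]
  -- The base value has a margin `m` inside `[m, L]`; half of it is spent on the background and half
  -- on the perturbation.
  have hmem : ∀ {a y z x : ℝ}, a ∈ Icc (2 * m) (L - m) →
      |y - a| ≤ C₀ * (W.δS + W.waveDist t (x + W.σ g * t)) → |z| ≤ m / 2 →
      y + z ∈ Icc m L := fun {a y z x} ha h1 h2 => by
    have h3 := abs_le.1 (h1.trans (hsmall x))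
    have h4 := abs_le.1 h2
    exact ⟨by linarith [ha.1], by linarith [ha.2]⟩
  have h0 : |(0 : ℝ)| ≤ m / 2 := by rw [abs_zero]; positivity
  exact
    { base := hB.base
      σ_mem := hB.σ_mem
      speed := hB.speed.trans (by
        gcongr
        rw [hC₀]; unfold nearConst
        linarith)
      front := isFront hB hS (X t)
      d_le := hd
      rate := fun x => hS.rate _
      ϑ_cont := (hS.smooth_θ.continuous_deriv (by norm_num)).comp (by fun_prop)
      ϑ_near := fun x => hS.deriv_θ _
      vb_cont := by
        change Continuous fun x => (W.rare t (x + W.σ g * t)).v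
          + g.R * W.Θ ((x + W.σ g * t) / √(1 + t)) / g.p W.Us
          + (W.shock (x - X t)).v - W.Us.v - W.Uc.v
        fun_prop
      θb_cont := by
        change Continuous fun x => (W.rare t (x + W.σ g * t)).θ
          + W.Θ ((x + W.σ g * t) / √(1 + t)) + (W.shock (x - X t)).θ - W.Us.θ - W.Uc.θ
        fun_prop
      vb_mem := fun x => by simpa using hmem hB.v_mem (hvn x) h0
      θb_mem := fun x => by simpa using hmem hB.θ_mem (hθn x) h0
      v_mem := fun x => hmem hB.v_mem (hvn x) ((hφε x).trans hε')
      θ_mem := fun x => hmem hB.θ_mem (hθn x) ((hζε x).trans hε')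
      vb_near := hvn
      θb_near := hθn
      N_cont := by unfold waveDist; fun_prop
      N_nonneg := fun x => W.waveDist_nonneg _ _
      N_le := fun x => hN _
      φ_mem := hφ
      ψ_mem := hψ
      ζ_mem := hζ
      φ_le := hφε
      ψ_le := hψε
      ζ_le := hζε
      ψ_sq := hψ2 }

end Pattern

lemma Snapshot.mono {g : Gas} {m L τ C₀ ε ε' : ℝ} {U : State} {s σ d : ℝ}
    {w ρ ϑ N vb θb φ ψ ζ : ℝ → ℝ} (S : Snapshot g m L τ C₀ ε U s σ d w ρ ϑ N vb θb φ ψ ζ)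
    (h : ε ≤ ε') : Snapshot g m L τ C₀ ε' U s σ d w ρ ϑ N vb θb φ ψ ζ :=
  { S with
    d_le := S.d_le.trans h
    N_le := fun x => (S.N_le x).trans h
    φ_le := fun x => (S.φ_le x).trans h
    ψ_le := fun x => (S.ψ_le x).trans h
    ζ_le := fun x => (S.ζ_le x).trans h
    ψ_sq := S.ψ_sq.trans (pow_le_pow_left₀ S.ε_pos.le h 2) }

/-! ### The equation for the shift -/

/-- An absolutely continuous solution of `X' = f` almost everywhere, with `f` continuous, is a
classical solution. -/
lemma hasDerivWithinAt_of_ac {X f : ℝ → ℝ} {T : ℝ} (hT : 0 ≤ T)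
    (hX : AbsolutelyContinuousOnInterval X 0 T) (hf : ContinuousOn f (Icc 0 T))
    (h : ∀ᵐ t ∂(volume.restrict (Icc 0 T)), HasDerivAt X (f t) t) {t : ℝ} (ht : t ∈ Icc 0 T) :
    HasDerivWithinAt X (f t) (Icc 0 T) t := by
  -- Extending `f` by constants makes its primitive differentiable at the end points as well.
  set F : ℝ → ℝ := IccExtend hT ((Icc 0 T).domRestrict f) with hF
  have hFc : Continuous F := hf.domRestrict.Icc_extend'
  have hFf : ∀ s ∈ Icc 0 T, F s = f s := fun s hs => IccExtend_of_mem hT _ hs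
  have hXe : ∀ s ∈ Icc 0 T, X s = X 0 + ∫ r in (0 : ℝ)..s, F r := fun s hs => by
    have h1 : AbsolutelyContinuousOnInterval X 0 s :=
      hX.mono (by rw [uIcc_of_le hs.1, uIcc_of_le hT]; exact Icc_subset_Icc le_rfl hs.2)
    have h2 : ∫ r in (0 : ℝ)..s, F r = ∫ r in (0 : ℝ)..s, deriv X r := by
      refine intervalIntegral.integral_congr_ae ?_
      rw [ae_restrict_iff' measurableSet_Icc] at h
      filter_upwards [h] with r hr hr'
      rw [uIoc_of_le hs.1] at hr'
      have hr2 : r ∈ Icc 0 T := ⟨hr'.1.le, hr'.2.trans hs.2⟩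
      rw [hFf r hr2, (hr hr2).deriv]
    rw [h2, h1.integral_deriv_eq_sub]
    ring
  have hd : HasDerivAt (fun s => X 0 + ∫ r in (0 : ℝ)..s, F r) (F t) t :=
    (intervalIntegral.integral_hasDerivAt_right (hFc.intervalIntegrable _ _)
      (hFc.stronglyMeasurableAtFilter _ _) hFc.continuousAt).const_add _
  rw [hFf t ht] at hd
  exact hd.hasDerivWithinAt.congr hXe (hXe t ht)

lemma abs_le_of_hasDerivWithinAt {X f : ℝ → ℝ} {T B : ℝ} (hX0 : X 0 = 0)
    (h : ∀ t ∈ Icc 0 T, HasDerivWithinAt X (f t) (Icc 0 T) t) (hB : ∀ t ∈ Icc 0 T, |f t| ≤ B)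
    {t : ℝ} (ht : t ∈ Icc 0 T) : |X t| ≤ B * t := by
  have h0 : (0 : ℝ) ∈ Icc 0 T := ⟨le_rfl, ht.1.trans ht.2⟩
  have := Convex.norm_image_sub_le_of_norm_hasDerivWithin_le (f := X) (f' := f) h
    (fun t ht => hB t ht) (convex_Icc 0 T) h0 ht
  rw [hX0, sub_zero, sub_zero, Real.norm_eq_abs, Real.norm_eq_abs, abs_of_nonneg ht.1] at this
  exact this

namespace Pattern

variable {W : Pattern} {g : Gas} {m L τ CS cS : ℝ}

/-- The integrand on the right-hand side of the equation for the shift. -/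
noncomputable def shiftIntegrand (W : Pattern) (g : Gas) (lam : ℝ) (U : ℝ → ℝ → State) (X : ℝ → ℝ)
    (t ξ : ℝ) : ℝ :=
  W.a lam (ξ - X t) *
    (W.duS (ξ - X t) * W.du g X U t ξ
      + g.R * W.dθS (ξ - X t) / ((g.γ - 1) * (W.bar g X t ξ).θ) * W.dθ g X U t ξ
      + g.p (W.bar g X t ξ) * W.dvS (ξ - X t) / (W.bar g X t ξ).v * W.dv g X U t ξ)

lemma shiftIntegrand_eq (hS : g.WeakShock W.Uc W.shock W.δS (W.σ g) (W.σc g) τ CS cS)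
    (lam : ℝ) (U : ℝ → ℝ → State) (X : ℝ → ℝ) (t ξ : ℝ) :
    W.shiftIntegrand g lam U X t ξ =
      (1 + lam / W.δS * ((W.shock (ξ - X t)).v - W.Uc.v)) *
        (-W.σ g * W.dvS (ξ - X t) * W.du g X U t ξ
          + g.R * W.dθS (ξ - X t) / ((g.γ - 1) * (W.bar g X t ξ).θ) * W.dθ g X U t ξ
          + g.R * (W.bar g X t ξ).θ / (W.bar g X t ξ).v * W.dvS (ξ - X t) / (W.bar g X t ξ).v
            * W.dv g X U t ξ) := by
  have h : W.duS (ξ - X t) = -W.σ g * W.dvS (ξ - X t) := hS.deriv_u _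
  unfold shiftIntegrand
  rw [h]
  rfl

/-- The right-hand side of the equation for the shift is continuous in time. -/
theorem continuousOn_shiftRHS {C₀ ε lam M T B : ℝ}
    (hB : W.IsBox g m L) (hW : W.IsGeneric g)
    (hS : g.WeakShock W.Uc W.shock W.δS (W.σ g) (W.σc g) τ CS cS)
    (hrv : ContinuousOn (fun z : ℝ × ℝ => (W.rare z.1 z.2).v) (Ici 0 ×ˢ univ))
    (hrθ : ContinuousOn (fun z : ℝ × ℝ => (W.rare z.1 z.2).θ) (Ici 0 ×ˢ univ))
    {X : ℝ → ℝ} (hX : ContinuousOn X (Icc 0 T)) {U : ℝ → ℝ → State}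
    (hφ : MemCH1 T (W.dv g X U)) (hψ : MemCH1 T (W.du g X U)) (hζ : MemCH1 T (W.dθ g X U))
    (hsnap : ∀ t ∈ Icc 0 T, Snapshot g m L τ C₀ ε W.Uc (W.σc g) (W.σ g) W.δS
      (fun x => (W.shock (x - X t)).v - W.Uc.v) (fun x => W.dvS (x - X t))
      (fun x => W.dθS (x - X t)) (fun x => W.waveDist t (x + W.σ g * t))
      (fun x => (W.bar g X t x).v) (fun x => (W.bar g X t x).θ)
      (W.dv g X U t) (W.du g X U t) (W.dθ g X U t))
    (hbd : ∀ t ∈ Icc 0 T, ∀ ξ, |W.shiftIntegrand g lam U X t ξ| ≤ B * W.dvS (ξ - X t)) :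
    ContinuousOn (W.shiftRHS g lam M U X) (Icc 0 T) := by
  have hm := hB.base.m_pos
  -- Translating by `X t` freezes the shock, so its derivative is a majorant independent of time and
  -- dominated convergence applies.
  have e : ∀ t, W.shiftRHS g lam M U X t =
      -(M / W.δS) * ∫ ξ, W.shiftIntegrand g lam U X t (ξ + X t) := fun t => by
    rw [integral_add_right_eq_self (W.shiftIntegrand g lam U X t)]
    rfl
  have hfun : W.shiftRHS g lam M U X = fun t =>
      -(M / W.δS) * ∫ ξ, W.shiftIntegrand g lam U X t (ξ + X t) := funext e
  rw [hfun]
  intro t ht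
  refine ContinuousWithinAt.mul continuousWithinAt_const ?_
  have hint : Integrable fun ξ => B * W.dvS ξ := by
    have := (isFront hB hS 0).integrable.const_mul B
    simpa using this
  refine continuousWithinAt_of_dominated (bound := fun ξ => B * W.dvS ξ) ?_ ?_ hint
    (ae_of_all _ fun ξ => ?_)
  · filter_upwards [self_mem_nhdsWithin] with s hs
    have h1 := (hsnap s hs).continuous_shift_integrand lam
    have h2 : Continuous (W.shiftIntegrand g lam U X s) := by
      convert h1 using 2 with ξ
      exact shiftIntegrand_eq hS lam U X s ξ
    exact (h2.comp (continuous_add_const (X s))).aestronglyMeasurable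
  · filter_upwards [self_mem_nhdsWithin] with s hs
    refine ae_of_all _ fun ξ => ?_
    have := hbd s hs (ξ + X s)
    rwa [add_sub_cancel_right] at this
  · have hcurve : ContinuousWithinAt (fun s => ξ + X s) (Icc 0 T) t :=
      continuousWithinAt_const.add (hX t ht)
    have hx : ContinuousWithinAt (fun s => ξ + X s + W.σ g * s) (Icc 0 T) t :=
      hcurve.add (continuousWithinAt_const.mul continuousWithinAt_id)
    have hmaps : MapsTo (fun s => (s, ξ + X s + W.σ g * s)) (Icc 0 T) (Ici 0 ×ˢ univ) :=
      fun s hs => ⟨hs.1, mem_univ _⟩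
    have hpair : ContinuousWithinAt (fun s => (s, ξ + X s + W.σ g * s)) (Icc 0 T) t :=
      continuousWithinAt_id.prodMk hx
    have r1 : ContinuousWithinAt (fun s => (W.rare s (ξ + X s + W.σ g * s)).v) (Icc 0 T) t :=
      (hrv (t, ξ + X t + W.σ g * t) (hmaps ht)).comp
        (f := fun s => (s, ξ + X s + W.σ g * s)) hpair hmaps
    have r2 : ContinuousWithinAt (fun s => (W.rare s (ξ + X s + W.σ g * s)).θ) (Icc 0 T) t :=
      (hrθ (t, ξ + X t + W.σ g * t) (hmaps ht)).comp
        (f := fun s => (s, ξ + X s + W.σ g * s)) hpair hmaps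
    have hsq : ContinuousWithinAt (fun s => √(1 + s)) (Icc 0 T) t :=
      (by fun_prop : Continuous fun s : ℝ => √(1 + s)).continuousWithinAt
    have r3 : ContinuousWithinAt (fun s => W.Θ ((ξ + X s + W.σ g * s) / √(1 + s))) (Icc 0 T) t :=
      hW.contact.smooth.continuous.continuousAt.comp_continuousWithinAt
        (hx.div hsq (Real.sqrt_pos.2 (by linarith [ht.1])).ne')
    have cv : ContinuousWithinAt (fun s => (W.bar g X s (ξ + X s)).v) (Icc 0 T) t := by
      have : ContinuousWithinAt (fun s => (W.rare s (ξ + X s + W.σ g * s)).v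
          + g.R * W.Θ ((ξ + X s + W.σ g * s) / √(1 + s)) / g.p W.Us
          + (W.shock ξ).v - W.Us.v - W.Uc.v) (Icc 0 T) t :=
        (((r1.add ((continuousWithinAt_const.mul r3).div_const _)).add
          continuousWithinAt_const).sub continuousWithinAt_const).sub continuousWithinAt_const
      refine this.congr (fun s _ => ?_) ?_ <;>
        · unfold bar Gas.contactWave; simp only [add_sub_cancel_right]
    have cθ : ContinuousWithinAt (fun s => (W.bar g X s (ξ + X s)).θ) (Icc 0 T) t := by
      have : ContinuousWithinAt (fun s => (W.rare s (ξ + X s + W.σ g * s)).θ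
          + W.Θ ((ξ + X s + W.σ g * s) / √(1 + s))
          + (W.shock ξ).θ - W.Us.θ - W.Uc.θ) (Icc 0 T) t :=
        (((r2.add r3).add continuousWithinAt_const).sub continuousWithinAt_const).sub
          continuousWithinAt_const
      refine this.congr (fun s _ => ?_) ?_ <;>
        · unfold bar Gas.contactWave; simp only [add_sub_cancel_right]
    have cφ : ContinuousWithinAt (fun s => W.dv g X U s (ξ + X s)) (Icc 0 T) t :=
      hφ.tendsto_along ht hcurve
    have cψ : ContinuousWithinAt (fun s => W.du g X U s (ξ + X s)) (Icc 0 T) t :=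
      hψ.tendsto_along ht hcurve
    have cζ : ContinuousWithinAt (fun s => W.dθ g X U s (ξ + X s)) (Icc 0 T) t :=
      hζ.tendsto_along ht hcurve
    have hv0 : (W.bar g X t (ξ + X t)).v ≠ 0 :=
      (hm.trans_le ((hsnap t ht).vb_mem (ξ + X t)).1).ne'
    have hθ0 : (g.γ - 1) * (W.bar g X t (ξ + X t)).θ ≠ 0 :=
      mul_ne_zero g.γ_sub_pos.ne' (hm.trans_le ((hsnap t ht).θb_mem (ξ + X t)).1).ne'
    unfold shiftIntegrand Gas.p
    simp only [add_sub_cancel_right]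
    exact continuousWithinAt_const.mul (((continuousWithinAt_const.mul cψ).add
      ((continuousWithinAt_const.div (continuousWithinAt_const.mul cθ) hθ0).mul cζ)).add
      (((((continuousWithinAt_const.mul cθ).div cv hv0).mul continuousWithinAt_const).div cv
        hv0).mul cφ))

end Pattern

/-! ### ### Assembly -/

lemma add_rpow_four_thirds_le {a b : ℝ} (ha : 0 ≤ a) (hb : 0 ≤ b) :
    (a + b) ^ (4 / 3 : ℝ) ≤ 2 ^ (4 / 3 : ℝ) * (a ^ (4 / 3 : ℝ) + b ^ (4 / 3 : ℝ)) := by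
  have key : ∀ {a b : ℝ}, 0 ≤ a → a ≤ b →
      (a + b) ^ (4 / 3 : ℝ) ≤ 2 ^ (4 / 3 : ℝ) * (a ^ (4 / 3 : ℝ) + b ^ (4 / 3 : ℝ)) :=
    fun {a b} ha hab => by
      have hb := ha.trans hab
      calc (a + b) ^ (4 / 3 : ℝ) ≤ (2 * b) ^ (4 / 3 : ℝ) :=
            Real.rpow_le_rpow (by linarith) (by linarith) (by norm_num)
        _ = 2 ^ (4 / 3 : ℝ) * b ^ (4 / 3 : ℝ) := Real.mul_rpow (by norm_num) hb
        _ ≤ _ := by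
          gcongr
          have := Real.rpow_nonneg ha (4 / 3 : ℝ)
          linarith
  rcases le_total a b with h | h
  · exact key ha h
  · rw [add_comm a b, add_comm (a ^ (4 / 3 : ℝ))]; exact key hb h

lemma abs_le_and_sq_le_of_h1NormSq_le {f : ℝ → ℝ} (hf : MemH1 f) {ε : ℝ} (hε : 0 ≤ ε)
    (h : h1NormSq f ≤ ε ^ 2) : (∀ x, |f x| ≤ ε) ∧ ∫ x, f x ^ 2 ≤ ε ^ 2 := by
  refine ⟨fun x => abs_le_of_sq_le_sq ((hf.sq_le_h1NormSq x).trans h) hε, le_trans ?_ h⟩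
  unfold h1NormSq
  exact le_add_of_nonneg_right (integral_nonneg fun _ => sq_nonneg _)

namespace Pattern

variable {W : Pattern} {g : Gas} {m L τ CS cS : ℝ}

lemma shiftConst_eq (hB : W.IsBox g m L) : W.shiftConst g * W.σc g ^ 2 =
    g.nonlin W.Uc (W.σc g) * (1 + 2 * g.κ * (g.γ - 1) ^ 2 / (g.μ * g.R * g.γ)) := by
  have hs := hB.base.s_pos.ne'
  have hv := hB.base.adm.1.ne'
  unfold shiftConst Gas.nonlin pc
  field_simp

/-- The lower bound on `M` needed for the shift to compensate the mean of `ψ`; it holds a fortiori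
for `3/2` times the constant. -/
lemma nonlin_le (hB : W.IsBox g m L) :
    g.nonlin W.Uc (W.σc g) ≤ W.shiftConst g * W.σc g ^ 2 := by
  have := g.μ_pos; have := g.κ_pos; have := g.R_pos; have := g.γ_pos; have := g.γ_sub_pos
  rw [shiftConst_eq hB]
  refine le_mul_of_one_le_right hB.base.nonlin_pos.le ?_
  have : 0 ≤ 2 * g.κ * (g.γ - 1) ^ 2 / (g.μ * g.R * g.γ) := by positivity
  linarith

lemma shiftConst_pos (hB : W.IsBox g m L) : 0 < W.shiftConst g := by
  have h1 := hB.base.nonlin_pos.trans_le (nonlin_le hB)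
  exact pos_of_mul_pos_left h1 (sq_nonneg _)

lemma shiftConst_le (hB : W.IsBox g m L) : W.shiftConst g ≤
    g.γ * (g.γ + 1) * |L| / (2 * m ^ 2 * m ^ 3)
      * (1 + 2 * g.κ * (g.γ - 1) ^ 2 / (g.μ * g.R * g.γ)) := by
  have := g.μ_pos; have := g.κ_pos; have := g.R_pos; have := g.γ_pos; have := g.γ_sub_pos
  have hm := hB.base.m_pos
  have h1 := hB.base.v_mem.1
  have h2 := hB.base.s_mem.1
  have h3 : W.pc g ≤ |L| := hB.base.p_mem.2.trans (le_abs_self L)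
  unfold shiftConst
  gcongr

lemma da_eq (hS : g.WeakShock W.Uc W.shock W.δS (W.σ g) (W.σc g) τ CS cS) (lam ξ : ℝ) :
    W.da lam ξ = lam / W.δS * W.dvS ξ := by
  have h := ((hS.smooth_v.differentiable (by norm_num)) ξ).hasDerivAt
  exact (((h.sub_const W.Uc.v).const_mul (lam / W.δS)).const_add 1).deriv

/-- The weight contributions in terms of the entropy flux. -/
lemma B2_sub_G {C₀ ε : ℝ} (lam : ℝ) {t : ℝ} {X : ℝ → ℝ} {U : ℝ → ℝ → State}
    (hS : g.WeakShock W.Uc W.shock W.δS (W.σ g) (W.σc g) τ CS cS)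
    (S : Snapshot g m L τ C₀ ε W.Uc (W.σc g) (W.σ g) W.δS
      (fun x => (W.shock (x - X t)).v - W.Uc.v) (fun x => W.dvS (x - X t))
      (fun x => W.dθS (x - X t)) (fun x => W.waveDist t (x + W.σ g * t))
      (fun x => (W.bar g X t x).v) (fun x => (W.bar g X t x).θ)
      (W.dv g X U t) (W.du g X U t) (W.dθ g X U t)) :
    W.B2 g lam X U t - W.G g lam X U t = lam / W.δS * ∫ x, W.dvS (x - X t) *
      g.fluxDefect (W.σ g) (W.bar g X t x).v (W.bar g X t x).θ
        (W.dv g X U t x) (W.du g X U t x) (W.dθ g X U t x) := by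
  have F := S.front
  have hv : ∀ x, (W.bar g X t x).v + W.dv g X U t x = (U t x).v := fun x => by unfold dv; ring
  have hθ : ∀ x, (W.bar g X t x).θ + W.dθ g X U t x = (U t x).θ := fun x => by unfold dθ; ring
  have h1 := F.integrable_mul S.isBC_flux
  have h2 := F.integrable_mul S.isBC_entropy
  have e1 : W.B2 g lam X U t = lam / W.δS * ∫ x, W.dvS (x - X t) * (W.du g X U t x *
      (g.R * ((W.bar g X t x).θ + W.dθ g X U t x) / ((W.bar g X t x).v + W.dv g X U t x)
        - g.R * (W.bar g X t x).θ / (W.bar g X t x).v)) := by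
    unfold B2
    rw [← integral_const_mul]
    congr 1; ext x
    rw [da_eq hS, hv, hθ]
    unfold Gas.p
    ring
  have e2 : W.G g lam X U t = lam / W.δS * (W.σ g * ∫ x, W.dvS (x - X t) *
      (g.R * (W.bar g X t x).θ * Phi (((W.bar g X t x).v + W.dv g X U t x) / (W.bar g X t x).v)
      + g.R * (W.bar g X t x).θ / (g.γ - 1)
        * Phi (((W.bar g X t x).θ + W.dθ g X U t x) / (W.bar g X t x).θ)
      + W.du g X U t x ^ 2 / 2)) := by
    unfold G
    rw [mul_left_comm, ← integral_const_mul (lam / W.δS)]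
    congr 2; ext x
    rw [da_eq hS, hv, hθ]
    unfold Gas.relEntropy du
    ring
  rw [e1, e2, ← mul_sub, ← integral_const_mul (W.σ g), ← integral_sub h1 (h2.const_mul _)]
  congr 2; ext x
  unfold Gas.fluxDefect
  ring

lemma D_eq (lam t : ℝ) (X : ℝ → ℝ) (U : ℝ → ℝ → State) :
    W.D g lam X U t = ∫ x, (1 + lam / W.δS * ((W.shock (x - X t)).v - W.Uc.v)) *
      (g.μ / ((W.bar g X t x).v + W.dv g X U t x) * deriv (W.du g X U t) x ^ 2
        + g.κ / (((W.bar g X t x).v + W.dv g X U t x) * ((W.bar g X t x).θ + W.dθ g X U t x))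
          * deriv (W.dθ g X U t) x ^ 2) := by
  have hv : ∀ x, (W.bar g X t x).v + W.dv g X U t x = (U t x).v := fun x => by unfold dv; ring
  have hθ : ∀ x, (W.bar g X t x).θ + W.dθ g X U t x = (U t x).θ := fun x => by unfold dθ; ring
  simp only [hv, hθ]
  rfl

lemma GS_eq (hS : g.WeakShock W.Uc W.shock W.δS (W.σ g) (W.σc g) τ CS cS) (t : ℝ) (X : ℝ → ℝ)
    (U : ℝ → ℝ → State) : W.GS g X U t = ∫ x, W.dvS (x - X t) *
      (W.dv g X U t x ^ 2 + W.du g X U t x ^ 2 + W.dθ g X U t x ^ 2) := by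
  unfold GS
  congr 1; ext x
  rw [abs_of_pos (show 0 < W.dvS (x - X t) from hS.pos _)]

end Pattern

end NSF

open NSF in
theorem lemma4p3 (g : NSF.Gas) (Up : NSF.State) (hUp : Up.Admissible) (K : ℝ) (hK : 0 < K) :
    ∃ δ₀ ε₁ η C₁ C₂ C₃ : ℝ,
      0 < δ₀ ∧ 0 < ε₁ ∧ 0 < η ∧ 0 < C₁ ∧ 0 < C₂ ∧ 0 < C₃ ∧
      ∀ W : NSF.Pattern, W.Up = Up → W.IsGeneric g →
        W.δR < δ₀ → W.δC < δ₀ → W.δS < δ₀ →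
      ∀ lam : ℝ, W.δS ≤ η * lam → lam ≤ K * Real.sqrt W.δS →
      ∀ M : ℝ, (M = W.shiftConst g ∨ M = 3 / 2 * W.shiftConst g) →
      ∀ T : ℝ, 0 < T →
      ∀ (U : ℝ → ℝ → NSF.State) (X : ℝ → ℝ),
        g.IsSolution (W.σ g) T U →
        W.IsShift g lam M T U X →
        NSF.MemCH1 T (W.dv g X U) →
        NSF.MemCH1 T (W.du g X U) → NSF.MemL2H2 T (W.du g X U) →
        NSF.MemCH1 T (W.dθ g X U) → NSF.MemL2H2 T (W.dθ g X U) →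
        (∀ t ∈ Set.Icc 0 T,
          Real.sqrt (NSF.h1NormSq (W.dv g X U t) + NSF.h1NormSq (W.du g X U t)
            + NSF.h1NormSq (W.dθ g X U t)) ≤ ε₁) →
      ∀ t ∈ Set.Icc 0 T,
        DifferentiableWithinAt ℝ X (Set.Icc 0 T) t ∧
        -(W.δS / (2 * M)) * |derivWithin X (Set.Icc 0 T) t| ^ 2
            + W.B1 g lam X U t + W.B2 g lam X U t - W.G g lam X U t - 3 / 4 * W.D g lam X U t
          ≤ -C₁ * W.GS g X U t
            + C₂ * (W.δR ^ (4 / 3 : ℝ) + W.δC ^ (4 / 3 : ℝ)) * W.δS ^ (4 / 3 : ℝ)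
              * Real.exp (-C₃ * W.δS * t) := by
  have hR := g.R_pos; have hγ := g.γ_pos; have hγ1 := g.γ_sub_pos
  have hμ := g.μ_pos; have hκ := g.κ_pos
  obtain ⟨m, L, δ₁, hm, hδ₁, hbox⟩ := exists_isBox g hUp
  set M₁ := g.γ * (g.γ + 1) * |L| / (2 * m ^ 2 * m ^ 3)
      * (1 + 2 * g.κ * (g.γ - 1) ^ 2 / (g.μ * g.R * g.γ)) with hM₁
  have hM₁0 : 0 ≤ M₁ := by positivity
  set Mm := 3 / 2 * M₁ + 1 with hMm
  have hMm0 : 0 < Mm := by positivity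
  -- Order of choice: first `τ`, then the shock constants `CS` and `cS`, then `C₀`, and only then
  -- the smallness `ε` and `η`.
  obtain ⟨τ, hτ, hτ1, hest⟩ := snapshot_estimate g L hm hK hMm0
  obtain ⟨δ₂, CS, cS, hδ₂, hCS, hcS, hws⟩ := exists_weakShock (L := L) g hm hτ
  set C₀ := Pattern.nearConst g m L CS with hC₀
  have hC₀0 : 0 < C₀ := Pattern.nearConst_pos hm hCS
  obtain ⟨ε, η, c, C, hε, hη, hc, hC, hmain⟩ := hest C₀ hC₀0
  obtain ⟨CJ, hCJ, hJ⟩ := shift_integrand_le g L hm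
  obtain ⟨CI, cI, hCI, hcI, hinter⟩ := Pattern.interaction_decay g L hm hCS hcS
  -- The bounds `m / 2` and `m / (4 C₀)` keep background and solution in the box, `1 / (2 C₀)` is
  -- required for the shift integrand, and the last entry yields `|Ẋ| ≤ m / 4`.
  set ε₁ := min ε (min (m / 2) (min (m / (4 * C₀)) (min (1 / (2 * C₀)) (m / (4 * (Mm * CJ))))))
    with hε₁
  have hε₁0 : 0 < ε₁ := by positivity
  have e1 : ε₁ ≤ ε := min_le_left _ _
  have e' : ε₁ ≤ _ := min_le_right _ _
  simp only [le_min_iff] at e'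
  obtain ⟨e2, e3, e4, e5⟩ := e'
  rw [le_div_iff₀ (by positivity)] at e3 e4 e5
  -- In order: the box, the weak shock, `d ≤ ε₁`, the decay of the interaction, `N ≤ ε₁`, and `lam ≤
  -- K √d ≤ 1`.
  set δ₀ := min δ₁ (min δ₂ (min ε₁ (min 1 (min (ε₁ / (2 * CI)) (1 / K ^ 2))))) with hδ₀
  have hδ₀0 : 0 < δ₀ := by positivity
  set Q := (K * √CI) ^ (4 / 3 : ℝ) with hQ
  have hQ0 : 0 < Q := by positivity
  refine ⟨δ₀, ε₁, η, c, C * (Q * 2 ^ (4 / 3 : ℝ)), 2 / 3 * cI, hδ₀0, hε₁0, hη, hc, by positivity,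
    by positivity, fun W hWp hW hdR hdC hdS lam hlη hlK M hM T hT U X _ hsh hφ hψ _ hζ _ hnorm t ht
    => ?_⟩
  rw [hδ₀] at hdR hdC hdS
  simp only [lt_min_iff] at hdR hdC hdS
  obtain ⟨s1, s2, s3, s4, s5, s6⟩ := hdS
  have hB := hbox W hWp hW hdR.1 hdC.1 s1
  have hd := hB.δS_pos
  obtain ⟨hUc, hlt, hσ, hRH⟩ := hW.mem_S3
  have hS : g.WeakShock W.Uc W.shock W.δS (W.σ g) (W.σc g) τ CS cS := by
    have := hws W.Uc W.Up (W.σ g) (W.σc g) W.shock hB.base hB.σ_mem hW.adm hlt hRH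
      (by rw [← hB.δS_eq]; exact s2) hW.shock
    rwa [← hB.δS_eq] at this
  have hl0 : 0 < lam := by
    by_contra! hneg
    have := mul_nonpos_of_nonneg_of_nonpos hη.le hneg
    linarith
  have hl1 : lam ≤ 1 := by
    refine hlK.trans ?_
    rw [lt_div_iff₀ (by positivity)] at s6
    have : √W.δS * K ≤ 1 := by
      rw [← Real.sqrt_sq hK.le, ← Real.sqrt_mul hd.le]
      exact Real.sqrt_le_one.2 s6.le
    linarith
  have hMlow : W.shiftConst g ≤ M := by
    have := Pattern.shiftConst_pos hB
    rcases hM with h | h <;> linarith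
  have hM0 : 0 < M := (Pattern.shiftConst_pos hB).trans_le hMlow
  have hMup : M ≤ Mm := by
    have h1 := Pattern.shiftConst_le hB
    have h2 := Pattern.shiftConst_pos hB
    rw [← hM₁] at h1
    rcases hM with h | h <;> linarith
  have hMs : g.nonlin W.Uc (W.σc g) ≤ M * W.σc g ^ 2 :=
    (Pattern.nonlin_le hB).trans (by gcongr)
  obtain ⟨hrv, hrθ, hNb, hdecay⟩ := hinter W τ hB hW hS s4.le
  have hδR : 0 ≤ W.δR := abs_nonneg _
  have hδC : 0 ≤ W.δC := abs_nonneg _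
  set Δ := W.δR + W.δC with hΔ
  have hΔ0 : 0 ≤ Δ := add_nonneg hδR hδC
  have hNε : ∀ r, 0 ≤ r → ∀ x, W.waveDist r x ≤ ε₁ := fun r hr x => by
    refine (hNb r hr x).trans ?_
    have h1 := hdR.2.2.2.2.1.le
    have h2 := hdC.2.2.2.2.1.le
    calc CI * Δ ≤ CI * (ε₁ / (2 * CI) + ε₁ / (2 * CI)) := by gcongr; linarith
      _ = ε₁ := by field_simp; ring
  -- the snapshots
  have hsnap : ∀ r ∈ Icc 0 T, Snapshot g m L τ C₀ ε₁ W.Uc (W.σc g) (W.σ g) W.δS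
      (fun x => (W.shock (x - X r)).v - W.Uc.v) (fun x => W.dvS (x - X r))
      (fun x => W.dθS (x - X r)) (fun x => W.waveDist r (x + W.σ g * r))
      (fun x => (W.bar g X r x).v) (fun x => (W.bar g X r x).θ)
      (W.dv g X U r) (W.du g X U r) (W.dθ g X U r) := fun r hr => by
    have h0 := (Real.sqrt_le_left hε₁0.le).1 (hnorm r hr)
    have n1 := h1NormSq_nonneg (W.dv g X U r)
    have n2 := h1NormSq_nonneg (W.du g X U r)
    have n3 := h1NormSq_nonneg (W.dθ g X U r)
    obtain ⟨a1, -⟩ := abs_le_and_sq_le_of_h1NormSq_le (hφ.1 r hr) hε₁0.le (by linarith)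
    obtain ⟨a2, a3⟩ := abs_le_and_sq_le_of_h1NormSq_le (hψ.1 r hr) hε₁0.le (by linarith)
    obtain ⟨a4, -⟩ := abs_le_and_sq_le_of_h1NormSq_le (hζ.1 r hr) hε₁0.le (by linarith)
    exact Pattern.snapshot hB hW hCS hS hrv hrθ hr.1 s3.le (hNε r hr.1) (by linarith) e2
      (hφ.1 r hr) (hψ.1 r hr) (hζ.1 r hr) a1 a2 a4 a3
  -- the shift
  have hJb : ∀ r ∈ Icc 0 T, ∀ ξ, |W.shiftIntegrand g lam U X r ξ| ≤
      CJ * ε₁ * W.dvS (ξ - X r) := fun r hr ξ => by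
    rw [Pattern.shiftIntegrand_eq hS]
    exact hJ (hsnap r hr) lam hl0.le hl1 hτ1 hτ.le hC₀0.le (by linarith) ξ
  have hXc : ContinuousOn X (Icc 0 T) := by
    have := hsh.ac.continuousOn
    rwa [uIcc_of_le hT.le] at this
  have hcont := Pattern.continuousOn_shiftRHS (M := M) hB hW hS hrv hrθ hXc hφ hψ hζ hsnap hJb
  have hder : ∀ r ∈ Icc 0 T, HasDerivWithinAt X (W.shiftRHS g lam M U X r) (Icc 0 T) r :=
    fun r hr => hasDerivWithinAt_of_ac hT.le hsh.ac hcont hsh.ode hr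
  -- The shift integrand is at most `CJ ε₁ ρ` and `∫ ρ = δ_S`, so the factor `1 / δ_S` in the
  -- equation cancels.
  have hXb : |X t| ≤ m / 4 * t := by
    refine abs_le_of_hasDerivWithinAt hsh.init hder (fun r hr => ?_) ht
    have F := (hsnap r hr).front
    have h1 : |∫ ξ, W.shiftIntegrand g lam U X r ξ| ≤ CJ * ε₁ * W.δS := by
      rw [← F.integral_eq, ← integral_const_mul]
      exact norm_integral_le_of_norm_le (F.integrable.const_mul _) 
        (ae_of_all _ fun ξ => (Real.norm_eq_abs _).trans_le (hJb r hr ξ))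
    change |-(M / W.δS) * ∫ ξ, W.shiftIntegrand g lam U X r ξ| ≤ m / 4
    rw [abs_mul, abs_neg, abs_of_pos (by positivity)]
    calc M / W.δS * _ ≤ M / W.δS * (CJ * ε₁ * W.δS) := by gcongr
      _ = M * CJ * ε₁ := by field_simp
      _ ≤ Mm * CJ * ε₁ := by gcongr
      _ ≤ m / 4 := by linarith
  refine ⟨(hder t ht).differentiableWithinAt, ?_⟩
  rw [(hder t ht).derivWithin (uniqueDiffOn_Icc hT t ht)]
  -- the interaction term
  have S := hsnap t ht
  have F := S.front
  have hρBC : IsBC fun x => W.dvS (x - X t) :=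
    ⟨F.cont, CS * W.δS ^ 2, fun x => by
      rw [abs_of_pos (F.pos x)]; exact hS.deriv_le _⟩
  -- A bound for `(lam / δ_S) ‖ρ N‖`; its cube root `q` is the variable of Young's inequality, so
  -- the remainder `q ^ 4` is `x₀ ^ (4/3)`. The exponent `1/2` times `4/3` gives the rate `2/3 cI`.
  set x₀ := K * √CI * W.δS * Δ * Real.exp (-(cI * W.δS * t) / 2) with hx₀
  have hx₀0 : 0 ≤ x₀ := by positivity
  set q := x₀ ^ (1 / 3 : ℝ) with hq
  have hq0 : 0 ≤ q := Real.rpow_nonneg hx₀0 _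
  have hq3 : q ^ 3 = x₀ := by
    rw [hq, ← Real.rpow_natCast, ← Real.rpow_mul hx₀0]; norm_num
  have hq4 : q ^ 4 = x₀ ^ (4 / 3 : ℝ) := by
    rw [hq, ← Real.rpow_natCast, ← Real.rpow_mul hx₀0]; norm_num
  have hQint : (lam / W.δS) ^ 2 * ∫ x, (W.dvS (x - X t) * W.waveDist t (x + W.σ g * t)) ^ 2 ≤
      (q ^ 3) ^ 2 := by
    set B := CI * W.δS ^ 2 * Δ ^ 2 * Real.exp (-(cI * W.δS * t)) with hBdef
    have hB0 : 0 ≤ B := by positivity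
    have h1 : ∫ x, (W.dvS (x - X t) * W.waveDist t (x + W.σ g * t)) ^ 2 ≤ W.δS * B := by
      have h2 : ∫ x, W.dvS (x - X t) * (W.dvS (x - X t) * W.waveDist t (x + W.σ g * t) ^ 2) ≤
          ∫ x, W.dvS (x - X t) * B :=
        F.integral_mono (hρBC.mul (S.isBC_N.pow 2)) (IsBC.const B)
          fun x => hdecay t (X t) ht.1 hXb x
      rw [integral_mul_const, F.integral_eq] at h2
      refine le_trans (le_of_eq ?_) h2
      congr 1; ext x; ring
    -- The singular factor `1 / δ_S` is exactly compensated by the mass `δ_S` of the front.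
    have h3 : (lam / W.δS) ^ 2 ≤ K ^ 2 / W.δS := by
      have h4 : lam ^ 2 ≤ K ^ 2 * W.δS := by
        calc lam ^ 2 ≤ (K * √W.δS) ^ 2 := pow_le_pow_left₀ hl0.le hlK 2
          _ = _ := by rw [mul_pow, Real.sq_sqrt hd.le]
      rw [div_pow, div_le_div_iff₀ (by positivity) hd]
      calc lam ^ 2 * W.δS ≤ K ^ 2 * W.δS * W.δS := by gcongr
        _ = _ := by ring
    rw [hq3]
    calc _ ≤ K ^ 2 / W.δS * (W.δS * B) :=
          mul_le_mul h3 h1 (integral_nonneg fun _ => sq_nonneg _) (by positivity)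
      _ = K ^ 2 * CI * W.δS ^ 2 * Δ ^ 2 * Real.exp (-(cI * W.δS * t)) := by
        rw [hBdef]; field_simp
      _ = K ^ 2 * √CI ^ 2 * W.δS ^ 2 * Δ ^ 2 * Real.exp (-(cI * W.δS * t) / 2) ^ 2 := by
        rw [Real.sq_sqrt hCI.le, ← Real.exp_nat_mul]
        congr 2
        push_cast; ring
      _ = x₀ ^ 2 := by rw [hx₀]; ring
  have hfin := hmain (S.mono e1) lam M q hlη hlK hMs hMup hρBC hq0 hQint
  have hq4le : C * q ^ 4 ≤ C * (Q * 2 ^ (4 / 3 : ℝ)) * (W.δR ^ (4 / 3 : ℝ) + W.δC ^ (4 / 3 : ℝ))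
      * W.δS ^ (4 / 3 : ℝ) * Real.exp (-(2 / 3 * cI) * W.δS * t) := by
    have h1 : q ^ 4 = Q * W.δS ^ (4 / 3 : ℝ) * Δ ^ (4 / 3 : ℝ)
        * Real.exp (-(2 / 3 * cI) * W.δS * t) := by
      rw [hq4, hx₀, Real.mul_rpow (by positivity) (Real.exp_pos _).le,
        Real.mul_rpow (by positivity) hΔ0, Real.mul_rpow (by positivity) hd.le, ← Real.exp_mul]
      congr 2
      ring
    have h2 := add_rpow_four_thirds_le hδR hδC
    rw [h1]
    calc C * (Q * W.δS ^ (4 / 3 : ℝ) * Δ ^ (4 / 3 : ℝ) * Real.exp (-(2 / 3 * cI) * W.δS * t))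
        ≤ C * (Q * W.δS ^ (4 / 3 : ℝ) * (2 ^ (4 / 3 : ℝ) *
          (W.δR ^ (4 / 3 : ℝ) + W.δC ^ (4 / 3 : ℝ))) *
            Real.exp (-(2 / 3 * cI) * W.δS * t)) := by gcongr
      _ = _ := by ring
  rw [Pattern.GS_eq hS, Pattern.D_eq]
  have hBG := Pattern.B2_sub_G lam hS S
  -- The factor `M / δ_S` of the shift equation enters squared, which turns `δ_S / (2 M)` into `M /
  -- (2 δ_S)`.
  have hsq : -(W.δS / (2 * M)) * |W.shiftRHS g lam M U X t| ^ 2 =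
      -(M / (2 * W.δS)) * (∫ ξ, W.shiftIntegrand g lam U X t ξ) ^ 2 := by
    have : W.shiftRHS g lam M U X t =
      -(M / W.δS) * ∫ ξ, W.shiftIntegrand g lam U X t ξ := rfl
    rw [sq_abs, this]
    field_simp
  rw [hsq]
  simp only [Pattern.shiftIntegrand_eq hS]
  have hB1 : W.B1 g lam X U t = ∫ x, (1 + lam / W.δS * ((W.shock (x - X t)).v - W.Uc.v))
      * W.dvS (x - X t) * ((g.γ + 1) * g.p W.Uc * W.σc g / (2 * W.Uc.v ^ 2) * W.dv g X U t x ^ 2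
        + g.R * W.σc g / (2 * W.Uc.v * W.Uc.θ) * W.dθ g X U t x ^ 2
        - g.p W.Uc * W.σc g / (W.Uc.v * W.Uc.θ) * (W.dv g X U t x * W.dθ g X U t x)) := rfl
  rw [hB1]
  linarith
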